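/- Let $\mathcal O=\mathbb C[[t]]$, $\mathcal K=\mathbb C((t))$, and let $\mathfrak{so}_{2n}$ and $\mathrm{SO}_{2n}$ be defined by a fixed symmetric pairing on $\mathcal O^{2n}$ that is non-degenerate (perfect) over $\mathcal O$. Let $L^\heartsuit\mathfrak{so}_{2n}\subset\mathfrak{so}_{2n}(\mathcal K)$ be the set of topologically nilpotent regular semisimple elements. Let $\gamma\in L^\heartsuit\mathfrak{so}_{2n}$, and suppose that $\chi_\gamma(\lambda)=\det(\lambda-\gamma)=f_1f_2\cdots$ is the factorization according to the Newton polygon: each $f_i\in\mathcal O[\lambda]$ is monic of degree $2n_i>0$, its Newton polygon has a single slope (that is, if $a_j$ is the coefficient of $\lambda^{2n_i-j}$ in $f_i$ and $m_i=\mathrm{ord}_t f_i(0)$, then $2n_i\,\mathrm{ord}_t(a_j)\ge j\,m_i$ for all $0\le j\le 2n_i$), and the slopes $2n_i/m_i$ are strictly decreasing in $i$. Write $2n_i=m_ik_i+l_i$ with $0\le l_i<m_i$, and let $\mathbf d_i=[(k_i+1)^{l_i},k_i^{m_i-l_i}]$ (parts equal to $0$ are always discarded). If $m_i=\infty$, that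 is, $f_i(0)=0$ (possible only for the last factor, which is then $\lambda^2$), put $k_i=0$, $l_i=2n_i$, $\mathbf d_i=[1^{2n_i}]$, and count $m_i$ as odd or even in such a way that the number of odd $m_i$ is even. Let $\mathbf d_D$ be the partition of $2n$ that consists of all parts of the partitions $\widetilde{\mathbf d}_i$, where the $\widetilde{\mathbf d}_i$ are defined recursively, from the first factor on, as follows. Let $f_i$ be the first factor that is not yet treated. (D1) Suppose that $m_i$ is even. If $l_i\ne 0$ or $k_i$ is odd, then $\widetilde{\mathbf d}_i=\mathbf d_i$. If $l_i=0$ and $k_i$ is even, let $\mathrm{gr}(f_i)=\sum_{\alpha=0}^{m_i}(a_{\alpha k_i})_\alpha X^{m_i-\alpha}\in\mathbb C[X]$, where $(a)_\alpha$ is the coefficient of $t^\alpha$ in $a$ and $a_j$ is the coefficient of $\lambda^{2n_i-j}$ in $f_i$; then $\widetilde{\mathbf d}_i=\mathbf d_i=[k_i^{m_i}]$ if $\mathrm{gr}(f_i)$ is a square in $\mathbb C[X]$, and $\widetilde{\mathbf d}_i=[k_i+1,k_i^{m_i-2},k_i-1]$ otherwise. (D2) Suppose that $m_i$ is odd, and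 let $j>i$ be the smallest index with $m_j$ odd. Then $\widetilde{\mathbf d}_i=[(k_i+1)^{l_i+1},k_i^{m_i-l_i-1}]$; $\widetilde{\mathbf d}_s=\mathbf d_s$ for $i<s<j$; and $\widetilde{\mathbf d}_j=[(k_j+1)^{l_j-1},k_j^{m_j-l_j+1}]$ if $l_j\ne0$, $\widetilde{\mathbf d}_j=[k_j^{m_j-1},k_j-1]$ if $l_j=0$. Then $\gamma$ has a reduction with partition $\mathbf d_D$: there is $h\in\mathrm{SO}_{2n}(\mathcal K)$ such that $h^{-1}\gamma h\in\mathfrak{so}_{2n}(\mathcal O)$ and $h^{-1}\gamma h \bmod t$ is nilpotent with Jordan blocks of sizes $\mathbf d_D$. -/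

import Mathlib

open Polynomial PowerSeries LaurentSeries

noncomputable section

namespace LoopSO

/-! ### The loop algebra of `so_{2n}`

`𝒪 = ℂ⟦X⟧` and `𝒦 = ℂ⸨X⸩`; the variable is the `t` of `𝒪 = ℂ[[t]]`. For a commutative ring `R`,
`so_{2n}(R)` is `LieAlgebra.Orthogonal.typeD (Fin n) R`, the matrices that are skew-adjoint for the
perfect split symmetric pairing `JD` on `R^{2n}`. -/

/-- `γ ∈ L so_{2n}` is regular semisimple: it is a semisimple endomorphism and its centralizer in
`so_{2n}(𝒦)` has the smallest possible dimension, the rank `n`. -/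
def IsRegularSemisimple {n : ℕ} (γ : LieAlgebra.Orthogonal.typeD (Fin n) ℂ⸨X⸩) : Prop :=
  Module.End.IsSemisimple
      (Matrix.toLin' (γ : Matrix (Fin n ⊕ Fin n) (Fin n ⊕ Fin n) ℂ⸨X⸩)) ∧
    Module.finrank ℂ⸨X⸩ (LinearMap.ker
      (LieAlgebra.ad ℂ⸨X⸩ (LieAlgebra.Orthogonal.typeD (Fin n) ℂ⸨X⸩) γ)) = n

/-- The set `L^♥ so_{2n}` of topologically nilpotent (for the `t`-adic topology) regular
semisimple elements of `L so_{2n}`. -/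
def heart (n : ℕ) : Set (LieAlgebra.Orthogonal.typeD (Fin n) ℂ⸨X⸩) :=
  {γ | IsTopologicallyNilpotent (γ : Matrix (Fin n ⊕ Fin n) (Fin n ⊕ Fin n) ℂ⸨X⸩) ∧
    IsRegularSemisimple γ}

/-- Membership in the loop group `L SO_{2n} = SO_{2n}(𝒦)` of the pairing `JD`. -/
def MemLoopSO {n : ℕ} (h : Matrix (Fin n ⊕ Fin n) (Fin n ⊕ Fin n) ℂ⸨X⸩) : Prop :=
  h.transpose * LieAlgebra.Orthogonal.JD (Fin n) ℂ⸨X⸩ * h = LieAlgebra.Orthogonal.JD (Fin n) ℂ⸨X⸩ ∧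
    h.det = 1

/-- `A` is nilpotent with Jordan blocks of sizes `d` (a multiset of positive integers): there is a
basis made of Jordan chains `v₀, …, v_{s-1}`, `A v₀ = 0`, `A v_{j+1} = v_j`, whose lengths `s` are
the elements of `d`. -/
def HasJordanPartition {ι : Type} [Fintype ι] (A : Matrix ι ι ℂ) (d : Multiset ℕ) : Prop :=
  ∃ (q : ℕ) (s : Fin q → ℕ) (b : Module.Basis (Σ i : Fin q, Fin (s i)) ℂ (ι → ℂ)),
    (∀ i, 0 < s i) ∧ Multiset.map s Finset.univ.val = d ∧
    ∀ (i : Fin q) (j : ℕ) (hj : j < s i),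
      A.mulVec (b ⟨i, ⟨j, hj⟩⟩) =
        if j = 0 then 0 else b ⟨i, ⟨j - 1, lt_of_le_of_lt (Nat.sub_le j 1) hj⟩⟩

/-- `γ` has a reduction with partition `d`: some `h ∈ L SO_{2n}` conjugates `γ` into an element
`h⁻¹ γ h = δ` of `L⁺ so_{2n} = so_{2n}(𝒪)` whose reduction `δ mod t` is nilpotent with Jordan
partition `d`. -/
def HasReduction {n : ℕ} (γ : LieAlgebra.Orthogonal.typeD (Fin n) ℂ⸨X⸩) (d : Multiset ℕ) : Prop :=
  ∃ (h : Matrix (Fin n ⊕ Fin n) (Fin n ⊕ Fin n) ℂ⸨X⸩)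
    (δ : LieAlgebra.Orthogonal.typeD (Fin n) ℂ⟦X⟧),
    MemLoopSO h ∧
    h⁻¹ * (γ : Matrix (Fin n ⊕ Fin n) (Fin n ⊕ Fin n) ℂ⸨X⸩) * h =
      (δ : Matrix (Fin n ⊕ Fin n) (Fin n ⊕ Fin n) ℂ⟦X⟧).map (algebraMap ℂ⟦X⟧ ℂ⸨X⸩) ∧
    HasJordanPartition
      ((δ : Matrix (Fin n ⊕ Fin n) (Fin n ⊕ Fin n) ℂ⟦X⟧).map (PowerSeries.constantCoeff (R := ℂ))) d

/-! ### Newton polygons -/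

/-- The coefficient `a_i` of `f = λ^N + a_1 λ^{N-1} + ⋯ + a_N`, where `N` is the degree. -/
def lowerCoeff (f : ℂ⟦X⟧[X]) (i : ℕ) : ℂ⟦X⟧ := f.coeff (f.natDegree - i)

/-- The order in `t` of the constant term of `f`; it is `⊤` if the constant term is `0`. -/
def constOrder (f : ℂ⟦X⟧[X]) : ℕ∞ := PowerSeries.order (f.coeff 0)

/-- The Newton polygon of `f = λ^N + a_1 λ^{N-1} + ⋯ + a_N` has a single slope: the points
`(ord a_i, N - i)` do not lie below the segment from `(0, N)` to `(ord a_N, 0)`, that is,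
`ord a_i ≥ i ⬝ ord a_N / N`. (If `a_N = 0`, this says `f = λ^N`.) -/
def HasSingleSlope (f : ℂ⟦X⟧[X]) : Prop :=
  ∀ i ≤ f.natDegree, (i : ℕ∞) * constOrder f ≤ (f.natDegree : ℕ∞) * PowerSeries.order (lowerCoeff f i)

/-- `fs = [f_1, f_2, …]` is the factorization of `χ` according to its Newton polygon: the `f_i` are
monic of positive degree `N_i` with a single slope `N_i / m_i`, where `m_i = ord f_i(0)`, and these
slopes are strictly decreasing. -/
structure IsNewtonFactorization (χ : ℂ⸨X⸩[X]) (fs : List ℂ⟦X⟧[X]) : Prop where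
  prod_eq : χ = (fs.prod).map (algebraMap ℂ⟦X⟧ ℂ⸨X⸩)
  monic : ∀ f ∈ fs, f.Monic
  natDegree_pos : ∀ f ∈ fs, 0 < f.natDegree
  singleSlope : ∀ f ∈ fs, HasSingleSlope f
  slopes_decreasing : fs.Pairwise fun f g =>
    (g.natDegree : ℕ∞) * constOrder f < (f.natDegree : ℕ∞) * constOrder g

/-! ### The partition `d_D`

Partitions are multisets of natural numbers; parts equal to `0` are discarded at the end. In this
section `N = m k + l` with `0 ≤ l < m`, so that `k = N / m` and `l = N % m`. -/

/-- The `m`-balanced partition `[(k+1)^l, k^{m-l}]` of `N`. -/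
def balanced (N m : ℕ) : Multiset ℕ :=
  Multiset.replicate (N % m) (N / m + 1) + Multiset.replicate (m - N % m) (N / m)

/-- `[(k+1)^{l+1}, k^{m-l-1}]`. -/
def raised (N m : ℕ) : Multiset ℕ :=
  Multiset.replicate (N % m + 1) (N / m + 1) + Multiset.replicate (m - N % m - 1) (N / m)

/-- `[(k+1)^{l-1}, k^{m-l+1}]` if `l ≠ 0`, and `[k^{m-l-1}, k-1]` if `l = 0`. -/
def lowered (N m : ℕ) : Multiset ℕ :=
  if N % m ≠ 0 then
    Multiset.replicate (N % m - 1) (N / m + 1) + Multiset.replicate (m - N % m + 1) (N / m)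
  else
    Multiset.replicate (m - N % m - 1) (N / m) + {N / m - 1}

/-- `[k+1, k^{m-2}, k-1]`. -/
def spread (N m : ℕ) : Multiset ℕ :=
  {N / m + 1} + Multiset.replicate (m - 2) (N / m) + {N / m - 1}

/-- The graded polynomial `gr_{d,k}(f)` of a partition `d` at a part `k` of multiplicity `j`: if
`p` parts of `d` are larger than `k`, with sum `s`, it is `∑_{α=0}^{j} (a_{s + α k})_{p + α} X^{j-α}`
with `(a)_i` the coefficient of `t^i` in `a`. -/
def grPoly (d : Multiset ℕ) (k : ℕ) (f : ℂ⟦X⟧[X]) : ℂ[X] :=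
  ∑ α ∈ Finset.range (d.count k + 1),
    Polynomial.C (PowerSeries.coeff ((d.filter (k < ·)).card + α)
      (lowerCoeff f ((d.filter (k < ·)).sum + α * k))) * Polynomial.X ^ (d.count k - α)

open Classical in
/-- The modified partition of a factor `f` with `m` even, outside of the range between two paired
factors with `m` odd: it is the balanced partition `[(k+1)^l, k^{m-l}]`, except if `l = 0`, `k` is
even and the graded polynomial at `k` is not a square, when it is `[k+1, k^{m-2}, k-1]`. -/
def evenPart (f : ℂ⟦X⟧[X]) (m : ℕ) : Multiset ℕ :=
  if f.natDegree % m ≠ 0 ∨ Odd (f.natDegree / m) ∨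
      IsSquare (grPoly (balanced f.natDegree m) (f.natDegree / m) f) then
    balanced f.natDegree m
  else
    spread f.natDegree m

open Classical in
/-- The modification of the balanced partitions of `f_1, f_2, …` in type D. The flag `pending` is
`true` between a factor with `m_i` odd and the next one: the first of these two is raised, the
second one is lowered, and what is in between keeps its balanced partition.

A factor with `m_i = ⊤` has constant term `0`; it is the last one, its balanced partition is
`[1^{N_i}]` (`k_i = 0`, `l_i = N_i`), and `m_i` is taken odd or even so that the number of odd `m_i`
is even. -/
def modifyD : Bool → List ℂ⟦X⟧[X] → Multiset ℕ
  | _, [] => 0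
  | false, f :: fs =>
      if constOrder f = ⊤ then Multiset.replicate f.natDegree 1 + modifyD false fs
      else if Odd (constOrder f).toNat then
        raised f.natDegree (constOrder f).toNat + modifyD true fs
      else evenPart f (constOrder f).toNat + modifyD false fs
  | true, f :: fs =>
      if constOrder f = ⊤ then Multiset.replicate (f.natDegree - 1) 1 + modifyD false fs
      else if Odd (constOrder f).toNat then
        lowered f.natDegree (constOrder f).toNat + modifyD false fs
      else balanced f.natDegree (constOrder f).toNat + modifyD true fs

/-- The partition `d_D` attached to the Newton factorization `fs` of a characteristic polynomial. -/
def partitionD (fs : List ℂ⟦X⟧[X]) : Multiset ℕ := (modifyD false fs).filter (0 < ·)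

end LoopSO

end

open Polynomial PowerSeries LaurentSeries

noncomputable section

namespace LoopSO

/-! A reduction amounts to a lattice in `𝒦^{2n}` that is self-dual for the pairing and stable under
`Γ = γ`: every perfect symmetric pairing over `ℂ⟦X⟧` is isometric to `JD` (`cong_JD`), and a
reflection corrects the determinant. The lattice is spanned by chains `x, Γ x, …, Γ^(d-1) x` such
that `Γ^d x` vanishes modulo `t` in the lattice; the lengths `d` are then the sizes of the Jordan
blocks.

The pairings are controlled by rational levels. On a factor of degree `2h` with `ord f(0) = m`, the
map `Γ` raises the level by `ν = m/(2h)`, multiplication by `t` raises it by `1`, and vectors of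
levels `a` and `b` pair in order at least `a + b`. The vectors of level between `-1/2` and `1/2` are
kept. Since orders are integers, two of them have an integral pairing unless both have level `-1/2`;
modulo `t` only pairs of level sum at most `0` matter, so the Gram matrix is triangular with respect
to the level; and `Γ^d x`, of level at least `1/2`, pairs to `0` modulo `t`. The ties in these
inequalities are settled by auxiliary integer weights `T` and by explicit vanishing.
`ChainSys.IsGood` and `ChainSys.StartOK` record what is needed, and `hasReduction_of_chainSys` turns
such a system into a reduction.

Regularity forces the kernel of `Γ` to have dimension `0` or `2` and its range to be cyclic
(`range_le_of_commutant`). So the space is the orthogonal sum of modules `𝒦[λ]/(f)`, one for each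
Newton factor with `f(0) ≠ 0`, and of the kernel; these `f` are even polynomials because their
slopes are distinct. On `𝒦[λ]/(f)` two forms compatible with `λ ↦ -λ` differ by an even element, and
this element is a norm, because a finite extension of `ℂ⸨X⸩` has at most two square classes and its
binary forms are universal. Hence the generator can be chosen such that `λ^a` and `λ^b` pair to `±
t^(-ε) F(a + b)`, where `F(e)` is the coefficient of `λ^(2h-1)` in `λ^(e+2h-1)`
(`exists_cyclic_form`). The function `F` has order at least `e ν`, and it vanishes for `-2h < e <
0`; this gap disposes of almost all ties.

For every exponent `e` with `-m < e ≤ m` and `e ≡ ε` modulo `2`, the monomials `t^((e+ε)/2) λ^b` of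
admissible level form one chain. Counting their lengths gives the balanced, raised, lowered and
spread partitions (`chainLens_eq_balanced` and its companions). If the graded polynomial is a square
`g²`, combinations of monomials with the coefficients of `g` are isotropic to leading order, and the
balanced partition replaces the spread one (`squareSys_isGood`).

For odd `m` and `ε = 0`, one initial vector `X p` of level `-1/2` has a norm of order exactly `-1`:
the system is pending. With `ε = 1` the generator `L` itself is left out of the chains, and its norm
has order `-1` too. Since `ℂ⸨X⸩` contains the square roots of its units of order `0`, `X p + ι L` is
isotropic for a suitable `ι`, which closes the pending system (`Correction.link`); the first factor
gains a dimension and the second loses one. Factors with even `m` between two odd ones use `ε = 1`: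
they close one pending vector and open another. Finally the determinant of a skew matrix is a
square, so a pending vector is left at the end exactly when the kernel offers a plug, that is, a
vector of norm of order `-1` (`kernelPiece`). -/

/-! ### Orders of Laurent series -/

/-- `x` has order at least `r`. -/
def OrdGE (x : ℂ⸨X⸩) (r : ℚ) : Prop := ∀ k : ℤ, (k : ℚ) < r → x.coeff k = 0

theorem OrdGE.zero (r : ℚ) : OrdGE 0 r := fun _ _ => by simp

theorem OrdGE.mono {x : ℂ⸨X⸩} {r s : ℚ} (h : OrdGE x r) (hs : s ≤ r) : OrdGE x s :=
  fun k hk => h k (hk.trans_le hs)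

theorem OrdGE.add {x y : ℂ⸨X⸩} {r : ℚ} (hx : OrdGE x r) (hy : OrdGE y r) : OrdGE (x + y) r :=
  fun k hk => by simp [hx k hk, hy k hk]

theorem OrdGE.neg {x : ℂ⸨X⸩} {r : ℚ} (hx : OrdGE x r) : OrdGE (-x) r :=
  fun k hk => by simp [hx k hk]

theorem OrdGE.sum {ι : Type*} {s : Finset ι} {f : ι → ℂ⸨X⸩} {r : ℚ}
    (h : ∀ i ∈ s, OrdGE (f i) r) : OrdGE (∑ i ∈ s, f i) r := by
  classical
  induction s using Finset.induction_on with
  | empty => simpa using OrdGE.zero r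
  | insert a s ha ih =>
    rw [Finset.sum_insert ha]
    exact (h a (Finset.mem_insert_self a s)).add
      (ih fun i hi => h i (Finset.mem_insert_of_mem hi))

theorem coeff_mul_of_ordGE {x y : ℂ⸨X⸩} {a b : ℤ} (hx : OrdGE x a) (hy : OrdGE y b) :
    (x * y).coeff (a + b) = x.coeff a * y.coeff b := by
  rw [HahnSeries.coeff_mul, Finset.sum_eq_single (a, b)]
  · intro ij hij hne
    have h := (Finset.mem_antidiagonal.1 hij).2.2
    by_cases h1 : ij.1 < a
    · rw [hx _ (by exact_mod_cast h1), zero_mul]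
    · by_cases h2 : ij.2 < b
      · rw [hy _ (by exact_mod_cast h2), mul_zero]
      · exact absurd (Prod.ext (by simp; omega) (by simp; omega)) hne
  · intro h
    by_contra h0
    exact h (Finset.mem_antidiagonal.2 ⟨left_ne_zero_of_mul h0, right_ne_zero_of_mul h0, rfl⟩)

theorem OrdGE.mul {x y : ℂ⸨X⸩} {r s : ℚ} (hx : OrdGE x r) (hy : OrdGE y s) :
    OrdGE (x * y) (r + s) := by
  intro k hk
  rw [HahnSeries.coeff_mul]
  refine Finset.sum_eq_zero fun ij hij => ?_
  have h := (Finset.mem_antidiagonal.1 hij).2.2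
  by_cases h1 : (ij.1 : ℚ) < r
  · simp [hx _ h1]
  · have : (ij.2 : ℚ) < s := by
      have : (ij.1 : ℚ) + ij.2 = k := by exact_mod_cast h
      linarith
    simp [hy _ this]

/-- Orders are integers, so a rational bound above `k - 1` rounds up to `k`. This rounding turns
inequalities between fractional levels into integrality and into vanishing modulo `t`. -/
theorem OrdGE.of_gt {x : ℂ⸨X⸩} {r : ℚ} (h : OrdGE x r) {k : ℤ} (hk : (k : ℚ) - 1 < r) :
    OrdGE x k := by
  intro i hi
  refine h i ?_
  have h1 : i ≤ k - 1 := by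
    have : i < k := by exact_mod_cast hi
    omega
  have : (i : ℚ) ≤ k - 1 := by exact_mod_cast h1
  linarith

theorem OrdGE.one_of_pos {x : ℂ⸨X⸩} {r : ℚ} (h : OrdGE x r) (hr : 0 < r) : OrdGE x 1 := by
  simpa using h.of_gt (k := 1) (by push_cast; linarith)

theorem OrdGE.zero_of_gt {x : ℂ⸨X⸩} {r : ℚ} (h : OrdGE x r) (hr : -1 < r) : OrdGE x 0 := by
  simpa using h.of_gt (k := 0) (by push_cast; linarith)

theorem OrdGE.succ {x : ℂ⸨X⸩} {k : ℤ} (h : OrdGE x k) (h0 : x.coeff k = 0) :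
    OrdGE x (k + 1) := by
  intro i hi
  have hi' : i < k + 1 := by exact_mod_cast hi
  rcases (Int.lt_add_one_iff.1 hi').lt_or_eq with h1 | rfl
  · exact h i (by exact_mod_cast h1)
  · exact h0

theorem OrdGE.coeff_zero {x : ℂ⸨X⸩} (h : OrdGE x 1) : x.coeff 0 = 0 := h 0 (by norm_num)

theorem ordGE_one_iff {x : ℂ⸨X⸩} (h : OrdGE x 0) : OrdGE x 1 ↔ x.coeff 0 = 0 :=
  ⟨OrdGE.coeff_zero, fun h0 => by simpa using OrdGE.succ (k := 0) (by simpa using h) h0⟩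

/-- The power `t ^ c`. -/
def tp (c : ℤ) : ℂ⸨X⸩ := HahnSeries.single c 1

theorem tp_zero : tp 0 = 1 := rfl

theorem tp_add (a b : ℤ) : tp (a + b) = tp a * tp b := by
  simp [tp, HahnSeries.single_mul_single]

theorem coeff_tp_mul (c : ℤ) (x : ℂ⸨X⸩) (k : ℤ) : (tp c * x).coeff k = x.coeff (k - c) := by
  simp [tp, HahnSeries.coeff_single_mul]

theorem ordGE_tp (c : ℤ) : OrdGE (tp c) c := fun k hk => by
  have : k ≠ c := by rintro rfl; exact lt_irrefl _ hk
  simp [tp, HahnSeries.coeff_single_of_ne this]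

theorem OrdGE.tp_mul {x : ℂ⸨X⸩} {r : ℚ} (h : OrdGE x r) (c : ℤ) : OrdGE (tp c * x) (c + r) :=
  (ordGE_tp c).mul h

theorem ordGE_C (c : ℂ) : OrdGE (HahnSeries.C c) 0 := fun k hk => by
  have : k ≠ 0 := by rintro rfl; simp at hk
  simp [HahnSeries.C_apply, HahnSeries.coeff_single_of_ne this]

theorem ordGE_one : OrdGE 1 0 := by simpa using ordGE_C 1

theorem ordGE_zero_iff {x : ℂ⸨X⸩} : OrdGE x 0 ↔ ∃ p : ℂ⟦X⟧, algebraMap ℂ⟦X⟧ ℂ⸨X⸩ p = x := by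
  constructor
  · intro h
    refine ⟨PowerSeries.mk fun n => x.coeff n, ?_⟩
    ext k
    rw [LaurentSeries.coe_algebraMap, PowerSeries.coeff_coe]
    split_ifs with hk
    · exact (h k (by exact_mod_cast hk)).symm
    · rw [PowerSeries.coeff_mk, Int.natAbs_of_nonneg (by omega)]
  · rintro ⟨p, rfl⟩ k hk
    rw [LaurentSeries.coe_algebraMap, PowerSeries.coeff_coe, if_pos (by exact_mod_cast hk)]

theorem coeff_algebraMap (p : ℂ⟦X⟧) (k : ℕ) :
    (algebraMap ℂ⟦X⟧ ℂ⸨X⸩ p).coeff k = PowerSeries.coeff k p := by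
  rw [LaurentSeries.coe_algebraMap, LaurentSeries.coeff_coe_powerSeries]

theorem coeff_zero_algebraMap (p : ℂ⟦X⟧) :
    (algebraMap ℂ⟦X⟧ ℂ⸨X⸩ p).coeff 0 = PowerSeries.constantCoeff p := by
  simpa using coeff_algebraMap p 0

theorem ordGE_algebraMap (p : ℂ⟦X⟧) : OrdGE (algebraMap ℂ⟦X⟧ ℂ⸨X⸩ p) 0 :=
  ordGE_zero_iff.2 ⟨p, rfl⟩

theorem algebraMap_injective : Function.Injective (algebraMap ℂ⟦X⟧ ℂ⸨X⸩) :=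
  IsFractionRing.injective ℂ⟦X⟧ ℂ⸨X⸩

theorem ordGE_algebraMap_iff (p : ℂ⟦X⟧) (r : ℚ) :
    OrdGE (algebraMap ℂ⟦X⟧ ℂ⸨X⸩ p) r ↔ ∀ k : ℕ, (k : ℚ) < r → PowerSeries.coeff k p = 0 := by
  constructor
  · intro h k hk
    rw [← coeff_algebraMap]
    exact h k (by exact_mod_cast hk)
  · intro h k hk
    rcases lt_or_ge k 0 with h0 | h0
    · exact ordGE_algebraMap p k (by exact_mod_cast h0)
    · lift k to ℕ using h0
      rw [coeff_algebraMap]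
      exact h k (by exact_mod_cast hk)

/-- The value of the order of `x` is exactly `k`. -/
def OrdEq (x : ℂ⸨X⸩) (k : ℤ) : Prop := OrdGE x k ∧ x.coeff k ≠ 0

theorem OrdEq.ne_zero {x : ℂ⸨X⸩} {k : ℤ} (h : OrdEq x k) : x ≠ 0 := by
  rintro rfl
  exact h.2 (by simp)

theorem ordEq_order {x : ℂ⸨X⸩} (h : x ≠ 0) : OrdEq x x.order :=
  ⟨fun k hk => HahnSeries.coeff_eq_zero_of_lt_order (by exact_mod_cast hk),
    by simpa using HahnSeries.coeff_order_eq_zero.not.2 h⟩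

theorem OrdEq.mul {x y : ℂ⸨X⸩} {a b : ℤ} (hx : OrdEq x a) (hy : OrdEq y b) :
    OrdEq (x * y) (a + b) :=
  ⟨by simpa using hx.1.mul hy.1, by rw [coeff_mul_of_ordGE hx.1 hy.1]; exact mul_ne_zero hx.2 hy.2⟩

theorem OrdEq.unique {x : ℂ⸨X⸩} {a b : ℤ} (hx : OrdEq x a) (hy : OrdEq x b) : a = b := by
  by_contra h
  rcases lt_or_gt_of_ne h with h | h
  · exact hx.2 (hy.1 a (by exact_mod_cast h))
  · exact hy.2 (hx.1 b (by exact_mod_cast h))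

theorem OrdEq.le_of_ordGE {x : ℂ⸨X⸩} {a : ℤ} {r : ℚ} (hx : OrdEq x a) (h : OrdGE x r) :
    r ≤ a := by
  by_contra hlt
  exact hx.2 (h a (not_le.1 hlt))

theorem exists_ordEq {x : ℂ⸨X⸩} (h : x ≠ 0) : ∃ k, OrdEq x k := ⟨_, ordEq_order h⟩

theorem ordEq_one : OrdEq 1 0 := ⟨by simpa using ordGE_one, by simp⟩

theorem OrdEq.inv {x : ℂ⸨X⸩} {a : ℤ} (hx : OrdEq x a) : OrdEq x⁻¹ (-a) := by
  obtain ⟨b, hb⟩ := exists_ordEq (inv_ne_zero hx.ne_zero)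
  have h := hx.mul hb
  rw [mul_inv_cancel₀ hx.ne_zero] at h
  have := h.unique ordEq_one
  rwa [show -a = b by omega]

theorem OrdEq.neg {x : ℂ⸨X⸩} {a : ℤ} (hx : OrdEq x a) : OrdEq (-x) a :=
  ⟨hx.1.neg, by simpa using hx.2⟩

theorem ordEq_tp (c : ℤ) : OrdEq (tp c) c := ⟨ordGE_tp c, by simp [tp]⟩

theorem OrdEq.pow {x : ℂ⸨X⸩} {a : ℤ} (hx : OrdEq x a) (n : ℕ) : OrdEq (x ^ n) (n * a) := by
  induction n with
  | zero => simpa using ordEq_one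
  | succ n ih => rw [pow_succ]; convert ih.mul hx using 1; push_cast; ring

theorem ordEq_zero_algebraMap (p : ℂ⟦X⟧) :
    OrdEq (algebraMap ℂ⟦X⟧ ℂ⸨X⸩ p) 0 ↔ IsUnit p := by
  rw [PowerSeries.isUnit_iff_constantCoeff, isUnit_iff_ne_zero, ← coeff_zero_algebraMap]
  exact ⟨fun h => h.2, fun h => ⟨by simpa using ordGE_algebraMap p, h⟩⟩

/-! ### Completeness and square roots -/

/-- Completeness serves twice: for Hensel's lemma in the extraction of square roots, and for
Weierstrass division by distinguished polynomials. -/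
instance isAdicComplete_powerSeries :
    IsAdicComplete (IsLocalRing.maximalIdeal ℂ⟦X⟧) ℂ⟦X⟧ := by
  have key (n : ℕ) (x y : ℂ⟦X⟧) :
      x ≡ y [SMOD (IsLocalRing.maximalIdeal ℂ⟦X⟧ ^ n • ⊤ : Submodule ℂ⟦X⟧ ℂ⟦X⟧)] ↔
        ∀ m < n, PowerSeries.coeff m x = PowerSeries.coeff m y := by
    rw [SModEq.sub_mem, PowerSeries.maximalIdeal_eq_span_X, Ideal.span_singleton_pow,
      smul_eq_mul, Ideal.mul_top, Ideal.mem_span_singleton, PowerSeries.X_pow_dvd_iff]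
    simp [sub_eq_zero]
  have h1 : IsHausdorff (IsLocalRing.maximalIdeal ℂ⟦X⟧) ℂ⟦X⟧ := by
    refine ⟨fun x hx => ?_⟩
    ext m
    simpa using (key (m + 1) x 0).1 (hx (m + 1)) m (Nat.lt_succ_self m)
  have h2 : IsPrecomplete (IsLocalRing.maximalIdeal ℂ⟦X⟧) ℂ⟦X⟧ := by
    refine ⟨fun f hf => ⟨PowerSeries.mk fun n => PowerSeries.coeff n (f (n + 1)), fun n => ?_⟩⟩
    rw [key]
    intro m hm
    rw [PowerSeries.coeff_mk]
    exact ((key (m + 1) _ _).1 (hf (show m + 1 ≤ n from hm)) m (Nat.lt_succ_self m)).symm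
  exact { }

theorem exists_sq_eq_powerSeries {p : ℂ⟦X⟧} (hp : IsUnit p) : ∃ s, s ^ 2 = p := by
  have hp0 := isUnit_iff_ne_zero.1 (PowerSeries.isUnit_iff_constantCoeff.1 hp)
  obtain ⟨c, hc⟩ := IsAlgClosed.exists_pow_nat_eq (PowerSeries.constantCoeff p) (n := 2) (by norm_num)
  have hmem (x : ℂ⟦X⟧) : x ∈ IsLocalRing.maximalIdeal ℂ⟦X⟧ ↔ PowerSeries.constantCoeff x = 0 := by
    rw [PowerSeries.maximalIdeal_eq_span_X, Ideal.mem_span_singleton, PowerSeries.X_dvd_iff]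
  have hc0 : c ≠ 0 := by rintro rfl; simp at hc; exact hp0 hc.symm
  obtain ⟨a, ha, -⟩ := HenselianRing.is_henselian (I := IsLocalRing.maximalIdeal ℂ⟦X⟧)
    (Polynomial.X ^ 2 - Polynomial.C p) (Polynomial.monic_X_pow_sub_C p two_ne_zero)
    (PowerSeries.C c) (by rw [hmem]; simp [hc]) (by
      refine IsUnit.map _ ?_
      rw [PowerSeries.isUnit_iff_constantCoeff]
      simp [hc0])
  refine ⟨a, ?_⟩
  have := ha
  simp only [Polynomial.IsRoot, Polynomial.eval_sub, Polynomial.eval_pow, Polynomial.eval_X,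
    Polynomial.eval_C] at this
  exact sub_eq_zero.1 this

theorem exists_sq_eq {x : ℂ⸨X⸩} {a : ℤ} (hx : OrdEq x (2 * a)) :
    ∃ y, y ^ 2 = x ∧ OrdEq y a := by
  have h0 : OrdEq (tp (-(2 * a)) * x) 0 := by
    have := (ordEq_tp (-(2 * a))).mul hx
    simpa using this
  obtain ⟨p, hp⟩ := ordGE_zero_iff.1 (by simpa using h0.1)
  rw [← hp, ordEq_zero_algebraMap] at h0
  obtain ⟨s, rfl⟩ := exists_sq_eq_powerSeries h0
  have hs : IsUnit s := (isUnit_pow_iff two_ne_zero).1 h0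
  refine ⟨tp a * algebraMap ℂ⟦X⟧ ℂ⸨X⸩ s, ?_, ?_⟩
  · rw [mul_pow, ← map_pow, hp, ← mul_assoc, sq, ← tp_add, ← tp_add]
    simp [show a + a + -(2 * a) = 0 by ring, tp_zero]
  · simpa using (ordEq_tp a).mul ((ordEq_zero_algebraMap s).2 hs)

theorem exists_sq_eq_neg_one : ∃ i : ℂ⸨X⸩, i ^ 2 = -1 ∧ OrdEq i 0 :=
  exists_sq_eq (a := 0) (by simpa using ordEq_one.neg)

/-! ### Perfect symmetric pairings over `ℂ⟦X⟧` are split -/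

section

open Matrix

/-- Congruence of symmetric matrices. -/
def Cong {ι R : Type*} [Fintype ι] [DecidableEq ι] [CommRing R] (G G' : Matrix ι ι R) : Prop :=
  ∃ P : Matrix ι ι R, IsUnit P.det ∧ Pᵀ * G * P = G'

theorem Cong.trans {ι R : Type*} [Fintype ι] [DecidableEq ι] [CommRing R]
    {G G' G'' : Matrix ι ι R} (h : Cong G G') (h' : Cong G' G'') : Cong G G'' := by
  obtain ⟨P, hP, rfl⟩ := h
  obtain ⟨Q, hQ, rfl⟩ := h'
  exact ⟨P * Q, by rw [det_mul]; exact hP.mul hQ, by simp only [transpose_mul, Matrix.mul_assoc]⟩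

theorem Cong.symm' {ι R : Type*} [Fintype ι] [DecidableEq ι] [CommRing R]
    {G G' : Matrix ι ι R} (h : Cong G G') : Cong G' G := by
  obtain ⟨P, hP, rfl⟩ := h
  refine ⟨P⁻¹, (Matrix.isUnit_nonsing_inv_det_iff).2 hP, ?_⟩
  have h1 : P * P⁻¹ = 1 := mul_nonsing_inv P hP
  have h2 : (P⁻¹)ᵀ * Pᵀ = 1 := by rw [← transpose_mul, h1, transpose_one]
  calc (P⁻¹)ᵀ * (Pᵀ * G * P) * P⁻¹ = ((P⁻¹)ᵀ * Pᵀ) * G * (P * P⁻¹) := by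
        simp only [Matrix.mul_assoc]
    _ = G := by rw [h1, h2]; simp

theorem Cong.of_submatrix {ι κ R : Type*} [Fintype ι] [DecidableEq ι] [Fintype κ] [DecidableEq κ]
    [CommRing R] {G : Matrix ι ι R} (e : κ ≃ ι) (h : Cong (G.submatrix e e) 1) : Cong G 1 := by
  obtain ⟨P, hP, h⟩ := h
  refine ⟨P.submatrix e.symm e.symm, by rwa [det_submatrix_equiv_self], ?_⟩
  have hG : G = (G.submatrix e e).submatrix e.symm e.symm := by simp
  rw [hG, transpose_submatrix, submatrix_mul_equiv, submatrix_mul_equiv, h]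
  simp

/-- If no diagonal entry is a unit, some off-diagonal entry `G k l` is, because `G` does not vanish
modulo `t`; the vector `e_k + e_l` then has norm `2 G k l` modulo `t`. -/
theorem exists_unit_norm {ι : Type*} [Fintype ι] [DecidableEq ι] [Nonempty ι]
    {G : Matrix ι ι ℂ⟦X⟧} (hs : Gᵀ = G) (hd : IsUnit G.det) :
    ∃ G', Cong G G' ∧ G'ᵀ = G' ∧ ∃ k, IsUnit (G' k k) := by
  by_cases h : ∃ k, IsUnit (G k k)
  · exact ⟨G, ⟨1, by simp, by simp⟩, hs, h⟩
  push Not at h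
  have : ∃ k l, IsUnit (G k l) := by
    by_contra hno
    push Not at hno
    have h0 : G.map (PowerSeries.constantCoeff (R := ℂ)) = 0 := by
      ext k l
      have := hno k l
      rw [PowerSeries.isUnit_iff_constantCoeff, isUnit_iff_ne_zero, not_not] at this
      simpa using this
    have h1 := hd.map (PowerSeries.constantCoeff (R := ℂ))
    rw [RingHom.map_det, RingHom.mapMatrix_apply, h0, det_zero] at h1
    exact not_isUnit_zero h1
  obtain ⟨k, l, hkl⟩ := this
  have hne : k ≠ l := by rintro rfl; exact h k hkl
  refine ⟨(Matrix.transvection l k (1 : ℂ⟦X⟧))ᵀ * G * Matrix.transvection l k (1 : ℂ⟦X⟧), ⟨_, ?_, rfl⟩, ?_, k, ?_⟩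
  · rw [det_transvection_of_ne _ _ hne.symm]; exact isUnit_one
  · simp [transpose_mul, hs, Matrix.mul_assoc]
  · have h1 (A : Matrix ι ι ℂ⟦X⟧) (i : ι) :
        (A * Matrix.transvection l k (1 : ℂ⟦X⟧) : Matrix ι ι ℂ⟦X⟧) i k = A i k + A i l := by
      simp [Matrix.transvection, Matrix.mul_add]
    have h2 (i : ι) : ((Matrix.transvection l k (1 : ℂ⟦X⟧))ᵀ * G : Matrix ι ι ℂ⟦X⟧) k i =
        G k i + G l i := by
      have : ((Matrix.transvection l k (1 : ℂ⟦X⟧))ᵀ * G : Matrix ι ι ℂ⟦X⟧) =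
          (Gᵀ * Matrix.transvection l k (1 : ℂ⟦X⟧))ᵀ := by
        simp [transpose_mul]
      rw [this, transpose_apply, h1, transpose_apply, transpose_apply]
    have hval : ((Matrix.transvection l k (1 : ℂ⟦X⟧))ᵀ * G *
        Matrix.transvection l k (1 : ℂ⟦X⟧) : Matrix ι ι ℂ⟦X⟧) k k =
        G k k + G l k + (G k l + G l l) := by
      rw [h1, h2, h2]
    have hsym : G l k = G k l := by
      conv_lhs => rw [← hs]
      rfl
    rw [hval, hsym]
    have h1 := h k
    have h2 := h l
    rw [PowerSeries.isUnit_iff_constantCoeff, isUnit_iff_ne_zero] at hkl ⊢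
    rw [PowerSeries.isUnit_iff_constantCoeff, isUnit_iff_ne_zero, not_not] at h1 h2
    simp only [map_add, h1, h2, zero_add, add_zero]
    intro h0
    exact hkl (by linear_combination h0 / 2)

/-- Gram–Schmidt: units are squares, so a vector of unit norm can be normalised and split off, and
the rank goes down by one. -/
theorem cong_one {ι : Type} [Fintype ι] [DecidableEq ι] (G : Matrix ι ι ℂ⟦X⟧)
    (hs : Gᵀ = G) (hd : IsUnit G.det) : Cong G 1 := by
  classical
  suffices H : ∀ (N : ℕ) (ι : Type) [Fintype ι] [DecidableEq ι] (G : Matrix ι ι ℂ⟦X⟧),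
      Fintype.card ι = N → Gᵀ = G → IsUnit G.det → Cong G 1 from H _ ι G rfl hs hd
  clear hd hs G
  intro N
  induction N with
  | zero =>
    intro ι _ _ G hc hs hd
    have := Fintype.card_eq_zero_iff.1 hc
    exact ⟨1, by simp, by ext i; exact this.elim i⟩
  | succ N ih =>
    intro ι _ _ G hc hs hd
    have hne : Nonempty ι := Fintype.card_pos_iff.1 (by omega)
    obtain ⟨G', hGG', hs', k, hk⟩ := exists_unit_norm hs hd
    have hd' : IsUnit G'.det := by
      obtain ⟨P, hP, rfl⟩ := hGG'
      rw [det_mul, det_mul, det_transpose]; exact (hP.mul hd).mul hP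
    refine hGG'.trans ?_
    obtain ⟨e⟩ : Nonempty (Fin N ⊕ Unit ≃ ι) := ⟨Fintype.equivOfCardEq (by simp [hc])⟩
    -- The swap moves the index of the unit norm into the one-dimensional block.
    let e' : Fin N ⊕ Unit ≃ ι := e.trans (Equiv.swap (e (Sum.inr ())) k)
    have he' : e' (Sum.inr ()) = k := by simp [e']
    refine Cong.of_submatrix e' ?_
    set H := G'.submatrix e' e' with hH
    have hHs : Hᵀ = H := by rw [hH, transpose_submatrix, hs']
    have hHd : IsUnit H.det := by rwa [hH, det_submatrix_equiv_self]
    obtain ⟨s, hsq⟩ := exists_sq_eq_powerSeries hk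
    have hsu : IsUnit s := (isUnit_pow_iff two_ne_zero).1 (hsq ▸ hk)
    obtain ⟨r, hr⟩ := hsu.exists_right_inv
    have hru : IsUnit r := IsUnit.of_mul_eq_one s (by rw [mul_comm]; exact hr)
    have hblk : H = fromBlocks H.toBlocks₁₁ H.toBlocks₁₂ H.toBlocks₂₁ H.toBlocks₂₂ :=
      (fromBlocks_toBlocks H).symm
    have h22 : H.toBlocks₂₂ = (s ^ 2) • (1 : Matrix Unit Unit ℂ⟦X⟧) := by
      ext i j
      simp [toBlocks₂₂, hH, he', hsq]
    have h21 : H.toBlocks₂₁ = H.toBlocks₁₂ᵀ := by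
      ext i j
      conv_lhs => rw [← hHs]
      rfl
    set A := H.toBlocks₁₁
    set b := H.toBlocks₁₂
    have hA : Aᵀ = A := by
      refine Matrix.ext fun i j => ?_
      change (Hᵀ) (Sum.inl i) (Sum.inl j) = H (Sum.inl i) (Sum.inl j)
      rw [hHs]
    rw [h21, h22] at hblk
    have hr2 : s ^ 2 * (r ^ 2) = 1 := by rw [← mul_pow, hr, one_pow]
    -- Block elimination: the first block becomes the Schur complement, and the last vector is
    -- divided by `s`, the square root of its norm.
    have hcong : Cong H (fromBlocks (A - (r ^ 2) • (b * bᵀ)) 0 0 1) := by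
      refine ⟨fromBlocks 1 0 (-((r ^ 2) • bᵀ)) (r • (1 : Matrix Unit Unit ℂ⟦X⟧)), ?_, ?_⟩
      · rw [det_fromBlocks_zero₁₂]; simpa using hru
      · have h3 : r ^ 2 • (s ^ 2 • bᵀ) = bᵀ := by rw [smul_smul, mul_comm, hr2, one_smul]
        have h4 : H * fromBlocks 1 0 (-((r ^ 2) • bᵀ)) (r • (1 : Matrix Unit Unit ℂ⟦X⟧)) =
            fromBlocks (A - (r ^ 2) • (b * bᵀ)) (r • b) 0 ((s ^ 2 * r) • 1) := by
          rw [hblk, fromBlocks_multiply]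
          congr 1
          · simp [sub_eq_add_neg]
          · simp
          · simp [h3]
          · simp [smul_smul, mul_comm]
        rw [Matrix.mul_assoc, h4, fromBlocks_transpose, fromBlocks_multiply]
        congr 1
        · simp
        · have : s ^ 2 * r * r ^ 2 = r := by linear_combination r * hr2
          simp [smul_smul, this]
        · simp
        · have : s ^ 2 * r * r = 1 := by linear_combination hr2
          simp [smul_smul, this]
    refine hcong.trans ?_
    obtain ⟨Q, hQ, hQ1⟩ := ih (Fin N) (A - (r ^ 2) • (b * bᵀ)) (by simp)
      (by simp [transpose_mul, hA]) (by
        obtain ⟨P, hP, hP1⟩ := hcong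
        have := congrArg Matrix.det hP1
        rw [det_fromBlocks_zero₁₂, det_mul, det_mul, det_transpose, det_one, mul_one] at this
        rw [← this]
        exact (hP.mul hHd).mul hP)
    refine ⟨fromBlocks Q 0 0 1, by rw [det_fromBlocks_zero₁₂]; simpa using hQ, ?_⟩
    rw [fromBlocks_transpose, fromBlocks_multiply, fromBlocks_multiply, ← fromBlocks_one]
    congr 1 <;> simp [hQ1]

open LieAlgebra.Orthogonal in
theorem JD_mul_JD (n : ℕ) (R : Type*) [CommRing R] : JD (Fin n) R * JD (Fin n) R = 1 := by
  simp [JD, fromBlocks_multiply]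

open LieAlgebra.Orthogonal in
theorem JD_transpose (n : ℕ) (R : Type*) [CommRing R] : (JD (Fin n) R)ᵀ = JD (Fin n) R := by
  simp [JD, fromBlocks_transpose]

open LieAlgebra.Orthogonal in
theorem cong_JD {n : ℕ} (G : Matrix (Fin n ⊕ Fin n) (Fin n ⊕ Fin n) ℂ⟦X⟧)
    (hs : Gᵀ = G) (hd : IsUnit G.det) : Cong G (JD (Fin n) ℂ⟦X⟧) :=
  (cong_one G hs hd).trans (cong_one _ (JD_transpose n _) (by
    have := congrArg Matrix.det (JD_mul_JD n ℂ⟦X⟧)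
    rw [det_mul, det_one] at this
    exact IsUnit.of_mul_eq_one _ this)).symm'

open LieAlgebra.Orthogonal in
/-- An orthogonal reflection. -/
theorem exists_reflection {n : ℕ} (hn : 0 < n) (R : Type*) [CommRing R] :
    ∃ S : Matrix (Fin n ⊕ Fin n) (Fin n ⊕ Fin n) R, Sᵀ * JD (Fin n) R * S = JD (Fin n) R ∧
      S.det = -1 := by
  let i : Fin n := ⟨0, hn⟩
  let s : Equiv.Perm (Fin n ⊕ Fin n) := Equiv.swap (Sum.inl i) (Sum.inr i)
  refine ⟨(1 : Matrix _ _ R).submatrix s id, ?_, ?_⟩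
  · have hss : ∀ a, s (s a) = a := fun a => Equiv.swap_apply_self _ _ a
    have hJ : ∀ a b, JD (Fin n) R a b = if b = Sum.swap a then 1 else 0 := by
      rintro (a | a) (b | b) <;> simp [JD, one_apply, eq_comm]
    have hsw : ∀ a, Sum.swap (s a) = s (Sum.swap a) := by
      rintro (a | a) <;> by_cases h : a = i <;> simp [s, Equiv.swap_apply_def, h]
    ext a b
    simp only [mul_apply, transpose_apply, submatrix_apply, id, one_apply]
    have h1 : ∀ c x, s c = x ↔ c = s x := fun c x =>
      ⟨fun h => by rw [← h, hss], fun h => by rw [h, hss]⟩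
    simp only [h1, ite_mul, one_mul, zero_mul, mul_ite, mul_one, mul_zero, Finset.sum_ite_eq', Finset.mem_univ,
      if_true]
    rw [hJ, hJ, hsw]
    simp
  · rw [det_permute]
    simp [s]

end

section

open Matrix

/-! ### Chain systems -/

/-- Data of a system of chains `X j, Γ X j, …, Γ ^ (d j - 1) X j` with slopes `ν`, initial levels
`α`, a duality `σ` and tie-breaking weights `T`. -/
structure ChainSys (V J : Type) where
  X : J → V
  d : J → ℕ
  ν : J → ℚ
  α : J → ℚ
  σ : J → J
  T : J → ℕ → ℤ

section

variable {V J : Type} [AddCommGroup V] [Module ℂ⸨X⸩ V]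

/-- The level of the `a`-th element of the chain `j`. -/
def ChainSys.al (S : ChainSys V J) (j : J) (a : ℕ) : ℚ := S.α j + a * S.ν j

/-- The conditions on a chain system. -/
structure ChainSys.IsGood (S : ChainSys V J) (B : LinearMap.BilinForm ℂ⸨X⸩ V)
    (Γ : Module.End ℂ⸨X⸩ V) : Prop where
  d_pos : ∀ j, 0 < S.d j
  ν_pos : ∀ j, 0 < S.ν j
  σσ : ∀ j, S.σ (S.σ j) = j
  d_σ : ∀ j, S.d (S.σ j) = S.d j
  ν_σ : ∀ j, S.ν (S.σ j) = S.ν j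
  α_σ : ∀ j, S.α (S.σ j) = -(S.α j + (S.d j - 1) * S.ν j)
  T_σ : ∀ j a b, a + b + 1 = S.d j → S.T (S.σ j) b = -S.T j a
  α_ge : ∀ j, -(1 / 2) ≤ S.α j
  end_ge : ∀ j, 1 / 2 ≤ S.al j (S.d j)
  ord : ∀ j j' a a', a ≤ S.d j → a' ≤ S.d j' →
    OrdGE (B ((Γ ^ a) (S.X j)) ((Γ ^ a') (S.X j'))) (S.al j a + S.al j' a')
  end_tie : ∀ j j', S.al j (S.d j) = 1 / 2 → S.α j' = -(1 / 2) →
    OrdGE (B ((Γ ^ S.d j) (S.X j)) (S.X j')) 1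
  dual : ∀ j, (B ((Γ ^ (S.d j - 1)) (S.X j)) (S.X (S.σ j))).coeff 0 ≠ 0
  tie : ∀ j j' a a', a < S.d j → a' < S.d j' → S.al j a + S.al j' a' = 0 →
    0 ≤ S.T j a + S.T j' a' → ¬(j' = S.σ j ∧ a + a' + 1 = S.d j) →
    (B ((Γ ^ a) (S.X j)) ((Γ ^ a') (S.X j'))).coeff 0 = 0

/-- The pairings of initial vectors of level `-1/2` are integral, except possibly at `p`. -/
def ChainSys.StartOK (S : ChainSys V J) (B : LinearMap.BilinForm ℂ⸨X⸩ V) (E : J → J → Prop) :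
    Prop :=
  ∀ j j', S.α j = -(1 / 2) → S.α j' = -(1 / 2) → ¬ E j j' → OrdGE (B (S.X j) (S.X j')) 0

end

/-! ### Powers of skew maps, Jordan bases and triangular Gram matrices. -/

theorem skew_pow {V : Type} [AddCommGroup V] [Module ℂ⸨X⸩ V] {B : LinearMap.BilinForm ℂ⸨X⸩ V}
    {Γ : Module.End ℂ⸨X⸩ V} (hΓ : ∀ x y, B (Γ x) y = -B x (Γ y)) (a : ℕ) (x y : V) :
    B ((Γ ^ a) x) y = (-1) ^ a * B x ((Γ ^ a) y) := by
  induction a generalizing x y with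
  | zero => simp
  | succ a ih =>
    rw [pow_succ', Module.End.mul_apply, hΓ, ih, ← Module.End.mul_apply, ← pow_succ, pow_succ' Γ a, pow_succ (-1 : ℂ⸨X⸩)]
    ring

/-- A matrix with a basis of Jordan chains. -/
theorem hasJordanPartition_of_basis {ι J : Type} [Fintype ι] [Fintype J] (A : Matrix ι ι ℂ)
    (d : J → ℕ) (hd : ∀ j, 0 < d j) (b : Module.Basis (Σ j : J, Fin (d j)) ℂ (ι → ℂ))
    (h : ∀ (j : J) (a : ℕ) (ha : a < d j), A.mulVec (b ⟨j, ⟨a, ha⟩⟩) =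
      if h' : a + 1 < d j then b ⟨j, ⟨a + 1, h'⟩⟩ else 0) :
    HasJordanPartition A (Multiset.map d Finset.univ.val) := by
  let e := (Fintype.equivFin J).symm
  -- The chains are reversed: here `A` raises the index along a chain, whereas in
  -- `HasJordanPartition` it lowers it.
  let eb : (Σ i : Fin (Fintype.card J), Fin (d (e i))) ≃ Σ j : J, Fin (d j) :=
    (Equiv.sigmaCongrRight fun i => Fin.revPerm).trans (Equiv.sigmaCongrLeft (β := fun j => Fin (d j)) e)
  refine ⟨Fintype.card J, fun i => d (e i), b.reindex eb.symm, fun i => hd _, ?_, ?_⟩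
  · rw [show (fun i => d (e i)) = d ∘ e from rfl, ← Multiset.map_map]
    congr 1
    simp
  · intro i j hj
    have hj' : j < d (e i) := hj
    have he (k : Fin (d (e i))) : eb ⟨i, k⟩ = ⟨e i, k.rev⟩ := rfl
    simp only [Module.Basis.reindex_apply, Equiv.symm_symm, he]
    have hlt : d (e i) - (j + 1) < d (e i) := by have := hd (e i); omega
    have := h (e i) (d (e i) - (j + 1)) hlt
    rw [show (⟨j, hj⟩ : Fin (d (e i))).rev = ⟨d (e i) - (j + 1), hlt⟩ from rfl, this]
    by_cases h0 : j = 0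
    · subst h0
      rw [dif_neg (by have := hd (e i); omega), if_pos rfl]
    · rw [dif_pos (by omega), if_neg h0]
      congr 2
      ext
      simp [Fin.val_rev]
      omega

/-- A weight-triangular matrix has nonzero determinant. -/
theorem det_ne_zero_of_weight {I W : Type} [Fintype I] [DecidableEq I] [LinearOrder W]
    (G : Matrix I I ℂ) (τ : I → I) (hτ : ∀ p, τ (τ p) = p) (w : I → W)
    (hdual : ∀ p, G p (τ p) ≠ 0) (hz : ∀ p q, G p (τ q) ≠ 0 → p ≠ q → w p < w q) : G.det ≠ 0 := by
  intro h0
  obtain ⟨v, hv, hGv⟩ := Matrix.exists_mulVec_eq_zero_iff.2 h0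
  -- At an index of maximal weight in the support of the kernel vector, row `p` has a single
  -- surviving term.
  obtain ⟨p, hp, hmax⟩ : ∃ p, v (τ p) ≠ 0 ∧ ∀ q, v (τ q) ≠ 0 → w q ≤ w p := by
    obtain ⟨p0, hp0⟩ := Function.ne_iff.1 hv
    obtain ⟨p, hp, hm⟩ := Finset.exists_max_image (Finset.univ.filter fun p => v (τ p) ≠ 0) w
      ⟨τ p0, by simpa [hτ] using hp0⟩
    exact ⟨p, by simpa using hp, fun q hq => hm q (by simpa using hq)⟩
  have h1 := congrFun hGv p
  rw [Matrix.mulVec, dotProduct, Finset.sum_eq_single (τ p)] at h1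
  · exact mul_ne_zero (hdual p) hp h1
  · intro q _ hq
    by_contra hne
    have hq1 : G p (τ (τ q)) ≠ 0 := by rw [hτ]; exact left_ne_zero_of_mul hne
    have hlt := hz p (τ q) hq1 (by rintro rfl; exact hq (hτ q).symm)
    exact absurd (hmax (τ q) (by rw [hτ]; exact right_ne_zero_of_mul hne)) (not_le.2 hlt)
  · simp

end

section

open Matrix LieAlgebra.Orthogonal

/-! ### From chain systems to reductions -/

section

variable {V J : Type} [AddCommGroup V] [Module ℂ⸨X⸩ V] {B : LinearMap.BilinForm ℂ⸨X⸩ V}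
  {Γ : Module.End ℂ⸨X⸩ V} {S : ChainSys V J}

theorem ChainSys.IsGood.al_ge (h : S.IsGood B Γ) (j : J) (a : ℕ) : -(1 / 2) ≤ S.al j a := by
  have h1 := h.α_ge j
  have h2 : 0 ≤ (a : ℚ) * S.ν j := mul_nonneg (by positivity) (h.ν_pos j).le
  unfold ChainSys.al
  linarith

theorem ChainSys.IsGood.start_of_al_eq (h : S.IsGood B Γ) {j : J} {a : ℕ}
    (he : S.al j a = -(1 / 2)) : a = 0 ∧ S.α j = -(1 / 2) := by
  have h1 := h.α_ge j
  unfold ChainSys.al at he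
  rcases Nat.eq_zero_or_pos a with rfl | ha
  · exact ⟨rfl, by simpa using he⟩
  · have h2 : 0 < (a : ℚ) * S.ν j := mul_pos (by exact_mod_cast ha) (h.ν_pos j)
    linarith

/-- A level sum above `-1` gives a non-negative order by rounding. The sum equals `-1` only for two
initial vectors of level `-1/2`, and these are covered by `StartOK`. -/
theorem ChainSys.IsGood.integral (h : S.IsGood B Γ) (h0 : S.StartOK B fun _ _ => False)
    (j j' : J) (a a' : ℕ) (ha : a ≤ S.d j) (ha' : a' ≤ S.d j') :
    OrdGE (B ((Γ ^ a) (S.X j)) ((Γ ^ a') (S.X j'))) 0 := by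
  have h1 := h.al_ge j a
  have h2 := h.al_ge j' a'
  have h3 := h.ord j j' a a' ha ha'
  by_cases hlt : -1 < S.al j a + S.al j' a'
  · exact h3.zero_of_gt hlt
  · obtain ⟨rfl, hj⟩ := h.start_of_al_eq (j := j) (a := a) (by linarith)
    obtain ⟨rfl, hj'⟩ := h.start_of_al_eq (j := j') (a := a') (by linarith)
    simpa using h0 j j' hj hj' (by simp)

/-- The image of the last vector has level at least `1/2`, so its pairings have positive order
unless the other vector is an initial one of level `-1/2`; that tie is the condition `end_tie`. -/
theorem ChainSys.IsGood.end_ordGE (h : S.IsGood B Γ) (j j' : J) (a' : ℕ) (ha' : a' ≤ S.d j') :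
    OrdGE (B ((Γ ^ S.d j) (S.X j)) ((Γ ^ a') (S.X j'))) 1 := by
  have h1 := h.end_ge j
  have h2 := h.al_ge j' a'
  have h3 := h.ord j j' (S.d j) a' le_rfl ha'
  by_cases hlt : 0 < S.al j (S.d j) + S.al j' a'
  · exact h3.one_of_pos hlt
  · obtain ⟨rfl, hj'⟩ := h.start_of_al_eq (j := j') (a := a') (by linarith)
    simpa using h.end_tie j j' (by linarith) hj'

end

theorem sigma_fin_ext {J : Type} {d : J → ℕ} {p q : Σ j : J, Fin (d j)} (h : p.1 = q.1)
    (h' : (p.2 : ℕ) = q.2) : p = q := by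
  obtain ⟨j, a⟩ := p
  obtain ⟨j', a'⟩ := q
  obtain rfl : j = j' := h
  obtain rfl : a = a' := Fin.ext h'
  rfl

/-- The standard split pairing. -/
def stdB (n : ℕ) : LinearMap.BilinForm ℂ⸨X⸩ (Fin n ⊕ Fin n → ℂ⸨X⸩) :=
  Matrix.toBilin' (JD (Fin n) ℂ⸨X⸩)

theorem stdB_apply (n : ℕ) (x y : Fin n ⊕ Fin n → ℂ⸨X⸩) :
    stdB n x y = x ⬝ᵥ (JD (Fin n) ℂ⸨X⸩).mulVec y := Matrix.toBilin'_apply' _ _ _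

theorem stdB_symm (n : ℕ) (x y : Fin n ⊕ Fin n → ℂ⸨X⸩) : stdB n x y = stdB n y x := by
  rw [stdB_apply, stdB_apply, dotProduct_mulVec, dotProduct_comm, ← mulVec_transpose,
    JD_transpose]

theorem mem_typeD {n : ℕ} {R : Type*} [CommRing R] {A : Matrix (Fin n ⊕ Fin n) (Fin n ⊕ Fin n) R} :
    A ∈ typeD (Fin n) R ↔ (JD (Fin n) R * A)ᵀ = -(JD (Fin n) R * A) := by
  rw [typeD, mem_skewAdjointMatricesLieSubalgebra, mem_skewAdjointMatricesSubmodule,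
    Matrix.IsSkewAdjoint, Matrix.IsAdjointPair, transpose_mul, JD_transpose, Matrix.mul_neg]

theorem stdB_skew {n : ℕ} (γ : typeD (Fin n) ℂ⸨X⸩) (x y : Fin n ⊕ Fin n → ℂ⸨X⸩) :
    stdB n (Matrix.toLin' (γ : Matrix (Fin n ⊕ Fin n) (Fin n ⊕ Fin n) ℂ⸨X⸩) x) y =
      -stdB n x (Matrix.toLin' (γ : Matrix (Fin n ⊕ Fin n) (Fin n ⊕ Fin n) ℂ⸨X⸩) y) := by
  have h := mem_typeD.1 γ.2
  rw [stdB_symm, stdB_apply, stdB_apply, toLin'_apply, toLin'_apply, mulVec_mulVec, mulVec_mulVec,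
    dotProduct_mulVec, dotProduct_comm, ← mulVec_transpose, h, neg_mulVec, dotProduct_neg]

/-- The matrices `G` of the pairings `⟨u_i, u_k⟩` and `H` of the pairings `⟨u_i, Γ u_k⟩` are
integral, and `G` is invertible modulo `t`. So the chains span a self-dual lattice on which `Γ` acts
by `G⁻¹ H`, and modulo `t` this is the shift along the chains. A splitting of the lattice turns its
basis into an element of the loop group. -/
theorem hasReduction_of_chainSys {n : ℕ} (γ : typeD (Fin n) ℂ⸨X⸩) {J : Type} [Fintype J]
    (S : ChainSys (Fin n ⊕ Fin n → ℂ⸨X⸩) J)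
    (hS : S.IsGood (stdB n) (Matrix.toLin' (γ : Matrix (Fin n ⊕ Fin n) (Fin n ⊕ Fin n) ℂ⸨X⸩)))
    (h0 : S.StartOK (stdB n) fun _ _ => False) (hcard : ∑ j, S.d j = 2 * n) :
    HasReduction γ (Multiset.map S.d Finset.univ.val) := by
  classical
  set g : Matrix (Fin n ⊕ Fin n) (Fin n ⊕ Fin n) ℂ⸨X⸩ := (γ : Matrix (Fin n ⊕ Fin n) (Fin n ⊕ Fin n) ℂ⸨X⸩) with hg
  set Γ := Matrix.toLin' g with hΓ
  let ι := Fin n ⊕ Fin n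
  let I := Σ j : J, Fin (S.d j)
  obtain ⟨e⟩ : Nonempty (ι ≃ I) := ⟨Fintype.equivOfCardEq (by simp [ι, I, hcard]; ring)⟩
  let U : I → ι → ℂ⸨X⸩ := fun p => (Γ ^ (p.2 : ℕ)) (S.X p.1)
  let u : ι → ι → ℂ⸨X⸩ := fun i => U (e i)
  have hu (p : I) : u (e.symm p) = (Γ ^ (p.2 : ℕ)) (S.X p.1) :=
    congrArg U (e.apply_symm_apply p)
  have hΓu (i : ι) : Γ (u i) = (Γ ^ ((e i).2 + 1 : ℕ)) (S.X (e i).1) := by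
    rw [pow_succ', Module.End.mul_apply]
  let Q : Matrix ι ι ℂ⸨X⸩ := Matrix.of fun i k => u k i
  have hGram (i k : ι) : (Qᵀ * JD (Fin n) ℂ⸨X⸩ * Q) i k = stdB n (u i) (u k) := by
    rw [Matrix.mul_assoc, stdB_apply]
    rfl
  have hGram2 (i k : ι) : (Qᵀ * JD (Fin n) ℂ⸨X⸩ * (g * Q)) i k = stdB n (u i) (Γ (u k)) := by
    rw [Matrix.mul_assoc, stdB_apply, hΓ, toLin'_apply]
    rfl
  have hint (i k : ι) : OrdGE (stdB n (u i) (u k)) 0 :=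
    hS.integral h0 _ _ _ _ (e i).2.2.le (e k).2.2.le
  have hint2 (i k : ι) : OrdGE (stdB n (u i) (Γ (u k))) 0 := by
    rw [hΓu]; exact hS.integral h0 _ _ _ _ (e i).2.2.le (e k).2.2
  choose G0 hG0 using fun i k => ordGE_zero_iff.1 (hint i k)
  choose H0 hH0 using fun i k => ordGE_zero_iff.1 (hint2 i k)
  let G : Matrix ι ι ℂ⟦X⟧ := Matrix.of G0
  let H : Matrix ι ι ℂ⟦X⟧ := Matrix.of H0
  let am := algebraMap ℂ⟦X⟧ ℂ⸨X⸩
  have hG : G.map am = Qᵀ * JD (Fin n) ℂ⸨X⸩ * Q := by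
    ext1 i k; rw [hGram]; exact hG0 i k
  have hH : H.map am = Qᵀ * JD (Fin n) ℂ⸨X⸩ * (g * Q) := by
    ext1 i k; rw [hGram2]; exact hH0 i k
  have hinj : Function.Injective (fun A : Matrix ι ι ℂ⟦X⟧ => A.map am) :=
    Matrix.map_injective algebraMap_injective
  have hGs : Gᵀ = G := by
    refine hinj ?_
    ext1 i k
    change am (G0 k i) = am (G0 i k)
    rw [hG0, hG0, stdB_symm]
  have hHs : Hᵀ = -H := by
    refine hinj ?_
    ext1 i k
    change am (H0 k i) = am (-H0 i k)
    rw [map_neg, hH0, hH0, stdB_symm, stdB_skew]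
  -- the reduction of the Gram matrix
  let cc := PowerSeries.constantCoeff (R := ℂ)
  have hGc (i k : ι) : cc (G i k) = (stdB n (u i) (u k)).coeff 0 := by
    rw [← hG0, coeff_zero_algebraMap]; rfl
  have hHc (i k : ι) : cc (H i k) = (stdB n (u i) (Γ (u k))).coeff 0 := by
    rw [← hH0, coeff_zero_algebraMap]; rfl
  have hdet : (G.map cc).det ≠ 0 := by
    -- The dual of the `a`-th vector of the chain `j` is the `(d - 1 - a)`-th vector of the chain `σ
    -- j`; it has the opposite level and the opposite weight.
    let τI : I → I := fun p => ⟨S.σ p.1, ⟨S.d p.1 - 1 - p.2, by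
      rw [hS.d_σ]; have := p.2.2; omega⟩⟩
    have hτI (p : I) : τI (τI p) = p := by
      refine sigma_fin_ext (hS.σσ _) ?_
      have := p.2.2
      simp only [τI, hS.d_σ]
      omega
    -- Lexicographic weight: the level first, then `T` to break ties.
    let wI : I → ℚ ×ₗ ℤ := fun p => toLex (S.al p.1 p.2, S.T p.1 p.2)
    have hal (p : I) : S.al (τI p).1 (τI p).2 = -S.al p.1 p.2 := by
      have h1 := p.2.2
      have h2 : ((S.d p.1 - 1 - (p.2 : ℕ) : ℕ) : ℚ) = S.d p.1 - 1 - (p.2 : ℕ) := by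
        rw [Nat.cast_sub (by omega), Nat.cast_sub (by omega)]; simp
      simp only [τI, ChainSys.al, hS.α_σ, hS.ν_σ, h2]
      ring
    have hT (p : I) : S.T (τI p).1 (τI p).2 = -S.T p.1 p.2 :=
      hS.T_σ _ _ _ (by have := p.2.2; simp only [τI]; omega)
    refine det_ne_zero_of_weight _ (fun i => e.symm (τI (e i))) (fun i => by simp [hτI])
      (fun i => wI (e i)) ?_ ?_
    · intro i
      rw [Matrix.map_apply, hGc]
      have h1 := hS.dual (e i).1
      have h2 : S.d (e i).1 - 1 - ((e i).2 : ℕ) + (e i).2 = S.d (e i).1 - 1 := by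
        have := (e i).2.2; omega
      -- Skewness of `Γ` transports the duality condition from the last vector of a chain to all the
      -- others, up to sign.
      have h3 : stdB n ((Γ ^ (S.d (e i).1 - 1)) (S.X (e i).1)) (S.X (S.σ (e i).1)) =
          (-1) ^ (S.d (e i).1 - 1 - ((e i).2 : ℕ)) *
            stdB n (u i) (u (e.symm (τI (e i)))) := by
        rw [hu, ← h2, pow_add, Module.End.mul_apply, skew_pow (stdB_skew γ), h2]
      intro h4
      rw [h3] at h1
      rcases neg_one_pow_eq_or ℂ⸨X⸩ (S.d (e i).1 - 1 - ((e i).2 : ℕ)) with h | h <;>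
        rw [h] at h1 <;> simp [h4] at h1
    · intro i k hne hik
      rw [Matrix.map_apply, hGc] at hne
      set p := e i with hp
      set q := τI (e k) with hq
      rw [hu] at hne
      have h1 : S.al p.1 p.2 + S.al q.1 q.2 ≤ 0 := by
        by_contra hlt
        exact hne (((hS.ord p.1 q.1 p.2 q.2 p.2.2.le q.2.2.le).one_of_pos (not_le.1 hlt)).coeff_zero)
      rw [Prod.Lex.lt_iff]
      change S.al p.1 p.2 < S.al (e k).1 (e k).2 ∨ S.al p.1 p.2 = S.al (e k).1 (e k).2 ∧
        S.T p.1 p.2 < S.T (e k).1 (e k).2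
      have h2 := hal (e k)
      have h3 := hT (e k)
      rw [← hq] at h2 h3
      rcases h1.lt_or_eq with h1 | h1
      · left; linarith
      · right
        refine ⟨by linarith, ?_⟩
        by_contra hlt
        refine hne (hS.tie p.1 q.1 p.2 q.2 p.2.2 q.2.2 h1 (by omega) ?_)
        rintro ⟨h4, h5⟩
        apply hik
        apply e.injective
        rw [← hτI (e k), ← hq, ← hp, ← hτI p]
        refine congrArg τI (sigma_fin_ext h4.symm ?_)
        simp only [τI]
        omega
  have hGdet : IsUnit G.det := by
    rw [PowerSeries.isUnit_iff_constantCoeff, isUnit_iff_ne_zero, RingHom.map_det]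
    exact hdet
  -- the shift matrix
  let Sh : Matrix ι ι ℂ := Matrix.of fun i k =>
    if (e i).1 = (e k).1 ∧ ((e i).2 : ℕ) = (e k).2 + 1 then 1 else 0
  have hSh1 (p : I) (k : ι) : Sh (e.symm p) k =
      if p.1 = (e k).1 ∧ (p.2 : ℕ) = (e k).2 + 1 then 1 else 0 := by
    conv_rhs => rw [← e.apply_symm_apply p]
    rfl
  have hSh2 (i : ι) (p : I) : Sh i (e.symm p) =
      if (e i).1 = p.1 ∧ ((e i).2 : ℕ) = p.2 + 1 then 1 else 0 := by
    conv_rhs => rw [← e.apply_symm_apply p]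
    rfl
  -- Modulo `t`, the vector `Γ u_k` has the same pairings as the next vector of its chain, or as `0`
  -- at the end of the chain. As `G` is invertible, this identifies the action of `Γ` with the
  -- shift.
  have hSh : G.map cc * Sh = H.map cc := by
    ext i k
    rw [Matrix.mul_apply, Matrix.map_apply, hHc, hΓu]
    by_cases hk : ((e k).2 : ℕ) + 1 < S.d (e k).1
    · rw [Finset.sum_eq_single (e.symm ⟨(e k).1, ⟨(e k).2 + 1, hk⟩⟩)]
      · rw [Matrix.map_apply, hGc, hu, hSh1, if_pos ⟨rfl, rfl⟩, mul_one]
      · intro x _ hx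
        have : ¬((e x).1 = (e k).1 ∧ ((e x).2 : ℕ) = (e k).2 + 1) := by
          rintro ⟨h1, h2⟩
          apply hx
          rw [Equiv.eq_symm_apply]
          exact sigma_fin_ext h1 h2
        simp [Sh, this]
      · simp
    · have hk' : ((e k).2 : ℕ) + 1 = S.d (e k).1 := by have := (e k).2.2; omega
      rw [Finset.sum_eq_zero]
      · rw [stdB_symm, hk']
        exact (hS.end_ordGE _ _ _ (e i).2.2.le).coeff_zero.symm
      · intro x _
        have : ¬((e x).1 = (e k).1 ∧ ((e x).2 : ℕ) = (e k).2 + 1) := by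
          rintro ⟨h1, h2⟩
          have := (e x).2.2
          rw [h2, h1] at this
          omega
        simp [Sh, this]
  -- the splitting
  obtain ⟨P, hP, hPJ⟩ : ∃ P : Matrix ι ι ℂ⟦X⟧, (Q * P.map am).det = 1 ∧
      Pᵀ * G * P = JD (Fin n) ℂ⟦X⟧ := by
    obtain ⟨P, hP, hPJ⟩ := cong_JD G hGs hGdet
    have hsq : (Q * P.map am).det ^ 2 = 1 := by
      have h1 := congrArg (fun A : Matrix ι ι ℂ⟦X⟧ => (A.map am).det) hPJ
      have h2 : (JD (Fin n) ℂ⟦X⟧).map am = JD (Fin n) ℂ⸨X⸩ := by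
        simp [JD, fromBlocks_map]
      have h3 := congrArg Matrix.det (JD_mul_JD n ℂ⸨X⸩)
      simp only [Matrix.map_mul, hG, h2, transpose_map, det_mul, det_transpose, det_one] at h1 h3 ⊢
      have h4 : (JD (Fin n) ℂ⸨X⸩).det ≠ 0 := left_ne_zero_of_mul_eq_one h3
      apply mul_right_cancel₀ h4
      linear_combination h1
    rcases sq_eq_one_iff.1 hsq with h | h
    · exact ⟨P, h, hPJ⟩
    -- Determinant `-1` is repaired by a reflection. For `n = 0` there is none, but the empty
    -- determinant is `1` anyway.
    · rcases Nat.eq_zero_or_pos n with rfl | hn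
      · exact ⟨P, by simp [ι], hPJ⟩
      obtain ⟨R, hR, hRd⟩ := exists_reflection hn ℂ⟦X⟧
      refine ⟨P * R, ?_, ?_⟩
      · rw [Matrix.map_mul, ← Matrix.mul_assoc, det_mul, h]
        have : (R.map am).det = am R.det := (RingHom.map_det am R).symm
        rw [this, hRd, map_neg, map_one]; ring
      · rw [transpose_mul]
        calc Rᵀ * Pᵀ * G * (P * R) = Rᵀ * (Pᵀ * G * P) * R := by simp only [Matrix.mul_assoc]
          _ = _ := by rw [hPJ, hR]
  have hJJ (R : Type) [CommRing R] : JD (Fin n) R * JD (Fin n) R = 1 := JD_mul_JD n R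
  have hJm : (JD (Fin n) ℂ⟦X⟧).map am = JD (Fin n) ℂ⸨X⸩ := by simp [JD, fromBlocks_map]
  have hPdet : IsUnit P.det := by
    have h1 := congrArg Matrix.det hPJ
    have h2 : IsUnit (JD (Fin n) ℂ⟦X⟧).det := by
      have := congrArg Matrix.det (hJJ ℂ⟦X⟧)
      rw [det_mul, det_one] at this
      exact IsUnit.of_mul_eq_one _ this
    rw [← h1, det_mul] at h2
    exact isUnit_of_mul_isUnit_right h2
  -- `G⁻¹ * H` is the matrix of `Γ` in the basis of the chains, so `δ` is integral by construction.
  let δ : Matrix ι ι ℂ⟦X⟧ := P⁻¹ * (G⁻¹ * H) * P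
  have hGP : G * (P * δ) = H * P := by
    calc G * (P * δ) = G * (P * P⁻¹) * (G⁻¹ * H) * P := by simp only [δ, Matrix.mul_assoc]
      _ = (G * G⁻¹) * H * P := by
        rw [Matrix.mul_nonsing_inv _ hPdet, Matrix.mul_one]; simp only [Matrix.mul_assoc]
      _ = H * P := by rw [Matrix.mul_nonsing_inv _ hGdet, Matrix.one_mul]
  have hJδ : JD (Fin n) ℂ⟦X⟧ * δ = Pᵀ * H * P := by
    rw [← hPJ, Matrix.mul_assoc, Matrix.mul_assoc, hGP, Matrix.mul_assoc]
  have hδ : δ ∈ typeD (Fin n) ℂ⟦X⟧ := by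
    rw [mem_typeD, hJδ, transpose_mul, transpose_mul, hHs, transpose_transpose]
    simp [Matrix.mul_assoc]
  let h := Q * P.map am
  have hh : hᵀ * JD (Fin n) ℂ⸨X⸩ * h = JD (Fin n) ℂ⸨X⸩ := by
    calc hᵀ * JD (Fin n) ℂ⸨X⸩ * h = (P.map am)ᵀ * (Qᵀ * JD (Fin n) ℂ⸨X⸩ * Q) * P.map am := by
          simp only [h, transpose_mul, Matrix.mul_assoc]
      _ = (Pᵀ * G * P).map am := by
          rw [← hG, Matrix.map_mul, Matrix.map_mul, transpose_map]
      _ = _ := by rw [hPJ, hJm]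
  have hhg : hᵀ * JD (Fin n) ℂ⸨X⸩ * (g * h) = JD (Fin n) ℂ⸨X⸩ * δ.map am := by
    calc hᵀ * JD (Fin n) ℂ⸨X⸩ * (g * h) =
          (P.map am)ᵀ * (Qᵀ * JD (Fin n) ℂ⸨X⸩ * (g * Q)) * P.map am := by
          simp only [h, transpose_mul, Matrix.mul_assoc]
      _ = (Pᵀ * H * P).map am := by
          rw [← hH, Matrix.map_mul, Matrix.map_mul, transpose_map]
      _ = _ := by rw [← hJδ, Matrix.map_mul, hJm]
  have hinv : h⁻¹ = JD (Fin n) ℂ⸨X⸩ * (hᵀ * JD (Fin n) ℂ⸨X⸩) := by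
    refine Matrix.inv_eq_left_inv ?_
    rw [Matrix.mul_assoc, hh, hJJ]
  refine ⟨h, ⟨δ, hδ⟩, ⟨hh, hP⟩, ?_, ?_⟩
  · change h⁻¹ * g * h = δ.map am
    rw [hinv, Matrix.mul_assoc, Matrix.mul_assoc, hhg, ← Matrix.mul_assoc, hJJ, Matrix.one_mul]
  · change HasJordanPartition (δ.map cc) _
    have hPc : IsUnit (P.map cc).det := by
      rw [show (P.map cc).det = cc P.det from (RingHom.map_det cc P).symm]
      exact hPdet.map cc
    have hGc' : IsUnit (G.map cc).det := isUnit_iff_ne_zero.2 hdet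
    have hcomm : δ.map cc * (P.map cc)⁻¹ = (P.map cc)⁻¹ * Sh := by
      have h1 : G.map cc * (P.map cc * δ.map cc) = G.map cc * (Sh * P.map cc) := by
        rw [← Matrix.mul_assoc (G.map cc) Sh, hSh, ← Matrix.map_mul, ← Matrix.map_mul,
          ← Matrix.map_mul, hGP]
      have h2 : P.map cc * δ.map cc = Sh * P.map cc := by
        have := congrArg ((G.map cc)⁻¹ * ·) h1
        simpa only [← Matrix.mul_assoc, Matrix.nonsing_inv_mul _ hGc', Matrix.one_mul] using this
      calc δ.map cc * (P.map cc)⁻¹ = (P.map cc)⁻¹ * (P.map cc * δ.map cc) * (P.map cc)⁻¹ := by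
            rw [← Matrix.mul_assoc, Matrix.nonsing_inv_mul _ hPc, Matrix.one_mul]
        _ = _ := by
            rw [h2, Matrix.mul_assoc, Matrix.mul_assoc, Matrix.mul_nonsing_inv _ hPc,
              Matrix.mul_one]
    let b : Module.Basis I ℂ (ι → ℂ) := ((Pi.basisFun ℂ ι).map (Matrix.toLin'OfInv
      (Matrix.mul_nonsing_inv _ hPc) (Matrix.nonsing_inv_mul _ hPc))).reindex e
    have hb (p : I) : b p = (P.map cc)⁻¹ *ᵥ Pi.single (e.symm p) 1 := by
      simp [b, Matrix.toLin'OfInv]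
    refine hasJordanPartition_of_basis _ S.d hS.d_pos b fun j a ha => ?_
    rw [hb, mulVec_mulVec, hcomm, ← mulVec_mulVec]
    have hcol (i : ι) : (Sh *ᵥ Pi.single (e.symm ⟨j, ⟨a, ha⟩⟩) 1) i =
        if (e i).1 = j ∧ ((e i).2 : ℕ) = a + 1 then 1 else 0 := by
      rw [Matrix.mulVec_single_one, Matrix.col_apply, hSh2]
    split_ifs with h'
    · rw [hb]
      congr 1
      ext i
      rw [hcol, Pi.single_apply]
      refine if_congr ?_ rfl rfl
      rw [Equiv.eq_symm_apply]
      constructor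
      · rintro ⟨h1, h2⟩
        exact sigma_fin_ext h1 h2
      · intro h1
        rw [h1]
        exact ⟨rfl, rfl⟩
    · have : Sh *ᵥ Pi.single (e.symm ⟨j, ⟨a, ha⟩⟩) 1 = 0 := by
        ext i
        rw [hcol, if_neg]
        · rfl
        · rintro ⟨h1, h2⟩
          have := (e i).2.2
          rw [h2, h1] at this
          exact h' this
      rw [this, mulVec_zero]

end

/-! ### Gluing chain systems -/

/-- `x` has order greater than `r`. -/
def OrdGT (x : ℂ⸨X⸩) (r : ℚ) : Prop := ∀ k : ℤ, (k : ℚ) ≤ r → x.coeff k = 0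

theorem OrdGE.gt {x : ℂ⸨X⸩} {r s : ℚ} (h : OrdGE x r) (hs : s < r) : OrdGT x s :=
  fun k hk => h k (hk.trans_lt hs)

theorem OrdGT.zero (r : ℚ) : OrdGT 0 r := fun _ _ => by simp

theorem OrdGT.coeff_zero {x : ℂ⸨X⸩} {r : ℚ} (h : OrdGT x r) (hr : 0 ≤ r) : x.coeff 0 = 0 :=
  h 0 (by simpa using hr)

theorem OrdGT.one {x : ℂ⸨X⸩} {r : ℚ} (h : OrdGT x r) (hr : 0 ≤ r) : OrdGE x 1 := by
  intro k hk
  refine h k (le_trans ?_ hr)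
  have : k < 1 := by exact_mod_cast hk
  exact_mod_cast Int.lt_add_one_iff.1 this

theorem OrdGT.int {x : ℂ⸨X⸩} {r : ℚ} (h : OrdGT x r) (hr : -1 ≤ r) : OrdGE x 0 := by
  intro k hk
  refine h k (le_trans ?_ hr)
  have : k < 0 := by exact_mod_cast hk
  exact_mod_cast Int.le_sub_one_of_lt this

section

variable {V J J' : Type}

theorem ChainSys.al_zero (S : ChainSys V J) (j : J) : S.al j 0 = S.α j := by simp [ChainSys.al]

variable [AddCommGroup V] [Module ℂ⸨X⸩ V] {B : LinearMap.BilinForm ℂ⸨X⸩ V}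
  {Γ : Module.End ℂ⸨X⸩ V} {S : ChainSys V J} {S' : ChainSys V J'}

/-- The union of two chain systems, with corrections of the initial vectors. -/
def ChainSys.glue (S : ChainSys V J) (S' : ChainSys V J') (L : J → V) (Y : J' → V) :
    ChainSys V (J ⊕ J') where
  X := Sum.elim (fun j => S.X j + L j) (fun j => Y j + S'.X j)
  d := Sum.elim S.d S'.d
  ν := Sum.elim S.ν S'.ν
  α := Sum.elim S.α S'.α
  σ := Sum.map S.σ S'.σ
  T := Sum.elim S.T S'.T

theorem ChainSys.IsGood.al_dual (h : S.IsGood B Γ) (j : J) :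
    S.al j (S.d j - 1) + S.al (S.σ j) 0 = 0 := by
  have := h.d_pos j
  rw [ChainSys.al, ChainSys.al, h.α_σ, Nat.cast_sub (by omega)]
  push_cast
  ring

/-- The result of gluing two orthogonal chain systems is a chain system. -/
theorem ChainSys.IsGood.glue (hBs : ∀ x y, B x y = B y x)
    (hS : S.IsGood B Γ) (hS' : S'.IsGood B Γ)
    {U U' : Submodule ℂ⸨X⸩ V} (hU : ∀ x ∈ U, ∀ a : ℕ, (Γ ^ a) x ∈ U)
    (hU' : ∀ x ∈ U', ∀ a : ℕ, (Γ ^ a) x ∈ U')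
    (horth : ∀ x ∈ U, ∀ y ∈ U', B x y = 0) (hX : ∀ j, S.X j ∈ U) (hX' : ∀ j, S'.X j ∈ U')
    {L : J → V} {Y : J' → V} (hL : ∀ j, L j ∈ U') (hY : ∀ j, Y j ∈ U)
    (hLL : ∀ j k a b, OrdGE (B ((Γ ^ a) (L j)) ((Γ ^ b) (L k))) (S.al j a + S.al k b) ∧
      (-1 < S.al j a + S.al k b →
        OrdGT (B ((Γ ^ a) (L j)) ((Γ ^ b) (L k))) (S.al j a + S.al k b)))
    (hYY : ∀ j k a b, a ≤ S'.d j → b ≤ S'.d k →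
      OrdGE (B ((Γ ^ a) (Y j)) ((Γ ^ b) (Y k))) (S'.al j a + S'.al k b) ∧
      (a < S'.d j →
        OrdGT (B ((Γ ^ a) (Y j)) ((Γ ^ b) (Y k))) (S'.al j a + S'.al k b)))
    (hLX : ∀ j k a b, b ≤ S'.d k →
      OrdGE (B ((Γ ^ a) (L j)) ((Γ ^ b) (S'.X k))) (S.al j a + S'.al k b) ∧
      (-(1 / 2) < S.al j a →
        OrdGT (B ((Γ ^ a) (L j)) ((Γ ^ b) (S'.X k))) (S.al j a + S'.al k b)))
    (hXY : ∀ j k a b, a ≤ S.d j → b ≤ S'.d k →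
      OrdGE (B ((Γ ^ a) (S.X j)) ((Γ ^ b) (Y k))) (S.al j a + S'.al k b) ∧
      (b < S'.d k →
        OrdGT (B ((Γ ^ a) (S.X j)) ((Γ ^ b) (Y k))) (S.al j a + S'.al k b)))
    (hT : ∀ j k b, L j ≠ 0 → b < S'.d k → S'.al k b = 1 / 2 → S.T j 0 + S'.T k b < 0)
    (hend : ∀ j k, S'.al k (S'.d k) = 1 / 2 → S.α j = -(1 / 2) →
      OrdGE (B ((Γ ^ S'.d k) (Y k)) (S.X j) + B ((Γ ^ S'.d k) (S'.X k)) (L j)) 1) :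
    (S.glue S' L Y).IsGood B Γ := by
  have h11 (j k a b) : B ((Γ ^ a) (S.X j + L j)) ((Γ ^ b) (S.X k + L k)) =
      B ((Γ ^ a) (S.X j)) ((Γ ^ b) (S.X k)) + B ((Γ ^ a) (L j)) ((Γ ^ b) (L k)) := by
    have e1 := horth _ (hU _ (hX j) a) _ (hU' _ (hL k) b)
    have e2 := horth _ (hU _ (hX k) b) _ (hU' _ (hL j) a)
    rw [hBs] at e2
    simp only [map_add, LinearMap.add_apply, e1, e2]; ring
  have h12 (j k a b) : B ((Γ ^ a) (S.X j + L j)) ((Γ ^ b) (Y k + S'.X k)) =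
      B ((Γ ^ a) (S.X j)) ((Γ ^ b) (Y k)) + B ((Γ ^ a) (L j)) ((Γ ^ b) (S'.X k)) := by
    have e1 := horth _ (hU _ (hX j) a) _ (hU' _ (hX' k) b)
    have e2 := horth _ (hU _ (hY k) b) _ (hU' _ (hL j) a)
    rw [hBs] at e2
    simp only [map_add, LinearMap.add_apply, e1, e2]; ring
  have h22 (j k a b) : B ((Γ ^ a) (Y j + S'.X j)) ((Γ ^ b) (Y k + S'.X k)) =
      B ((Γ ^ a) (Y j)) ((Γ ^ b) (Y k)) + B ((Γ ^ a) (S'.X j)) ((Γ ^ b) (S'.X k)) := by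
    have e1 := horth _ (hU _ (hY j) a) _ (hU' _ (hX' k) b)
    have e2 := horth _ (hU _ (hY k) b) _ (hU' _ (hX' j) a)
    rw [hBs] at e2
    simp only [map_add, LinearMap.add_apply, e1, e2]; ring
  have ord12 (j k a b) (ha : a ≤ S.d j) (hb : b ≤ S'.d k) :
      OrdGE (B ((Γ ^ a) (S.X j + L j)) ((Γ ^ b) (Y k + S'.X k))) (S.al j a + S'.al k b) := by
    rw [h12]
    exact (hXY j k a b ha hb).1.add (hLX j k a b hb).1
  have tie12 (j k a b) (ha : a < S.d j) (hb : b < S'.d k) (h0 : S.al j a + S'.al k b = 0)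
      (h1 : 0 ≤ S.T j a + S'.T k b) :
      (B ((Γ ^ a) (S.X j + L j)) ((Γ ^ b) (Y k + S'.X k))).coeff 0 = 0 := by
    have hge := hS.al_ge j a
    rw [h12, HahnSeries.coeff_add]
    have e2 : (B ((Γ ^ a) (L j)) ((Γ ^ b) (S'.X k))).coeff 0 = 0 := by
      rcases hge.lt_or_eq with hlt | heq
      · exact ((hLX j k a b hb.le).2 hlt).coeff_zero h0.ge
      · obtain ⟨rfl, hα⟩ := hS.start_of_al_eq heq.symm
        by_cases hLj : L j = 0
        · simp [hLj]
        · exact absurd h1 (not_le.2 (hT j k b hLj hb (by linarith)))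
    have e1 := ((hXY j k a b ha.le hb.le).2 hb).coeff_zero h0.ge
    rw [e1, e2, add_zero]
  constructor
  · rintro (j | j)
    exacts [hS.d_pos j, hS'.d_pos j]
  · rintro (j | j)
    exacts [hS.ν_pos j, hS'.ν_pos j]
  · rintro (j | j)
    exacts [congrArg Sum.inl (hS.σσ j), congrArg Sum.inr (hS'.σσ j)]
  · rintro (j | j)
    exacts [hS.d_σ j, hS'.d_σ j]
  · rintro (j | j)
    exacts [hS.ν_σ j, hS'.ν_σ j]
  · rintro (j | j)
    exacts [hS.α_σ j, hS'.α_σ j]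
  · rintro (j | j)
    exacts [hS.T_σ j, hS'.T_σ j]
  · rintro (j | j)
    exacts [hS.α_ge j, hS'.α_ge j]
  · rintro (j | j)
    exacts [hS.end_ge j, hS'.end_ge j]
  · rintro (j | j) (k | k) a b ha hb
    · change OrdGE (B ((Γ ^ a) (S.X j + L j)) ((Γ ^ b) (S.X k + L k))) (S.al j a + S.al k b)
      rw [h11]
      exact (hS.ord j k a b ha hb).add (hLL j k a b).1
    · exact ord12 j k a b ha hb
    · rw [hBs, add_comm]
      exact ord12 k j b a hb ha
    · change OrdGE (B ((Γ ^ a) (Y j + S'.X j)) ((Γ ^ b) (Y k + S'.X k))) (S'.al j a + S'.al k b)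
      rw [h22]
      exact (hYY j k a b ha hb).1.add (hS'.ord j k a b ha hb)
  · rintro (j | j) (k | k) hj hk
    · change S.al j (S.d j) = 1 / 2 at hj
      change S.α k = -(1 / 2) at hk
      change OrdGE (B ((Γ ^ S.d j) (S.X j + L j)) ((Γ ^ 0) (S.X k + L k))) 1
      rw [h11]
      refine (hS.end_tie j k hj hk).add (((hLL j k (S.d j) 0).2 ?_).one ?_) <;>
      · rw [S.al_zero, hj, hk]; norm_num
    · change S.al j (S.d j) = 1 / 2 at hj
      change S'.α k = -(1 / 2) at hk
      change OrdGE (B ((Γ ^ S.d j) (S.X j + L j)) ((Γ ^ 0) (Y k + S'.X k))) 1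
      rw [h12]
      refine OrdGE.add (((hXY j k (S.d j) 0 le_rfl (Nat.zero_le _)).2 (hS'.d_pos k)).one ?_)
        (((hLX j k (S.d j) 0 (Nat.zero_le _)).2 ?_).one ?_)
      · rw [S'.al_zero, hj, hk]; norm_num
      · rw [hj]; norm_num
      · rw [S'.al_zero, hj, hk]; norm_num
    · change S'.al j (S'.d j) = 1 / 2 at hj
      change S.α k = -(1 / 2) at hk
      change OrdGE (B ((Γ ^ S'.d j) (Y j + S'.X j)) ((Γ ^ 0) (S.X k + L k))) 1
      rw [hBs, h12, hBs, hBs ((Γ ^ 0) (L k))]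
      exact hend k j hj hk
    · change S'.al j (S'.d j) = 1 / 2 at hj
      change S'.α k = -(1 / 2) at hk
      change OrdGE (B ((Γ ^ S'.d j) (Y j + S'.X j)) ((Γ ^ 0) (Y k + S'.X k))) 1
      rw [h22]
      refine OrdGE.add ?_ (hS'.end_tie j k hj hk)
      rw [hBs]
      refine ((hYY k j 0 (S'.d j) (Nat.zero_le _) le_rfl).2 (hS'.d_pos k)).one ?_
      rw [S'.al_zero, hj, hk]; norm_num
  · rintro (j | j)
    · change (B ((Γ ^ (S.d j - 1)) (S.X j + L j)) ((Γ ^ 0) (S.X (S.σ j) + L (S.σ j)))).coeff 0 ≠ 0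
      rw [h11, HahnSeries.coeff_add, ((hLL j (S.σ j) (S.d j - 1) 0).2 ?_).coeff_zero, add_zero]
      · exact hS.dual j
      · rw [hS.al_dual]
      · rw [hS.al_dual]; norm_num
    · have hd := hS'.d_pos j
      change (B ((Γ ^ (S'.d j - 1)) (Y j + S'.X j)) ((Γ ^ 0) (Y (S'.σ j) + S'.X (S'.σ j)))).coeff 0
        ≠ 0
      rw [h22, HahnSeries.coeff_add, ((hYY j (S'.σ j) (S'.d j - 1) 0 (by omega)
        (Nat.zero_le _)).2 (by omega)).coeff_zero, zero_add]
      · exact hS'.dual j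
      · rw [hS'.al_dual]
  · rintro (j | j) (k | k) a b ha hb h0 h1 h2
    · change a < S.d j at ha
      change b < S.d k at hb
      change S.al j a + S.al k b = 0 at h0
      change (B ((Γ ^ a) (S.X j + L j)) ((Γ ^ b) (S.X k + L k))).coeff 0 = 0
      rw [h11, HahnSeries.coeff_add, ((hLL j k a b).2 (by rw [h0]; norm_num)).coeff_zero h0.ge,
        add_zero]
      refine hS.tie j k a b ha hb h0 h1 ?_
      rintro ⟨rfl, h3⟩
      exact h2 ⟨rfl, h3⟩
    · exact tie12 j k a b ha hb h0 h1
    · rw [hBs]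
      exact tie12 k j b a hb ha (by rw [add_comm]; exact h0) (by rw [add_comm]; exact h1)
    · change a < S'.d j at ha
      change b < S'.d k at hb
      change S'.al j a + S'.al k b = 0 at h0
      change (B ((Γ ^ a) (Y j + S'.X j)) ((Γ ^ b) (Y k + S'.X k))).coeff 0 = 0
      rw [h22, HahnSeries.coeff_add, ((hYY j k a b ha.le hb.le).2 ha).coeff_zero h0.ge,
        zero_add]
      refine hS'.tie j k a b ha hb h0 h1 ?_
      rintro ⟨rfl, h3⟩
      exact h2 ⟨rfl, h3⟩

/-- Rescaling the tie-breaking weights. -/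
def ChainSys.scale (S : ChainSys V J) (C : ℤ) : ChainSys V J := { S with T := fun j a => C * S.T j a }

theorem ChainSys.IsGood.scale (h : S.IsGood B Γ) {C : ℤ} (hC : 0 < C) : (S.scale C).IsGood B Γ where
  __ := h
  T_σ j a b hab := by
    change C * S.T (S.σ j) b = -(C * S.T j a)
    rw [h.T_σ j a b hab]; ring
  ord := h.ord
  end_ge := h.end_ge
  tie j j' a a' ha ha' h0 h1 h2 := by
    refine h.tie j j' a a' ha ha' h0 ?_ h2
    change 0 ≤ C * S.T j a + C * S.T j' a' at h1
    rw [← mul_add] at h1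
    exact nonneg_of_mul_nonneg_right h1 hC

end

section

variable {V J J' : Type} [AddCommGroup V] [Module ℂ⸨X⸩ V]

/-- Corrections of the initial vectors of two orthogonal chain systems by which they can be
glued. -/
structure Correction (S : ChainSys V J) (S' : ChainSys V J') (B : LinearMap.BilinForm ℂ⸨X⸩ V)
    (Γ : Module.End ℂ⸨X⸩ V) (U U' : Submodule ℂ⸨X⸩ V) (L : J → V) (Y : J' → V) : Prop where
  L_mem : ∀ j, L j ∈ U'
  Y_mem : ∀ j, Y j ∈ U
  LL : ∀ j k a b, OrdGE (B ((Γ ^ a) (L j)) ((Γ ^ b) (L k))) (S.al j a + S.al k b) ∧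
      (-1 < S.al j a + S.al k b →
        OrdGT (B ((Γ ^ a) (L j)) ((Γ ^ b) (L k))) (S.al j a + S.al k b))
  YY : ∀ j k a b, a ≤ S'.d j → b ≤ S'.d k →
      OrdGE (B ((Γ ^ a) (Y j)) ((Γ ^ b) (Y k))) (S'.al j a + S'.al k b) ∧
      (a < S'.d j →
        OrdGT (B ((Γ ^ a) (Y j)) ((Γ ^ b) (Y k))) (S'.al j a + S'.al k b))
  LX : ∀ j k a b, b ≤ S'.d k →
      OrdGE (B ((Γ ^ a) (L j)) ((Γ ^ b) (S'.X k))) (S.al j a + S'.al k b) ∧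
      (-(1 / 2) < S.al j a →
        OrdGT (B ((Γ ^ a) (L j)) ((Γ ^ b) (S'.X k))) (S.al j a + S'.al k b))
  XY : ∀ j k a b, a ≤ S.d j → b ≤ S'.d k →
      OrdGE (B ((Γ ^ a) (S.X j)) ((Γ ^ b) (Y k))) (S.al j a + S'.al k b) ∧
      (b < S'.d k →
        OrdGT (B ((Γ ^ a) (S.X j)) ((Γ ^ b) (Y k))) (S.al j a + S'.al k b))
  tie : ∀ j k b, L j ≠ 0 → b < S'.d k → S'.al k b = 1 / 2 → S.T j 0 + S'.T k b < 0
  end_tie : ∀ j k, S'.al k (S'.d k) = 1 / 2 → S.α j = -(1 / 2) →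
      OrdGE (B ((Γ ^ S'.d k) (Y k)) (S.X j) + B ((Γ ^ S'.d k) (S'.X k)) (L j)) 1
  start : ∀ j k, S.α j = -(1 / 2) → S.α k = -(1 / 2) →
      OrdGE (B (S.X j) (S.X k) + B (L j) (L k)) 0
  LX_start : ∀ j k, S.α j = -(1 / 2) → S'.α k = -(1 / 2) → OrdGE (B (L j) (S'.X k)) 0

/-- The chain system `S` is complete except for the pairing of `X p` with itself; `Y D` is used to
correct a chain of length `D`. -/
structure ChainSys.IsPending (S : ChainSys V J) (B : LinearMap.BilinForm ℂ⸨X⸩ V)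
    (Γ : Module.End ℂ⸨X⸩ V) (p : J) (ν : ℚ) (Y : ℕ → V) : Prop where
  α_p : S.α p = -(1 / 2)
  ν_p : S.ν p = ν
  coeff_ne : (B (S.X p) (S.X p)).coeff (-1) ≠ 0
  start : S.StartOK B fun j k => j = p ∧ k = p
  YX : ∀ D a j b, a ≤ D → b ≤ S.d j →
    OrdGE (B ((Γ ^ a) (Y D)) ((Γ ^ b) (S.X j))) (1 / 2 - (D - a) * ν + S.al j b)
  YY : ∀ D a D' b, a ≤ D → b ≤ D' →
    OrdGE (B ((Γ ^ a) (Y D)) ((Γ ^ b) (Y D'))) (1 - (D - a) * ν - (D' - b) * ν)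
  Yp : ∀ D, 0 < D → (B ((Γ ^ D) (Y D)) (S.X p)).coeff 0 ≠ 0
  Yj : ∀ D j, 0 < D → j ≠ p → S.α j = -(1 / 2) → OrdGE (B ((Γ ^ D) (Y D)) (S.X j)) 1

/-- The vector `L` can be used to complete a pending chain system. -/
structure ChainSys.HasPlug (S : ChainSys V J) (B : LinearMap.BilinForm ℂ⸨X⸩ V)
    (Γ : Module.End ℂ⸨X⸩ V) (ν : ℚ) (L : V) : Prop where
  ν_eq : ∀ j, S.ν j = ν
  LL : ∀ a b : ℕ, OrdGE (B ((Γ ^ a) L) ((Γ ^ b) L)) (-1 + (a + b) * ν)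
  coeff_ne : (B L L).coeff (-1) ≠ 0
  LX : ∀ (a : ℕ) j b, b ≤ S.d j →
    OrdGE (B ((Γ ^ a) L) ((Γ ^ b) (S.X j))) (-(1 / 2) + a * ν + S.al j b)
  start : ∀ j, S.α j = -(1 / 2) → OrdGE (B L (S.X j)) 0
  end_tie : ∀ j, S.al j (S.d j) = 1 / 2 →
    OrdGE (B ((Γ ^ S.d j) (S.X j)) L) 1 ∨ (Γ ^ S.d j) (S.X j) = tp 1 • L
  T_neg : ∀ j b, b < S.d j → S.al j b = 1 / 2 → S.T j b < 0

/-- Compatibility of the vectors used to complete on both sides. -/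
structure PlugCompat (B : LinearMap.BilinForm ℂ⸨X⸩ V) (Γ : Module.End ℂ⸨X⸩ V) (ν : ℚ) (L : V)
    (Y : ℕ → V) : Prop where
  ge : ∀ D a b : ℕ, a ≤ D →
    OrdGE (B ((Γ ^ a) (Y D)) ((Γ ^ b) L)) (1 / 2 - (D - a) * ν + (-(1 / 2) + b * ν))
  one : ∀ D, 0 < D → OrdGE (B ((Γ ^ D) (Y D)) L) 1

/-- There is a chain system on `U` with lengths `M`, which completes a pending system if `ε`, and
which is pending itself if `ε'`. -/
def Piece (B : LinearMap.BilinForm ℂ⸨X⸩ V) (Γ : Module.End ℂ⸨X⸩ V) (ε ε' : Bool)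
    (U : Submodule ℂ⸨X⸩ V) (ν : ℚ) (M : Multiset ℕ) : Prop :=
  ∃ (J : Type) (_ : Fintype J) (S : ChainSys V J) (L : V) (Y : ℕ → V),
    S.IsGood B Γ ∧ (∀ j, S.X j ∈ U) ∧ L ∈ U ∧ (∀ D, Y D ∈ U) ∧
    Multiset.map S.d Finset.univ.val = M ∧ (ε = true → S.HasPlug B Γ ν L) ∧
    (ε' = false → S.StartOK B fun _ _ => False) ∧ (ε' = true → ∃ p, S.IsPending B Γ p ν Y) ∧
    (ε = true → ε' = true → PlugCompat B Γ ν L Y)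

variable {B : LinearMap.BilinForm ℂ⸨X⸩ V}
  {Γ : Module.End ℂ⸨X⸩ V} {S : ChainSys V J} {S' : ChainSys V J'} {U U' : Submodule ℂ⸨X⸩ V}
  {L : J → V} {Y : J' → V}

theorem Correction.zero (hS : S.StartOK B fun _ _ => False) :
    Correction S S' B Γ U U' (fun _ => 0) (fun _ => 0) where
  L_mem _ := zero_mem _
  Y_mem _ := zero_mem _
  LL j k a b := by simp [OrdGE.zero, OrdGT.zero]
  YY j k a b _ _ := by simp [OrdGE.zero, OrdGT.zero]
  LX j k a b _ := by simp [OrdGE.zero, OrdGT.zero]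
  XY j k a b _ _ := by simp [OrdGE.zero, OrdGT.zero]
  tie j k b h := absurd rfl h
  end_tie j k _ _ := by simp [OrdGE.zero]
  start j k hj hk := by simpa using hS j k hj hk (by simp)
  LX_start j k _ _ := by simp [OrdGE.zero]

theorem Correction.startOK (h : Correction S S' B Γ U U' L Y) (hBs : ∀ x y, B x y = B y x)
    (hS' : S'.IsGood B Γ)
    (horth : ∀ x ∈ U, ∀ y ∈ U', B x y = 0) (hX : ∀ j, S.X j ∈ U) (hX' : ∀ j, S'.X j ∈ U')
    {E : J' → J' → Prop} (hE : S'.StartOK B E) :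
    (S.glue S' L Y).StartOK B fun x y => ∃ j k, x = Sum.inr j ∧ y = Sum.inr k ∧ E j k := by
  have cross (j k) (hj : S.α j = -(1 / 2)) (hk : S'.α k = -(1 / 2)) :
      OrdGE (B (S.X j + L j) (Y k + S'.X k)) 0 := by
    have e1 := horth _ (hX j) _ (hX' k)
    have e2 := horth _ (h.Y_mem k) _ (h.L_mem j)
    rw [hBs] at e2
    have e3 := ((h.XY j k 0 0 (Nat.zero_le _) (Nat.zero_le _)).2 (hS'.d_pos k)).int
      (by rw [S.al_zero, S'.al_zero, hj, hk]; norm_num)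
    have e4 := e3.add (h.LX_start j k hj hk)
    simpa only [map_add, LinearMap.add_apply, e1, e2, zero_add, add_zero, pow_zero,
      Module.End.one_apply] using e4
  rintro (j | j) (k | k) hj hk hne
  · change S.α j = -(1 / 2) at hj
    change S.α k = -(1 / 2) at hk
    change OrdGE (B (S.X j + L j) (S.X k + L k)) 0
    have e1 := horth _ (hX j) _ (h.L_mem k)
    have e2 := horth _ (hX k) _ (h.L_mem j)
    rw [hBs] at e2
    simpa only [map_add, LinearMap.add_apply, e1, e2, zero_add, add_zero] using h.start j k hj hk
  · exact cross j k hj hk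
  · rw [hBs]
    exact cross k j hk hj
  · change S'.α j = -(1 / 2) at hj
    change S'.α k = -(1 / 2) at hk
    change OrdGE (B (Y j + S'.X j) (Y k + S'.X k)) 0
    have e1 := horth _ (h.Y_mem j) _ (hX' k)
    have e2 := horth _ (h.Y_mem k) _ (hX' j)
    rw [hBs] at e2
    have e3 := ((h.YY j k 0 0 (Nat.zero_le _) (Nat.zero_le _)).2 (hS'.d_pos j)).int
      (by rw [S'.al_zero, S'.al_zero, hj, hk]; norm_num)
    have e4 := e3.add (hE j k hj hk fun h1 => hne ⟨j, k, rfl, rfl, h1⟩)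
    simpa only [map_add, LinearMap.add_apply, e1, e2, zero_add, add_zero, pow_zero,
      Module.End.one_apply] using e4

theorem Correction.isGood (h : Correction S S' B Γ U U' L Y) (hBs : ∀ x y, B x y = B y x)
    (hS : S.IsGood B Γ) (hS' : S'.IsGood B Γ)
    (hU : ∀ x ∈ U, ∀ a : ℕ, (Γ ^ a) x ∈ U) (hU' : ∀ x ∈ U', ∀ a : ℕ, (Γ ^ a) x ∈ U')
    (horth : ∀ x ∈ U, ∀ y ∈ U', B x y = 0) (hX : ∀ j, S.X j ∈ U) (hX' : ∀ j, S'.X j ∈ U') :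
    (S.glue S' L Y).IsGood B Γ :=
  hS.glue hBs hS' hU hU' horth hX hX' h.L_mem h.Y_mem h.LL h.YY h.LX h.XY h.tie h.end_tie

theorem Correction.isPending (h : Correction S S' B Γ U U' L Y) (hBs : ∀ x y, B x y = B y x)
    (hS' : S'.IsGood B Γ) (hU' : ∀ x ∈ U', ∀ a : ℕ, (Γ ^ a) x ∈ U')
    (hU : ∀ x ∈ U, ∀ a : ℕ, (Γ ^ a) x ∈ U)
    (horth : ∀ x ∈ U, ∀ y ∈ U', B x y = 0) (hX : ∀ j, S.X j ∈ U) (hX' : ∀ j, S'.X j ∈ U')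
    {p : J'} {ν : ℚ} {Z : ℕ → V} (hp : S'.IsPending B Γ p ν Z) (hZ : ∀ D, Z D ∈ U')
    (hZL : ∀ D a j b, a ≤ D → b ≤ S.d j →
      OrdGE (B ((Γ ^ a) (Z D)) ((Γ ^ b) (L j))) (1 / 2 - (D - a) * ν + S.al j b))
    (hZL1 : ∀ D j, 0 < D → S.α j = -(1 / 2) → OrdGE (B ((Γ ^ D) (Z D)) (L j)) 1) :
    (S.glue S' L Y).IsPending B Γ (.inr p) ν Z := by
  have eU (D a j b) : B ((Γ ^ a) (Z D)) ((Γ ^ b) (S.X j + L j)) =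
      B ((Γ ^ a) (Z D)) ((Γ ^ b) (L j)) := by
    have e := horth _ (hU _ (hX j) b) _ (hU' _ (hZ D) a)
    rw [hBs] at e
    simp only [map_add, e, zero_add]
  have eU' (D a j b) : B ((Γ ^ a) (Z D)) ((Γ ^ b) (Y j + S'.X j)) =
      B ((Γ ^ a) (Z D)) ((Γ ^ b) (S'.X j)) := by
    have e := horth _ (hU _ (h.Y_mem j) b) _ (hU' _ (hZ D) a)
    rw [hBs] at e
    simp only [map_add, e, zero_add]
  refine ⟨hp.α_p, hp.ν_p, ?_, ?_, ?_, hp.YY, ?_, ?_⟩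
  · change (B (Y p + S'.X p) (Y p + S'.X p)).coeff (-1) ≠ 0
    have e1 := horth _ (h.Y_mem p) _ (hX' p)
    have e2 := e1
    rw [hBs] at e2
    have e3 := (h.YY p p 0 0 (Nat.zero_le _) (Nat.zero_le _)).2 (hS'.d_pos p) (-1)
      (by rw [S'.al_zero, hp.α_p]; norm_num)
    simp only [pow_zero, Module.End.one_apply] at e3
    simpa only [map_add, LinearMap.add_apply, e1, e2, zero_add, add_zero, HahnSeries.coeff_add,
      e3] using hp.coeff_ne
  · intro x y hx hy hne
    refine h.startOK hBs hS' horth hX hX' hp.start x y hx hy ?_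
    rintro ⟨j, k, rfl, rfl, rfl, rfl⟩
    exact hne ⟨rfl, rfl⟩
  · rintro D a (j | j) b ha hb
    · change OrdGE (B ((Γ ^ a) (Z D)) ((Γ ^ b) (S.X j + L j))) _
      rw [eU]
      exact hZL D a j b ha hb
    · change OrdGE (B ((Γ ^ a) (Z D)) ((Γ ^ b) (Y j + S'.X j))) _
      rw [eU']
      exact hp.YX D a j b ha hb
  · intro D hD
    change (B ((Γ ^ D) (Z D)) ((Γ ^ 0) (Y p + S'.X p))).coeff 0 ≠ 0
    rw [eU']
    exact hp.Yp D hD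
  · rintro D (j | j) hD hj hα
    · change OrdGE (B ((Γ ^ D) (Z D)) ((Γ ^ 0) (S.X j + L j))) 1
      rw [eU]
      exact hZL1 D j hD hα
    · change OrdGE (B ((Γ ^ D) (Z D)) ((Γ ^ 0) (Y j + S'.X j))) 1
      rw [eU']
      exact hp.Yj D j hD (fun e => hj (congrArg _ e)) hα

end

/-! ### Completing a pending system with a plug. -/

section

variable {V J J' : Type} [AddCommGroup V] [Module ℂ⸨X⸩ V] {B : LinearMap.BilinForm ℂ⸨X⸩ V}
  {Γ : Module.End ℂ⸨X⸩ V} {S : ChainSys V J} {S' : ChainSys V J'} {U U' : Submodule ℂ⸨X⸩ V}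

/-- `X p` is replaced by the isotropic vector `X p + ι L`. A chain of `S'` that ends in `t L` then
pairs with it in order `0`, where order `1` is required, and adding a multiple of `Y D` to its
initial vector cancels this pairing exactly. Since `ν < ν'`, the powers of `Γ` lift `L` faster than
the chain of `p`, and `Y D` stays, before its last step, above the chain that it corrects; so the
remaining inequalities are strict. -/
theorem Correction.link {p : J} {ν ν' : ℚ} {L : V} {Y : ℕ → V} (hBs : ∀ x y, B x y = B y x)
    (hS : S.IsGood B Γ) (hS' : S'.IsGood B Γ) (hp : S.IsPending B Γ p ν Y)
    (hL : S'.HasPlug B Γ ν' L) (hLU : L ∈ U') (hYU : ∀ D, Y D ∈ U) (hν : ν < ν')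
    (hT : ∀ k b, b < S'.d k → S'.al k b = 1 / 2 → S.T p 0 + S'.T k b < 0) :
    ∃ (ι : ℂ⸨X⸩) (Lf : J → V) (Yf : J' → V), Correction S S' B Γ U U' Lf Yf ∧ OrdGE ι 0 ∧
      ∀ j, Lf j = 0 ∨ j = p ∧ Lf j = ι • L := by
  classical
  have hν0 : 0 < ν := hp.ν_p ▸ hS.ν_pos p
  have halp (a : ℕ) : S.al p a = -(1 / 2) + a * ν := by rw [ChainSys.al, hp.α_p, hp.ν_p]
  have hLL0 : OrdEq (B L L) (-1) := ⟨by simpa using hL.LL 0 0, hL.coeff_ne⟩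
  have hpp : OrdEq (B (S.X p) (S.X p)) (-1) := by
    refine ⟨?_, hp.coeff_ne⟩
    have := hS.ord p p 0 0 (Nat.zero_le _) (Nat.zero_le _)
    rw [S.al_zero, hp.α_p] at this
    exact OrdGE.mono this (by push_cast; norm_num)
  -- Both norms have order `-1`, so their quotient has order `0` and a square root.
  obtain ⟨ι, hι, hι0⟩ : ∃ ι, ι ^ 2 = -B (S.X p) (S.X p) * (B L L)⁻¹ ∧ OrdEq ι 0 :=
    exists_sq_eq (a := 0) (by simpa using hpp.neg.mul hLL0.inv)
  have hιL : B (S.X p) (S.X p) + ι * (ι * B L L) = 0 := by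
    have : ι * (ι * B L L) = ι ^ 2 * B L L := by ring
    rw [this, hι, mul_assoc, inv_mul_cancel₀ hLL0.ne_zero]; ring
  have hYp (D : ℕ) (hD : 0 < D) : OrdEq (B ((Γ ^ D) (Y D)) (S.X p)) 0 := by
    refine ⟨?_, hp.Yp D hD⟩
    have := hp.YX D D p 0 le_rfl (Nat.zero_le _)
    rw [S.al_zero, hp.α_p] at this
    exact OrdGE.mono this (by push_cast; linarith)
  -- The solution of `κ ⟨Γ^D Y, X p⟩ + ι ⟨t L, L⟩ = 0`. Both pairings have order `0`, so `κ` is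
  -- integral.
  let κ : ℕ → ℂ⸨X⸩ := fun D => -(ι * (tp 1 * B L L)) * (B ((Γ ^ D) (Y D)) (S.X p))⁻¹
  have hκ (D : ℕ) (hD : 0 < D) : OrdGE (κ D) 0 := by
    simpa using ((hι0.mul ((ordEq_tp 1).mul hLL0)).neg.mul (hYp D hD).inv).1
  -- Only the chains that end exactly in `t L` need a correction.
  let c : J' → Prop := fun k => S'.al k (S'.d k) = 1 / 2 ∧ (Γ ^ S'.d k) (S'.X k) = tp 1 • L
  let Lf : J → V := fun j => if j = p then ι • L else 0
  let Yf : J' → V := fun k => if c k then κ (S'.d k) • Y (S'.d k) else 0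
  have hι1 : OrdGE ι 0 := by simpa using hι0.1
  have hLp : Lf p = ι • L := if_pos rfl
  have hLn {j} (hj : j ≠ p) : Lf j = 0 := if_neg hj
  have hYc {k} (hk : c k) : Yf k = κ (S'.d k) • Y (S'.d k) := if_pos hk
  have hYn {k} (hk : ¬c k) : Yf k = 0 := if_neg hk
  have halY {k} (hk : c k) (a : ℕ) : S'.al k a = 1 / 2 - (S'.d k - a) * ν' := by
    have := hk.1
    rw [ChainSys.al, hL.ν_eq] at this ⊢
    linarith
  have hLX (k : J') (a b : ℕ) (hb : b ≤ S'.d k) :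
      OrdGE (B ((Γ ^ a) (Lf p)) ((Γ ^ b) (S'.X k))) (-(1 / 2) + a * ν' + S'.al k b) := by
    rw [hLp]
    simpa using hι1.mul (hL.LX a k b hb)
  refine ⟨ι, Lf, Yf, ⟨?_, ?_, ?_, ?_, ?_, ?_, ?_, ?_, ?_, ?_⟩, hι1, ?_⟩
  · intro j
    by_cases hj : j = p
    · rw [hj, hLp]; exact Submodule.smul_mem _ _ hLU
    · rw [hLn hj]; exact zero_mem _
  · intro k
    by_cases hk : c k
    · rw [hYc hk]; exact Submodule.smul_mem _ _ (hYU _)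
    · rw [hYn hk]; exact zero_mem _
  · intro j k a b
    by_cases hj : j = p
    · by_cases hk : k = p
      · subst hj hk
        rw [hLp]
        have h1 : OrdGE (B ((Γ ^ a) (ι • L)) ((Γ ^ b) (ι • L))) (-1 + (a + b) * ν') := by
          simpa using hι1.mul (hι1.mul (hL.LL a b))
        have h2 : (0 : ℚ) ≤ (a : ℚ) + b := by positivity
        refine ⟨h1.mono ?_, fun h => h1.gt ?_⟩
        · rw [halp, halp]
          nlinarith
        · rw [halp, halp] at h ⊢
          have h3 : 0 < ((a : ℚ) + b) * ν := by linarith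
          have h4 : 0 < (a : ℚ) + b := pos_of_mul_pos_left h3 hν0.le
          nlinarith
      · rw [hLn hk]; simp [OrdGE.zero, OrdGT.zero]
    · rw [hLn hj]; simp [OrdGE.zero, OrdGT.zero]
  · intro j k a b ha hb
    by_cases hj : c j
    · by_cases hk : c k
      · rw [hYc hj, hYc hk, halY hj, halY hk]
        have h1 : OrdGE (B ((Γ ^ a) (κ (S'.d j) • Y (S'.d j))) ((Γ ^ b) (κ (S'.d k) • Y (S'.d k))))
            (1 - (S'.d j - a) * ν - (S'.d k - b) * ν) := by
          simpa using (hκ _ (hS'.d_pos k)).mul ((hκ _ (hS'.d_pos j)).mul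
            (hp.YY (S'.d j) a (S'.d k) b ha hb))
        have h2 : (0 : ℚ) ≤ S'.d j - a := by rw [sub_nonneg]; exact_mod_cast ha
        have h3 : (0 : ℚ) ≤ S'.d k - b := by rw [sub_nonneg]; exact_mod_cast hb
        refine ⟨h1.mono ?_, fun h => h1.gt ?_⟩
        · nlinarith
        · have h4 : (0 : ℚ) < S'.d j - a := by rw [sub_pos]; exact_mod_cast h
          nlinarith
      · rw [hYn hk]; simp [OrdGE.zero, OrdGT.zero]
    · rw [hYn hj]; simp [OrdGE.zero, OrdGT.zero]
  · intro j k a b hb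
    by_cases hj : j = p
    · subst hj
      have h1 := hLX k a b hb
      have h2 : (0 : ℚ) ≤ (a : ℚ) := by positivity
      refine ⟨h1.mono ?_, fun h => h1.gt ?_⟩
      · rw [halp]
        nlinarith
      · rw [halp] at h ⊢
        have h3 : 0 < (a : ℚ) * ν := by linarith
        have h4 : 0 < (a : ℚ) := pos_of_mul_pos_left h3 hν0.le
        nlinarith
    · rw [hLn hj]; simp [OrdGE.zero, OrdGT.zero]
  · intro j k a b ha hb
    by_cases hk : c k
    · rw [hYc hk, halY hk]
      have h1 : OrdGE (B ((Γ ^ a) (S.X j)) ((Γ ^ b) (κ (S'.d k) • Y (S'.d k))))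
          (S.al j a + (1 / 2 - (S'.d k - b) * ν)) := by
        rw [hBs, add_comm]
        simpa using (hκ _ (hS'.d_pos k)).mul (hp.YX (S'.d k) b j a hb ha)
      have h3 : (0 : ℚ) ≤ S'.d k - b := by rw [sub_nonneg]; exact_mod_cast hb
      refine ⟨h1.mono ?_, fun h => h1.gt ?_⟩
      · nlinarith
      · have h4 : (0 : ℚ) < S'.d k - b := by rw [sub_pos]; exact_mod_cast h
        nlinarith
    · rw [hYn hk]; simp [OrdGE.zero, OrdGT.zero]
  · intro j k b hj hb hal
    have : j = p := by
      by_contra h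
      exact hj (hLn h)
    subst this
    exact hT k b hb hal
  · intro j k hk hj
    by_cases hjp : j = p
    · subst hjp
      rw [hLp]
      by_cases hc : c k
      · have : B ((Γ ^ S'.d k) (Yf k)) (S.X j) + B ((Γ ^ S'.d k) (S'.X k)) (ι • L) = 0 := by
          rw [hYc hc, hc.2]
          have := (hYp _ (hS'.d_pos k)).ne_zero
          simp only [map_smul, LinearMap.smul_apply, smul_eq_mul, κ]
          field_simp
          ring
        rw [this]
        exact OrdGE.zero _
      · rw [hYn hc]
        rcases hL.end_tie k hk with h | h
        · simpa using hι1.mul h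
        · exact absurd ⟨hk, h⟩ hc
    · rw [hLn hjp, map_zero, add_zero]
      by_cases hc : c k
      · rw [hYc hc]
        simpa using (hκ _ (hS'.d_pos k)).mul (hp.Yj _ j (hS'.d_pos k) hjp hj)
      · rw [hYn hc]; simp [OrdGE.zero]
  · intro j k hj hk
    by_cases h : j = p ∧ k = p
    · obtain ⟨rfl, rfl⟩ := h
      rw [hLp]
      simp only [map_smul, LinearMap.smul_apply, smul_eq_mul, hιL]
      exact OrdGE.zero _
    · have : B (Lf j) (Lf k) = 0 := by
        rcases not_and_or.1 h with h | h <;> rw [hLn h] <;> simp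
      rw [this, add_zero]
      exact hp.start j k hj hk h
  · intro j k hj hk
    by_cases h : j = p
    · rw [h, hLp]
      simpa using hι1.mul (hL.start k hk)
    · rw [hLn h]; simp [OrdGE.zero]
  · intro j
    by_cases h : j = p
    · exact Or.inr ⟨h, by rw [h, hLp]⟩
    · exact Or.inl (hLn h)

/-- Gluing of pieces. -/
theorem Piece.glue {ε ε' : Bool} {ν ν' : ℚ} {M M' : Multiset ℕ} (hBs : ∀ x y, B x y = B y x)
    (hU : ∀ x ∈ U, Γ x ∈ U) (hU' : ∀ x ∈ U', Γ x ∈ U') (horth : ∀ x ∈ U, ∀ y ∈ U', B x y = 0)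
    (h : Piece B Γ false ε U ν M) (h' : Piece B Γ ε ε' U' ν' M') (hν : ε = true → ν < ν') :
    Piece B Γ false ε' (U ⊔ U') ν' (M + M') := by
  have hUp (x) (hx : x ∈ U) (a : ℕ) : (Γ ^ a) x ∈ U := by
    induction a with
    | zero => exact hx
    | succ a ih => rw [pow_succ', Module.End.mul_apply]; exact hU _ ih
  have hUp' (x) (hx : x ∈ U') (a : ℕ) : (Γ ^ a) x ∈ U' := by
    induction a with
    | zero => exact hx
    | succ a ih => rw [pow_succ', Module.End.mul_apply]; exact hU' _ ih
  obtain ⟨J, _, S, L, Y, hS, hX, -, hY, hM, -, hst, hpend, -⟩ := h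
  obtain ⟨J', _, S', L', Y', hS', hX', hL', hY', hM', hplug, hst', hpend', hcomp⟩ := h'
  -- `S''` will be `S'` with rescaled weights, so it has the same vectors and the same lengths.
  suffices ∃ (S'' : ChainSys V J') (Lf : J → V) (Yf : J' → V), S''.IsGood B Γ ∧ S''.X = S'.X ∧
      S''.d = S'.d ∧ Correction S S'' B Γ U U' Lf Yf ∧
      (ε' = false → S''.StartOK B fun _ _ => False) ∧
      (ε' = true → ∃ p, S''.IsPending B Γ p ν' Y' ∧
        (∀ D a j b, a ≤ D → b ≤ S.d j →
          OrdGE (B ((Γ ^ a) (Y' D)) ((Γ ^ b) (Lf j))) (1 / 2 - (D - a) * ν' + S.al j b)) ∧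
        ∀ D j, 0 < D → S.α j = -(1 / 2) → OrdGE (B ((Γ ^ D) (Y' D)) (Lf j)) 1) by
    obtain ⟨S'', Lf, Yf, hS'', hX'', hd'', hc, hst'', hpend''⟩ := this
    rw [← hX''] at hX'
    refine ⟨J ⊕ J', inferInstance, S.glue S'' Lf Yf, 0, Y',
      hc.isGood hBs hS hS'' hUp hUp' horth hX hX', ?_, zero_mem _,
      fun D => Submodule.mem_sup_right (hY' D), ?_, by simp, ?_, ?_, by simp⟩
    · rintro (j | j)
      · exact add_mem (Submodule.mem_sup_left (hX j)) (Submodule.mem_sup_right (hc.L_mem j))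
      · exact add_mem (Submodule.mem_sup_left (hc.Y_mem j)) (Submodule.mem_sup_right (hX' j))
    · rw [← hM, ← hM', ← hd'']
      change Multiset.map (Sum.elim S.d S''.d) (Multiset.disjSum _ _) = _
      rw [Multiset.disjSum, Multiset.map_add, Multiset.map_map, Multiset.map_map]
      rfl
    · intro hε x y hx hy _
      refine hc.startOK hBs hS'' horth hX hX' (hst'' hε) x y hx hy ?_
      rintro ⟨_, _, _, _, h⟩
      exact h
    · intro hε
      obtain ⟨p, hp, h1, h2⟩ := hpend'' hε
      exact ⟨_, hc.isPending hBs hS'' hUp' hUp horth hX hX' hp hY' h1 h2⟩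
  cases ε with
  | false =>
    refine ⟨S', fun _ => 0, fun _ => 0, hS', rfl, rfl, .zero (hst rfl), hst', fun hε => ?_⟩
    obtain ⟨p, hp⟩ := hpend' hε
    exact ⟨p, hp, by simp [OrdGE.zero], by simp [OrdGE.zero]⟩
  | true =>
    obtain ⟨p, hp⟩ := hpend rfl
    have hL := hplug rfl
    -- The weights of `S'` at level `1/2` are negative integers; multiplied by this factor they
    -- outweigh `T p 0`.
    have hC : 0 < 1 + |S.T p 0| := by positivity
    have hS'' := hS'.scale hC
    obtain ⟨ι, Lf, Yf, hc, hι, hLf⟩ := Correction.link (U := U) (U' := U')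
      (S' := S'.scale (1 + |S.T p 0|)) hBs hS hS'' hp
      ⟨hL.ν_eq, hL.LL, hL.coeff_ne, hL.LX, hL.start, hL.end_tie, fun j b hb hal =>
        mul_neg_of_pos_of_neg hC (hL.T_neg j b hb hal)⟩ hL' hY (hν rfl) (by
        intro k b hb hal
        have h1 := hL.T_neg k b hb hal
        change S.T p 0 + (1 + |S.T p 0|) * S'.T k b < 0
        have h2 := le_abs_self (S.T p 0)
        have h3 := abs_nonneg (S.T p 0)
        nlinarith)
    refine ⟨_, Lf, Yf, hS'', rfl, rfl, hc, hst', fun hε => ?_⟩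
    obtain ⟨q, hq⟩ := hpend' hε
    have hcp := hcomp rfl hε
    refine ⟨q, ⟨hq.α_p, hq.ν_p, hq.coeff_ne, hq.start, hq.YX, hq.YY, hq.Yp, hq.Yj⟩, ?_, ?_⟩
    · intro D a j b ha hb
      rcases hLf j with h0 | ⟨rfl, h0⟩
      · rw [h0]; simp [OrdGE.zero]
      · rw [h0]
        have h1 : OrdGE (B ((Γ ^ a) (Y' D)) ((Γ ^ b) (ι • L')))
            (1 / 2 - (D - a) * ν' + (-(1 / 2) + b * ν')) := by
          simpa using hι.mul (hcp.ge D a b ha)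
        refine h1.mono ?_
        have := hν rfl
        have hb' : (0 : ℚ) ≤ b := by positivity
        rw [ChainSys.al, hp.α_p, hp.ν_p]
        nlinarith
    · intro D j hD _
      rcases hLf j with h0 | ⟨rfl, h0⟩
      · rw [h0]; simp [OrdGE.zero]
      · rw [h0]
        simpa using hι.mul (hcp.one D hD)

end

/-! ### Chain systems of monomials -/

/-- The orbit `W b = Γ ^ b v` of a vector `v` with prescribed pairings. -/
structure CycVec {V : Type} [AddCommGroup V] [Module ℂ⸨X⸩ V] (B : LinearMap.BilinForm ℂ⸨X⸩ V)
    (Γ : Module.End ℂ⸨X⸩ V) (W : ℤ → V) (h m ε : ℤ) : Prop where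
  h_pos : 0 < h
  m_pos : 0 < m
  step : ∀ b, Γ (W b) = W (b + 1)
  ge : ∀ a b, OrdGE (B (W a) (W b)) ((a + b) * (m / (2 * h)) - ε)
  zero : ∀ a b, -(2 * h) < a + b → a + b < 0 → B (W a) (W b) = 0
  unit : ∀ a b, a + b = 0 → OrdEq (B (W a) (W b)) (-ε)
  low : ∀ a b, a + b = -(2 * h) → OrdEq (B (W a) (W b)) (-m - ε)

/-- The level of the monomial of exponents `e` and `b`. -/
def lev (h m e b : ℤ) : ℚ := e / 2 + b * (m / (2 * h))

/-- The smallest exponent in the chain of `e`. -/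
def chainStart (h m e : ℤ) : ℤ := -((h * (e + 1) - if 0 ≤ e ∧ e < m then 0 else 1) / m)

/-- The largest exponent in the chain of `e`. -/
def chainEnd (h m e : ℤ) : ℤ := (h * (1 - e) - if e ≤ 0 then 0 else 1) / m

/-- The length of the chain of `e`. -/
def chainLen (h m e : ℤ) : ℕ := (chainEnd h m e - chainStart h m e + 1).toNat

section

variable {h m : ℤ}

theorem lev_le_iff (hh : 0 < h) (e b r : ℤ) : (r : ℚ) / 2 ≤ lev h m e b ↔ h * r ≤ h * e + m * b := by
  have hh' : (0 : ℚ) < h := by exact_mod_cast hh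
  have e1 : lev h m e b = (h * e + m * b) / (2 * h) := by unfold lev; field_simp
  rw [e1, le_div_iff₀ (by positivity), show (r : ℚ) / 2 * (2 * h) = h * r by ring]
  exact_mod_cast Iff.rfl

theorem lev_eq_iff (hh : 0 < h) (e b r : ℤ) : lev h m e b = r / 2 ↔ h * e + m * b = h * r := by
  have hh' : (0 : ℚ) < h := by exact_mod_cast hh
  have e1 : lev h m e b = (h * e + m * b) / (2 * h) := by unfold lev; field_simp
  rw [e1, div_eq_iff (by positivity), show (r : ℚ) / 2 * (2 * h) = h * r by ring]
  exact_mod_cast Iff.rfl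

theorem lev_add (e b e' b' : ℤ) : lev h m e b + lev h m e' b' = lev h m (e + e') (b + b') := by
  unfold lev; push_cast; ring

theorem lev_add_right (e b c : ℤ) : lev h m e (b + c) = lev h m e b + c * (m / (2 * h)) := by
  unfold lev; push_cast; ring

/-- A monomial belongs to the chain of `e` if its level lies in `[-1/2, 1/2]`, where `-1/2` is
allowed only for `0 ≤ e < m` and `1/2` only for `e ≤ 0`. The subtracted `1` encodes the strict
inequality in the other cases. -/
theorem start_spec (hm : 0 < m) (e : ℤ) :
    -(h * (e + 1) - if 0 ≤ e ∧ e < m then 0 else 1) ≤ m * chainStart h m e ∧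
      m * (chainStart h m e - 1) < -(h * (e + 1) - if 0 ≤ e ∧ e < m then 0 else 1) := by
  have h1 := Int.ediv_mul_le (h * (e + 1) - if 0 ≤ e ∧ e < m then 0 else 1) hm.ne'
  have h2 := Int.lt_ediv_add_one_mul_self (h * (e + 1) - if 0 ≤ e ∧ e < m then 0 else 1) hm
  unfold chainStart
  constructor <;> linarith

theorem end_spec (hm : 0 < m) (e : ℤ) :
    m * chainEnd h m e ≤ h * (1 - e) - (if e ≤ 0 then 0 else 1) ∧
      h * (1 - e) - (if e ≤ 0 then 0 else 1) < m * (chainEnd h m e + 1) := by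
  have h1 := Int.ediv_mul_le (h * (1 - e) - if e ≤ 0 then 0 else 1) hm.ne'
  have h2 := Int.lt_ediv_add_one_mul_self (h * (1 - e) - if e ≤ 0 then 0 else 1) hm
  unfold chainEnd
  constructor <;> linarith

/-- The conventions at the two ends are exchanged by `e ↦ -e`; this is why the chain of `-e` can be
dual to the chain of `e`. -/
theorem start_neg {e : ℤ} (h1 : -m < e) : chainStart h m (-e) = -chainEnd h m e := by
  unfold chainStart chainEnd
  have : (0 ≤ -e ∧ -e < m) ↔ e ≤ 0 := by omega
  simp only [this]
  congr 3
  ring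

theorem end_neg {e : ℤ} (h2 : e < m) : chainEnd h m (-e) = -chainStart h m e := by
  have := start_neg (h := h) (m := m) (e := -e) (by omega)
  rw [neg_neg] at this
  omega

/-- The exponent `m` has no opposite in `(-m, m]`. Its chain is dual to itself through the pairings
with `a + b = -2h`, whose negative order compensates the powers of `t`. -/
theorem start_add_end_top (hm : 0 < m) : chainStart h m m + chainEnd h m m = -(2 * h) := by
  have e1 : chainStart h m m = -(h + (h - 1) / m) := by
    unfold chainStart
    rw [if_neg (by omega), show h * (m + 1) - 1 = h - 1 + h * m by ring,
      Int.add_mul_ediv_right _ _ hm.ne']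
    ring
  have e2 : chainEnd h m m = (h - 1) / m - h := by
    unfold chainEnd
    rw [if_neg (by omega), show h * (1 - m) - 1 = h - 1 + (-h) * m by ring,
      Int.add_mul_ediv_right _ _ hm.ne']
    ring
  rw [e1, e2]; ring

variable {V : Type} [AddCommGroup V] [Module ℂ⸨X⸩ V] {B : LinearMap.BilinForm ℂ⸨X⸩ V}
    {Γ : Module.End ℂ⸨X⸩ V} {W : ℤ → V} {ε : ℤ}

/-- The monomial of exponents `e` and `b`. -/
def mon (W : ℤ → V) (ε e b : ℤ) : V := tp ((e + ε) / 2) • W b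

theorem CycVec.pow_mon (C : CycVec B Γ W h m ε) (e b : ℤ) (a : ℕ) :
    (Γ ^ a) (mon W ε e b) = mon W ε e (b + a) := by
  induction a with
  | zero => simp
  | succ a ih =>
    rw [pow_succ', Module.End.mul_apply, ih, mon, map_smul, C.step, mon]
    congr 2
    push_cast; ring

theorem CycVec.mon_ge (C : CycVec B Γ W h m ε) {e e' : ℤ} (he : 2 ∣ e - ε) (he' : 2 ∣ e' - ε)
    (b b' : ℤ) : OrdGE (B (mon W ε e b) (mon W ε e' b')) (lev h m e b + lev h m e' b') := by
  obtain ⟨c, hc⟩ : ∃ c, e + ε = 2 * c := ⟨(e + ε) / 2, by omega⟩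
  obtain ⟨c', hc'⟩ : ∃ c, e' + ε = 2 * c := ⟨(e' + ε) / 2, by omega⟩
  have h1 : OrdGE (B (mon W ε e b) (mon W ε e' b')) (c' + (c + ((b + b') * (m / (2 * h)) - ε))) := by
    have := ((C.ge b b').tp_mul c).tp_mul c'
    simpa [mon, hc, hc'] using this
  refine h1.mono (le_of_eq ?_)
  have e1 : (e : ℚ) = 2 * c - ε := by
    have : e = 2 * c - ε := by omega
    rw [this]; push_cast; ring
  have e2 : (e' : ℚ) = 2 * c' - ε := by
    have : e' = 2 * c' - ε := by omega
    rw [this]; push_cast; ring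
  rw [lev, lev, e1, e2]
  ring

/-- The conditions place `b + b'` strictly between `-2h` and `0`, in the gap where the pairings
vanish. Ties between levels are resolved this way. -/
theorem CycVec.mon_eq_zero (C : CycVec B Γ W h m ε) {e e' b b' r : ℤ}
    (h0 : h * (e + e') + m * (b + b') = h * r) (h1 : r < e + e') (h2 : e + e' < r + 2 * m) :
    B (mon W ε e b) (mon W ε e' b') = 0 := by
  have hh := C.h_pos
  have hm := C.m_pos
  have h3 : b + b' < 0 := by
    by_contra hlt
    have := mul_nonneg hm.le (not_lt.1 hlt)
    nlinarith
  have h4 : -(2 * h) < b + b' := by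
    by_contra hlt
    nlinarith
  simp [mon, C.zero b b' h4 h3]

theorem CycVec.mon_unit (C : CycVec B Γ W h m ε) {e e' b b' q : ℤ} (he : 2 ∣ e - ε)
    (he' : 2 ∣ e' - ε) (h0 : b + b' = 0) (hq : e + e' = 2 * q) :
    OrdEq (B (mon W ε e b) (mon W ε e' b')) q := by
  have := (ordEq_tp ((e' + ε) / 2)).mul ((ordEq_tp ((e + ε) / 2)).mul (C.unit b b' h0))
  rw [show (e' + ε) / 2 + ((e + ε) / 2 + -ε) = q by omega] at this
  simpa [mon] using this

theorem CycVec.mon_low (C : CycVec B Γ W h m ε) {e e' b b' q : ℤ} (he : 2 ∣ e - ε)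
    (he' : 2 ∣ e' - ε) (h0 : b + b' = -(2 * h)) (hq : e + e' = 2 * q) :
    OrdEq (B (mon W ε e b) (mon W ε e' b')) (q - m) := by
  have := (ordEq_tp ((e' + ε) / 2)).mul ((ordEq_tp ((e + ε) / 2)).mul (C.low b b' h0))
  rw [show (e' + ε) / 2 + ((e + ε) / 2 + (-m - ε)) = q - m by omega] at this
  simpa [mon] using this

/-- The exponents of the chains. -/
def chainExps (h m ε : ℤ) : Finset ℤ :=
  (Finset.Ioc (-m) m).filter fun e => 2 ∣ e - ε ∧ 0 < chainLen h m e

theorem mem_chainExps {e : ℤ} : e ∈ chainExps h m ε ↔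
    (-m < e ∧ e ≤ m) ∧ 2 ∣ e - ε ∧ 0 < chainLen h m e := by
  simp [chainExps]

/-- The duality of the exponents. -/
def dualExp (m e : ℤ) : ℤ := if e = m then m else -e

theorem len_dualExp {e : ℤ} (he : -m < e ∧ e ≤ m) :
    chainLen h m (dualExp m e) = chainLen h m e := by
  unfold dualExp
  split_ifs with h1
  · rw [h1]
  · unfold chainLen
    rw [start_neg (by omega), end_neg (by omega)]
    congr 1
    ring

theorem dualExp_mem (hm : 0 < m) {e : ℤ} (he : e ∈ chainExps h m ε) :
    dualExp m e ∈ chainExps h m ε := by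
  rw [mem_chainExps] at he ⊢
  rw [len_dualExp he.1]
  refine ⟨?_, ?_, he.2.2⟩ <;> unfold dualExp <;> split_ifs <;> omega

/-- The chain system of monomials. -/
def monoSys (W : ℤ → V) (h m ε : ℤ) (hm : 0 < m) : ChainSys V (chainExps h m ε) where
  X e := mon W ε e (chainStart h m e)
  d e := chainLen h m e
  ν _ := m / (2 * h)
  α e := lev h m e (chainStart h m e)
  σ e := ⟨dualExp m e, dualExp_mem hm e.2⟩
  T e a := if (e : ℤ) = m then 0 else -(chainStart h m e + a)

theorem monoSys_al (hm : 0 < m) (e : chainExps h m ε) (a : ℕ) :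
    (monoSys W h m ε hm).al e a = lev h m e (chainStart h m e + a) := by
  rw [lev_add_right]
  rfl

theorem CycVec.monoSys_pow (C : CycVec B Γ W h m ε) (e : chainExps h m ε) (a : ℕ) :
    (Γ ^ a) ((monoSys W h m ε C.m_pos).X e) = mon W ε e (chainStart h m e + a) := C.pow_mon _ _ _

theorem start_add_len {e : ℤ} (he : 0 < chainLen h m e) :
    chainStart h m e + chainLen h m e = chainEnd h m e + 1 := by
  unfold chainLen at *
  omega

theorem α_eq_iff (hh : 0 < h) (hm : 0 < m) {e : ℤ} (he : lev h m e (chainStart h m e) = -(1 / 2)) :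
    m * chainStart h m e = -(h * (e + 1)) ∧ 0 ≤ e ∧ e < m := by
  have h1 : h * e + m * chainStart h m e = h * (-1) := by
    rw [← lev_eq_iff hh, he]; norm_num
  have h2 := (start_spec (h := h) hm e).1
  refine ⟨by linarith, ?_⟩
  by_contra h3
  rw [if_neg h3] at h2
  linarith

/-- Consider a tie at level sum `0`. If neither exponent is `m`, the condition on the weights says
`b + b' ≤ 0`: a negative sum lies in the gap, and a zero sum forces `e' = -e`, the dual pair. If
exactly one exponent is `m`, then `0 < e + e' < 2m`, and the gap applies without weights. If both
are `m`, then `b + b' = -2h` and the pair is dual. -/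
theorem CycVec.monoSys_isGood (C : CycVec B Γ W h m ε) :
    (monoSys W h m ε C.m_pos).IsGood B Γ := by
  have hh := C.h_pos
  have hm := C.m_pos
  have hpar (e : chainExps h m ε) : 2 ∣ (e : ℤ) - ε := (mem_chainExps.1 e.2).2.1
  have hrange (e : chainExps h m ε) : -m < (e : ℤ) ∧ (e : ℤ) ≤ m := (mem_chainExps.1 e.2).1
  have hpos (e : chainExps h m ε) : 0 < chainLen h m e := (mem_chainExps.1 e.2).2.2
  have hlen (e : chainExps h m ε) := start_add_len (hpos e)
  have hend (e : chainExps h m ε) : (chainLen h m e : ℤ) = chainEnd h m e - chainStart h m e + 1 := by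
    have := hlen e
    omega
  have hσ (e : chainExps h m ε) :
      chainStart h m (dualExp m e) = if (e : ℤ) = m then chainStart h m e else -chainEnd h m e := by
    have := hrange e
    unfold dualExp
    split_ifs with h1
    · rw [h1]
    · rw [start_neg (by omega)]
  have hdual (e : chainExps h m ε) : chainStart h m (dualExp m e) =
      -chainEnd h m e + if (e : ℤ) = m then -(2 * h) else 0 := by
    rw [hσ]
    split_ifs with h1
    · rw [h1]; have := start_add_end_top (h := h) hm; omega
    · ring
  have htop : dualExp m m = m := if_pos rfl
  have hh' : (0 : ℚ) < h := by exact_mod_cast hh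
  have hm' : (0 : ℚ) < m := by exact_mod_cast hm
  refine ⟨hpos, fun _ => by simp only [monoSys]; positivity, ?_, ?_, fun _ => rfl, ?_, ?_, ?_, ?_,
    ?_, ?_, ?_, ?_⟩
  · intro e
    refine Subtype.ext ?_
    have := hrange e
    simp only [monoSys, dualExp]
    split_ifs <;> omega
  · intro e
    exact len_dualExp (hrange e)
  · intro e
    simp only [monoSys]
    rw [hdual]
    have e1 : ((chainLen h m e : ℕ) : ℚ) = chainEnd h m e - chainStart h m e + 1 := by
      exact_mod_cast hend e
    rw [e1]
    unfold lev dualExp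
    split_ifs with h1
    · rw [h1]
      push_cast
      field_simp
      ring
    · push_cast
      ring
  · intro e a b hab
    have hab' : (a : ℤ) + b + 1 = chainLen h m e := by exact_mod_cast hab
    have := hrange e
    simp only [monoSys]
    by_cases h1 : (e : ℤ) = m
    · rw [if_pos h1, if_pos (by rw [h1, htop])]
      rfl
    · rw [if_neg h1, if_neg (by unfold dualExp; rw [if_neg h1]; omega), hσ, if_neg h1]
      have := hend e
      omega
  · intro e
    have h1 := (start_spec (h := h) hm e).1
    have h2 : (((-1 : ℤ) : ℚ)) / 2 ≤ lev h m e (chainStart h m e) := by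
      rw [lev_le_iff hh]
      split_ifs at h1 <;> linarith
    simp only [monoSys]
    refine le_trans (le_of_eq ?_) h2
    norm_num
  · intro e
    rw [monoSys_al]
    have h1 := (end_spec (h := h) hm e).2
    have h2 : (((1 : ℤ) : ℚ)) / 2 ≤ lev h m e (chainStart h m e + chainLen h m e) := by
      rw [lev_le_iff hh, hlen]
      split_ifs at h1 <;> linarith
    refine le_trans (le_of_eq ?_) h2
    norm_num
  · intro j j' a a' _ _
    rw [C.monoSys_pow, C.monoSys_pow, monoSys_al, monoSys_al]
    exact C.mon_ge (hpar j) (hpar j') _ _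
  · intro j j' hj hj'
    have h1 := (end_spec (h := h) hm j).2
    rw [monoSys_al] at hj
    have h2 : h * (j : ℤ) + m * (chainEnd h m j + 1) = h * 1 := by
      rw [← hlen, ← lev_eq_iff hh]
      rw [show ((1 : ℤ) : ℚ) = 1 by norm_num]
      exact hj
    have h3 : 0 < (j : ℤ) := by
      by_contra hlt
      rw [if_pos (not_lt.1 hlt)] at h1
      linarith
    obtain ⟨h4, h5, h6⟩ := α_eq_iff hh hm hj'
    rw [C.monoSys_pow]
    change OrdGE (B _ (mon W ε j' (chainStart h m j'))) 1
    rw [C.mon_eq_zero (r := 0)]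
    · exact OrdGE.zero _
    · change h * (j + j' : ℤ) + m * (chainStart h m j + chainLen h m j + chainStart h m j') = h * 0
      rw [hlen]; linarith
    · omega
    · have := hrange j; omega
  · intro j
    have h1 := hpos j
    rw [C.monoSys_pow]
    change (B (mon W ε j (chainStart h m j + ((chainLen h m j - 1 : ℕ) : ℤ)))
      (mon W ε (dualExp m j) (chainStart h m (dualExp m j)))).coeff 0 ≠ 0
    have h2 : chainStart h m j + ((chainLen h m j - 1 : ℕ) : ℤ) = chainEnd h m j := by
      have := hlen j
      omega
    rw [h2, hdual]
    by_cases h3 : (j : ℤ) = m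
    · rw [h3, htop, if_pos rfl]
      have := (C.mon_low (e := m) (e' := m) (b := chainEnd h m m)
        (b' := -chainEnd h m m + -(2 * h)) (q := m) (h3 ▸ hpar j) (h3 ▸ hpar j) (by ring)
        (by ring)).2
      rwa [sub_self] at this
    · rw [if_neg h3, dualExp, if_neg h3]
      exact (C.mon_unit (q := 0) (hpar j) (by have := hpar j; omega) (by ring) (by ring)).2
  · intro j j' a a' ha ha' h0 hT hne
    rw [monoSys_al, monoSys_al, lev_add] at h0
    have h1 : h * ((j : ℤ) + j') + m * (chainStart h m j + a + (chainStart h m j' + a')) = h * 0 := by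
      rw [← lev_eq_iff hh, h0]; norm_num
    have hj := hrange j
    have hj' := hrange j'
    rw [C.monoSys_pow, C.monoSys_pow]
    have key : (0 < (j : ℤ) + j' ∧ (j : ℤ) + j' < 0 + 2 * m) ∨ (j' = (monoSys W h m ε C.m_pos).σ j ∧
        a + a' + 1 = chainLen h m j) := by
      by_cases hjm : (j : ℤ) = m
      · by_cases hjm' : (j' : ℤ) = m
        · right
          refine ⟨Subtype.ext ?_, ?_⟩
          · simp only [monoSys]; rw [hjm, hjm', htop]
          · have h2 := start_add_end_top (h := h) hm
            have h3 := hend j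
            rw [hjm, hjm'] at h1
            rw [hjm] at h3 ⊢
            have h4 : m * (chainStart h m m + a + (chainStart h m m + a') + 2 * h) = 0 := by linarith
            have h5 := (mul_eq_zero.1 h4).resolve_left hm.ne'
            omega
        · left; omega
      · by_cases hjm' : (j' : ℤ) = m
        · left; omega
        · simp only [monoSys] at hT
          rw [if_neg hjm, if_neg hjm'] at hT
          rcases (show (chainStart h m j + a + (chainStart h m j' + a')) ≤ 0 by linarith).lt_or_eq
            with h2 | h2
          · left
            refine ⟨?_, by omega⟩
            by_contra h3
            nlinarith
          · right
            rw [h2, mul_zero, add_zero, mul_zero] at h1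
            have h3 := (mul_eq_zero.1 h1).resolve_left hh.ne'
            have h4 : (j' : ℤ) = dualExp m j := by
              unfold dualExp
              rw [if_neg hjm]; omega
            refine ⟨Subtype.ext h4, ?_⟩
            rw [h4, hσ, if_neg hjm] at h2
            have := hend j
            omega
    rcases key with ⟨h2, h3⟩ | h2
    · rw [C.mon_eq_zero h1 h2 h3]; rfl
    · exact absurd h2 hne

end

/-! ### The monomial chains as pieces: plugs and pending vectors. -/

section

variable {h m : ℤ} {V : Type} [AddCommGroup V] [Module ℂ⸨X⸩ V] {B : LinearMap.BilinForm ℂ⸨X⸩ V}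
    {Γ : Module.End ℂ⸨X⸩ V} {W : ℤ → V} {ε : ℤ}

/-- Initial vectors of level `-1/2` have exponents in `[0, m - 1]`, and the pairing of two of them
falls into the gap unless both exponents are `m - 1`. So at most one norm fails to be integral. -/
theorem CycVec.startOK_of_lt (C : CycVec B Γ W h m ε) (E : chainExps h m ε → chainExps h m ε → Prop)
    (hE : ∀ j k : chainExps h m ε, (j : ℤ) = m - 1 → (k : ℤ) = m - 1 → E j k) :
    (monoSys W h m ε C.m_pos).StartOK B E := by
  intro j k hj hk hne
  obtain ⟨h1, h2, h3⟩ := α_eq_iff C.h_pos C.m_pos hj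
  obtain ⟨h4, h5, h6⟩ := α_eq_iff C.h_pos C.m_pos hk
  change OrdGE (B (mon W ε j (chainStart h m j)) (mon W ε k (chainStart h m k))) 0
  rw [C.mon_eq_zero (r := -2)]
  · exact OrdGE.zero _
  · linarith
  · omega
  · by_contra hlt
    exact hne (hE j k (by omega) (by omega))

/-- With odd exponents, `W 0` has level `-1/2` and norm of order `-1`, but the chain of `e = -1`
starts just after it, and the chain of `e = 1` stops just before `t W 0`. The latter is the only
chain whose end creates a tie with the plug; for the larger exponents the gap applies. -/
theorem CycVec.hasPlug (C : CycVec B Γ W h m 1) :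
    (monoSys W h m 1 C.m_pos).HasPlug B Γ (m / (2 * h)) (mon W 1 (-1) 0) := by
  have hh := C.h_pos
  have hm := C.m_pos
  have h11 : (2 : ℤ) ∣ -1 - 1 := ⟨-1, by norm_num⟩
  have hpar (e : chainExps h m 1) : 2 ∣ (e : ℤ) - 1 := (mem_chainExps.1 e.2).2.1
  have hrange (e : chainExps h m 1) : -m < (e : ℤ) ∧ (e : ℤ) ≤ m := (mem_chainExps.1 e.2).1
  have hpos (e : chainExps h m 1) : 0 < chainLen h m e := (mem_chainExps.1 e.2).2.2
  refine ⟨fun _ => rfl, ?_, ?_, ?_, ?_, ?_, ?_⟩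
  · intro a b
    rw [C.pow_mon, C.pow_mon]
    refine (C.mon_ge h11 h11 _ _).mono (le_of_eq ?_)
    unfold lev; push_cast; ring
  · exact (C.mon_unit (q := -1) h11 h11 (by norm_num) (by norm_num)).2
  · intro a j b _
    rw [C.pow_mon, C.monoSys_pow, monoSys_al]
    refine (C.mon_ge h11 (hpar j) _ _).mono (le_of_eq ?_)
    unfold lev; push_cast; ring
  · intro j hj
    obtain ⟨h1, h2, h3⟩ := α_eq_iff hh hm hj
    change OrdGE (B _ (mon W 1 j (chainStart h m j))) 0
    rw [C.mon_eq_zero (r := -2)]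
    · exact OrdGE.zero _
    · linarith
    · omega
    · omega
  · intro j hj
    rw [monoSys_al] at hj
    change lev h m j (chainStart h m j + chainLen h m j) = _ at hj
    rw [C.monoSys_pow]
    change OrdGE (B (mon W 1 j (chainStart h m j + chainLen h m j)) _) 1 ∨
      mon W 1 j (chainStart h m j + chainLen h m j) = _
    rw [start_add_len (hpos j)] at hj ⊢
    have h1 := (end_spec (h := h) hm j).2
    have h2 : h * (j : ℤ) + m * (chainEnd h m j + 1) = h * 1 := by
      rw [← lev_eq_iff hh, hj]; norm_num
    have h3 : 0 < (j : ℤ) := by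
      by_contra hlt
      rw [if_pos (not_lt.1 hlt)] at h1
      linarith
    by_cases h4 : (j : ℤ) = 1
    · right
      rw [h4] at h2 ⊢
      have h5 : m * (chainEnd h m 1 + 1) = 0 := by linarith
      rw [(mul_eq_zero.1 h5).resolve_left hm.ne']
      simp [mon, tp_zero]
    · left
      rw [C.mon_eq_zero (r := 0)]
      · exact OrdGE.zero _
      · linarith
      · omega
      · have := hrange j; omega
  · intro j b hb hj
    change b < chainLen h m j at hb
    rw [monoSys_al] at hj
    have h1 := (end_spec (h := h) hm j).1
    have h2 : h * (j : ℤ) + m * (chainStart h m j + b) = h * 1 := by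
      rw [← lev_eq_iff hh, hj]; norm_num
    have h3 := start_add_len (hpos j)
    have h4 : m * (chainStart h m j + b) ≤ m * chainEnd h m j :=
      mul_le_mul_of_nonneg_left (by omega) hm.le
    have h5 : (j : ℤ) ≤ 0 := by
      by_contra hlt
      rw [if_neg hlt] at h1
      linarith
    have h6 : 0 < chainStart h m j + b := by
      by_contra hlt
      nlinarith
    simp only [monoSys]
    rw [if_neg (by omega)]
    omega

/-- The monomial of exponent `m - 1` with `b = -h` has norm of order `-1`. The correcting vectors
are chosen such that `Γ^D (Y D) = t X p`, whose pairing with `X p` has order `0`. -/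
theorem CycVec.isPending (C : CycVec B Γ W h m ε) (hpar : 2 ∣ m - 1 - ε) :
    ∃ p, (monoSys W h m ε C.m_pos).IsPending B Γ p (m / (2 * h))
      fun D => mon W ε (m + 1) (-h - D) := by
  have hh := C.h_pos
  have hm := C.m_pos
  have hpar' (e : chainExps h m ε) : 2 ∣ (e : ℤ) - ε := (mem_chainExps.1 e.2).2.1
  have hrange (e : chainExps h m ε) : -m < (e : ℤ) ∧ (e : ℤ) ≤ m := (mem_chainExps.1 e.2).1
  have hstart : chainStart h m (m - 1) = -h := by
    unfold chainStart
    rw [if_pos (by omega), show h * (m - 1 + 1) - 0 = h * m by ring, Int.mul_ediv_cancel _ hm.ne']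
  have hlen : 0 < chainLen h m (m - 1) := by
    have h1 := (end_spec (h := h) hm (m - 1)).2
    have h2 : -h ≤ chainEnd h m (m - 1) := by
      by_contra hlt
      have h3 : chainEnd h m (m - 1) + 1 ≤ -h := by omega
      have h4 := mul_le_mul_of_nonneg_left h3 hm.le
      split_ifs at h1 <;> nlinarith
    unfold chainLen
    rw [hstart]
    omega
  have hν : (h : ℚ) * (m / (2 * h)) = m / 2 := by
    have : (0 : ℚ) < h := by exact_mod_cast hh
    field_simp
  have hm1 : 2 ∣ m + 1 - ε := by omega
  let p : chainExps h m ε := ⟨m - 1, mem_chainExps.2 ⟨by omega, hpar, hlen⟩⟩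
  have hXp : (monoSys W h m ε C.m_pos).X p = mon W ε (m - 1) (-h) := by
    simp only [monoSys, p, hstart]
  refine ⟨p, ?_, rfl, ?_, ?_, ?_, ?_, ?_, ?_⟩
  · change lev h m (m - 1) (chainStart h m (m - 1)) = -(1 / 2)
    rw [hstart, show (-(1 / 2) : ℚ) = ((-1 : ℤ) : ℚ) / 2 by norm_num, lev_eq_iff hh]
    ring
  · rw [hXp]
    have := (C.mon_low (q := m - 1) hpar hpar (show -h + -h = -(2 * h) by ring) (by ring)).2
    rwa [show m - 1 - m = -1 by ring] at this
  · refine C.startOK_of_lt _ ?_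
    intro j k hj hk
    exact ⟨Subtype.ext hj, Subtype.ext hk⟩
  · intro D a j b _ _
    rw [C.pow_mon, C.monoSys_pow, monoSys_al]
    refine (C.mon_ge hm1 (hpar' j) _ _).mono (le_of_eq ?_)
    have : lev h m (m + 1) (-h - D + a) = 1 / 2 - (D - a) * (m / (2 * h)) := by
      unfold lev
      push_cast
      linear_combination -hν
    rw [this]
  · intro D a D' b _ _
    rw [C.pow_mon, C.pow_mon]
    refine (C.mon_ge hm1 hm1 _ _).mono (le_of_eq ?_)
    unfold lev
    push_cast
    linear_combination 2 * hν
  · intro D _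
    rw [C.pow_mon, hXp]
    have := (C.mon_low (q := m) hm1 hpar (show -h - D + D + -h = -(2 * h) by ring) (by ring)).2
    rwa [sub_self] at this
  · intro D j _ hj hα
    obtain ⟨h1, h2, h3⟩ := α_eq_iff hh hm hα
    rw [C.pow_mon]
    change OrdGE (B _ (mon W ε j (chainStart h m j))) 1
    rw [C.mon_eq_zero (r := 0)]
    · exact OrdGE.zero _
    · linarith
    · omega
    · have : (j : ℤ) ≠ m - 1 := fun e => hj (Subtype.ext e)
      omega

/-- For even `m` and odd exponents the piece closes one pending vector and opens another. The plug
and the correcting vectors are then both monomials, and their tie falls into the gap. -/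
theorem CycVec.plugCompat (C : CycVec B Γ W h m 1) (hpar : 2 ∣ m) :
    PlugCompat B Γ (m / (2 * h)) (mon W 1 (-1) 0) fun D => mon W 1 (m + 1) (-h - D) := by
  have hh := C.h_pos
  have hm := C.m_pos
  have h11 : (2 : ℤ) ∣ -1 - 1 := ⟨-1, by norm_num⟩
  have hm1 : 2 ∣ m + 1 - 1 := by omega
  have hν : (h : ℚ) * (m / (2 * h)) = m / 2 := by
    have : (0 : ℚ) < h := by exact_mod_cast hh
    field_simp
  constructor
  · intro D a b _
    rw [C.pow_mon, C.pow_mon]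
    refine (C.mon_ge hm1 h11 _ _).mono (le_of_eq ?_)
    unfold lev
    push_cast
    linear_combination hν
  · intro D _
    rw [C.pow_mon, C.mon_eq_zero (r := 0)]
    · exact OrdGE.zero _
    · ring
    · omega
    · omega

/-- The piece made of the monomials. -/
theorem CycVec.piece {ε : Bool} (C : CycVec B Γ W h m (if ε then 1 else 0)) (ε' : Bool)
    (hε : ε' = true ↔ 2 ∣ m - 1 - if ε then 1 else 0) {U : Submodule ℂ⸨X⸩ V}
    (hU : ∀ b, W b ∈ U) :
    Piece B Γ ε ε' U (m / (2 * h))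
      ((chainExps h m (if ε then 1 else 0)).val.map (chainLen h m)) := by
  have hmon (ε e b) : mon W ε e b ∈ U := Submodule.smul_mem _ _ (hU b)
  refine ⟨_, inferInstance, monoSys W h m _ C.m_pos, mon W (if ε then 1 else 0) (-1) 0,
    fun D => mon W (if ε then 1 else 0) (m + 1) (-h - D), C.monoSys_isGood,
    fun _ => hmon _ _ _, hmon _ _ _, fun _ => hmon _ _ _, ?_, ?_, ?_, ?_, ?_⟩
  · rw [Finset.univ_eq_attach]
    exact Multiset.attach_map_val' (chainExps h m _).val (chainLen h m)
  · rintro rfl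
    exact C.hasPlug
  · intro h0
    refine C.startOK_of_lt _ fun j k hj _ => ?_
    have := (mem_chainExps.1 j.2).2.1
    rw [hj, ← hε, h0] at this
    exact absurd this (by simp)
  · intro h1
    exact C.isPending (hε.1 h1)
  · rintro rfl h1
    refine C.plugCompat ?_
    have := hε.1 h1
    simp only [if_true] at this
    omega

end

/-! ### Lengths of the chains of monomials -/

theorem exists_eq_replicate (k : ℕ) (M : Multiset ℕ) (h : ∀ x ∈ M, x = k ∨ x = k + 1) :
    ∃ a b, M = Multiset.replicate a (k + 1) + Multiset.replicate b k := by
  induction M using Multiset.induction_on with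
  | empty => exact ⟨0, 0, by simp⟩
  | cons x M ih =>
    obtain ⟨a, b, hM⟩ := ih fun y hy => h y (Multiset.mem_cons_of_mem hy)
    rcases h x (Multiset.mem_cons_self _ _) with rfl | rfl
    · exact ⟨a, b + 1, by rw [hM, Multiset.replicate_succ, Multiset.add_cons]⟩
    · exact ⟨a + 1, b, by rw [hM, Multiset.replicate_succ, Multiset.cons_add]⟩

/-- Cardinality and sum determine a multiset with values `k` and `k + 1`. The partitions below are
identified in this way, so that only bounds and the total length of the chains are needed. -/
theorem eq_replicate_of_sum (k c : ℕ) (M : Multiset ℕ) (h : ∀ x ∈ M, x = k ∨ x = k + 1)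
    (hs : M.sum = M.card * k + c) :
    M = Multiset.replicate c (k + 1) + Multiset.replicate (M.card - c) k := by
  obtain ⟨a, b, hM⟩ := exists_eq_replicate k M h
  have hc : M.card = a + b := by rw [hM]; simp
  have : a = c := by
    rw [hc, hM] at hs
    simp only [Multiset.sum_add, Multiset.sum_replicate, smul_eq_mul] at hs
    nlinarith
  subst this
  rw [hc, Nat.add_sub_cancel_left]
  exact hM

section

variable {h m : ℤ}

/-- The integers `b` of a chain fill a closed interval of length `2h/m = k + l/m`, from which
endpoints of level `±1/2` are removed: none for `e = 0`, both for `e = m`, and one otherwise. -/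
theorem len_bounds (hm : 0 < m) {e : ℤ} (hem : e ≤ m) {k l : ℤ} (hN : 2 * h = m * k + l) (hl0 : 0 ≤ l)
    (hl : l < m) :
    chainEnd h m e - chainStart h m e + 1 ≤ k + 1 ∧
    (l = 0 → e ≠ 0 → chainEnd h m e - chainStart h m e + 1 ≤ k) ∧
    k - 1 ≤ chainEnd h m e - chainStart h m e + 1 ∧
    (l ≠ 0 ∨ e ≠ m → k ≤ chainEnd h m e - chainStart h m e + 1) := by
  obtain ⟨a1, a2⟩ := end_spec (h := h) hm e
  obtain ⟨b1, b2⟩ := start_spec (h := h) hm e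
  set x : ℤ := if e ≤ 0 then 0 else 1 with hx
  set y : ℤ := if 0 ≤ e ∧ e < m then 0 else 1 with hy
  have hx1 : 0 ≤ x ∧ x ≤ 1 := by rw [hx]; split_ifs <;> omega
  have hy1 : 0 ≤ y ∧ y ≤ 1 := by rw [hy]; split_ifs <;> omega
  have h0 : e ≠ 0 → 1 ≤ x + y := by intro; rw [hx, hy]; split_ifs <;> omega
  have hm0 : e ≠ m → x + y ≤ 1 := by intro; rw [hx, hy]; split_ifs <;> omega
  set D := chainEnd h m e - chainStart h m e with hD
  have u : m * D ≤ m * k + l - x - y := by rw [hD]; linarith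
  have v : m * k + l - x - y + 2 ≤ m * (D + 2) := by
    rw [hD]; linarith [Int.add_one_le_iff.2 a2, Int.add_one_le_iff.2 b2]
  refine ⟨?_, ?_, ?_, ?_⟩
  · have := lt_of_mul_lt_mul_left (show m * D < m * (k + 1) by linarith) hm.le
    linarith
  · rintro rfl he
    have := lt_of_mul_lt_mul_left (show m * D < m * k by linarith [h0 he]) hm.le
    linarith
  · have := lt_of_mul_lt_mul_left (show m * (k - 1) < m * (D + 2) by linarith) hm.le
    linarith
  · intro hor
    have h1 : 0 < l - x - y + 2 := by
      rcases hor with h1 | h1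
      · have : 0 < l := lt_of_le_of_ne hl0 (Ne.symm h1)
        linarith
      · have := hm0 h1
        linarith
    have := lt_of_mul_lt_mul_left (show m * k < m * (D + 2) by linarith) hm.le
    linarith

/-- Consecutive chains of the same parity abut, which makes their lengths telescope. Between `e = 1`
and `e = -1` the integer `0` is skipped: this is the place of the plug. -/
theorem start_succ (hm : 0 < m) {e : ℤ} (he : e < m) :
    chainStart h m e - 1 = chainEnd h m (e + 2) + if e = -1 then 1 else 0 := by
  have neg_div (x : ℤ) : (-x - 1) / m = -(x / m) - 1 := by
    have h1 := Int.ediv_mul_le x hm.ne'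
    have h2 := Int.lt_ediv_add_one_mul_self x hm
    rw [Int.ediv_eq_iff_of_pos hm]
    constructor <;> linarith
  unfold chainStart chainEnd
  rcases lt_trichotomy e (-1) with h1 | rfl | h1
  · rw [if_neg (by omega), if_pos (by omega), if_neg (by omega),
      show h * (e + 1) - 1 = -(h * (1 - (e + 2))) - 1 by ring, neg_div]
    ring_nf
  · rw [if_neg (by omega), if_neg (by omega), if_pos rfl]
    have : ((-1 : ℤ)) / m = -1 := by simpa using neg_div 0
    norm_num [this]
  · rw [if_pos (by omega), if_neg (by omega), if_neg (by omega),
      show h * (1 - (e + 2)) - 1 = -(h * (e + 1)) - 1 by ring, neg_div]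
    ring_nf

/-- The lengths telescope. The term `-ε` is the skipped plug, and the conditional `1` is the
additional vector of a pending piece. -/
theorem sum_len (hm : 0 < m) {ε : ℤ} (hε : ε = 0 ∨ ε = 1) :
    ∑ e ∈ (Finset.Ioc (-m) m).filter (fun e => 2 ∣ e - ε),
      (chainEnd h m e - chainStart h m e + 1) =
      2 * h + (if 2 ∣ m - 1 - ε then 1 else 0) - ε := by
  obtain ⟨M, rfl⟩ := Int.eq_ofNat_of_zero_le hm.le
  -- The smallest exponent of the required parity; which of the two values it takes depends on the
  -- parity of `m`.
  obtain ⟨e0, he0, hpar⟩ : ∃ e0 : ℤ, (e0 = 1 - M ∨ e0 = 2 - M) ∧ 2 ∣ e0 - ε := by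
    rcases hε with rfl | rfl <;> rcases Int.emod_two_eq_zero_or_one (M : ℤ) with h1 | h1
    · exact ⟨2 - M, by omega, by omega⟩
    · exact ⟨1 - M, by omega, by omega⟩
    · exact ⟨1 - M, by omega, by omega⟩
    · exact ⟨2 - M, by omega, by omega⟩
  have hset : (Finset.Ioc (-(M : ℤ)) M).filter (fun e => 2 ∣ e - ε) =
      (Finset.range M).image fun i : ℕ => e0 + 2 * i := by
    ext e
    simp only [Finset.mem_filter, Finset.mem_Ioc, Finset.mem_image, Finset.mem_range]
    constructor
    · rintro ⟨h1, h2⟩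
      exact ⟨((e - e0) / 2).toNat, by omega, by omega⟩
    · rintro ⟨i, h1, rfl⟩
      omega
  rw [hset, Finset.sum_image (by intro i _ j _ hij; simpa using hij)]
  have htel (n : ℕ) (hn : e0 + 2 * n < M + 2) :
      ∑ i ∈ Finset.range n, (chainEnd h M (e0 + 2 * i) - chainStart h M (e0 + 2 * i) + 1) =
        chainEnd h M e0 - chainEnd h M (e0 + 2 * n) -
          if ε = 1 ∧ e0 ≤ -1 ∧ -1 < e0 + 2 * n then 1 else 0 := by
    induction n with
    | zero =>
      rw [if_neg (by push_cast; omega)]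
      simp
    | succ n ih =>
      push_cast at hn
      rw [Finset.sum_range_succ, ih (by omega)]
      have := start_succ (h := h) hm (e := e0 + 2 * n) (by omega)
      rw [show e0 + 2 * ((n + 1 : ℕ) : ℤ) = e0 + 2 * n + 2 by push_cast; ring]
      split_ifs at this ⊢ <;> omega
  rcases he0 with rfl | rfl
  · rw [htel M (by omega)]
    have e1 : chainEnd h M (1 - M) = h := by
      unfold chainEnd
      rw [if_pos (by omega), show h * (1 - (1 - (M : ℤ))) - 0 = h * M by ring,
        Int.mul_ediv_cancel _ hm.ne']
    have e2 : chainEnd h M (1 - M + 2 * M) = -h - 1 := by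
      have := start_succ (h := h) hm (e := M - 1) (by omega)
      rw [if_neg (by omega), show (M : ℤ) - 1 + 2 = 1 - M + 2 * M by ring] at this
      unfold chainStart at this
      rw [if_pos (by omega), show h * ((M : ℤ) - 1 + 1) - 0 = h * M by ring,
        Int.mul_ediv_cancel _ hm.ne'] at this
      omega
    rw [e1, e2, if_pos (show (2 : ℤ) ∣ M - 1 - ε by omega)]
    split_ifs with h1 <;> omega
  -- Here the last exponent is `m`, to which `start_succ` does not apply, so its length is computed
  -- directly.
  · obtain ⟨n, rfl⟩ : ∃ n, M = n + 1 := ⟨M - 1, by omega⟩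
    rw [Finset.sum_range_succ, htel n (by push_cast; omega),
      if_neg (show ¬(2 : ℤ) ∣ ((n + 1 : ℕ) : ℤ) - 1 - ε by omega)]
    have e0 : (2 : ℤ) - ((n + 1 : ℕ) : ℤ) + 2 * n = ((n + 1 : ℕ) : ℤ) := by push_cast; ring
    rw [e0]
    have e1 : chainStart h ((n + 1 : ℕ) : ℤ) ((n + 1 : ℕ) : ℤ) =
        -(h + (h - 1) / ((n + 1 : ℕ) : ℤ)) := by
      unfold chainStart
      rw [if_neg (by omega), show h * (((n + 1 : ℕ) : ℤ) + 1) - 1 =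
        h - 1 + h * ((n + 1 : ℕ) : ℤ) by ring, Int.add_mul_ediv_right _ _ hm.ne']
      ring
    rw [e1]
    rcases Nat.eq_zero_or_pos n with rfl | hn
    · have e3 : chainEnd h ((0 + 1 : ℕ) : ℤ) (2 - ((0 + 1 : ℕ) : ℤ)) = -1 := by
        unfold chainEnd
        norm_num
      rw [e3]
      simp only [show ¬((2 : ℤ) - ((0 + 1 : ℕ) : ℤ) ≤ -1) by norm_num, false_and, and_false,
        if_false]
      have e4 : chainEnd h ((0 + 1 : ℕ) : ℤ) ((0 + 1 : ℕ) : ℤ) = -1 := e3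
      rw [e4]
      have : (h - 1) / ((0 + 1 : ℕ) : ℤ) = h - 1 := by norm_num
      rw [this]
      have : ε = 1 := by push_cast at hpar; omega
      rw [this]
      ring
    · have e3 : chainEnd h ((n + 1 : ℕ) : ℤ) (2 - ((n + 1 : ℕ) : ℤ)) =
          h - 1 - (h - 1) / ((n + 1 : ℕ) : ℤ) := by
        unfold chainEnd
        rw [if_pos (by omega)]
        have h1 := Int.ediv_mul_le (h - 1) hm.ne'
        have h2 := Int.lt_ediv_add_one_mul_self (h - 1) hm
        rw [Int.ediv_eq_iff_of_pos hm]
        constructor <;> nlinarith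
      rw [e3]
      split_ifs with h1 <;> omega

theorem card_exps (hm : 0 < m) (ε : ℤ) :
    ((Finset.Ioc (-m) m).filter (fun e => 2 ∣ e - ε)).card = m.toNat := by
  obtain ⟨e0, he0, hpar⟩ : ∃ e0 : ℤ, (e0 = 1 - m ∨ e0 = 2 - m) ∧ 2 ∣ e0 - ε := by
    by_cases h1 : 2 ∣ 1 - m - ε
    · exact ⟨1 - m, by omega, by omega⟩
    · exact ⟨2 - m, by omega, by omega⟩
  have hset : (Finset.Ioc (-m) m).filter (fun e => 2 ∣ e - ε) =
      (Finset.range m.toNat).image fun i : ℕ => e0 + 2 * i := by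
    ext e
    simp only [Finset.mem_filter, Finset.mem_Ioc, Finset.mem_image, Finset.mem_range]
    constructor
    · rintro ⟨h1, h2⟩
      exact ⟨((e - e0) / 2).toNat, by omega, by omega⟩
    · rintro ⟨i, h1, rfl⟩
      omega
  rw [hset, Finset.card_image_of_injective, Finset.card_range]
  intro i j hij
  simpa using hij

end

/-- The lengths of the chains of monomials, including the zero ones. -/
def chainLens (h m : ℕ) (ε : ℤ) : Multiset ℕ :=
  ((Finset.Ioc (-(m : ℤ)) m).filter fun e => 2 ∣ e - ε).val.map (chainLen h m)

theorem map_chainExps (h m : ℕ) (ε : ℤ) :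
    (chainExps h m ε).val.map (chainLen h m) = (chainLens h m ε).filter (0 < ·) := by
  rw [chainLens, Multiset.filter_map, ← Finset.filter_val, Finset.filter_filter]
  rfl

theorem card_chainLens {h m : ℕ} (hm : 0 < m) (ε : ℤ) : (chainLens h m ε).card = m := by
  rw [chainLens, Multiset.card_map, Finset.card_val, card_exps (by exact_mod_cast hm)]
  simp

theorem sum_chainLens {h m : ℕ} (hh : 0 < h) (hm : 0 < m) {ε : ℤ} (hε : ε = 0 ∨ ε = 1) :
    ((chainLens h m ε).sum : ℤ) = 2 * h + (if 2 ∣ (m : ℤ) - 1 - ε then 1 else 0) - ε := by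
  have hm' : (0 : ℤ) < m := by exact_mod_cast hm
  rw [← sum_len hm' hε, chainLens]
  change ((∑ e ∈ _, chainLen h m e : ℕ) : ℤ) = _
  push_cast
  refine Finset.sum_congr rfl fun e he => ?_
  have hN : 2 * (h : ℤ) = m * ((2 * h : ℤ) / m) + (2 * h : ℤ) % m := (Int.mul_ediv_add_emod _ _).symm
  have := (len_bounds hm' (Finset.mem_Ioc.1 (Finset.mem_filter.1 he).1).2 hN (Int.emod_nonneg _ hm'.ne') (Int.emod_lt_of_pos _ hm')).2.2
  have h1 : 0 ≤ (2 * h : ℤ) / m := by positivity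
  unfold chainLen
  rw [Int.toNat_of_nonneg]
  rcases h1.lt_or_eq with h1 | h1
  · omega
  · by_cases h2 : (2 * h : ℤ) % m = 0
    · rw [← h1, h2] at hN
      omega
    · have := this.2 (Or.inl h2)
      omega

theorem chainLen_mem {h m : ℕ} {ε : ℤ} {x : ℕ} (hx : x ∈ chainLens h m ε) :
    ∃ e : ℤ, e ≤ m ∧ 2 ∣ e - ε ∧ x = chainLen h m e := by
  obtain ⟨e, he, rfl⟩ := Multiset.mem_map.1 hx
  have := Finset.mem_filter.1 (Finset.mem_val ▸ he)
  exact ⟨e, (Finset.mem_Ioc.1 this.1).2, this.2, rfl⟩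

theorem chainLen_bounds {h m : ℕ} (hm : 0 < m) {e : ℤ} (he : e ≤ m) :
    chainLen h m e ≤ 2 * h / m + 1 ∧
    (2 * h % m = 0 → e ≠ 0 → chainLen h m e ≤ 2 * h / m) ∧
    2 * h / m ≤ chainLen h m e + 1 ∧
    (2 * h % m ≠ 0 ∨ e ≠ m → 2 * h / m ≤ chainLen h m e) := by
  have hN : 2 * (h : ℤ) = m * ((2 * h / m : ℕ) : ℤ) + ((2 * h % m : ℕ) : ℤ) := by
    exact_mod_cast (Nat.div_add_mod (2 * h) m).symm
  have h1 := len_bounds (by exact_mod_cast hm) he hN (by positivity)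
    (by exact_mod_cast Nat.mod_lt _ hm)
  unfold chainLen
  generalize 2 * h / m = k at *
  generalize 2 * h % m = l at *
  refine ⟨by omega, by omega, by omega, by omega⟩

/-- For `e = m` the start and the end add up to `-2h`, so the length is odd; as it is `k - 1` or
`k`, the parity of `k` decides. -/
theorem chainLen_top_parity {h m : ℕ} (hm : 0 < m) (hl : 2 * h % m = 0) (hh : 0 < h) :
    (Odd (2 * h / m) → 2 * h / m ≤ chainLen h m m) ∧
    (Even (2 * h / m) → chainLen h m m + 1 = 2 * h / m) := by
  have hm' : (0 : ℤ) < m := by exact_mod_cast hm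
  have hN : 2 * (h : ℤ) = m * ((2 * h / m : ℕ) : ℤ) + 0 := by
    have := Nat.div_add_mod (2 * h) m
    rw [hl] at this
    exact_mod_cast this.symm
  have h1 := len_bounds hm' le_rfl hN le_rfl hm'
  have h2 := start_add_end_top (h := h) hm'
  have h3 := h1.2.1 rfl hm'.ne'
  have h4 : 0 < 2 * h / m := Nat.div_pos (Nat.le_of_dvd (by omega) (Nat.dvd_of_mod_eq_zero hl)) hm
  unfold chainLen
  constructor
  · rintro ⟨c, hc⟩
    omega
  · rintro ⟨c, hc⟩
    omega

/-- For `e = 0` both levels `-1/2` and `1/2` are attained and allowed, which yields one vector more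
than `k`. -/
theorem chainLen_zero_of_even {h m : ℕ} (hm : 0 < m) (hl : 2 * h % m = 0) (hk : Even (2 * h / m)) :
    chainLen h m 0 = 2 * h / m + 1 := by
  obtain ⟨c, hc⟩ := hk
  have hm' : (0 : ℤ) < m := by exact_mod_cast hm
  have h0 : h = m * c := by
    have := Nat.div_add_mod (2 * h) m
    rw [hl, hc, add_zero, ← two_mul, mul_left_comm] at this
    exact (Nat.eq_of_mul_eq_mul_left two_pos this).symm
  have h1 : (h : ℤ) = c * m := by rw [h0]; push_cast; ring
  have e1 : chainEnd h m 0 = c := by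
    unfold chainEnd
    rw [if_pos le_rfl, sub_zero, sub_zero, mul_one, h1, Int.mul_ediv_cancel _ hm'.ne']
  have e2 : chainStart h m 0 = -c := by
    unfold chainStart
    rw [if_pos ⟨le_rfl, hm'⟩, sub_zero, zero_add, mul_one, h1, Int.mul_ediv_cancel _ hm'.ne']
  unfold chainLen
  rw [e1, e2, hc]
  omega

/-- Every length is `k` or `k + 1`. The only doubtful exponent is `m` when `l = 0`: it has the wrong
parity for `ε = 1`, and for `ε = 0` it is settled by `chainLen_top_parity`. -/
theorem chainLens_eq_balanced {h m : ℕ} (hh : 0 < h) (hm : 0 < m) (h2 : 2 ∣ m) {ε : ℤ}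
    (hε : ε = 0 ∧ (2 * h % m ≠ 0 ∨ Odd (2 * h / m)) ∨ ε = 1) :
    chainLens h m ε = balanced (2 * h) m := by
  have hs := sum_chainLens hh hm (ε := ε) (by tauto)
  have hc := card_chainLens (h := h) hm ε
  have hd := Nat.div_add_mod (2 * h) m
  have hs' : (chainLens h m ε).sum = 2 * h := by
    rcases hε with ⟨rfl, -⟩ | rfl <;> split_ifs at hs <;> omega
  have := eq_replicate_of_sum (2 * h / m) (2 * h % m) (chainLens h m ε) (fun x hx => by
    obtain ⟨e, he, he2, rfl⟩ := chainLen_mem hx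
    obtain ⟨h3, -, h4, h5⟩ := chainLen_bounds (h := h) hm he
    have h6 : 2 * h / m ≤ chainLen h m e := by
      by_cases h7 : 2 * h % m ≠ 0 ∨ e ≠ m
      · exact h5 h7
      · rw [not_or, not_ne_iff, not_ne_iff] at h7
        obtain ⟨h7, rfl⟩ := h7
        refine (chainLen_top_parity hm h7 hh).1 ?_
        rcases hε with ⟨-, h8 | h8⟩ | rfl
        · exact absurd h7 h8
        · exact h8
        · omega
    omega) (by rw [hs', hc, hd])
  rw [this, hc]
  rfl

theorem chainLens_eq_raised {h m : ℕ} (hh : 0 < h) (hm : 0 < m) (h2 : Odd m) :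
    chainLens h m 0 = raised (2 * h) m := by
  have hs := sum_chainLens hh hm (ε := 0) (by tauto)
  have hc := card_chainLens (h := h) hm 0
  have hd := Nat.div_add_mod (2 * h) m
  obtain ⟨q, hq⟩ := h2
  have hs' : (chainLens h m 0).sum = 2 * h + 1 := by
    split_ifs at hs <;> omega
  have := eq_replicate_of_sum (2 * h / m) (2 * h % m + 1) (chainLens h m 0) (fun x hx => by
    obtain ⟨e, he, he2, rfl⟩ := chainLen_mem hx
    obtain ⟨h3, -, h4, h5⟩ := chainLen_bounds (h := h) hm he
    have := h5 (Or.inr (by omega))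
    omega) (by rw [hs', hc]; omega)
  rw [this, hc]
  rfl

theorem chainLens_eq_lowered {h m : ℕ} (hh : 0 < h) (hm : 0 < m) (h2 : Odd m) :
    chainLens h m 1 = lowered (2 * h) m := by
  have hs := sum_chainLens hh hm (ε := 1) (by tauto)
  have hc := card_chainLens (h := h) hm 1
  have hd := Nat.div_add_mod (2 * h) m
  obtain ⟨q, hq⟩ := h2
  have hs' : (chainLens h m 1).sum + 1 = 2 * h := by
    split_ifs at hs <;> omega
  unfold lowered
  split_ifs with hl
  · have := eq_replicate_of_sum (2 * h / m) (2 * h % m - 1) (chainLens h m 1) (fun x hx => by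
      obtain ⟨e, he, he2, rfl⟩ := chainLen_mem hx
      obtain ⟨h3, -, h4, h5⟩ := chainLen_bounds (h := h) hm he
      have := h5 (Or.inl hl)
      omega) (by rw [hc]; omega)
    rw [this, hc]
    have hlt := Nat.mod_lt (2 * h) hm
    rw [show m - (2 * h % m - 1) = m - 2 * h % m + 1 by omega]
  · have hl0 : 2 * h % m = 0 := by omega
    have hk : 0 < 2 * h / m :=
      Nat.div_pos (Nat.le_of_dvd (by omega) (Nat.dvd_of_mod_eq_zero hl0)) hm
    -- Odd exponents exclude `e = 0`, so for `l = 0` no length exceeds `2h/m`; the total `2h - 1`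
    -- leaves exactly one part below it.
    obtain ⟨k, hk⟩ : ∃ k, 2 * h / m = k + 1 := ⟨2 * h / m - 1, by omega⟩
    have := eq_replicate_of_sum k (m - 1) (chainLens h m 1) (fun x hx => by
      obtain ⟨e, he, he2, rfl⟩ := chainLen_mem hx
      obtain ⟨h3, h6, h4, h5⟩ := chainLen_bounds (h := h) hm he
      have := h6 hl0 (by omega)
      omega) (by
        rw [hc]
        rw [hl0, hk, mul_add] at hd
        omega)
    rw [this, hc, hl0, hk, Nat.sub_zero, Nat.add_sub_cancel, show m - (m - 1) = 1 by omega]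
    rfl

/-- The exponent `0` gains one, the exponent `m` loses one, and all the others give exactly `k`. -/
theorem chainLens_eq_spread {h m : ℕ} (hh : 0 < h) (hm : 0 < m) (h2 : 2 ∣ m) (hl : 2 * h % m = 0)
    (hk : Even (2 * h / m)) : chainLens h m 0 = spread (2 * h) m := by
  have hc := card_exps (m := m) (by exact_mod_cast hm) 0
  set E := (Finset.Ioc (-(m : ℤ)) m).filter fun e => 2 ∣ e - 0 with hE
  have h0 : (0 : ℤ) ∈ E := by simp [hE]; omega
  have hmE : (m : ℤ) ∈ E.erase 0 := by simp [hE]; omega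
  have h1 : E.val = 0 ::ₘ ((m : ℤ) ::ₘ ((E.erase 0).erase m).val) := by
    rw [Finset.erase_val, Multiset.cons_erase (by exact hmE), Finset.erase_val,
      Multiset.cons_erase (by exact h0)]
  have h3 : ((E.erase 0).erase (m : ℤ)).val.map (chainLen h m) =
      Multiset.replicate (m - 2) (2 * h / m) := by
    rw [Multiset.eq_replicate]
    constructor
    · rw [Multiset.card_map, Finset.card_val, Finset.card_erase_of_mem hmE,
        Finset.card_erase_of_mem h0, hc]
      simp
      omega
    · intro x hx
      obtain ⟨e, he, rfl⟩ := Multiset.mem_map.1 hx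
      have he' : e ∈ (E.erase 0).erase (m : ℤ) := he
      simp only [Finset.mem_erase, hE, Finset.mem_filter, Finset.mem_Ioc] at he'
      obtain ⟨-, h5, -, h6⟩ := chainLen_bounds (h := h) hm he'.2.2.1.2
      exact le_antisymm (h5 hl he'.2.1) (h6 (Or.inr he'.1))
  have h4 := (chainLen_top_parity hm hl hh).2 hk
  rw [chainLens, ← hE, h1, Multiset.map_cons, Multiset.map_cons, h3, chainLen_zero_of_even hm hl hk,
    show chainLen h m m = 2 * h / m - 1 by omega, spread]
  rw [← Multiset.singleton_add, ← Multiset.singleton_add, add_assoc]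
  congr 1
  exact add_comm _ _

/-! ### Recurrence of the pairings -/

/-- The sign `(-1) ^ b`. -/
def sgn (b : ℤ) : ℂ⸨X⸩ := if Even b then 1 else -1

theorem ordEq_sgn (b : ℤ) : OrdEq (sgn b) 0 := by
  unfold sgn
  split_ifs
  exacts [ordEq_one, ordEq_one.neg]

/-- The orbit of a vector whose pairings are given by the linear recurrence of `f`. -/
structure CycForm {V : Type} [AddCommGroup V] [Module ℂ⸨X⸩ V] (B : LinearMap.BilinForm ℂ⸨X⸩ V)
    (Γ : Module.End ℂ⸨X⸩ V) (W : ℤ → V) (F : ℤ → ℂ⸨X⸩) (f : ℂ⟦X⟧[X]) (h m : ℕ) (ε : ℤ) :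
    Prop where
  h_pos : 0 < h
  m_pos : 0 < m
  top : lowerCoeff f 0 = 1
  slope : ∀ j ≤ 2 * h, OrdGE (algebraMap ℂ⟦X⟧ ℂ⸨X⸩ (lowerCoeff f j)) (j * (m / (2 * h)))
  low : OrdEq (algebraMap ℂ⟦X⟧ ℂ⸨X⸩ (lowerCoeff f (2 * h))) m
  step : ∀ b, Γ (W b) = W (b + 1)
  form : ∀ a b, B (W a) (W b) = sgn b * (tp (-ε) * F (a + b))
  recur : ∀ e, ∑ j ∈ Finset.range (2 * h + 1),
    algebraMap ℂ⟦X⟧ ℂ⸨X⸩ (lowerCoeff f j) * F (e + 2 * h - j) = 0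
  F_zero : F 0 = 1
  F_eq_zero : ∀ e, -(2 * (h : ℤ)) < e → e < 0 → F e = 0

section

variable {V : Type} [AddCommGroup V] [Module ℂ⸨X⸩ V] {B : LinearMap.BilinForm ℂ⸨X⸩ V}
  {Γ : Module.End ℂ⸨X⸩ V} {W : ℤ → V} {F : ℤ → ℂ⸨X⸩} {f : ℂ⟦X⟧[X]} {h m : ℕ} {ε : ℤ}

/-- The recurrence runs upwards by the leading coefficient `1` and downwards by the last
coefficient, whose order is exactly `m`. In both directions the slope condition propagates the
linear bound from the initial values. -/
theorem CycForm.F_ge (C : CycForm B Γ W F f h m ε) (e : ℤ) : OrdGE (F e) (e * (m / (2 * h))) := by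
  have hh := C.h_pos
  have hh' : (0 : ℚ) < h := by exact_mod_cast hh
  have hm' : (0 : ℚ) < m := by exact_mod_cast C.m_pos
  have slope := C.slope
  obtain ⟨ν, hν⟩ : ∃ ν : ℚ, ν = m / (2 * h) := ⟨_, rfl⟩
  rw [← hν] at slope ⊢
  have hNν : 2 * (h : ℚ) * ν = m := by rw [hν]; field_simp
  have base (e : ℤ) (h1 : -(2 * (h : ℤ)) < e) (h2 : e ≤ 0) : OrdGE (F e) (e * ν) := by
    rcases h2.lt_or_eq with h2 | rfl
    · rw [C.F_eq_zero e h1 h2]; exact OrdGE.zero _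
    · rw [C.F_zero]; simpa using ordGE_one
  have term (e : ℤ) (j : ℕ) (hj : j ≤ 2 * h) (hF : OrdGE (F (e + 2 * h - j))
      ((e + 2 * h - j : ℤ) * ν)) :
      OrdGE (algebraMap ℂ⟦X⟧ ℂ⸨X⸩ (lowerCoeff f j) * F (e + 2 * h - j)) ((e + 2 * h : ℤ) * ν) :=
    ((slope j hj).mul hF).mono (le_of_eq (by push_cast; ring))
  rcases le_or_gt e (-(2 * (h : ℤ))) with h1 | h1
  · obtain ⟨n, hn⟩ : ∃ n : ℕ, e = -(2 * (h : ℤ)) - n := ⟨(-(2 * (h : ℤ)) - e).toNat, by omega⟩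
    clear h1
    induction n using Nat.strong_induction_on generalizing e with
    | _ n ih =>
      have hrec := C.recur e
      rw [Finset.sum_range_succ] at hrec
      have h3 : OrdGE (algebraMap ℂ⟦X⟧ ℂ⸨X⸩ (lowerCoeff f (2 * h)) * F e) ((e + 2 * h : ℤ) * ν) := by
        have h4 : algebraMap ℂ⟦X⟧ ℂ⸨X⸩ (lowerCoeff f (2 * h)) * F e =
            -∑ j ∈ Finset.range (2 * h), algebraMap ℂ⟦X⟧ ℂ⸨X⸩ (lowerCoeff f j) *
              F (e + 2 * h - j) := by
          rw [← eq_neg_iff_add_eq_zero] at hrec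
          rw [hrec, neg_neg]
          congr 2
          push_cast; ring
        rw [h4]
        refine (OrdGE.sum fun j hj => ?_).neg
        have hj' := Finset.mem_range.1 hj
        refine term e j hj'.le ?_
        by_cases h5 : -(2 * (h : ℤ)) < e + 2 * h - j
        · exact base _ h5 (by omega)
        · exact ih (n - (2 * h - j)) (by omega) _ (by omega)
      have h5 := C.low.inv.1.mul h3
      rw [inv_mul_cancel_left₀ C.low.ne_zero] at h5
      refine h5.mono (le_of_eq ?_)
      push_cast
      linear_combination -hNν
  · rcases le_or_gt e 0 with h2 | h2
    · exact base e h1 h2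
    obtain ⟨n, hn⟩ : ∃ n : ℕ, e = n + 1 := ⟨(e - 1).toNat, by omega⟩
    clear h1 h2
    induction n using Nat.strong_induction_on generalizing e with
    | _ n ih =>
      have hrec := C.recur (e - 2 * h)
      rw [Finset.sum_range_succ', C.top, map_one, one_mul,
        show e - 2 * h + 2 * h - ((0 : ℕ) : ℤ) = e by push_cast; ring] at hrec
      rw [← neg_eq_iff_add_eq_zero] at hrec
      rw [← hrec]
      refine (OrdGE.sum fun j hj => ?_).neg
      have hj' := Finset.mem_range.1 hj
      have := term (e - 2 * h) (j + 1) (by omega) (by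
        have e1 : e - 2 * h + 2 * h - ((j + 1 : ℕ) : ℤ) = e - (j + 1) := by push_cast; ring
        rw [e1]
        by_cases h5 : e - ((j : ℤ) + 1) ≤ 0
        · exact base _ (by omega) h5
        · exact ih (n - (j + 1)) (by omega) _ (by omega))
      rwa [show e - 2 * (h : ℤ) + 2 * h = e by ring] at this ⊢

/-- At `e = -2h` the gap leaves only the two extreme terms of the recurrence, so this value is minus
the inverse of the constant coefficient of `f`. -/
theorem CycForm.F_low (C : CycForm B Γ W F f h m ε) : OrdEq (F (-(2 * h))) (-m) := by
  have hh := C.h_pos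
  have hrec := C.recur (-(2 * h))
  rw [Finset.sum_range_succ, Finset.sum_eq_single 0] at hrec
  · rw [C.top, map_one, one_mul, show -(2 * (h : ℤ)) + 2 * h - ((0 : ℕ) : ℤ) = 0 by push_cast; ring,
      C.F_zero, show -(2 * (h : ℤ)) + 2 * h - ((2 * h : ℕ) : ℤ) = -(2 * h) by push_cast; ring] at hrec
    have h1 : F (-(2 * h)) = -(algebraMap ℂ⟦X⟧ ℂ⸨X⸩ (lowerCoeff f (2 * h)))⁻¹ := by
      have := C.low.ne_zero
      field_simp
      linear_combination hrec
    rw [h1]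
    exact C.low.inv.neg
  · intro j hj hj0
    have := Finset.mem_range.1 hj
    rw [C.F_eq_zero _ (by omega) (by omega), mul_zero]
  · intro h0
    exact absurd (Finset.mem_range.2 (by omega)) h0

theorem CycForm.cycVec (C : CycForm B Γ W F f h m ε) : CycVec B Γ W h m ε where
  h_pos := by exact_mod_cast C.h_pos
  m_pos := by exact_mod_cast C.m_pos
  step := C.step
  ge a b := by
    rw [C.form]
    refine ((ordEq_sgn b).1.mul ((ordGE_tp (-ε)).mul (C.F_ge (a + b)))).mono ?_
    push_cast
    linarith
  zero a b h1 h2 := by rw [C.form, C.F_eq_zero _ h1 h2]; simp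
  unit a b h0 := by
    rw [C.form, h0, C.F_zero]
    simpa using (ordEq_sgn b).mul (ordEq_tp (-ε))
  low a b h0 := by
    rw [C.form, h0]
    have := (ordEq_sgn b).mul ((ordEq_tp (-ε)).mul C.F_low)
    rwa [show 0 + (-ε + -(m : ℤ)) = -m - ε by ring] at this

/-- The leading terms of the pairings satisfy the recurrence of the graded polynomial. -/
theorem CycForm.recur_coeff (C : CycForm B Γ W F f h m ε) {k : ℕ} (hk : 0 < k) (hN : 2 * h = m * k)
    (n : ℤ) : ∑ α ∈ Finset.range (m + 1), PowerSeries.coeff α (lowerCoeff f (α * k)) *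
      (F (k * (n + m - α))).coeff (n + m - α) = 0 := by
  have hh' : (0 : ℚ) < h := by exact_mod_cast C.h_pos
  have hm' : (0 : ℚ) < m := by exact_mod_cast C.m_pos
  have hk' : (0 : ℚ) < k := by exact_mod_cast hk
  have hν : (m : ℚ) / (2 * h) = 1 / k := by
    have : 2 * (h : ℚ) = m * k := by exact_mod_cast hN
    rw [this]; field_simp
  have h0 := congrArg (fun x : ℂ⸨X⸩ => x.coeff (n + m)) (C.recur (k * n))
  simp only [HahnSeries.coeff_sum, HahnSeries.coeff_zero] at h0
  rw [← h0]
  have hinj : Function.Injective fun α : ℕ => α * k := fun a b hab => Nat.eq_of_mul_eq_mul_right hk hab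
  refine Eq.trans ?_ (Finset.sum_subset (s₁ := (Finset.range (m + 1)).image fun α : ℕ => α * k)
    ?_ ?_)
  · rw [Finset.sum_image hinj.injOn]
    refine Finset.sum_congr rfl fun α hα => ?_
    have hα' : α ≤ m := by have := Finset.mem_range.1 hα; omega
    have h1 : OrdGE (algebraMap ℂ⟦X⟧ ℂ⸨X⸩ (lowerCoeff f (α * k))) ((α : ℤ) : ℚ) := by
      refine (C.slope (α * k) (by rw [hN]; exact Nat.mul_le_mul_right _ hα')).mono (le_of_eq ?_)
      rw [hν]; push_cast; field_simp
    have e1 : (k : ℤ) * n + 2 * h - ((α * k : ℕ) : ℤ) = k * (n + m - α) := by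
      have : 2 * (h : ℤ) = m * k := by exact_mod_cast hN
      rw [this]; push_cast; ring
    rw [e1]
    have h2 : OrdGE (F (k * (n + m - α))) ((n + m - α : ℤ) : ℚ) := by
      refine (C.F_ge _).mono (le_of_eq ?_)
      rw [hν]; push_cast; field_simp
    rw [← coeff_algebraMap, ← coeff_mul_of_ordGE h1 h2]
    congr 1
    ring
  · intro j hj
    obtain ⟨α, hα, rfl⟩ := Finset.mem_image.1 hj
    have hα' : α ≤ m := by have := Finset.mem_range.1 hα; omega
    rw [Finset.mem_range, hN]
    have := Nat.mul_le_mul_right k hα'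
    omega
  · intro j hj hj'
    have hj2 : j ≤ 2 * h := by have := Finset.mem_range.1 hj; omega
    have hnd : ¬ k ∣ j := by
      rintro ⟨α, rfl⟩
      refine hj' (Finset.mem_image.2 ⟨α, ?_, mul_comm _ _⟩)
      rw [hN, mul_comm] at hj2
      have := Nat.le_of_mul_le_mul_right hj2 hk
      exact Finset.mem_range.2 (by omega)
    -- both factors have order larger than the integer part
    have hdm := Nat.div_add_mod j k
    have hmod : 0 < j % k := Nat.pos_of_ne_zero fun h => hnd (Nat.dvd_of_mod_eq_zero h)
    have hmod' := Nat.mod_lt j hk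
    generalize j / k = z at hdm
    generalize j % k = w at hdm hmod hmod'
    have h1 : OrdGE (algebraMap ℂ⟦X⟧ ℂ⸨X⸩ (lowerCoeff f j)) (((z : ℤ) + 1 : ℤ) : ℚ) := by
      refine (C.slope j hj2).of_gt ?_
      rw [hν]
      push_cast
      rw [add_sub_cancel_right, mul_one_div, lt_div_iff₀ hk']
      have : z * k < j := by rw [mul_comm]; omega
      exact_mod_cast this
    have h2 : OrdGE (F (k * n + 2 * h - j)) ((n + m - z : ℤ) : ℚ) := by
      refine (C.F_ge _).of_gt ?_
      rw [hν]
      push_cast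
      rw [mul_one_div, lt_div_iff₀ hk']
      have e1 : 2 * (h : ℚ) = m * k := by exact_mod_cast hN
      have : j < (z + 1) * k := by rw [add_mul, mul_comm z]; omega
      have : (j : ℚ) < ((z : ℚ) + 1) * k := by exact_mod_cast this
      rw [e1]
      linarith
    have h3 := h1.mul h2
    refine h3 _ ?_
    push_cast
    linarith

end

/-! ### Square graded polynomials -/

theorem grPoly_balanced {m k : ℕ} (hm : 0 < m) (f : ℂ⟦X⟧[X]) :
    grPoly (balanced (m * k) m) k f = ∑ α ∈ Finset.range (m + 1),
      Polynomial.C (PowerSeries.coeff α (lowerCoeff f (α * k))) * Polynomial.X ^ (m - α) := by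
  have h1 : balanced (m * k) m = Multiset.replicate m k := by
    rw [balanced, Nat.mul_mod_right, Nat.mul_div_cancel_left _ hm]
    simp
  rw [h1, grPoly]
  have h2 : (Multiset.replicate m k).filter (k < ·) = 0 := by
    rw [Multiset.filter_eq_nil]
    intro a ha
    rw [Multiset.eq_of_mem_replicate ha]
    exact lt_irrefl k
  rw [h2, Multiset.count_replicate_self]
  simp

section

variable {V : Type} [AddCommGroup V] [Module ℂ⸨X⸩ V] {B : LinearMap.BilinForm ℂ⸨X⸩ V}
  {Γ : Module.End ℂ⸨X⸩ V} {W : ℤ → V} {F : ℤ → ℂ⸨X⸩} {f : ℂ⟦X⟧[X]} {h m k : ℕ}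

theorem coeff_C_mul_laurent (c : ℂ) (x : ℂ⸨X⸩) (n : ℤ) :
    (HahnSeries.C c * x).coeff n = c * x.coeff n := by
  rw [HahnSeries.C_mul_eq_smul, HahnSeries.coeff_smul, smul_eq_mul]

/-- The vector `t ^ (-i) Γ ^ (k i + c) v`. -/
def twist (W : ℤ → V) (k : ℕ) (i c : ℤ) : V := tp (-i) • W (k * i + c)

theorem CycForm.pow_twist {ε : ℤ} (C : CycForm B Γ W F f h m ε) (i c : ℤ) (a : ℕ) :
    (Γ ^ a) (twist W k i c) = twist W k i (c + a) := by
  induction a with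
  | zero => simp
  | succ a ih =>
    rw [pow_succ', Module.End.mul_apply, ih, twist, map_smul, C.step, twist]
    congr 2
    push_cast; ring

/-- Since `k` is even, shifting the exponent by `k i'` does not affect the sign. -/
theorem CycForm.twist_form (C : CycForm B Γ W F f h m 1) (hk : Even k) (i c i' c' : ℤ) :
    B (twist W k i c) (twist W k i' c') =
      sgn c' * (tp (-(i + i') - 1) * F (k * (i + i') + (c + c'))) := by
  have h1 : sgn (k * i' + c') = sgn c' := by
    have : Even ((k : ℤ) * i') := Even.mul_right (by exact_mod_cast hk) _
    simp [sgn, Int.even_add, this]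
  simp only [twist, map_smul, LinearMap.smul_apply, smul_eq_mul, C.form, h1]
  rw [show (k : ℤ) * i + c + (k * i' + c') = k * (i + i') + (c + c') by ring,
    show -(i + i') - 1 = -i' + (-i + -1) by ring, tp_add, tp_add]
  ring

theorem CycForm.twist_ge (C : CycForm B Γ W F f h m 1) (hk0 : 0 < k) (hN : 2 * h = m * k)
    (hk : Even k) (i c i' c' : ℤ) :
    OrdGE (B (twist W k i c) (twist W k i' c')) (-1 + (c + c') * (1 / k)) := by
  have hm' : (0 : ℚ) < m := by exact_mod_cast C.m_pos
  have hk' : (0 : ℚ) < k := by exact_mod_cast hk0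
  rw [C.twist_form hk]
  refine ((ordEq_sgn c').1.mul ((ordGE_tp _).mul (C.F_ge _))).mono (le_of_eq ?_)
  have : 2 * (h : ℚ) = m * k := by exact_mod_cast hN
  rw [this]
  push_cast
  field_simp
  ring

theorem CycForm.twist_coeff (C : CycForm B Γ W F f h m 1) (hk : Even k) (i c i' c' z : ℤ)
    (hc : c + c' = k * z) :
    (B (twist W k i c) (twist W k i' c')).coeff (z - 1) =
      (sgn c').coeff 0 * (F (k * (i + i' + z))).coeff (i + i' + z) := by
  have h1 : OrdGE (sgn c') ((0 : ℤ) : ℚ) := (ordEq_sgn c').1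
  have h2 (x : ℂ⸨X⸩) (n : ℤ) : (sgn c' * x).coeff n = (sgn c').coeff 0 * x.coeff n := by
    unfold sgn
    split_ifs
    · simp
    · rw [show (-1 : ℂ⸨X⸩) * x = -x by ring]; simp
  rw [C.twist_form hk, h2, coeff_tp_mul, hc]
  congr 2
  · ring_nf
  · ring

/-- The combination of the vectors `twist` with the coefficients of `g`. -/
def twistSum (W : ℤ → V) (k : ℕ) (g : ℂ[X]) (q : ℕ) (i c : ℤ) : V :=
  ∑ r ∈ Finset.range (q + 1), (HahnSeries.C (g.coeff r) : ℂ⸨X⸩) • twist W k (i + r) c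

variable {g : ℂ[X]} {q : ℕ}

theorem CycForm.pow_twistSum {ε : ℤ} (C : CycForm B Γ W F f h m ε) (i c : ℤ) (a : ℕ) :
    (Γ ^ a) (twistSum W k g q i c) = twistSum W k g q i (c + a) := by
  simp only [twistSum, map_sum, map_smul, C.pow_twist]

theorem CycForm.twistSum_ge (C : CycForm B Γ W F f h m 1) (hk0 : 0 < k) (hN : 2 * h = m * k)
    (hk : Even k) (i c i' c' : ℤ) :
    OrdGE (B (twistSum W k g q i c) (twist W k i' c')) (-1 + (c + c') * (1 / k)) := by
  simp only [twistSum, map_sum, map_smul, LinearMap.sum_apply, LinearMap.smul_apply, smul_eq_mul]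
  refine OrdGE.sum fun r _ => ?_
  simpa using (ordGE_C (g.coeff r)).mul (C.twist_ge hk0 hN hk (i + r) c i' c')

theorem CycForm.twistSum_ge_self (C : CycForm B Γ W F f h m 1) (hk0 : 0 < k) (hN : 2 * h = m * k)
    (hk : Even k) (i c i' c' : ℤ) :
    OrdGE (B (twistSum W k g q i c) (twistSum W k g q i' c')) (-1 + (c + c') * (1 / k)) := by
  conv in (twistSum W k g q i' c') => rw [twistSum]
  simp only [map_sum, map_smul, smul_eq_mul]
  refine OrdGE.sum fun r _ => ?_
  simpa using (ordGE_C (g.coeff r)).mul (C.twistSum_ge hk0 hN hk i c (i' + r) c')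

theorem CycForm.twistSum_coeff (C : CycForm B Γ W F f h m 1) (hk : Even k) (i c i' c' z : ℤ)
    (hc : c + c' = k * z) :
    (B (twistSum W k g q i c) (twist W k i' c')).coeff (z - 1) =
      (sgn c').coeff 0 * ∑ r ∈ Finset.range (q + 1),
        g.coeff r * (F (k * (i + i' + z + r))).coeff (i + i' + z + r) := by
  simp only [twistSum, map_sum, map_smul, LinearMap.sum_apply, LinearMap.smul_apply, smul_eq_mul,
    HahnSeries.coeff_sum, coeff_C_mul_laurent, Finset.mul_sum]
  refine Finset.sum_congr rfl fun r _ => ?_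
  rw [C.twist_coeff hk _ _ _ _ z hc, show i + (r : ℤ) + i' + z = i + i' + z + r by ring]
  ring

/-- Evaluation of polynomials at the leading terms of the pairings. -/
def leadFun (F : ℤ → ℂ⸨X⸩) (k : ℕ) (n : ℤ) : ℂ[X] →ₗ[ℂ] ℂ :=
  Polynomial.lsum fun u => (F (k * (n + u))).coeff (n + u) • LinearMap.id

theorem leadFun_C_mul_X_pow (n : ℤ) (c : ℂ) (u : ℕ) :
    leadFun F k n (Polynomial.C c * Polynomial.X ^ u) = c * (F (k * (n + u))).coeff (n + u) := by
  rw [leadFun, Polynomial.C_mul_X_pow_eq_monomial, Polynomial.lsum_apply,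
    Polynomial.sum_monomial_index _ _ (by simp)]
  simp [mul_comm]

/-- Along the multiples of `k`, the leading coefficients of `F` form a linear recurrent sequence
whose characteristic polynomial is the graded polynomial. -/
theorem CycForm.leadFun_gr (C : CycForm B Γ W F f h m 1) (hk0 : 0 < k) (hN : 2 * h = m * k)
    (n : ℤ) : leadFun F k n (∑ α ∈ Finset.range (m + 1),
      Polynomial.C (PowerSeries.coeff α (lowerCoeff f (α * k))) * Polynomial.X ^ (m - α)) = 0 := by
  rw [map_sum, ← C.recur_coeff hk0 hN n]
  refine Finset.sum_congr rfl fun α hα => ?_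
  have hα' : α ≤ m := by have := Finset.mem_range.1 hα; omega
  rw [leadFun_C_mul_X_pow, Nat.cast_sub hα', add_sub_assoc]

/-- The leading coefficient of this pairing is bilinear in the two copies of `g`: up to sign it is
`leadFun` at `g * g`, the graded polynomial, and therefore `0`. -/
theorem CycForm.twistSum_coeff_self (C : CycForm B Γ W F f h m 1) (hk0 : 0 < k)
    (hN : 2 * h = m * k) (hk : Even k) (hgq : g.natDegree ≤ q)
    (hg : grPoly (balanced (2 * h) m) k f = g * g) (i c i' c' z : ℤ) (hc : c + c' = k * z) :
    (B (twistSum W k g q i c) (twistSum W k g q i' c')).coeff (z - 1) = 0 := by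
  conv in (twistSum W k g q i' c') => rw [twistSum]
  simp only [map_sum, map_smul, smul_eq_mul, HahnSeries.coeff_sum, coeff_C_mul_laurent,
    C.twistSum_coeff hk _ _ _ _ z hc]
  have h0 := C.leadFun_gr hk0 hN (i + i' + z)
  rw [← grPoly_balanced C.m_pos, ← hN, hg] at h0
  have hsum : g = ∑ r ∈ Finset.range (q + 1), Polynomial.C (g.coeff r) * Polynomial.X ^ r :=
    Polynomial.as_sum_range_C_mul_X_pow' g (by omega)
  have h1 : g * g = ∑ s ∈ Finset.range (q + 1), ∑ r ∈ Finset.range (q + 1),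
      Polynomial.C (g.coeff s * g.coeff r) * Polynomial.X ^ (s + r) := by
    conv_lhs => rw [hsum, Finset.sum_mul_sum]
    refine Finset.sum_congr rfl fun s _ => Finset.sum_congr rfl fun r _ => ?_
    rw [Polynomial.C_mul, pow_add]
    ring
  rw [h1] at h0
  simp only [map_sum, leadFun_C_mul_X_pow] at h0
  have h2 : ∑ s ∈ Finset.range (q + 1), g.coeff s * ((sgn c').coeff 0 *
      ∑ r ∈ Finset.range (q + 1), g.coeff r *
        (F (k * (i + (i' + s) + z + r))).coeff (i + (i' + s) + z + r)) =
      (sgn c').coeff 0 * ∑ s ∈ Finset.range (q + 1), ∑ r ∈ Finset.range (q + 1),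
        g.coeff s * g.coeff r * (F (k * (i + i' + z + (s + r : ℕ)))).coeff (i + i' + z + (s + r : ℕ)) := by
    rw [Finset.mul_sum]
    refine Finset.sum_congr rfl fun s _ => ?_
    rw [Finset.mul_sum, Finset.mul_sum, Finset.mul_sum]
    refine Finset.sum_congr rfl fun r _ => ?_
    rw [show i + (i' + (s : ℤ)) + z + r = i + i' + z + (s + r : ℕ) by push_cast; ring]
    ring
  rw [h2, h0, mul_zero]

/-- The chain system attached to a square root `g` of the graded polynomial. -/
def squareSys (W : ℤ → V) (k m : ℕ) (g : ℂ[X]) (q : ℕ) : ChainSys V (Fin q ⊕ Fin q) where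
  X := Sum.elim (fun i => twistSum W k g q i 0) (fun j => twist W k (j - m) 1)
  d _ := k
  ν _ := 1 / k
  α := Sum.elim (fun _ => -(1 / 2)) (fun _ => -(1 / 2) + 1 / k)
  σ := Sum.elim (fun i => .inr i.rev) (fun j => .inl j.rev)
  T := Sum.elim (fun i _ => q - i) (fun j _ => -(j + 1))

theorem sgn_coeff_ne (c : ℤ) : (sgn c).coeff 0 ≠ 0 := (ordEq_sgn c).2

/-- The chains built from `g` start at level `-1/2` and are isotropic to leading order; the monomial
chains that start one step later are dual to them. At level sum `0` the pairing of the chains `i`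
and `j` is, up to sign, `∑ g_r F(k n)` in leading coefficients, with `n = i + j + 1 - m + r`. If `i
+ j + 1 ≤ q`, the gap kills every term with `n < 0`, and `n = 0` requires `r = q` and `i + j + 1 =
q`; what remains is the leading coefficient of `g`. The weights restrict the ties to `i + j + 1 ≤
q`. -/
theorem CycForm.squareSys_isGood (C : CycForm B Γ W F f h m 1) (hBs : ∀ x y, B x y = B y x)
    (hk0 : 0 < k)
    (hN : 2 * h = m * k) (hk : Even k) (hm : m = 2 * q) (hgq : g.natDegree = q) (hg0 : g ≠ 0)
    (hg : grPoly (balanced (2 * h) m) k f = g * g) :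
    (squareSys W k m g q).IsGood B Γ ∧ (squareSys W k m g q).StartOK B fun _ _ => False := by
  have hk' : (0 : ℚ) < k := by exact_mod_cast hk0
  have h1k : (0 : ℚ) < 1 / k := by positivity
  have hkk : (k : ℚ) * (1 / k) = 1 := by field_simp
  have hq : 0 < q := by have := C.m_pos; omega
  have hgc : g.coeff q ≠ 0 := by rw [← hgq]; exact Polynomial.leadingCoeff_ne_zero.2 hg0
  have hF0 : (F (k * 0)).coeff 0 = 1 := by rw [mul_zero, C.F_zero]; simp
  have hFz (n : ℤ) (h1 : -(m : ℤ) < n) (h2 : n < 0) : (F (k * n)).coeff n = 0 := by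
    have h3 : 2 * (h : ℤ) = m * k := by exact_mod_cast hN
    have h4 : (0 : ℤ) < k := by exact_mod_cast hk0
    rw [C.F_eq_zero _ (by nlinarith) (by nlinarith)]
    simp
  have hself (i c i' c' z : ℤ) (hc : c + c' = k * z) :=
    C.twistSum_coeff_self hk0 hN hk hgq.le hg i c i' c' z hc
  have hXx (i : Fin q) (a : ℕ) : (Γ ^ a) ((squareSys W k m g q).X (.inl i)) =
      twistSum W k g q i (0 + a) := C.pow_twistSum _ _ _
  have hXy (j : Fin q) (a : ℕ) : (Γ ^ a) ((squareSys W k m g q).X (.inr j)) =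
      twist W k (j - m) (1 + a) := C.pow_twist _ _ _
  have hax (i : Fin q) (a : ℕ) : (squareSys W k m g q).al (.inl i) a = -(1 / 2) + a * (1 / k) := rfl
  have hay (j : Fin q) (a : ℕ) : (squareSys W k m g q).al (.inr j) a =
      -(1 / 2) + 1 / k + a * (1 / k) := rfl
  have hxy (i j : Fin q) (a b : ℕ) (hab : a + b + 1 = k) (hT : (i : ℕ) + j + 1 < q) :
      (B (twistSum W k g q i (0 + a)) (twist W k (j - m) (1 + b))).coeff 0 = 0 := by
    have h0 : (0 : ℤ) + a + (1 + b) = k * 1 := by omega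
    have h1 := C.twistSum_coeff (g := g) (q := q) hk i (0 + a) (j - m) (1 + b) 1 h0
    rw [sub_self] at h1
    rw [h1, Finset.sum_eq_zero,
      mul_zero]
    intro r hr
    have := Finset.mem_range.1 hr
    rw [hFz _ (by omega) (by omega), mul_zero]
  have hxyd (i j : Fin q) (a b : ℕ) (hab : a + b + 1 = k) (hT : (i : ℕ) + j + 1 = q) :
      (B (twistSum W k g q i (0 + a)) (twist W k (j - m) (1 + b))).coeff 0 ≠ 0 := by
    have h0 : (0 : ℤ) + a + (1 + b) = k * 1 := by omega
    have h1 := C.twistSum_coeff (g := g) (q := q) hk i (0 + a) (j - m) (1 + b) 1 h0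
    rw [sub_self] at h1
    rw [h1, Finset.sum_eq_single q]
    · rw [show (i : ℤ) + (j - m) + 1 + q = 0 by omega, hF0, mul_one]
      exact mul_ne_zero (sgn_coeff_ne _) hgc
    · intro r hr hrq
      have := Finset.mem_range.1 hr
      rw [hFz _ (by omega) (by omega), mul_zero]
    · intro h1
      exact absurd (Finset.mem_range.2 (by omega)) h1
  have eq_of {a : ℤ} (ha : -1 + (a : ℚ) * (1 / k) = 0) : a = k * 1 := by
    have : (a : ℚ) = k := by field_simp at ha; linarith
    rw [mul_one]
    exact_mod_cast this
  constructor
  · refine ⟨fun _ => hk0, fun _ => h1k, ?_, fun _ => rfl, fun _ => rfl, ?_, ?_, ?_, ?_, ?_, ?_, ?_, ?_⟩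
    · rintro (i | j) <;> simp [squareSys]
    · rintro (i | j)
      · change -(1 / 2) + 1 / (k : ℚ) = -(-(1 / 2) + (k - 1) * (1 / k))
        linear_combination hkk
      · change -(1 / 2) = -(-(1 / 2) + 1 / (k : ℚ) + (k - 1) * (1 / k))
        linear_combination hkk
    · rintro (i | j) a b _
      · change -((i.rev : ℕ) + 1 : ℤ) = -(q - i)
        rw [Fin.val_rev]; omega
      · change (q : ℤ) - (j.rev : ℕ) = - -(j + 1)
        rw [Fin.val_rev]; omega
    · rintro (i | j)
      · exact le_rfl
      · change -(1 / 2) ≤ -(1 / 2) + 1 / (k : ℚ)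
        linarith
    · rintro (i | j)
      · rw [hax]
        change 1 / 2 ≤ -(1 / 2) + (k : ℚ) * (1 / k)
        linarith
      · rw [hay]
        change 1 / 2 ≤ -(1 / 2) + 1 / k + (k : ℚ) * (1 / k)
        linarith
    · rintro (i | j) (i' | j') a b _ _
      · rw [hXx, hXx, hax, hax]
        refine (C.twistSum_ge_self hk0 hN hk _ _ _ _).mono (le_of_eq ?_)
        push_cast; ring
      · rw [hXx, hXy, hax, hay]
        refine (C.twistSum_ge hk0 hN hk _ _ _ _).mono (le_of_eq ?_)
        push_cast; ring
      · rw [hBs, hXy, hXx, hax, hay]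
        refine (C.twistSum_ge hk0 hN hk _ _ _ _).mono (le_of_eq ?_)
        push_cast; ring
      · rw [hXy, hXy, hay, hay]
        refine (C.twist_ge hk0 hN hk _ _ _ _).mono (le_of_eq ?_)
        push_cast; ring
    · rintro (i | j) (i' | j') h1 h2
      · change OrdGE (B ((Γ ^ k) _) ((Γ ^ 0) ((squareSys W k m g q).X (.inl i')))) 1
        rw [hXx, hXx, ordGE_one_iff]
        · exact hself i (0 + k) i' (0 + (0 : ℕ)) 1 (by push_cast; ring)
        · refine (C.twistSum_ge_self hk0 hN hk _ _ _ _).mono (le_of_eq ?_)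
          push_cast; linarith
      · change -(1 / 2) + 1 / (k : ℚ) = -(1 / 2) at h2
        linarith
      · rw [hay] at h1
        change -(1 / 2) + 1 / k + (k : ℚ) * (1 / k) = 1 / 2 at h1
        linarith
      · change -(1 / 2) + 1 / (k : ℚ) = -(1 / 2) at h2
        linarith
    · rintro (i | j)
      · change (B ((Γ ^ (k - 1)) _) ((Γ ^ 0) ((squareSys W k m g q).X (.inr i.rev)))).coeff 0 ≠ 0
        rw [hXx, hXy]
        exact hxyd _ _ _ _ (by omega) (by rw [Fin.val_rev]; omega)
      · change (B ((Γ ^ (k - 1)) _) ((Γ ^ 0) ((squareSys W k m g q).X (.inl j.rev)))).coeff 0 ≠ 0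
        rw [hBs, hXx, hXy]
        exact hxyd _ _ _ _ (by omega) (by rw [Fin.val_rev]; omega)
    · rintro (i | j) (i' | j') a b ha hb h0 hT hne
      · rw [hax, hax] at h0
        rw [hXx, hXx]
        exact hself i (0 + a) i' (0 + b) 1 (eq_of (by push_cast; linarith))
      · rw [hax, hay] at h0
        have h2 := eq_of (a := a + b + 1) (by push_cast; linarith)
        rw [hXx, hXy]
        change (0 : ℤ) ≤ q - i + -(j' + 1) at hT
        refine hxy _ _ _ _ (by omega) (lt_of_le_of_ne (by omega) fun h3 => hne ⟨?_, ?_⟩)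
        · change Sum.inr j' = Sum.inr i.rev
          congr 1
          ext
          rw [Fin.val_rev]; omega
        · change a + b + 1 = k
          omega
      · rw [hax, hay] at h0
        have h2 := eq_of (a := a + b + 1) (by push_cast; linarith)
        rw [hBs, hXx, hXy]
        change (0 : ℤ) ≤ -(j + 1) + (q - i') at hT
        refine hxy _ _ _ _ (by omega) (lt_of_le_of_ne (by omega) fun h3 => hne ⟨?_, ?_⟩)
        · change Sum.inl i' = Sum.inl j.rev
          congr 1
          ext
          rw [Fin.val_rev]; omega
        · change a + b + 1 = k
          omega
      · change (0 : ℤ) ≤ -(j + 1) + -(j' + 1) at hT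
        omega
  · rintro (i | j) (i' | j') h1 h2 _
    · have h3 : OrdGE (B (twistSum W k g q i 0) (twistSum W k g q i' 0)) ((-1 : ℤ) : ℚ) := by
        refine (C.twistSum_ge_self hk0 hN hk _ _ _ _).mono (le_of_eq ?_)
        push_cast; ring
      have h4 := h3.succ (hself i 0 i' 0 0 (by ring))
      refine OrdGE.mono h4 (le_of_eq ?_)
      norm_num
    · change -(1 / 2) + 1 / (k : ℚ) = -(1 / 2) at h2
      linarith
    · change -(1 / 2) + 1 / (k : ℚ) = -(1 / 2) at h1
      linarith
    · change -(1 / 2) + 1 / (k : ℚ) = -(1 / 2) at h2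
      linarith

/-- The piece of a factor whose graded polynomial is a square. -/
theorem CycForm.squarePiece (C : CycForm B Γ W F f h m 1) (hBs : ∀ x y, B x y = B y x)
    (hl : 2 * h % m = 0) (hk : Even (2 * h / m)) (hm : 2 ∣ m)
    (hg : IsSquare (grPoly (balanced (2 * h) m) (2 * h / m) f)) {U : Submodule ℂ⸨X⸩ V}
    (hU : ∀ b, W b ∈ U) (ν : ℚ) :
    Piece B Γ false false U ν ((balanced (2 * h) m).filter (0 < ·)) := by
  have hh := C.h_pos
  have hm0 := C.m_pos
  have hk0 : 0 < 2 * h / m := Nat.div_pos (Nat.le_of_dvd (by omega) (Nat.dvd_of_mod_eq_zero hl)) hm0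
  have hN : 2 * h = m * (2 * h / m) := (Nat.mul_div_cancel' (Nat.dvd_of_mod_eq_zero hl)).symm
  obtain ⟨q, hq⟩ := hm
  obtain ⟨g, hg⟩ := hg
  generalize hkk : 2 * h / m = k at *
  have hgr := grPoly_balanced (k := k) hm0 f
  rw [← hN, hg] at hgr
  -- The graded polynomial is monic of degree `m`, which forces its square root to have degree `m /
  -- 2`.
  have hcoef : (g * g).coeff m = 1 := by
    rw [hgr, Polynomial.finsetSum_coeff, Finset.sum_eq_single 0]
    · simp [C.top]
    · intro α hα hα0
      have := Finset.mem_range.1 hα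
      rw [Polynomial.coeff_C_mul_X_pow, if_neg (by omega)]
    · simp
  have hdeg : (g * g).natDegree ≤ m := by
    rw [hgr]
    refine Polynomial.natDegree_sum_le_of_forall_le _ _ fun α _ => ?_
    exact (Polynomial.natDegree_C_mul_X_pow_le _ _).trans (Nat.sub_le _ _)
  have hg0 : g ≠ 0 := by
    rintro rfl
    simp at hcoef
  have hgq : g.natDegree = q := by
    have h1 : m ≤ (g * g).natDegree := Polynomial.le_natDegree_of_ne_zero (by rw [hcoef]; simp)
    rw [Polynomial.natDegree_mul hg0 hg0] at h1 hdeg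
    omega
  obtain ⟨hgood, hstart⟩ := C.squareSys_isGood hBs hk0 hN hk hq hgq hg0 hg
  have htw (i c) : twist W k i c ∈ U := Submodule.smul_mem _ _ (hU _)
  refine ⟨_, inferInstance, squareSys W k m g q, 0, fun _ => 0, hgood, ?_, zero_mem _,
    fun _ => zero_mem _, ?_, by simp, fun _ => hstart, by simp, by simp⟩
  · rintro (i | j)
    · change twistSum W k g q i 0 ∈ U
      exact Submodule.sum_mem _ fun r _ => Submodule.smul_mem _ _ (htw _ _)
    · exact htw _ _
  · have h1 : balanced (2 * h) m = Multiset.replicate m k := by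
      rw [balanced, hl, hkk]
      simp
    rw [h1, Multiset.filter_eq_self.2]
    · change Multiset.map (fun _ => k) _ = _
      rw [Multiset.map_const', Finset.card_val, Finset.card_univ, Fintype.card_sum, Fintype.card_fin,
        hq, two_mul]
    · intro a ha
      rw [Multiset.eq_of_mem_replicate ha]
      exact hk0

end

/-! ### Vectors in the kernel -/

section

variable {V : Type} [AddCommGroup V] [Module ℂ⸨X⸩ V] {B : LinearMap.BilinForm ℂ⸨X⸩ V}
  {Γ : Module.End ℂ⸨X⸩ V} {J : Type}

/-- Chains of length one. -/
def trivialSys (X : J → V) (ν : ℚ) : ChainSys V J := ⟨X, fun _ => 1, fun _ => ν, 0, id, 0⟩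

theorem trivialSys_al (X : J → V) (ν : ℚ) (j : J) (a : ℕ) : (trivialSys X ν).al j a = a * ν := by
  simp [ChainSys.al, trivialSys]

/-- Vectors killed by `Γ` may be given any slope; a slope above `1/2` puts the ends of the chains,
of level `ν`, strictly above `1/2`, and no tie occurs there. -/
theorem trivialSys_isGood {X : J → V} {ν : ℚ} (hν : 1 / 2 < ν) (hΓ : ∀ j, Γ (X j) = 0)
    (h1 : ∀ j, OrdEq (B (X j) (X j)) 0) (h0 : ∀ j k, j ≠ k → B (X j) (X k) = 0) :
    (trivialSys X ν).IsGood B Γ where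
  d_pos _ := one_pos
  ν_pos _ := by change 0 < ν; linarith
  σσ _ := rfl
  d_σ _ := rfl
  ν_σ _ := rfl
  α_σ _ := by simp [trivialSys]
  T_σ _ _ _ _ := rfl
  α_ge _ := by simp [trivialSys]
  end_ge j := by
    rw [trivialSys_al]
    simp only [trivialSys, Nat.cast_one, one_mul]
    linarith
  ord j k a b ha hb := by
    change a ≤ 1 at ha
    change b ≤ 1 at hb
    change OrdGE (B ((Γ ^ a) (X j)) ((Γ ^ b) (X k))) _
    interval_cases a <;> interval_cases b
    · by_cases h : j = k
      · rw [← h, trivialSys_al]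
        simpa using (h1 j).1
      · simp [h0 j k h, OrdGE.zero]
    all_goals simp [hΓ, OrdGE.zero]
  end_tie j k _ _ := by
    change OrdGE (B ((Γ ^ 1) (X j)) (X k)) 1
    simp [hΓ, OrdGE.zero]
  dual j := (h1 j).2
  tie j k a b ha hb _ _ hne := by
    change a < 1 at ha
    change b < 1 at hb
    obtain rfl : a = 0 := by omega
    obtain rfl : b = 0 := by omega
    change (B (X j) (X k)).coeff 0 = 0
    rw [h0 j k fun h => hne ⟨h.symm, rfl⟩]
    rfl

theorem trivialSys_startOK (X : J → V) (ν : ℚ) (E) : (trivialSys X ν).StartOK B E := by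
  intro j k hj
  change (0 : ℚ) = -(1 / 2) at hj
  norm_num at hj

theorem kernelPiece_closed {U : Submodule ℂ⸨X⸩ V} {v w : V} (hv : v ∈ U) (hw : w ∈ U)
    (hΓv : Γ v = 0) (hΓw : Γ w = 0) (hvv : OrdEq (B v v) 0) (hww : OrdEq (B w w) 0)
    (hvw : B v w = 0) (hwv : B w v = 0) {ν : ℚ} (hν : 1 / 2 < ν) :
    Piece B Γ false false U ν (Multiset.replicate 2 1) := by
  refine ⟨Bool, inferInstance, trivialSys (fun b => cond b v w) ν, 0, fun _ => 0,
    trivialSys_isGood hν ?_ ?_ ?_, ?_, zero_mem _, fun _ => zero_mem _, rfl, by simp,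
    fun _ => trivialSys_startOK _ _ _, by simp, by simp⟩
  · rintro (_ | _) <;> assumption
  · rintro (_ | _) <;> assumption
  · rintro (_ | _) (_ | _) h <;> first | exact absurd rfl h | assumption
  · rintro (_ | _) <;> assumption

/-- The vector `w`, whose norm has order `-1`, is spent as a plug, and only `v` remains as a chain.
-/
theorem kernelPiece_plug {U : Submodule ℂ⸨X⸩ V} {v w : V} (hv : v ∈ U) (hw : w ∈ U)
    (hΓv : Γ v = 0) (hΓw : Γ w = 0) (hvv : OrdEq (B v v) 0) (hww : OrdEq (B w w) (-1))
    (hwv : B w v = 0) {ν : ℚ} (hν : 1 / 2 < ν) :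
    Piece B Γ true false U ν (Multiset.replicate 1 1) := by
  have hpow (x : V) (hx : Γ x = 0) (a : ℕ) (ha : a ≠ 0) : (Γ ^ a) x = 0 := by
    obtain ⟨b, rfl⟩ := Nat.exists_eq_succ_of_ne_zero ha
    rw [pow_succ, Module.End.mul_apply, hx, map_zero]
  refine ⟨Unit, inferInstance, trivialSys (fun _ => v) ν, w, fun _ => 0,
    trivialSys_isGood hν (fun _ => hΓv) (fun _ => hvv) (fun _ _ h => absurd rfl h), fun _ => hv, hw,
    fun _ => zero_mem _, rfl, fun _ => ⟨fun _ => rfl, ?_, hww.2, ?_, ?_, ?_, ?_⟩,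
    fun _ => trivialSys_startOK _ _ _, by simp, by simp⟩
  · intro a b
    rcases eq_or_ne a 0 with rfl | ha
    · rcases eq_or_ne b 0 with rfl | hb
      · simpa using hww.1
      · simp [hpow w hΓw b hb, OrdGE.zero]
    · simp [hpow w hΓw a ha, OrdGE.zero]
  · intro a j b hb
    change OrdGE (B ((Γ ^ a) w) ((Γ ^ b) v)) _
    rcases eq_or_ne a 0 with rfl | ha
    · rcases eq_or_ne b 0 with rfl | hb
      · simp [hwv, OrdGE.zero]
      · simp [hpow v hΓv b hb, OrdGE.zero]
    · simp [hpow w hΓw a ha, OrdGE.zero]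
  · intro j hj
    change (0 : ℚ) = -(1 / 2) at hj
    norm_num at hj
  · intro j hj
    rw [trivialSys_al] at hj
    change ((1 : ℕ) : ℚ) * ν = 1 / 2 at hj
    push_cast at hj
    linarith
  · intro j b hb hj
    change b < 1 at hb
    obtain rfl : b = 0 := by omega
    rw [trivialSys_al] at hj
    norm_num at hj

end

/-! ### Squares in finite extensions of the field of Laurent series -/

/-- Weierstrass division identifies `A[X]/(D)` with `A⟦X⟧/(D)`. -/
theorem _root_.Polynomial.IsDistinguishedAt.dvd_of_coe_dvd {A : Type*} [CommRing A] {I : Ideal A}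
    [IsAdicComplete I A] {D q : A[X]} (hD : D.IsDistinguishedAt I)
    (h : (D : A⟦X⟧) ∣ (q : A⟦X⟧)) : D ∣ q := by
  have h1 : hD.algEquivQuotient (Ideal.Quotient.mk _ q) = 0 := by
    change Ideal.Quotient.mk _ (q : A⟦X⟧) = 0
    rwa [Ideal.Quotient.eq_zero_iff_mem, Ideal.mem_span_singleton]
  have h2 := (map_eq_zero_iff _ hD.algEquivQuotient.injective).1 h1
  rwa [Ideal.Quotient.eq_zero_iff_mem, Ideal.mem_span_singleton] at h2

theorem _root_.Polynomial.IsDistinguishedAt.exists_coe_dvd_sub {A : Type*} [CommRing A]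
    {I : Ideal A} [IsAdicComplete I A] {D : A[X]} (hD : D.IsDistinguishedAt I) (s : A⟦X⟧) :
    ∃ σ : A[X], (D : A⟦X⟧) ∣ (σ : A⟦X⟧) - s := by
  obtain ⟨z, hz⟩ := hD.algEquivQuotient.surjective (Ideal.Quotient.mk _ s)
  obtain ⟨σ, rfl⟩ := Ideal.Quotient.mk_surjective z
  refine ⟨σ, ?_⟩
  rw [← Ideal.mem_span_singleton, ← Ideal.Quotient.eq, ← hz]
  rfl

theorem exists_distinguished_dvd {q : ℂ⟦X⟧[X]} {i : ℕ} (hi : IsUnit (q.coeff i))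
    (h0 : ¬ IsUnit (q.coeff 0)) :
    ∃ D : ℂ⟦X⟧[X], D.IsDistinguishedAt (IsLocalRing.maximalIdeal ℂ⟦X⟧) ∧ D ∣ q ∧
      1 ≤ D.natDegree := by
  have hne : PowerSeries.map (IsLocalRing.residue ℂ⟦X⟧) (q : ℂ⟦X⟧⟦X⟧) ≠ 0 := by
    intro h
    have h1 := congrArg (PowerSeries.coeff i) h
    rw [PowerSeries.coeff_map, Polynomial.coeff_coe, map_zero,
      IsLocalRing.residue_eq_zero_iff] at h1
    exact (IsLocalRing.mem_maximalIdeal _).1 h1 hi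
  obtain ⟨D, h, H⟩ := PowerSeries.exists_isWeierstrassFactorization hne
  have hD := H.isDistinguishedAt
  refine ⟨D, hD, ?_, ?_⟩
  · exact hD.dvd_of_coe_dvd ⟨h, H.eq_mul⟩
  · by_contra hlt
    have hD1 : D = 1 := Polynomial.eq_one_of_monic_natDegree_zero hD.monic (by omega)
    have h3 := H.eq_mul
    rw [hD1, Polynomial.coe_one, one_mul] at h3
    have h4 := H.isUnit
    rw [← h3] at h4
    have h5 := h4.map (PowerSeries.constantCoeff (R := ℂ⟦X⟧))
    rw [Polynomial.constantCoeff_coe] at h5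
    exact h0 h5

theorem exists_lift_of_ordGE {p : ℂ⸨X⸩[X]} (h : ∀ i, OrdGE (p.coeff i) 0) :
    ∃ P : ℂ⟦X⟧[X], P.map (algebraMap ℂ⟦X⟧ ℂ⸨X⸩) = p := by
  have h1 : p ∈ Polynomial.lifts (algebraMap ℂ⟦X⟧ ℂ⸨X⸩) := by
    rw [Polynomial.lifts_iff_coeff_lifts]
    intro i
    obtain ⟨y, hy⟩ := ordGE_zero_iff.1 (h i)
    exact ⟨y, hy⟩
  exact (Polynomial.mem_lifts _).1 h1

/-- Otherwise multiply by the power `t^a`, `a > 0`, that makes the polynomial integral and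
primitive. Some coefficient is then a unit, but the constant term is not, so Weierstrass preparation
yields a distinguished factor of positive degree; by irreducibility its degree is that of `p`. But
the top coefficient `t^a` vanishes modulo `t`, so the reduction has too small a degree to be
divisible by that of the factor. -/
theorem ordGE_coeff_of_irreducible {p : ℂ⸨X⸩[X]} (hp : p.Monic) (hirr : Irreducible p)
    (h0 : OrdGE (p.coeff 0) 0) (i : ℕ) : OrdGE (p.coeff i) 0 := by
  classical
  have hex : ∃ a : ℕ, ∀ i, OrdGE (p.coeff i) (-(a : ℚ)) := by
    have h1 : ∀ i, ∃ a : ℕ, OrdGE (p.coeff i) (-(a : ℚ)) := by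
      intro i
      by_cases hz : p.coeff i = 0
      · exact ⟨0, by rw [hz]; exact OrdGE.zero _⟩
      · refine ⟨((p.coeff i).order).natAbs, (ordEq_order hz).1.mono ?_⟩
        have : -(((p.coeff i).order).natAbs : ℤ) ≤ (p.coeff i).order := by omega
        exact_mod_cast this
    choose a ha using h1
    refine ⟨∑ i ∈ Finset.range (p.natDegree + 1), a i, fun i => ?_⟩
    by_cases hi : i < p.natDegree + 1
    · refine (ha i).mono ?_
      have : a i ≤ ∑ i ∈ Finset.range (p.natDegree + 1), a i :=
        Finset.single_le_sum (f := a) (fun _ _ => Nat.zero_le _) (Finset.mem_range.2 hi)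
      have : (a i : ℚ) ≤ (∑ i ∈ Finset.range (p.natDegree + 1), a i : ℕ) := by exact_mod_cast this
      linarith
    · rw [Polynomial.coeff_eq_zero_of_natDegree_lt (by omega)]
      exact OrdGE.zero _
  obtain ⟨a, ha⟩ : ∃ a, a = Nat.find hex := ⟨_, rfl⟩
  have hspec : ∀ i, OrdGE (p.coeff i) (-(a : ℚ)) := ha ▸ Nat.find_spec hex
  rcases Nat.eq_zero_or_pos a with ha0 | hapos
  · simpa [ha0] using hspec i
  exfalso
  obtain ⟨j, hj⟩ : ∃ j, (p.coeff j).coeff (-(a : ℤ)) ≠ 0 := by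
    by_contra hcon
    push Not at hcon
    refine Nat.find_min hex (m := a - 1) (by omega) fun i => ?_
    have h1 : OrdGE (p.coeff i) ((-(a : ℤ) : ℤ) : ℚ) := by simpa using hspec i
    refine (h1.succ (hcon i)).mono ?_
    rw [Nat.cast_sub hapos]
    push_cast
    linarith
  obtain ⟨q, hq⟩ := exists_lift_of_ordGE (p := Polynomial.C (tp a) * p) (fun i => by
    rw [Polynomial.coeff_C_mul]
    simpa using (hspec i).tp_mul a)
  have hqc : ∀ i, algebraMap ℂ⟦X⟧ ℂ⸨X⸩ (q.coeff i) = tp a * p.coeff i := fun i => by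
    rw [← Polynomial.coeff_map, hq, Polynomial.coeff_C_mul]
  have hqu : ∀ i, IsUnit (q.coeff i) ↔ (p.coeff i).coeff (-(a : ℤ)) ≠ 0 := fun i => by
    rw [PowerSeries.isUnit_iff_constantCoeff, isUnit_iff_ne_zero,
      ← coeff_zero_algebraMap, hqc, coeff_tp_mul, zero_sub]
  have hq0 : ¬ IsUnit (q.coeff 0) := by
    rw [hqu, not_not]
    exact h0 _ (by push_cast; simpa using hapos)
  obtain ⟨D, hD, ⟨g, hg⟩, hD1⟩ := exists_distinguished_dvd ((hqu j).2 hj) hq0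
  have hDm := hD.monic.map (algebraMap ℂ⟦X⟧ ℂ⸨X⸩)
  have hDdeg : (D.map (algebraMap ℂ⟦X⟧ ℂ⸨X⸩)).natDegree = D.natDegree :=
    hD.monic.natDegree_map _
  have hdvd : D.map (algebraMap ℂ⟦X⟧ ℂ⸨X⸩) ∣ p := by
    have h1 : D.map (algebraMap ℂ⟦X⟧ ℂ⸨X⸩) ∣ Polynomial.C (tp a) * p := by
      rw [← hq, hg, Polynomial.map_mul]
      exact dvd_mul_right _ _
    have h2 := dvd_mul_of_dvd_right h1 (Polynomial.C (tp (-a)))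
    rwa [← mul_assoc, ← Polynomial.C_mul, ← tp_add, neg_add_cancel, tp_zero, Polynomial.C_1,
      one_mul] at h2
  have hassoc : D.map (algebraMap ℂ⟦X⟧ ℂ⸨X⸩) = p := by
    rcases hirr.dvd_iff.1 hdvd with h | h
    · have := Polynomial.natDegree_eq_zero_of_isUnit h
      omega
    · exact (Polynomial.eq_of_monic_of_associated hp hDm h).symm
  have hdeg : D.natDegree = p.natDegree := by rw [← hDdeg, hassoc]
  have h1 : (q.map (PowerSeries.constantCoeff (R := ℂ))).natDegree < p.natDegree := by
    have hle : (q.map (PowerSeries.constantCoeff (R := ℂ))).natDegree ≤ p.natDegree := by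
      refine Polynomial.natDegree_le_iff_coeff_eq_zero.2 fun N hN => ?_
      rw [Polynomial.coeff_map]
      have h2 := hqc N
      rw [Polynomial.coeff_eq_zero_of_natDegree_lt hN, mul_zero,
        map_eq_zero_iff _ algebraMap_injective] at h2
      rw [h2, map_zero]
    have hp1 : 1 ≤ p.natDegree := hdeg ▸ hD1
    refine lt_of_le_of_ne hle fun heq => ?_
    have h2 : (q.map (PowerSeries.constantCoeff (R := ℂ))).coeff p.natDegree = 0 := by
      rw [Polynomial.coeff_map]
      have h3 := (hqu p.natDegree).not
      rw [PowerSeries.isUnit_iff_constantCoeff, isUnit_iff_ne_zero, not_not, not_not] at h3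
      rw [h3, Polynomial.coeff_natDegree, hp.leadingCoeff]
      simp
      omega
    rw [← heq, Polynomial.coeff_natDegree, Polynomial.leadingCoeff_eq_zero] at h2
    rw [h2] at heq
    simp at heq
    omega
  have hqne : q.map (PowerSeries.constantCoeff (R := ℂ)) ≠ 0 := by
    intro h2
    have h3 := congrArg (fun r => Polynomial.coeff r j) h2
    simp only [Polynomial.coeff_map, Polynomial.coeff_zero] at h3
    have h4 := (hqu j).2 hj
    rw [PowerSeries.isUnit_iff_constantCoeff, isUnit_iff_ne_zero] at h4
    exact h4 h3
  have h2 : (D.map (PowerSeries.constantCoeff (R := ℂ))).natDegree ≤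
      (q.map (PowerSeries.constantCoeff (R := ℂ))).natDegree := by
    refine Polynomial.natDegree_le_of_dvd ?_ hqne
    rw [hg, Polynomial.map_mul]
    exact dvd_mul_right _ _
  rw [hD.monic.natDegree_map] at h2
  omega

theorem isDistinguishedAt_of_irreducible {Q : ℂ⟦X⟧[X]} (hQ : Q.Monic)
    (hirr : Irreducible (Q.map (algebraMap ℂ⟦X⟧ ℂ⸨X⸩))) (h0 : ¬ IsUnit (Q.coeff 0)) :
    Q.IsDistinguishedAt (IsLocalRing.maximalIdeal ℂ⟦X⟧) := by
  obtain ⟨D, hD, ⟨g, hg⟩, hD1⟩ := exists_distinguished_dvd (q := Q) (i := Q.natDegree)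
    (by rw [Polynomial.coeff_natDegree, hQ.leadingCoeff]; exact isUnit_one) h0
  have hdvd : D.map (algebraMap ℂ⟦X⟧ ℂ⸨X⸩) ∣ Q.map (algebraMap ℂ⟦X⟧ ℂ⸨X⸩) := by
    rw [hg, Polynomial.map_mul]
    exact dvd_mul_right _ _
  rcases hirr.dvd_iff.1 hdvd with h | h
  · have := Polynomial.natDegree_eq_zero_of_isUnit h
    rw [hD.monic.natDegree_map] at this
    omega
  · have h1 := Polynomial.eq_of_monic_of_associated (hQ.map _) (hD.monic.map _) h
    have h2 : Q = D := Polynomial.map_injective _ algebraMap_injective h1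
    rw [h2]
    exact hD

/-- `c + X` has a square root in `ℂ⟦X⟧`, and Weierstrass division replaces this series by a
polynomial modulo `Q`. In effect a power series is evaluated at a root of `Q`, without any topology
on the extension. -/
theorem exists_sq_dvd_of_isDistinguishedAt {Q : ℂ⟦X⟧[X]}
    (hQ : Q.IsDistinguishedAt (IsLocalRing.maximalIdeal ℂ⟦X⟧)) {c : ℂ} (hc : c ≠ 0) :
    ∃ σ : ℂ⟦X⟧[X], Q ∣ σ ^ 2 - (Polynomial.C (PowerSeries.C c) + Polynomial.X) := by
  obtain ⟨s, hs⟩ := exists_sq_eq_powerSeries (p := PowerSeries.C c + PowerSeries.X)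
    (by rw [PowerSeries.isUnit_iff_constantCoeff]; simpa using hc)
  have hs' : (PowerSeries.map (PowerSeries.C (R := ℂ)) s) ^ 2 =
      ((Polynomial.C (PowerSeries.C c) + Polynomial.X : ℂ⟦X⟧[X]) : ℂ⟦X⟧⟦X⟧) := by
    rw [← map_pow, hs]
    simp
  obtain ⟨σ, g, hg⟩ := hQ.exists_coe_dvd_sub (PowerSeries.map (PowerSeries.C (R := ℂ)) s)
  refine ⟨σ, hQ.dvd_of_coe_dvd ⟨g * (σ + PowerSeries.map (PowerSeries.C (R := ℂ)) s), ?_⟩⟩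
  rw [Polynomial.coe_sub, ← hs', Polynomial.coe_pow, ← mul_assoc, ← hg]
  ring

/-- The minimal polynomial of `x` is integral with a unit as constant term, and it has a non-zero
root `c` modulo `t`. Then `x - c` is a root of a distinguished polynomial, at which the series of
the square root of `c + X` can be evaluated. -/
theorem isSquare_of_ordEq_norm {L : Type} [Field L] [Algebra ℂ⸨X⸩ L]
    [FiniteDimensional ℂ⸨X⸩ L] {x : L} (hx : OrdEq (Algebra.norm ℂ⸨X⸩ x) 0) : IsSquare x := by
  have hint : IsIntegral ℂ⸨X⸩ x := Algebra.IsIntegral.isIntegral x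
  have hirr := minpoly.irreducible hint
  have hmon := minpoly.monic hint
  obtain ⟨r, hr, hnorm⟩ : ∃ r : ℕ, r ≠ 0 ∧ Algebra.norm ℂ⸨X⸩ x =
      ((-1) ^ (minpoly ℂ⸨X⸩ x).natDegree * (minpoly ℂ⸨X⸩ x).coeff 0) ^ r := by
    refine ⟨Module.finrank (IntermediateField.adjoin ℂ⸨X⸩ {x}) L, Module.finrank_pos.ne', ?_⟩
    rw [Algebra.norm_eq_norm_adjoin]
    congr 1
    have h1 := Algebra.PowerBasis.norm_gen_eq_coeff_zero_minpoly
      (IntermediateField.adjoin.powerBasis hint)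
    rw [IntermediateField.adjoin.powerBasis_gen] at h1
    rw [h1, IntermediateField.adjoin.powerBasis_dim, IntermediateField.minpoly_gen]
  have hm0 : minpoly ℂ⸨X⸩ x |>.coeff 0 |> fun z => z ≠ 0 := by
    intro h
    rw [h, mul_zero, zero_pow hr] at hnorm
    exact hx.ne_zero hnorm
  obtain ⟨k, hk⟩ := exists_ordEq hm0
  have hk0 : k = 0 := by
    have h1 : OrdEq ((-1 : ℂ⸨X⸩) ^ (minpoly ℂ⸨X⸩ x).natDegree) 0 := by
      rcases neg_one_pow_eq_or ℂ⸨X⸩ (minpoly ℂ⸨X⸩ x).natDegree with h | h <;> rw [h]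
      · exact ordEq_one
      · exact ordEq_one.neg
    have h2 := (h1.mul hk).pow r
    rw [← hnorm] at h2
    have h3 := h2.unique hx
    have : (r : ℤ) ≠ 0 := by exact_mod_cast hr
    rw [zero_add] at h3
    rcases mul_eq_zero.1 h3 with h4 | h4
    · exact absurd h4 this
    · exact h4
  rw [hk0] at hk
  obtain ⟨P, hP⟩ := exists_lift_of_ordGE (ordGE_coeff_of_irreducible hmon hirr
    (by simpa using hk.1))
  have hPm : P.Monic := by
    refine Polynomial.monic_of_injective algebraMap_injective ?_
    rw [hP]; exact hmon
  have hP0 : IsUnit (P.coeff 0) := by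
    rw [← ordEq_zero_algebraMap, ← Polynomial.coeff_map, hP]
    exact hk
  obtain ⟨c, hc⟩ : ∃ c : ℂ, (P.map (PowerSeries.constantCoeff (R := ℂ))).IsRoot c := by
    refine IsAlgClosed.exists_root _ ?_
    rw [hPm.degree_map]
    have := minpoly.degree_pos hint
    rw [← hP, hPm.degree_map] at this
    exact this.ne'
  have hroot : PowerSeries.constantCoeff (P.eval (PowerSeries.C c)) = 0 := by
    have h1 := hc.eq_zero
    rw [Polynomial.eval_map] at h1
    rw [← Polynomial.eval₂_id, Polynomial.hom_eval₂, RingHom.comp_id, PowerSeries.constantCoeff_C]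
    exact h1
  have hc0 : c ≠ 0 := by
    rintro rfl
    rw [map_zero, ← Polynomial.coeff_zero_eq_eval_zero] at hroot
    rw [PowerSeries.isUnit_iff_constantCoeff, hroot] at hP0
    exact not_isUnit_zero hP0
  obtain ⟨Q, hQ⟩ : ∃ Q, Q = P.comp (Polynomial.X + Polynomial.C (PowerSeries.C c)) := ⟨_, rfl⟩
  have hQm : Q.Monic := hQ ▸ hPm.comp_X_add_C _
  have hQirr : Irreducible (Q.map (algebraMap ℂ⟦X⟧ ℂ⸨X⸩)) := by
    have h1 : Q.map (algebraMap ℂ⟦X⟧ ℂ⸨X⸩) = Polynomial.algEquivAevalXAddC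
        (algebraMap ℂ⟦X⟧ ℂ⸨X⸩ (PowerSeries.C c)) (minpoly ℂ⸨X⸩ x) := by
      rw [hQ, Polynomial.map_comp, hP]
      simp [Polynomial.comp, Polynomial.aeval_def]
    rw [h1]
    exact (MulEquiv.irreducible_iff _).2 hirr
  have hQ0 : ¬ IsUnit (Q.coeff 0) := by
    rw [PowerSeries.isUnit_iff_constantCoeff, Polynomial.coeff_zero_eq_eval_zero, hQ,
      Polynomial.eval_comp]
    simp [hroot]
  obtain ⟨σ, g, hσ⟩ := exists_sq_dvd_of_isDistinguishedAt
    (isDistinguishedAt_of_irreducible hQm hQirr hQ0) hc0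
  obtain ⟨φ, hφ⟩ : ∃ φ : ℂ⟦X⟧ →+* L, φ = (algebraMap ℂ⸨X⸩ L).comp (algebraMap ℂ⟦X⟧ ℂ⸨X⸩) :=
    ⟨_, rfl⟩
  have hQx : Q.eval₂ φ (x - φ (PowerSeries.C c)) = 0 := by
    rw [hQ, Polynomial.eval₂_comp]
    simp only [Polynomial.eval₂_add, Polynomial.eval₂_X, Polynomial.eval₂_C, sub_add_cancel]
    have h1 := minpoly.aeval ℂ⸨X⸩ x
    rw [← hP, Polynomial.aeval_def, Polynomial.eval₂_map] at h1
    rw [hφ]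
    exact h1
  have h1 := congrArg (Polynomial.eval₂ φ (x - φ (PowerSeries.C c))) hσ
  rw [Polynomial.eval₂_mul, hQx, zero_mul] at h1
  simp only [Polynomial.eval₂_sub, Polynomial.eval₂_pow, Polynomial.eval₂_add,
    Polynomial.eval₂_C, Polynomial.eval₂_X, add_sub_cancel] at h1
  refine ⟨σ.eval₂ φ (x - φ (PowerSeries.C c)), ?_⟩
  rw [← sq]
  exact (sub_eq_zero.1 h1).symm

/-! ### Binary quadratic forms over finite extensions of the field of Laurent series -/

theorem isSquare_of_isSquare_zpow {L : Type*} [Field L] {x : L} (hx : x ≠ 0) {b : ℤ} (hb : Odd b)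
    {z : L} (h : IsSquare (x ^ b * (z * z))) (hz : z ≠ 0) : IsSquare x := by
  obtain ⟨s, hs⟩ := h
  obtain ⟨c, rfl⟩ := hb
  refine ⟨s * z⁻¹ * x ^ (-c), ?_⟩
  have h1 : x ^ (2 * c + 1) = s * s * z⁻¹ * z⁻¹ := by
    rw [← hs]; field_simp
  have h2 : x = x ^ (2 * c + 1) * (x ^ (-c) * x ^ (-c)) := by
    rw [← zpow_add₀ hx, ← zpow_add₀ hx]
    have : 2 * c + 1 + (-c + -c) = 1 := by ring
    rw [this, zpow_one]
  calc x = x ^ (2 * c + 1) * (x ^ (-c) * x ^ (-c)) := h2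
    _ = _ := by rw [h1]; ring

/-- Elements with norm of order `0` are squares. If `a` and `b` are the orders of the norms of `x`
and `y`, and `a'`, `b'` their quotients by the gcd, then `x^b' y^(-a')` is such an element. As `a'`
and `b'` are not both even, this makes `x`, `y` or `x y` a square. -/
theorem isSquare_mul_of_not_isSquare {L : Type} [Field L] [Algebra ℂ⸨X⸩ L]
    [FiniteDimensional ℂ⸨X⸩ L] {x y : L} (hx : ¬ IsSquare x) (hy : ¬ IsSquare y) :
    IsSquare (x * y) := by
  have hx0 : x ≠ 0 := by rintro rfl; exact hx IsSquare.zero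
  have hy0 : y ≠ 0 := by rintro rfl; exact hy IsSquare.zero
  obtain ⟨a, ha⟩ := exists_ordEq (Algebra.norm_ne_zero_iff.2 hx0 : Algebra.norm ℂ⸨X⸩ x ≠ 0)
  obtain ⟨b, hb⟩ := exists_ordEq (Algebra.norm_ne_zero_iff.2 hy0 : Algebra.norm ℂ⸨X⸩ y ≠ 0)
  have ha0 : a ≠ 0 := by rintro rfl; exact hx (isSquare_of_ordEq_norm ha)
  have hzpow : ∀ {z : ℂ⸨X⸩} {k : ℤ}, OrdEq z k → ∀ r : ℤ, OrdEq (z ^ r) (r * k) := by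
    intro z k hz r
    obtain ⟨c, rfl | rfl⟩ := r.eq_nat_or_neg
    · rw [zpow_natCast]; exact hz.pow c
    · rw [zpow_neg, zpow_natCast, neg_mul]
      exact (hz.pow c).inv
  have hg : (Int.gcd a b : ℤ) ≠ 0 := by
    simp [Int.gcd_eq_zero_iff, ha0]
  obtain ⟨a', ha'⟩ := Int.gcd_dvd_left a b
  obtain ⟨b', hb'⟩ := Int.gcd_dvd_right a b
  have hodd : Odd a' ∨ Odd b' := by
    by_contra hcon
    push Not at hcon
    obtain ⟨h1, h2⟩ := hcon
    rw [Int.not_odd_iff_even, even_iff_two_dvd] at h1 h2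
    have h3 : (Int.gcd a b : ℤ) * 2 ∣ Int.gcd a b := by
      refine Int.dvd_coe_gcd ?_ ?_
      · nth_rw 2 [ha']; exact mul_dvd_mul_left _ h1
      · nth_rw 2 [hb']; exact mul_dvd_mul_left _ h2
    obtain ⟨c, hc⟩ := h3
    have h4 : (Int.gcd a b : ℤ) * (2 * c) = Int.gcd a b * 1 := by rw [mul_one]; linarith
    have h5 := mul_left_cancel₀ hg h4
    omega
  have hsq : IsSquare (x ^ b' * y ^ (-a')) := by
    apply isSquare_of_ordEq_norm
    have hn : ∀ (z : L) (r : ℤ), Algebra.norm ℂ⸨X⸩ (z ^ r) = (Algebra.norm ℂ⸨X⸩ z) ^ r :=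
      fun z r => map_zpow₀ (⟨⟨Algebra.norm ℂ⸨X⸩, Algebra.norm_zero⟩, map_one _, map_mul _⟩ :
        L →*₀ ℂ⸨X⸩) z r
    rw [map_mul, hn, hn]
    have h1 := (hzpow ha b').mul (hzpow hb (-a'))
    have h2 : b' * a + -a' * b = 0 := by
      generalize (Int.gcd a b : ℤ) = G at ha' hb'
      rw [ha', hb']; ring
    rwa [h2] at h1
  rcases Int.even_or_odd a' with hae | hao
  · have hbo : Odd b' := hodd.resolve_left (Int.not_odd_iff_even.2 hae)
    obtain ⟨c, hc⟩ := hae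
    exact absurd (isSquare_of_isSquare_zpow hx0 hbo (z := y ^ (-c))
      (by rw [← zpow_add₀ hy0, ← neg_add, ← hc]; exact hsq) (zpow_ne_zero _ hy0)) hx
  rcases Int.even_or_odd b' with hbe | hbo
  · obtain ⟨c, hc⟩ := hbe
    exact absurd (isSquare_of_isSquare_zpow hy0 hao.neg (z := x ^ c)
      (by rw [← zpow_add₀ hx0, ← hc, mul_comm]; exact hsq) (zpow_ne_zero _ hx0)) hy
  · obtain ⟨c, hc⟩ := hbo
    obtain ⟨e, he⟩ := hao
    refine isSquare_of_isSquare_zpow (mul_ne_zero hx0 hy0) odd_one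
      (z := x ^ c * y ^ (-e - 1)) ?_ (mul_ne_zero (zpow_ne_zero _ hx0) (zpow_ne_zero _ hy0))
    have h1 : (x * y) ^ (1 : ℤ) * (x ^ c * y ^ (-e - 1) * (x ^ c * y ^ (-e - 1))) =
        x ^ b' * y ^ (-a') := by
      rw [hc, he, zpow_one]
      have e1 : x ^ (2 * c + 1) = x * (x ^ c * x ^ c) := by
        rw [← zpow_add₀ hx0, ← zpow_one_add₀ hx0]; ring_nf
      have e2 : y ^ (-(2 * e + 1)) = y * (y ^ (-e - 1) * y ^ (-e - 1)) := by
        rw [← zpow_add₀ hy0, ← zpow_one_add₀ hy0]; ring_nf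
      rw [e1, e2]; ring
    rw [h1]; exact hsq

/-- If `μ` is a square, the form is hyperbolic. Otherwise `d` is a square, or `d μ` is one because
there are at most two square classes; in the latter case `-1` being a square finishes. -/
theorem exists_sq_sub_mul_sq_eq {L : Type} [Field L] [Algebra ℂ⸨X⸩ L]
    [FiniteDimensional ℂ⸨X⸩ L] {μ : L} (hμ : μ ≠ 0) (d : L) :
    ∃ p q : L, p ^ 2 - μ * q ^ 2 = d := by
  have h2 : (2 : L) ≠ 0 := by
    have h : (algebraMap ℂ⸨X⸩ L 2) ≠ 0 := by
      rw [← map_ofNat (HahnSeries.C (Γ := ℤ) (R := ℂ)) 2]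
      exact (_root_.map_ne_zero _).2 ((_root_.map_ne_zero _).2 two_ne_zero)
    rwa [map_ofNat] at h
  by_cases h : IsSquare μ
  · obtain ⟨s, rfl⟩ := h
    have hs : s ≠ 0 := by rintro rfl; simp at hμ
    exact ⟨(1 + d) / 2, (1 - d) / (2 * s), by field_simp; ring⟩
  by_cases hd : IsSquare d
  · obtain ⟨p, rfl⟩ := hd
    exact ⟨p, 0, by ring⟩
  obtain ⟨r, hr⟩ := isSquare_mul_of_not_isSquare hd h
  obtain ⟨i, hi, -⟩ := exists_sq_eq_neg_one
  have hi' : (algebraMap ℂ⸨X⸩ L i) ^ 2 = -1 := by rw [← map_pow, hi, map_neg, map_one]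
  refine ⟨0, algebraMap ℂ⸨X⸩ L i * r / μ, ?_⟩
  have h3 : d = r * r / μ := by rw [← hr]; field_simp
  rw [h3, div_pow, mul_pow, hi']
  field_simp
  ring

theorem exists_dvd_sq_sub_X_mul_sq_of_prime {g : ℂ⸨X⸩[X]} (hg : Prime g) (h0 : g.coeff 0 ≠ 0)
    (d : ℂ⸨X⸩[X]) : ∃ p q : ℂ⸨X⸩[X], g ∣ p ^ 2 - Polynomial.X * q ^ 2 - d := by
  have : Fact (Irreducible g) := ⟨hg.irreducible⟩
  have : FiniteDimensional ℂ⸨X⸩ (AdjoinRoot g) :=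
    (AdjoinRoot.powerBasis hg.ne_zero).finite
  have hμ : AdjoinRoot.root g ≠ 0 := by
    intro h
    rw [← AdjoinRoot.mk_X, AdjoinRoot.mk_eq_zero] at h
    obtain ⟨r, hr⟩ := h
    rcases (hg.irreducible.isUnit_or_isUnit (a := g) (b := 1) (by simp)) with h1 | -
    · exact hg.not_isUnit h1
    have hX := (Polynomial.irreducible_X (R := ℂ⸨X⸩)).isUnit_or_isUnit hr
    rcases hX with h2 | h2
    · exact hg.not_isUnit h2
    · have h3 := congrArg (fun p => Polynomial.coeff p 0) hr
      simp only [Polynomial.coeff_X_zero, Polynomial.mul_coeff_zero] at h3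
      rcases mul_eq_zero.1 h3.symm with h4 | h4
      · exact h0 h4
      · have h5 := Polynomial.isUnit_iff.1 h2
        obtain ⟨c, hc, rfl⟩ := h5
        rw [Polynomial.coeff_C_zero] at h4
        rw [h4] at hc
        exact not_isUnit_zero hc
  obtain ⟨p, q, h⟩ := exists_sq_sub_mul_sq_eq hμ (AdjoinRoot.mk g d)
  obtain ⟨p, rfl⟩ := AdjoinRoot.mk_surjective p
  obtain ⟨q, rfl⟩ := AdjoinRoot.mk_surjective q
  refine ⟨p, q, ?_⟩
  rw [← AdjoinRoot.mk_eq_zero, map_sub, map_sub, map_mul, map_pow, map_pow, AdjoinRoot.mk_X, h,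
    sub_self]

/-- Solutions modulo coprime factors are combined by the Chinese remainder theorem. -/
theorem exists_dvd_sq_sub_X_mul_sq_of_forall_prime {K : Type*} [Field K]
    (H : ∀ g : K[X], Prime g → g.coeff 0 ≠ 0 → ∀ d : K[X],
      ∃ p q : K[X], g ∣ p ^ 2 - Polynomial.X * q ^ 2 - d)
    {g : K[X]} (hg : Squarefree g) (h0 : g.coeff 0 ≠ 0) (d : K[X]) :
    ∃ p q : K[X], g ∣ p ^ 2 - Polynomial.X * q ^ 2 - d := by
  induction g using UniqueFactorizationMonoid.induction_on_coprime generalizing d with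
  | h0 => simp at h0
  | h1 h => exact ⟨0, 0, h.dvd⟩
  | hpr i hp =>
    rename_i p
    rcases Nat.lt_or_ge i 2 with hi | hi
    · interval_cases i
      · exact ⟨0, 0, by simp⟩
      · rw [pow_one] at h0 ⊢
        exact H _ hp h0 d
    · exfalso
      refine hp.not_isUnit (hg p ?_)
      rw [← sq]
      exact pow_dvd_pow _ hi
  | hcp hxy hx hy =>
    rename_i x y
    have hyd : y ∣ x * y := ⟨x, by ring⟩
    rw [Polynomial.mul_coeff_zero] at h0
    obtain ⟨p, q, h1⟩ := hx (hg.squarefree_of_dvd (dvd_mul_right _ _)) (left_ne_zero_of_mul h0) d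
    obtain ⟨p', q', h2⟩ :=
      hy (hg.squarefree_of_dvd hyd) (right_ne_zero_of_mul h0) d
    have hco := hxy.isCoprime
    obtain ⟨a, b, hab⟩ := id hco
    refine ⟨p * (b * y) + p' * (a * x), q * (b * y) + q' * (a * x),
      hco.mul_dvd ?_ ?_⟩
    · have e : b * y = 1 - a * x := by rw [← hab]; ring
      rw [e]
      obtain ⟨c, hc⟩ := h1
      have : (p * (1 - a * x) + p' * (a * x)) ^ 2 -
          Polynomial.X * (q * (1 - a * x) + q' * (a * x)) ^ 2 - d =
          (p ^ 2 - Polynomial.X * q ^ 2 - d) + x * (a * (p' - p) * (2 * p + a * x * (p' - p)) -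
            Polynomial.X * (a * (q' - q) * (2 * q + a * x * (q' - q)))) := by ring
      rw [this, hc, ← mul_add]
      exact dvd_mul_right _ _
    · have e : a * x = 1 - b * y := by rw [← hab]; ring
      rw [e]
      obtain ⟨c, hc⟩ := h2
      have : (p * (b * y) + p' * (1 - b * y)) ^ 2 -
          Polynomial.X * (q * (b * y) + q' * (1 - b * y)) ^ 2 - d =
          (p' ^ 2 - Polynomial.X * q' ^ 2 - d) + y * (b * (p - p') * (2 * p' + b * y * (p - p')) -
            Polynomial.X * (b * (q - q') * (2 * q' + b * y * (q - q')))) := by ring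
      rw [this, hc, ← mul_add]
      exact dvd_mul_right _ _

theorem exists_dvd_sq_sub_X_mul_sq {g : ℂ⸨X⸩[X]} (hg : Squarefree g) (h0 : g.coeff 0 ≠ 0)
    (d : ℂ⸨X⸩[X]) : ∃ p q : ℂ⸨X⸩[X], g ∣ p ^ 2 - Polynomial.X * q ^ 2 - d :=
  exists_dvd_sq_sub_X_mul_sq_of_forall_prime
    (fun _ hg h0 d => exists_dvd_sq_sub_X_mul_sq_of_prime hg h0 d) hg h0 d

/-! ### Cyclic modules with an involution -/

section

variable {K : Type*} [Field K]

theorem coeff_comp_neg_X (p : K[X]) (n : ℕ) :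
    (p.comp (-Polynomial.X)).coeff n = (-1) ^ n * p.coeff n := by
  have h : (-Polynomial.X : K[X]) = Polynomial.C (-1) * Polynomial.X := by simp
  rw [h, Polynomial.comp_C_mul_X_coeff, mul_comm]

theorem eq_comp_X_sq_of_comp_neg_X (h2 : (2 : K) ≠ 0) {p : K[X]}
    (hp : p.comp (-Polynomial.X) = p) : ∃ g : K[X], p = g.comp (Polynomial.X ^ 2) := by
  refine ⟨Polynomial.contract 2 p, ?_⟩
  rw [← Polynomial.expand_eq_comp_X_pow]
  ext n
  rw [Polynomial.coeff_expand two_pos]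
  split_ifs with hn
  · rw [Polynomial.coeff_contract two_ne_zero, Nat.div_mul_cancel hn]
  · have h := congrArg (fun q => Polynomial.coeff q n) hp
    simp only [coeff_comp_neg_X] at h
    rw [Odd.neg_one_pow (by rwa [← Nat.not_even_iff_odd, even_iff_two_dvd])] at h
    have h1 : 2 * p.coeff n = 0 := by linear_combination -h
    exact (mul_eq_zero.1 h1).resolve_left h2

variable {V : Type*} [AddCommGroup V] [Module K V] {B : LinearMap.BilinForm K V}
  {Γ : Module.End K V}

theorem aeval_skew (hΓ : ∀ x y, B (Γ x) y = -B x (Γ y)) (q : K[X]) (x y : V) :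
    B x (aeval Γ q y) = B (aeval Γ (q.comp (-Polynomial.X)) x) y := by
  induction q using Polynomial.induction_on generalizing x with
  | C a => simp [Module.algebraMap_end_apply]
  | add p q hp hq => simp [hp, hq]
  | monomial n a h =>
    obtain ⟨q, hq⟩ : ∃ q, q = Polynomial.C a * Polynomial.X ^ n := ⟨_, rfl⟩
    rw [pow_succ, ← mul_assoc, ← hq, mul_comm q, Polynomial.mul_comp, map_mul,
      Module.End.mul_apply, Polynomial.aeval_X, ← neg_neg (B x _), ← hΓ, hq, h, ← hq,
      mul_comm (Polynomial.X.comp _), map_mul, Module.End.mul_apply]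
    simp

/-- The action of `K[λ]/(f)` on a vector killed by `f`. -/
def cycAct {f : K[X]} (hf : f.Monic) (Γ : Module.End K V) (v : V) : AdjoinRoot f →ₗ[K] V :=
  ((LinearMap.applyₗ v).comp (aeval Γ).toLinearMap).comp (AdjoinRoot.modByMonicHom hf)

theorem cycAct_mk {f : K[X]} (hf : f.Monic) {v : V} (hv : aeval Γ f v = 0) (p : K[X]) :
    cycAct hf Γ v (AdjoinRoot.mk f p) = aeval Γ p v := by
  change aeval Γ (p %ₘ f) v = _
  conv_rhs => rw [← Polynomial.modByMonic_add_div p f]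
  rw [map_add, LinearMap.add_apply, mul_comm, map_mul, Module.End.mul_apply, hv, map_zero,
    add_zero]

/-- The involution `λ ↦ -λ` of `K[λ]/(f)`, where `f` is even. -/
def cycInv {f : K[X]} (he : f.comp (-Polynomial.X) = f) : AdjoinRoot f →ₐ[K] AdjoinRoot f :=
  AdjoinRoot.liftAlgHom f (Algebra.ofId K (AdjoinRoot f)) (-AdjoinRoot.root f) (by
    have h : f.eval₂ (AdjoinRoot.of f) (-AdjoinRoot.root f) =
        AdjoinRoot.mk f (f.comp (-Polynomial.X)) := by
      rw [Polynomial.comp, Polynomial.hom_eval₂]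
      congr 1
    exact h.trans (by rw [he, AdjoinRoot.mk_self]))

theorem cycInv_mk {f : K[X]} (he : f.comp (-Polynomial.X) = f) (p : K[X]) :
    cycInv he (AdjoinRoot.mk f p) = AdjoinRoot.mk f (p.comp (-Polynomial.X)) := by
  change p.eval₂ (AdjoinRoot.of f) (-AdjoinRoot.root f) = _
  rw [Polynomial.comp, Polynomial.hom_eval₂]
  simp
  rfl

theorem cycInv_root {f : K[X]} (he : f.comp (-Polynomial.X) = f) :
    cycInv he (AdjoinRoot.root f) = -AdjoinRoot.root f := by
  rw [← AdjoinRoot.mk_X, cycInv_mk]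
  simp

theorem modByMonicHom_cycInv {f : K[X]} (hf : f.Monic) (he : f.comp (-Polynomial.X) = f)
    (a : AdjoinRoot f) :
    AdjoinRoot.modByMonicHom hf (cycInv he a) =
      (AdjoinRoot.modByMonicHom hf a).comp (-Polynomial.X) := by
  obtain ⟨p, rfl⟩ := AdjoinRoot.mk_surjective a
  rw [AdjoinRoot.modByMonicHom_mk]
  have h1 : AdjoinRoot.mk f p = AdjoinRoot.mk f (p %ₘ f) := by
    rw [AdjoinRoot.mk_eq_mk]
    exact ⟨p /ₘ f, by rw [sub_eq_iff_eq_add, add_comm, Polynomial.modByMonic_add_div]⟩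
  rw [h1, cycInv_mk, AdjoinRoot.modByMonicHom_mk, Polynomial.modByMonic_eq_self_iff hf]
  refine lt_of_le_of_lt ?_ (Polynomial.degree_modByMonic_lt p hf)
  rw [Polynomial.degree_le_iff_coeff_zero]
  intro n hn
  rw [coeff_comp_neg_X, Polynomial.coeff_eq_zero_of_degree_lt hn, mul_zero]

theorem isUnit_root {f : K[X]} (h0 : f.coeff 0 ≠ 0) : IsUnit (AdjoinRoot.root f) := by
  refine IsUnit.of_mul_eq_one (AdjoinRoot.mk f (-Polynomial.C (f.coeff 0)⁻¹ * f.divX)) ?_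
  rw [← AdjoinRoot.mk_X, ← map_mul, ← map_one (AdjoinRoot.mk f), AdjoinRoot.mk_eq_mk]
  refine ⟨-Polynomial.C (f.coeff 0)⁻¹, ?_⟩
  have h := Polynomial.divX_mul_X_add f
  have h1 : Polynomial.C (f.coeff 0)⁻¹ * Polynomial.C (f.coeff 0) = 1 := by
    rw [← Polynomial.C_mul, inv_mul_cancel₀ h0, Polynomial.C_1]
  linear_combination (-Polynomial.C (f.coeff 0)⁻¹) * h + h1

/-- Every functional on a cyclic module with nondegenerate form is represented by an element. -/
theorem exists_functional_eq {f : K[X]} (hf : f.Monic) (ℓ ψ : AdjoinRoot f →ₗ[K] K)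
    (hℓ : ∀ a, (∀ b, ℓ (a * b) = 0) → a = 0) : ∃ c, ∀ a, ψ a = ℓ (c * a) := by
  have : FiniteDimensional K (AdjoinRoot f) := (AdjoinRoot.powerBasis hf.ne_zero).finite
  obtain ⟨Θ, hΘ⟩ : ∃ Θ : AdjoinRoot f →ₗ[K] Module.Dual K (AdjoinRoot f),
      ∀ a b, Θ a b = ℓ (a * b) := by
    exact ⟨(LinearMap.mul K (AdjoinRoot f)).compr₂ ℓ, fun a b => by simp⟩
  have hinj : Function.Injective Θ := by
    rw [injective_iff_map_eq_zero]
    intro a ha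
    exact hℓ a fun b => by rw [← hΘ, ha]; rfl
  obtain ⟨c, hc⟩ := (LinearMap.injective_iff_surjective_of_finrank_eq_finrank
    (Subspace.dual_finrank_eq).symm).1 hinj ψ
  exact ⟨c, fun a => by rw [← hΘ, hc]⟩

/-- On `K[λ]/(f)` with the involution `τ : λ ↦ -λ`, the given form is `ℓ(a τ(b))` and the desired
one is `ψ(a τ(b))`, with invariant functionals `ℓ` and `ψ`. Non-degeneracy gives `ψ = ℓ(c ·)` with
`τ c = c`, and if `c = u τ(u)`, then replacing `v` by `u v` changes the first form into the second.
Write `f = g(λ²)`, `c = d(λ²)` and `u = P(λ²) + λ Q(λ²)`: the equation for `u` becomes `P² - X Q² ≡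
d` modulo `g`, which `hS` solves. -/
theorem exists_cyclic_form (h2 : (2 : K) ≠ 0)
    (hS : ∀ g : K[X], Squarefree g → g.coeff 0 ≠ 0 → ∀ d : K[X],
      ∃ p q : K[X], g ∣ p ^ 2 - Polynomial.X * q ^ 2 - d)
    (hBs : ∀ x y, B x y = B y x) (hΓ : ∀ x y, B (Γ x) y = -B x (Γ y))
    {f : K[X]} (hf : f.Monic) (he : f.comp (-Polynomial.X) = f) (hsq : Squarefree f)
    (h0 : f.coeff 0 ≠ 0) {h : ℕ} (hh : 0 < h) (hdeg : f.natDegree = 2 * h) {v : V}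
    (hv : aeval Γ f v = 0)
    (hnd : ∀ p : K[X], (∀ q : K[X], B (aeval Γ p v) (aeval Γ q v) = 0) → f ∣ p) (T : K) :
    ∃ (W : ℤ → V) (F : ℤ → K), (∀ b, ∃ p : K[X], W b = aeval Γ p v) ∧ (∀ b, Γ (W b) = W (b + 1)) ∧
      (∀ a b, B (W a) (W b) = (if Even b then 1 else -1) * (T * F (a + b))) ∧
      (∀ e : ℤ, ∑ j ∈ Finset.range (2 * h + 1), f.coeff (2 * h - j) * F (e + 2 * h - j) = 0) ∧
      F 0 = 1 ∧ ∀ e : ℤ, -(2 * (h : ℤ)) < e → e < 0 → F e = 0 := by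
  obtain ⟨r, hr⟩ := isUnit_root h0
  obtain ⟨act, hact⟩ : ∃ act, act = cycAct hf Γ v := ⟨_, rfl⟩
  have hmk : ∀ p : K[X], act (AdjoinRoot.mk f p) = aeval Γ p v := fun p => by rw [hact, cycAct_mk hf hv]
  obtain ⟨τ, hτ⟩ : ∃ τ, τ = cycInv he := ⟨_, rfl⟩
  have hτmk : ∀ p : K[X], τ (AdjoinRoot.mk f p) = AdjoinRoot.mk f (p.comp (-Polynomial.X)) :=
    fun p => by rw [hτ, cycInv_mk]
  have hττ : ∀ a, τ (τ a) = a := fun a => by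
    obtain ⟨p, rfl⟩ := AdjoinRoot.mk_surjective a
    rw [hτmk, hτmk, Polynomial.comp_neg_X_comp_neg_X]
  -- The coefficient of `λ^(2h-1)`. Its odd exponent makes `φ` anti-invariant under `τ`; the odd
  -- power of `r` in the definition of `ψ` below restores invariance.
  obtain ⟨φ, hφ⟩ : ∃ φ : AdjoinRoot f →ₗ[K] K,
      ∀ a, φ a = (AdjoinRoot.modByMonicHom hf a).coeff (2 * h - 1) :=
    ⟨(Polynomial.lcoeff K (2 * h - 1)).comp (AdjoinRoot.modByMonicHom hf), fun a => rfl⟩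
  have hφpow : ∀ k < 2 * h, φ (r ^ k : (AdjoinRoot f)) = if k = 2 * h - 1 then 1 else 0 := by
    intro k hk
    rw [hφ, hr, ← AdjoinRoot.mk_X, ← map_pow, AdjoinRoot.modByMonicHom_mk,
      (Polynomial.modByMonic_eq_self_iff hf).2, Polynomial.coeff_X_pow]
    · simp [eq_comm]
    · rw [Polynomial.degree_X_pow, Polynomial.degree_eq_natDegree hf.ne_zero, hdeg]
      exact_mod_cast hk
  have hφτ : ∀ a, φ (τ a) = -φ a := by
    intro a
    rw [hφ, hφ, hτ, modByMonicHom_cycInv, coeff_comp_neg_X, Odd.neg_one_pow ⟨h - 1, by omega⟩,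
      neg_one_mul]
  obtain ⟨ℓ, hℓ⟩ : ∃ ℓ : AdjoinRoot f →ₗ[K] K, ∀ a, ℓ a = B (act a) v :=
    ⟨(B.flip v).comp act, fun a => rfl⟩
  have hBℓ : ∀ a b, B (act a) (act b) = ℓ (a * τ b) := by
    intro a b
    obtain ⟨p, rfl⟩ := AdjoinRoot.mk_surjective a
    obtain ⟨q, rfl⟩ := AdjoinRoot.mk_surjective b
    rw [hτmk, ← map_mul, hℓ, hmk, hmk, hmk, aeval_skew hΓ, mul_comm, map_mul,
      Module.End.mul_apply]
  have hact1 : act 1 = v := by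
    rw [← map_one (AdjoinRoot.mk f), hmk]; simp
  have hℓτ : ∀ a, ℓ (τ a) = ℓ a := by
    intro a
    rw [hℓ a, ← hact1, hBs, hBℓ, one_mul]
  have hℓnd : ∀ a, (∀ b, ℓ (a * b) = 0) → a = 0 := by
    intro a ha
    obtain ⟨p, rfl⟩ := AdjoinRoot.mk_surjective a
    rw [AdjoinRoot.mk_eq_zero]
    refine hnd p fun q => ?_
    rw [← hmk, ← hmk, hBℓ]
    exact ha _
  obtain ⟨ψ, hψ⟩ : ∃ ψ : AdjoinRoot f →ₗ[K] K, ∀ a, ψ a = T * φ (a * r ^ (2 * h - 1)) :=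
    ⟨T • φ.comp (LinearMap.mulRight K ((r : AdjoinRoot f) ^ (2 * h - 1))), fun a => rfl⟩
  have hτr : τ r = -r := by rw [hτ, hr, cycInv_root]
  have hψτ : ∀ a, ψ (τ a) = ψ a := by
    intro a
    have h1 : τ a * (r : AdjoinRoot f) ^ (2 * h - 1) = -τ (a * r ^ (2 * h - 1)) := by
      rw [map_mul, map_pow, hτr, Odd.neg_pow ⟨h - 1, by omega⟩]
      ring
    rw [hψ, hψ, h1, map_neg, hφτ, neg_neg]
  obtain ⟨c, hc⟩ := exists_functional_eq hf ℓ ψ hℓnd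
  have hcτ : τ c = c := by
    have h1 : τ c - c = 0 := by
      refine hℓnd _ fun b => ?_
      have h3 : ℓ (τ c * b) = ℓ (c * τ b) := by
        rw [← hℓτ, map_mul, hττ]
      rw [sub_mul, map_sub, h3, ← hc, ← hc, hψτ, sub_self]
    exact sub_eq_zero.1 h1
  obtain ⟨u, hu⟩ : ∃ u, u * τ u = c := by
    -- Lifting `c / 2` and symmetrising gives an even polynomial that represents `c`.
    obtain ⟨p, hp⟩ := AdjoinRoot.mk_surjective (AdjoinRoot.of f 2⁻¹ * c)
    obtain ⟨d, hd⟩ := eq_comp_X_sq_of_comp_neg_X h2 (p := p + p.comp (-Polynomial.X)) (by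
      rw [Polynomial.add_comp, Polynomial.comp_neg_X_comp_neg_X, add_comm])
    obtain ⟨g, hg⟩ := eq_comp_X_sq_of_comp_neg_X h2 he
    have hgsq : Squarefree g := by
      intro x hx
      have h3 : x.comp (Polynomial.X ^ 2) * x.comp (Polynomial.X ^ 2) ∣ f := by
        rw [hg, ← Polynomial.mul_comp]
        obtain ⟨y, rfl⟩ := hx
        rw [Polynomial.mul_comp _ y]
        exact dvd_mul_right _ _
      have h4 := Polynomial.natDegree_eq_zero_of_isUnit (hsq _ h3)
      rw [Polynomial.natDegree_comp, Polynomial.natDegree_X_pow] at h4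
      have h5 : x.natDegree = 0 := by omega
      have hx0 : x ≠ 0 := by
        rintro rfl
        rw [zero_mul, zero_dvd_iff] at hx
        rw [hx, Polynomial.zero_comp] at hg
        exact hf.ne_zero hg
      rw [Polynomial.eq_C_of_natDegree_eq_zero h5] at hx0 ⊢
      exact Polynomial.isUnit_C.2 (isUnit_iff_ne_zero.2 (by simpa using hx0))
    have hg0 : g.coeff 0 ≠ 0 := by
      rw [hg, Polynomial.coeff_zero_eq_eval_zero, Polynomial.eval_comp] at h0
      simpa [← Polynomial.coeff_zero_eq_eval_zero] using h0
    obtain ⟨P, Q, y, hPQ⟩ := hS g hgsq hg0 d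
    refine ⟨AdjoinRoot.mk f (P.comp (Polynomial.X ^ 2) + Polynomial.X * Q.comp (Polynomial.X ^ 2)),
      ?_⟩
    have hcd : c = AdjoinRoot.mk f (d.comp (Polynomial.X ^ 2)) := by
      rw [← hd, map_add, ← hτmk, hp, map_mul, hcτ, hτ]
      have h3 : cycInv he (AdjoinRoot.of f 2⁻¹) = AdjoinRoot.of f 2⁻¹ := by
        rw [← AdjoinRoot.mk_C, cycInv_mk]; simp
      rw [h3, ← add_mul, ← map_add]
      have h4 : (2 : K)⁻¹ + 2⁻¹ = 1 := by
        rw [← two_mul, mul_inv_cancel₀ h2]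
      rw [h4, map_one, one_mul]
    rw [hτmk, ← map_mul, hcd, AdjoinRoot.mk_eq_mk]
    refine ⟨y.comp (Polynomial.X ^ 2), ?_⟩
    have h5 := congrArg (fun p => p.comp (Polynomial.X ^ 2)) hPQ
    simp only [Polynomial.sub_comp, Polynomial.mul_comp, Polynomial.pow_comp,
      Polynomial.X_comp] at h5
    rw [← hg] at h5
    have hev : ∀ p : K[X], (p.comp (Polynomial.X ^ 2)).comp (-Polynomial.X) =
        p.comp (Polynomial.X ^ 2) := fun p => by
      rw [Polynomial.comp_assoc]; simp
    rw [Polynomial.add_comp, Polynomial.mul_comp, hev, hev, Polynomial.X_comp, ← h5]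
    ring
  have hform : ∀ a b, B (act (u * a)) (act (u * b)) = ψ (a * τ b) := by
    intro a b
    rw [hBℓ, hc, ← hu, map_mul τ]
    congr 1; ring
  refine ⟨fun b => act (u * ((r ^ b : (AdjoinRoot f)ˣ) : AdjoinRoot f)),
    fun e => φ ((r ^ (e + (2 * h - 1)) : (AdjoinRoot f)ˣ) : AdjoinRoot f), ?_, ?_, ?_, ?_, ?_, ?_⟩
  · intro b
    obtain ⟨p, hp⟩ := AdjoinRoot.mk_surjective (u * ((r ^ b : (AdjoinRoot f)ˣ) : AdjoinRoot f))
    exact ⟨p, by rw [← hmk, hp]⟩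
  · intro b
    obtain ⟨p, hp⟩ := AdjoinRoot.mk_surjective (u * ((r ^ b : (AdjoinRoot f)ˣ) : AdjoinRoot f))
    have h1 : u * ((r ^ (b + 1) : (AdjoinRoot f)ˣ) : AdjoinRoot f) = AdjoinRoot.mk f (Polynomial.X * p) := by
      rw [map_mul, hp, AdjoinRoot.mk_X, zpow_add_one, Units.val_mul, hr]
      ring
    simp only [h1]
    rw [← hp, hmk, hmk, map_mul, Polynomial.aeval_X, Module.End.mul_apply]
  · intro a b
    have h1 : τ ((r ^ b : (AdjoinRoot f)ˣ) : AdjoinRoot f) =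
        (if Even b then 1 else -1) * ((r ^ b : (AdjoinRoot f)ˣ) : AdjoinRoot f) := by
      have h3 : τ ((r ^ b : (AdjoinRoot f)ˣ) : AdjoinRoot f) = (((-r) ^ b : (AdjoinRoot f)ˣ) : AdjoinRoot f) := by
        have h4 : Units.map (τ : AdjoinRoot f →* AdjoinRoot f) r = -r := Units.ext hτr
        rw [← h4, ← map_zpow]
        rfl
      rw [h3]
      split_ifs with hb
      · rw [hb.neg_zpow, one_mul]
      · rw [(Int.not_even_iff_odd.1 hb).neg_zpow]
        simp
    simp only []
    rw [hform, h1]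
    have h5 : ψ (((r ^ a : (AdjoinRoot f)ˣ) : AdjoinRoot f) * ((r ^ b : (AdjoinRoot f)ˣ) : AdjoinRoot f)) =
        T * φ ((r ^ (a + b + (2 * h - 1)) : (AdjoinRoot f)ˣ) : AdjoinRoot f) := by
      rw [hψ, zpow_add, zpow_add, Units.val_mul, Units.val_mul]
      congr 3
      rw [← Units.val_pow_eq_pow_val, ← zpow_natCast, Nat.cast_sub (by omega)]
      norm_num
    rw [← h5]
    split_ifs
    · rw [one_mul, one_mul]
    · rw [neg_one_mul, mul_neg, map_neg, neg_one_mul]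
  · intro e
    have h1 : ∀ j ∈ Finset.range (2 * h + 1), f.coeff (2 * h - j) *
        φ ((r ^ (e + 2 * h - j + (2 * h - 1)) : (AdjoinRoot f)ˣ) : AdjoinRoot f) =
        φ (AdjoinRoot.of f (f.coeff (2 * h - j)) * (r : AdjoinRoot f) ^ (2 * h - j) *
          ((r ^ (e + (2 * h - 1)) : (AdjoinRoot f)ˣ) : AdjoinRoot f)) := by
      intro j hj
      have hj' : j ≤ 2 * h := by simpa [Nat.lt_succ_iff] using hj
      rw [mul_assoc, ← AdjoinRoot.algebraMap_eq, ← Algebra.smul_def, map_smul, smul_eq_mul]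
      congr 2
      rw [← Units.val_pow_eq_pow_val, ← Units.val_mul, ← zpow_natCast, ← zpow_add,
        Nat.cast_sub hj']
      congr 2
      push_cast
      ring
    simp only []
    rw [Finset.sum_congr rfl h1, ← map_sum, ← Finset.sum_mul]
    have h3 : ∑ j ∈ Finset.range (2 * h + 1),
        AdjoinRoot.of f (f.coeff (2 * h - j)) * (r : AdjoinRoot f) ^ (2 * h - j) = 0 := by
      have h4 := Finset.sum_range_reflect
        (fun j => AdjoinRoot.of f (f.coeff j) * (r : AdjoinRoot f) ^ j) (2 * h + 1)
      simp only [Nat.add_sub_cancel] at h4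
      rw [h4, hr, ← hdeg, ← Polynomial.eval₂_eq_sum_range]
      exact AdjoinRoot.eval₂_root f
    rw [h3, zero_mul, map_zero]
  · have h1 := hφpow (2 * h - 1) (by omega)
    rw [if_pos rfl] at h1
    rw [← h1, ← Units.val_pow_eq_pow_val, ← zpow_natCast, Nat.cast_sub (by omega)]
    simp
  · intro e he1 he2
    have h1 := hφpow (e + (2 * h - 1)).toNat (by omega)
    rw [if_neg (by omega), ← Units.val_pow_eq_pow_val, ← zpow_natCast,
      Int.toNat_of_nonneg (by omega)] at h1
    exact h1

end

/-! ### Semisimple skew endomorphisms with a small commutant -/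

theorem aeval_apply_comm {K V : Type*} [Field K] [AddCommGroup V] [Module K V]
    {Γ : Module.End K V} (p : K[X]) (x : V) : aeval Γ p (Γ x) = Γ (aeval Γ p x) := by
  have h := Polynomial.aeval_X (R := K) Γ
  have h1 : aeval Γ (p * Polynomial.X) x = aeval Γ (Polynomial.X * p) x := by rw [mul_comm]
  rwa [map_mul, map_mul, Module.End.mul_apply, Module.End.mul_apply, h] at h1

section

variable {K : Type*} [Field K] {V : Type*} [AddCommGroup V] [Module K V] [FiniteDimensional K V]
  {B : LinearMap.BilinForm K V} {Γ : Module.End K V}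

theorem exists_annihilator_vector (Γ : Module.End K V) :
    ∃ v : V, ∀ p : K[X], aeval Γ p v = 0 → aeval Γ p = 0 := by
  obtain ⟨x, hx⟩ := Module.exists_ker_toSpanSingleton_eq_annihilator K[X] (Module.AEval' Γ)
  obtain ⟨v, rfl⟩ := (Module.AEval'.of Γ).surjective x
  refine ⟨v, fun p hp => ?_⟩
  have h1 : p ∈ LinearMap.ker (LinearMap.toSpanSingleton K[X] _ (Module.AEval'.of Γ v)) := by
    rw [LinearMap.mem_ker, LinearMap.toSpanSingleton_apply, ← Module.AEval.of_aeval_smul]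
    change Module.AEval'.of Γ (aeval Γ p v) = 0
    rw [hp, map_zero]
  rw [hx, Module.mem_annihilator] at h1
  ext w
  have h2 := h1 (Module.AEval'.of Γ w)
  rw [← Module.AEval.of_aeval_smul] at h2
  exact (Module.AEval'.of Γ).map_eq_zero_iff.1 h2

theorem isCompl_ker_range (hss : Γ.IsSemisimple) :
    IsCompl (LinearMap.ker Γ) (LinearMap.range Γ) := by
  obtain ⟨T, hT, hc⟩ := Module.End.isSemisimple_iff.1 hss (LinearMap.ker Γ) (by
    intro x hx
    rw [LinearMap.mem_ker] at hx
    rw [Submodule.mem_comap, hx]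
    exact Submodule.zero_mem _)
  have hle : LinearMap.range Γ ≤ T := by
    rintro _ ⟨x, rfl⟩
    rw [← Submodule.projection_add_projection_eq_self hc x, map_add]
    have h1 : Γ ((LinearMap.ker Γ).projection T hc x) = 0 :=
      LinearMap.mem_ker.1 (Submodule.projection_apply_mem hc x)
    rw [h1, zero_add]
    exact hT (Submodule.projection_apply_mem hc.symm x)
  have hfin : Module.finrank K (LinearMap.range Γ) = Module.finrank K T := by
    have h1 := LinearMap.finrank_range_add_finrank_ker Γ
    have h2 := Submodule.finrank_add_eq_of_isCompl hc
    omega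
  rw [Submodule.eq_of_le_of_finrank_eq hle hfin]
  exact hc

/-- A vector annihilated by as little as possible can be moved everywhere by the commutant. -/
theorem exists_commute_apply_eq (hss : Γ.IsSemisimple) {v : V}
    (hv : ∀ p : K[X], aeval Γ p v = 0 → aeval Γ p = 0) (y : V) :
    ∃ A : Module.End K V, (∀ x, A (Γ x) = Γ (A x)) ∧ A v = y := by
  obtain ⟨φ, hφ⟩ : ∃ φ : K[X] →ₗ[K] V, ∀ p, φ p = aeval Γ p v :=
    ⟨(LinearMap.applyₗ v).comp (aeval Γ).toLinearMap, fun _ => rfl⟩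
  have hφX : ∀ p, Γ (φ p) = φ (Polynomial.X * p) := fun p => by
    rw [hφ, hφ, map_mul, Polynomial.aeval_X, Module.End.mul_apply]
  obtain ⟨T, hT, hc⟩ := Module.End.isSemisimple_iff.1 hss (LinearMap.range φ) (by
    rintro _ ⟨p, rfl⟩
    exact ⟨Polynomial.X * p, (hφX p).symm⟩)
  obtain ⟨s, hs⟩ := LinearMap.exists_rightInverse_of_surjective φ.rangeRestrict
    (LinearMap.range_rangeRestrict φ)
  have hs' : ∀ p, aeval Γ (s ⟨φ p, p, rfl⟩) = aeval Γ p := by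
    intro p
    rw [← sub_eq_zero, ← map_sub]
    refine hv _ ?_
    rw [← hφ, map_sub, sub_eq_zero]
    have h1 := congrArg Subtype.val (LinearMap.congr_fun hs ⟨φ p, p, rfl⟩)
    exact h1
  obtain ⟨A, hA⟩ : ∃ A : Module.End K V, ∀ x,
      A x = aeval Γ (s ((LinearMap.range φ).projectionOnto T hc x)) y :=
    ⟨(LinearMap.applyₗ y).comp ((aeval Γ).toLinearMap.comp
      (s.comp ((LinearMap.range φ).projectionOnto T hc))), fun _ => rfl⟩
  have hAφ : ∀ p, A (φ p) = aeval Γ p y := by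
    intro p
    rw [hA, ← hs' p]
    congr 3
    exact Submodule.projectionOnto_apply_left hc ⟨φ p, p, rfl⟩
  have hAT : ∀ x ∈ T, A x = 0 := by
    intro x hx
    rw [hA, Submodule.projectionOnto_apply_right hc ⟨x, hx⟩, map_zero, map_zero]
    rfl
  refine ⟨A, fun x => ?_, ?_⟩
  · rw [← Submodule.projection_add_projection_eq_self hc x]
    obtain ⟨p, hp⟩ := Submodule.projection_apply_mem hc x
    rw [← hp, map_add, map_add, map_add, hφX, hAφ, hAφ,
      hAT _ (Submodule.projection_apply_mem hc.symm x),
      hAT _ (hT (Submodule.projection_apply_mem hc.symm x)), map_mul,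
      Polynomial.aeval_X, Module.End.mul_apply, add_zero, add_zero]
  · have h1 : v = φ 1 := by rw [hφ]; simp
    rw [h1, hAφ]
    simp

/-- The endomorphisms that commute with `Γ` and vanish on its kernel. -/
def commutant (Γ : Module.End K V) : Submodule K (Module.End K V) where
  carrier := {A | (∀ x, A (Γ x) = Γ (A x)) ∧ ∀ x, Γ x = 0 → A x = 0}
  add_mem' := by
    rintro A A' ⟨h1, h2⟩ ⟨h1', h2'⟩
    exact ⟨fun x => by simp [h1, h1'], fun x hx => by simp [h2 x hx, h2' x hx]⟩
  zero_mem' := ⟨fun x => by simp, fun x _ => rfl⟩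
  smul_mem' := by
    rintro c A ⟨h1, h2⟩
    exact ⟨fun x => by simp [h1], fun x hx => by simp [h2 x hx]⟩

/-- The skew elements of the commutant. -/
def skewCommutant (B : LinearMap.BilinForm K V) (Γ : Module.End K V) :
    Submodule K (Module.End K V) where
  carrier := {A | A ∈ commutant Γ ∧ ∀ x y, B (A x) y = -B x (A y)}
  add_mem' := by
    rintro A A' ⟨h1, h2⟩ ⟨h1', h2'⟩
    refine ⟨Submodule.add_mem _ h1 h1', fun x y => ?_⟩
    simp [h2, h2']; ring
  zero_mem' := ⟨Submodule.zero_mem _, fun x y => by simp⟩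
  smul_mem' := by
    rintro c A ⟨h1, h2⟩
    refine ⟨Submodule.smul_mem _ _ h1, fun x y => ?_⟩
    simp [h2]

/-- With `A*` the adjoint, `A ↦ (A - A*, Γ (A + A*))` takes values in pairs of skew elements, as `Γ`
is skew and commutes with `A + A*`. If both components vanish, then `A` is self-adjoint and `Γ A =
0`; but `A` vanishes on the kernel and preserves the range, where `Γ` is injective, so `A = 0`. -/
theorem finrank_commutant_le (h2 : (2 : K) ≠ 0) (hB : B.Nondegenerate)
    (hBs : ∀ x y, B x y = B y x) (hΓ : ∀ x y, B (Γ x) y = -B x (Γ y)) (hss : Γ.IsSemisimple) :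
    Module.finrank K (commutant Γ) ≤ 2 * Module.finrank K (skewCommutant B Γ) := by
  have hext : ∀ x x', (∀ y, B x y = B x' y) → x = x' := by
    intro x x' h
    rw [← sub_eq_zero]
    refine hB.1 _ fun y => ?_
    rw [map_sub, LinearMap.sub_apply, h, sub_self]
  obtain ⟨ad, had⟩ : ∃ ad : Module.End K V → Module.End K V,
      ∀ A x y, B (ad A x) y = B x (A y) :=
    ⟨B.leftAdjointOfNondegenerate hB,
      fun A => B.isAdjointPairLeftAdjointOfNondegenerate hB A⟩
  have hadd : ∀ A A', ad (A + A') = ad A + ad A' := fun A A' => by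
    ext x
    refine hext _ _ fun y => ?_
    simp [had]
  have hsmul : ∀ (c : K) A, ad (c • A) = c • ad A := fun c A => by
    ext x
    refine hext _ _ fun y => ?_
    simp [had]
  have hadC : ∀ A ∈ commutant Γ, ad A ∈ commutant Γ := by
    rintro A ⟨hA1, hA2⟩
    have hcomm : ∀ x, ad A (Γ x) = Γ (ad A x) := fun x => by
      refine hext _ _ fun y => ?_
      rw [had, hΓ, hΓ, had, hA1]
    refine ⟨hcomm, fun x hx => ?_⟩
    refine hext _ _ fun y => ?_
    rw [had, map_zero, LinearMap.zero_apply]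
    rw [← Submodule.projection_add_projection_eq_self (isCompl_ker_range hss) y, map_add, map_add,
      hA2 _ (LinearMap.mem_ker.1 (Submodule.projection_apply_mem _ y)), map_zero, zero_add]
    obtain ⟨z, hz⟩ := Submodule.projection_apply_mem (isCompl_ker_range hss).symm y
    rw [← hz, hA1, ← neg_eq_zero, ← hΓ, hx, map_zero, LinearMap.zero_apply]
  have hadad : ∀ A x y, B (A x) y = B x (ad A y) := fun A x y => by
    rw [hBs, ← had, hBs]
  have hGC : ∀ A ∈ commutant Γ, Γ * A ∈ commutant Γ := by
    rintro A ⟨hA1, hA2⟩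
    refine ⟨fun x => ?_, fun x hx => ?_⟩
    · rw [Module.End.mul_apply, Module.End.mul_apply, hA1]
    · rw [Module.End.mul_apply, hA2 x hx, map_zero]
  obtain ⟨Ψ, hΨ⟩ : ∃ Ψ : commutant Γ →ₗ[K] skewCommutant B Γ × skewCommutant B Γ,
      ∀ A, ((Ψ A).1 : Module.End K V) = A - ad A ∧
        ((Ψ A).2 : Module.End K V) = Γ * (A + ad A) := by
    refine ⟨⟨⟨fun A => (⟨A - ad A, ?_⟩, ⟨Γ * (A + ad A), ?_⟩), ?_⟩, ?_⟩, fun A => ⟨rfl, rfl⟩⟩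
    · refine ⟨Submodule.sub_mem _ A.2 (hadC _ A.2), fun x y => ?_⟩
      simp only [LinearMap.sub_apply, map_sub, had, hadad]
      ring
    · refine ⟨hGC _ (Submodule.add_mem _ A.2 (hadC _ A.2)), fun x y => ?_⟩
      simp only [Module.End.mul_apply, LinearMap.add_apply, map_add, LinearMap.add_apply, hΓ,
        had, hadad, ← (hadC _ A.2).1, ← A.2.1]
      ring
    · intro A A'
      refine Prod.ext (Subtype.ext ?_) (Subtype.ext ?_)
      · simp [hadd]; abel
      · simp [hadd, mul_add]; abel
    · intro c A
      refine Prod.ext (Subtype.ext ?_) (Subtype.ext ?_)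
      · simp [hsmul, smul_sub]
      · simp [hsmul, mul_add]
  have hinj : Function.Injective Ψ := by
    rw [injective_iff_map_eq_zero]
    intro A hA
    obtain ⟨h3, h4⟩ := hΨ A
    rw [hA] at h3 h4
    have h5 : ad A = A := (sub_eq_zero.1 h3.symm).symm
    rw [h5] at h4
    refine Subtype.ext (LinearMap.ext fun x => ?_)
    have h6 : Γ ((A : Module.End K V) x) = 0 := by
      have h7 := LinearMap.congr_fun h4 x
      simp only [Prod.snd_zero, ZeroMemClass.coe_zero, LinearMap.zero_apply,
        Module.End.mul_apply, ← two_smul K, LinearMap.smul_apply, map_smul] at h7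
      exact (smul_eq_zero.1 h7.symm).resolve_left h2
    rw [← Submodule.projection_add_projection_eq_self (isCompl_ker_range hss) x] at h6 ⊢
    have h8 := A.2.2 _ (LinearMap.mem_ker.1
      (Submodule.projection_apply_mem (isCompl_ker_range hss) x))
    rw [map_add, h8, zero_add] at h6 ⊢
    obtain ⟨z, hz⟩ := Submodule.projection_apply_mem (isCompl_ker_range hss).symm x
    rw [← hz] at h6 ⊢
    exact Submodule.disjoint_def.1 (isCompl_ker_range hss).disjoint _ (LinearMap.mem_ker.2 h6)
      ⟨(A : Module.End K V) z, (A.2.1 z).symm⟩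
  have h3 := LinearMap.finrank_le_finrank_of_injective hinj
  rw [Module.finrank_prod] at h3
  omega

/-- The finite dimensional spaces of skew endomorphisms commuting with `Γ`, and vectors of the
kernel. -/
theorem finrank_skewCommutant_add_le {n : ℕ} (hBs : ∀ x y, B x y = B y x)
    (hΓ : ∀ x y, B (Γ x) y = -B x (Γ y))
    (hZ : ∀ Z : Submodule K (Module.End K V),
      (∀ A ∈ Z, (∀ x, A (Γ x) = Γ (A x)) ∧ ∀ x y, B (A x) y = -B x (A y)) →
      Module.finrank K Z ≤ n)
    {e : V} (he : Γ e = 0) {Y : Submodule K V} (hY : ∀ y ∈ Y, Γ y = 0 ∧ B e y = 0)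
    (heY : ∀ y ∈ Y, B e e • y = 0 → y = 0) :
    Module.finrank K (skewCommutant B Γ) + Module.finrank K Y ≤ n := by
  -- To the skew maps that vanish on the kernel are added the maps `x ↦ ⟨e, x⟩ y - ⟨y, x⟩ e`, which
  -- are skew and commute with `Γ` because `e` and `y` lie in its kernel. The value at `e` recovers
  -- `y`.
  obtain ⟨Φ, hΦ⟩ : ∃ Φ : skewCommutant B Γ × Y →ₗ[K] Module.End K V,
      ∀ A x, Φ A x = A.1.1 x + (B e x • (A.2 : V) - B A.2 x • e) := by
    refine ⟨⟨⟨fun A => A.1.1 + (LinearMap.smulRight (B e) (A.2 : V) -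
      LinearMap.smulRight (B A.2) e), ?_⟩, ?_⟩, fun A x => rfl⟩
    · intro A A'
      ext x
      simp [add_smul, smul_add]
      abel
    · intro c A
      ext x
      simp [smul_sub, smul_smul, mul_comm]
  have hinj : Function.Injective Φ := by
    rw [injective_iff_map_eq_zero]
    rintro ⟨A, y⟩ hA
    have h1 := LinearMap.congr_fun hA e
    rw [hΦ, LinearMap.zero_apply, A.2.1.2 e he, hBs y.1 e, (hY _ y.2).2, zero_smul, sub_zero,
      zero_add] at h1
    have hy : (y : V) = 0 := heY _ y.2 h1
    have hA0 : (A : Module.End K V) = 0 := by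
      ext x
      have h2 := LinearMap.congr_fun hA x
      rw [hΦ] at h2
      simpa [hy] using h2
    exact Prod.ext (Subtype.ext hA0) (Subtype.ext hy)
  rw [← Module.finrank_prod, ← LinearMap.finrank_range_of_inj hinj]
  refine hZ _ ?_
  rintro _ ⟨⟨A, y⟩, rfl⟩
  refine ⟨fun x => ?_, fun x z => ?_⟩
  · have h1 : B e (Γ x) = 0 := by rw [← neg_eq_zero, ← hΓ, he, map_zero, LinearMap.zero_apply]
    have h3 : B y (Γ x) = 0 := by
      rw [← neg_eq_zero, ← hΓ, (hY _ y.2).1, map_zero, LinearMap.zero_apply]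
    rw [hΦ, hΦ]
    simp [h1, h3, (hY _ y.2).1, he, A.2.1.1]
  · rw [hΦ, hΦ]
    have h1 := A.2.2 x z
    simp only [map_add, map_sub, map_smul, LinearMap.add_apply, LinearMap.sub_apply,
      LinearMap.smul_apply, smul_eq_mul, h1, hBs x y, hBs x e]
    ring

/-- Let `r` and `k` be the dimensions of the range and of the kernel. Evaluation at `Γ v`, for `v`
with the smallest annihilator, gives `r ≤ dim commutant ≤ 2 dim skewCommutant`. If `k > 0`, the
kernel contributes at least `k - 1` further skew maps, so `r ≤ 2 (n - k + 1)`; as `r + k = 2n`, this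
yields `k ≤ 2`, and the evenness of `k` forces equality `r = dim commutant`. An element of the
commutant is then determined by its value at `Γ v`; applied to a projection along `K[Γ] v`, this
shows that the range is cyclic. -/
theorem range_le_of_commutant {n : ℕ} (h2 : (2 : K) ≠ 0) (hB : B.Nondegenerate)
    (hBs : ∀ x y, B x y = B y x) (hΓ : ∀ x y, B (Γ x) y = -B x (Γ y)) (hss : Γ.IsSemisimple)
    (hn : Module.finrank K V = 2 * n) (hk : Even (Module.finrank K (LinearMap.ker Γ)))
    (hZ : ∀ Z : Submodule K (Module.End K V),
      (∀ A ∈ Z, (∀ x, A (Γ x) = Γ (A x)) ∧ ∀ x y, B (A x) y = -B x (A y)) →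
      Module.finrank K Z ≤ n) :
    Module.finrank K (LinearMap.ker Γ) ≤ 2 ∧
    ∃ v : V, (∀ p : K[X], aeval Γ p (Γ v) = 0 → ∀ x, aeval Γ p (Γ x) = 0) ∧
      ∀ x, ∃ p : K[X], Γ x = aeval Γ p (Γ v) := by
  have hc := isCompl_ker_range hss
  obtain ⟨v, hv⟩ := exists_annihilator_vector Γ
  have hcomm1 := finrank_commutant_le h2 hB hBs hΓ hss
  obtain ⟨π, hπ⟩ : ∃ π, π = (LinearMap.range Γ).projection _ hc.symm := ⟨_, rfl⟩
  have hπΓ : ∀ x, π (Γ x) = Γ x := fun x => by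
    rw [hπ, Submodule.projection_apply_of_mem_left hc.symm ⟨x, rfl⟩]
  have hπk : ∀ x, Γ x = 0 → π x = 0 := fun x hx => by
    rw [hπ, Submodule.projection_apply_eq_zero_iff]
    exact hx
  have hΓπ : ∀ x, Γ (π x) = Γ x := fun x => by
    have h3 := Submodule.projection_add_projection_eq_self hc x
    have h4 := LinearMap.mem_ker.1 (Submodule.projection_apply_mem hc x)
    conv_rhs => rw [← h3, map_add, h4, zero_add, ← hπ]
  have hmem : ∀ A : Module.End K V, (∀ x, A (Γ x) = Γ (A x)) → A * π ∈ commutant Γ := by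
    intro A hA
    refine ⟨fun x => ?_, fun x hx => ?_⟩
    · rw [Module.End.mul_apply, Module.End.mul_apply, hπΓ, ← hA, hΓπ]
    · rw [Module.End.mul_apply, hπk x hx, map_zero]
  obtain ⟨ev, hev⟩ : ∃ ev : commutant Γ →ₗ[K] LinearMap.range Γ,
      ∀ A, (ev A : V) = A.1 (Γ v) :=
    ⟨LinearMap.codRestrict _ ((LinearMap.applyₗ (Γ v)).comp (commutant Γ).subtype)
      fun A => ⟨A.1 v, (A.2.1 v).symm⟩, fun _ => rfl⟩
  have hsurj : Function.Surjective ev := by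
    rintro ⟨_, y, rfl⟩
    obtain ⟨A, hA, hAv⟩ := exists_commute_apply_eq hss hv y
    refine ⟨⟨A * π, hmem A hA⟩, Subtype.ext ?_⟩
    rw [hev]
    change A (π (Γ v)) = _
    rw [hπΓ, hA, hAv]
  have hge : Module.finrank K (LinearMap.range Γ) ≤ Module.finrank K (commutant Γ) :=
    LinearMap.finrank_le_finrank_of_surjective hsurj
  have hrk := LinearMap.finrank_range_add_finrank_ker Γ
  obtain ⟨hk2, hle⟩ : Module.finrank K (LinearMap.ker Γ) ≤ 2 ∧
      Module.finrank K (commutant Γ) ≤ Module.finrank K (LinearMap.range Γ) := by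
    by_cases h0 : Module.finrank K (LinearMap.ker Γ) = 0
    · have h3 := finrank_skewCommutant_add_le (n := n) (e := 0) (Y := ⊥) hBs hΓ hZ (map_zero _)
        (by rintro y hy; rw [(Submodule.mem_bot K).1 hy]; simp)
        (by rintro y hy -; exact (Submodule.mem_bot K).1 hy)
      rw [finrank_bot] at h3
      omega
    · obtain ⟨e, he, hee⟩ : ∃ e, Γ e = 0 ∧ B e e ≠ 0 := by
        by_contra hcon
        push Not at hcon
        have hzero : ∀ x y, Γ x = 0 → Γ y = 0 → B x y = 0 := by
          intro x y hx hy
          have h3 := hcon (x + y) (by rw [map_add, hx, hy, add_zero])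
          simp only [map_add, LinearMap.add_apply, hcon x hx, hcon y hy, hBs y x] at h3
          have h4 : 2 * B x y = 0 := by linear_combination h3
          exact (mul_eq_zero.1 h4).resolve_left h2
        refine h0 (Submodule.finrank_eq_zero.2 ((Submodule.eq_bot_iff _).2 fun x hx => ?_))
        refine hB.1 _ fun y => ?_
        rw [← Submodule.projection_add_projection_eq_self hc y, map_add,
          hzero _ _ hx (Submodule.projection_apply_mem hc y), zero_add]
        obtain ⟨z, hz⟩ := Submodule.projection_apply_mem hc.symm y
        rw [← hz, ← neg_eq_zero, ← hΓ, LinearMap.mem_ker.1 hx, map_zero, LinearMap.zero_apply]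
      have h3 := finrank_skewCommutant_add_le (n := n) (e := e)
        (Y := LinearMap.ker Γ ⊓ LinearMap.ker (B e)) hBs hΓ hZ he (fun y hy => hy)
        (fun y _ h => (smul_eq_zero.1 h).resolve_left hee)
      have h4 : Module.finrank K (LinearMap.ker Γ) ≤
          Module.finrank K (LinearMap.ker Γ ⊓ LinearMap.ker (B e) : Submodule K V) + 1 := by
        obtain ⟨g, hg⟩ : ∃ g : LinearMap.ker Γ →ₗ[K] K, ∀ x, g x = B e x :=
          ⟨(B e).domRestrict _, fun _ => rfl⟩
        have h5 := LinearMap.finrank_range_add_finrank_ker g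
        have h6 : Module.finrank K (LinearMap.range g) ≤ 1 := by
          have := Submodule.finrank_le (LinearMap.range g)
          rwa [Module.finrank_self] at this
        have h7 : Module.finrank K (LinearMap.ker g) ≤
            Module.finrank K (LinearMap.ker Γ ⊓ LinearMap.ker (B e) : Submodule K V) := by
          refine LinearMap.finrank_le_finrank_of_injective
            (f := LinearMap.codRestrict _ ((LinearMap.ker Γ).subtype.comp
              (LinearMap.ker g).subtype) fun x => ⟨x.1.2, ?_⟩) ?_
          · have h8 := LinearMap.mem_ker.1 x.2
            have h9 : g x.1 = B e x.1.1 := hg _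
            exact h9.symm.trans h8
          · intro x x' hxx
            have h8 := congrArg
              (fun z : (LinearMap.ker Γ ⊓ LinearMap.ker (B e) : Submodule K V) => (z : V)) hxx
            exact Subtype.ext (Subtype.ext h8)
        omega
      obtain ⟨k, hk⟩ := hk
      omega
  have hinj : Function.Injective ev :=
    (LinearMap.injective_iff_surjective_of_finrank_eq_finrank (le_antisymm hle hge)).2 hsurj
  refine ⟨hk2, v, fun p hp x => ?_, fun x => ?_⟩
  · have h3 : aeval Γ (p * Polynomial.X) = 0 := by
      refine hv _ ?_
      rw [map_mul, Polynomial.aeval_X, Module.End.mul_apply, hp]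
    have h4 := LinearMap.congr_fun h3 x
    rwa [map_mul, Polynomial.aeval_X, Module.End.mul_apply] at h4
  · obtain ⟨φ, hφ⟩ : ∃ φ : K[X] →ₗ[K] V, ∀ p, φ p = aeval Γ p v :=
      ⟨(LinearMap.applyₗ v).comp (aeval Γ).toLinearMap, fun _ => rfl⟩
    have hφX : ∀ p, Γ (φ p) = φ (Polynomial.X * p) := fun p => by
      rw [hφ, hφ, map_mul, Polynomial.aeval_X, Module.End.mul_apply]
    obtain ⟨T, hT, hcT⟩ := Module.End.isSemisimple_iff.1 hss (LinearMap.range φ) (by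
      rintro _ ⟨p, rfl⟩
      exact ⟨Polynomial.X * p, (hφX p).symm⟩)
    have hcomm : ∀ x, T.projection _ hcT.symm (Γ x) = Γ (T.projection _ hcT.symm x) := by
      intro x
      have h3 := Submodule.projection_add_projection_eq_self hcT x
      obtain ⟨p, hp⟩ := Submodule.projection_apply_mem hcT x
      conv_lhs => rw [← h3, map_add, map_add, ← hp, hφX]
      rw [(Submodule.projection_apply_eq_zero_iff hcT.symm).2 ⟨_, rfl⟩, zero_add,
        Submodule.projection_apply_of_mem_left hcT.symm
          (hT (Submodule.projection_apply_mem hcT.symm x))]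
    have h3 : (⟨T.projection _ hcT.symm * π, hmem _ hcomm⟩ : commutant Γ) = 0 := by
      refine hinj (Subtype.ext ?_)
      rw [map_zero, hev]
      change T.projection _ hcT.symm (π (Γ v)) = 0
      rw [hπΓ, Submodule.projection_apply_eq_zero_iff]
      exact ⟨Polynomial.X, by rw [hφ, Polynomial.aeval_X]⟩
    have h4 : ∀ z, Γ z ∈ LinearMap.range φ := fun z => by
      have h5 := LinearMap.congr_fun (congrArg Subtype.val h3) (Γ z)
      change T.projection _ hcT.symm (π (Γ z)) = 0 at h5
      rwa [hπΓ, Submodule.projection_apply_eq_zero_iff] at h5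
    obtain ⟨z, hz⟩ : ∃ z, Γ x = Γ (Γ z) := by
      obtain ⟨z, hz⟩ := Submodule.projection_apply_mem hc.symm x
      rw [← hπ] at hz
      exact ⟨z, by rw [hz, hΓπ]⟩
    obtain ⟨p, hp⟩ := h4 z
    refine ⟨p, ?_⟩
    rw [hz, ← hp, hφ, aeval_apply_comm]

end

/-! ### Regular semisimple elements of `so_{2n}` -/

theorem charpoly_neg_comp {ι R : Type*} [Fintype ι] [DecidableEq ι] [CommRing R]
    (hc : Even (Fintype.card ι)) (M : Matrix ι ι R) :
    (-M).charpoly = M.charpoly.comp (-Polynomial.X) := by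
  have h1 : M.charpoly.comp (-Polynomial.X) =
      Polynomial.compRingHom (-Polynomial.X) M.charpoly := rfl
  rw [h1, Matrix.charpoly, Matrix.charpoly, RingHom.map_det]
  have h2 : (Polynomial.compRingHom (-Polynomial.X)).mapMatrix M.charmatrix =
      -(-M).charmatrix := by
    ext1 i j
    rw [RingHom.mapMatrix_apply, Matrix.map_apply, Matrix.neg_apply, Matrix.charmatrix_apply,
      Matrix.charmatrix_apply]
    by_cases h : i = j
    · subst h
      simp
      ring
    · simp [Matrix.diagonal_apply_ne _ h]
  rw [h2, Matrix.det_neg, hc.neg_one_pow, one_mul]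

theorem charpoly_comp_neg_X_of_typeD {n : ℕ} {R : Type*} [CommRing R]
    (γ : LieAlgebra.Orthogonal.typeD (Fin n) R) :
    (γ : Matrix (Fin n ⊕ Fin n) (Fin n ⊕ Fin n) R).charpoly.comp (-Polynomial.X) =
      (γ : Matrix (Fin n ⊕ Fin n) (Fin n ⊕ Fin n) R).charpoly := by
  obtain ⟨M, hM⟩ : ∃ M, M = (γ : Matrix (Fin n ⊕ Fin n) (Fin n ⊕ Fin n) R) := ⟨_, rfl⟩
  have h := mem_typeD.1 γ.2
  rw [← hM, Matrix.transpose_mul, JD_transpose] at h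
  rw [← hM, ← charpoly_neg_comp (by simp), ← Matrix.charpoly_transpose M]
  have h1 : M.transpose = LieAlgebra.Orthogonal.JD (Fin n) R *
      (-M * LieAlgebra.Orthogonal.JD (Fin n) R) := by
    rw [← mul_assoc, Matrix.mul_neg, ← h, mul_assoc, JD_mul_JD, mul_one]
  rw [h1, Matrix.charpoly_mul_comm, mul_assoc, JD_mul_JD, mul_one]

open Classical in
theorem aeval_gcd_apply {K V : Type*} [Field K] [AddCommGroup V] [Module K V]
    {Γ : Module.End K V} {p q : K[X]} {u : V} (hp : aeval Γ p u = 0) (hq : aeval Γ q u = 0) :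
    aeval Γ (EuclideanDomain.gcd p q) u = 0 := by
  rw [EuclideanDomain.gcd_eq_gcd_ab, map_add, mul_comm p, mul_comm q, map_mul, map_mul,
    LinearMap.add_apply, Module.End.mul_apply, Module.End.mul_apply, hp, hq, map_zero, map_zero,
    add_zero]

theorem finrank_range_le_natDegree {K V : Type*} [Field K] [AddCommGroup V] [Module K V]
    [FiniteDimensional K V] {Γ : Module.End K V} {g : K[X]} (hg : g ≠ 0) {v : V}
    (hv : aeval Γ g (Γ v) = 0) (hcyc : ∀ x, ∃ p : K[X], Γ x = aeval Γ p (Γ v)) :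
    Module.finrank K (LinearMap.range Γ) ≤ g.natDegree := by
  obtain ⟨φ, hφ⟩ : ∃ φ : Polynomial.degreeLT K g.natDegree →ₗ[K] LinearMap.range Γ,
      ∀ p, (φ p : V) = aeval Γ p.1 (Γ v) :=
    ⟨LinearMap.codRestrict _ (((LinearMap.applyₗ (Γ v)).comp (aeval Γ).toLinearMap).comp
      (Polynomial.degreeLT K g.natDegree).subtype) fun p =>
        ⟨aeval Γ p.1 v, (aeval_apply_comm _ _).symm⟩, fun _ => rfl⟩
  have hsurj : Function.Surjective φ := by
    rintro ⟨_, x, rfl⟩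
    obtain ⟨p, hp⟩ := hcyc x
    refine ⟨⟨p % g, ?_⟩, Subtype.ext ?_⟩
    · rw [Polynomial.mem_degreeLT, ← Polynomial.degree_eq_natDegree hg]
      exact EuclideanDomain.mod_lt p hg
    · rw [hφ]
      change aeval Γ (p % g) (Γ v) = Γ x
      rw [hp]
      conv_rhs => rw [← EuclideanDomain.div_add_mod p g]
      rw [mul_comm, map_add, LinearMap.add_apply, map_mul, Module.End.mul_apply, hv, map_zero,
        zero_add]
  have h1 := LinearMap.finrank_le_finrank_of_surjective hsurj
  rwa [(Polynomial.degreeLTEquiv K g.natDegree).finrank_eq, Module.finrank_pi,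
    Fintype.card_fin] at h1

-- By semisimplicity the multiplicity `N` of the root `0` is the dimension of the kernel, so the
-- cyclic range has dimension `deg q`. A proper divisor of `q` that kills `Γ v` would bound this
-- dimension by a smaller degree, hence the annihilator of `Γ v` is exactly `(q)`.
open Classical in
theorem exists_cyclic_vector_of_commutant {K V : Type*} [Field K] [AddCommGroup V] [Module K V]
    [FiniteDimensional K V] {B : LinearMap.BilinForm K V} {Γ : Module.End K V} {n : ℕ}
    (h2 : (2 : K) ≠ 0) (hB : B.Nondegenerate)
    (hBs : ∀ x y, B x y = B y x) (hΓ : ∀ x y, B (Γ x) y = -B x (Γ y)) (hss : Γ.IsSemisimple)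
    (hn : Module.finrank K V = 2 * n)
    (hZ : ∀ Z : Submodule K (Module.End K V),
      (∀ A ∈ Z, (∀ x, A (Γ x) = Γ (A x)) ∧ ∀ x y, B (A x) y = -B x (A y)) →
      Module.finrank K Z ≤ n)
    {N : ℕ} {q : K[X]} (hχ : LinearMap.charpoly Γ = Polynomial.X ^ N * q)
    (heven : (LinearMap.charpoly Γ).comp (-Polynomial.X) = LinearMap.charpoly Γ)
    (hq : q.coeff 0 ≠ 0) :
    (N = 0 ∨ N = 2) ∧ Module.finrank K (LinearMap.ker Γ) = N ∧ Squarefree q ∧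
      q.comp (-Polynomial.X) = q ∧ ∃ v, (∀ p : K[X], aeval Γ p (Γ v) = 0 ↔ q ∣ p) ∧
        ∀ x, ∃ p : K[X], Γ x = aeval Γ p (Γ v) := by
  have hq0 : q ≠ 0 := by rintro rfl; simp at hq
  have htd : (Polynomial.X ^ N * q).natTrailingDegree = N := by
    have h0 := Polynomial.natTrailingDegree_eq_zero_of_constantCoeff_ne_zero
      (p := q) (by simpa using hq)
    rw [mul_comm, Polynomial.natTrailingDegree_mul_X_pow hq0, h0, zero_add]
  have hker : Module.finrank K (LinearMap.ker Γ) = N := by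
    rw [← htd, ← hχ, ← LinearMap.finrank_maxGenEigenspace_zero_eq,
      (Module.End.isFinitelySemisimple_iff_isSemisimple.mpr hss).maxGenEigenspace_eq_eigenspace,
      Module.End.eigenspace_zero]
  rw [hχ, Polynomial.mul_comp, Polynomial.X_pow_comp, neg_pow, mul_comm ((-1) ^ N), mul_assoc]
    at heven
  have heven' := mul_left_cancel₀ (pow_ne_zero N Polynomial.X_ne_zero) heven
  have hN : Even N := by
    by_contra hodd
    rw [Nat.not_even_iff_odd] at hodd
    rw [hodd.neg_one_pow] at heven'
    have h1 := congrArg (fun p => Polynomial.coeff p 0) heven'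
    simp only [neg_mul, one_mul, Polynomial.coeff_neg, coeff_comp_neg_X, pow_zero, one_mul] at h1
    have h3 : 2 * q.coeff 0 = 0 := by linear_combination -h1
    exact hq ((mul_eq_zero.1 h3).resolve_left h2)
  rw [hN.neg_one_pow, one_mul] at heven'
  obtain ⟨hk2, v, hv, hcyc⟩ := range_le_of_commutant h2 hB hBs hΓ hss hn (by rw [hker]; exact hN)
    hZ
  have hmon : (Polynomial.X ^ N * q).Monic := hχ ▸ LinearMap.charpoly_monic Γ
  have hdegq : q.natDegree + N = 2 * n := by
    have h1 := LinearMap.charpoly_natDegree Γ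
    rw [hχ, Polynomial.natDegree_mul (pow_ne_zero N Polynomial.X_ne_zero) hq0,
      Polynomial.natDegree_X_pow, hn] at h1
    omega
  have hdisj := Submodule.disjoint_def.1 (isCompl_ker_range hss).disjoint
  have hpow : ∀ k x, Γ ((Γ ^ k) (Γ x)) = 0 → Γ x = 0 := by
    intro k
    induction k with
    | zero => intro x hx; exact hdisj _ hx ⟨x, rfl⟩
    | succ k ih =>
      intro x hx
      rw [pow_succ, Module.End.mul_apply] at hx
      exact hdisj _ (LinearMap.mem_ker.2 (ih (Γ x) hx)) ⟨x, rfl⟩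
  have hqv : aeval Γ q (Γ v) = 0 := by
    have h1 := LinearMap.congr_fun (LinearMap.aeval_self_charpoly Γ) (Γ v)
    rw [hχ, map_mul, map_pow, Polynomial.aeval_X, Module.End.mul_apply, aeval_apply_comm,
      LinearMap.zero_apply] at h1
    rw [aeval_apply_comm]
    exact hpow N _ (by rw [h1, map_zero])
  have hann : ∀ p : K[X], aeval Γ p (Γ v) = 0 → q ∣ p := by
    intro p hp
    have h1 := aeval_gcd_apply hp hqv
    have hgdvd := EuclideanDomain.gcd_dvd_right p q
    have hg0 : EuclideanDomain.gcd p q ≠ 0 := fun h => hq0 (by rwa [h, zero_dvd_iff] at hgdvd)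
    have h3 := finrank_range_le_natDegree hg0 h1 hcyc
    have h4 := LinearMap.finrank_range_add_finrank_ker Γ
    have h5 : Associated (EuclideanDomain.gcd p q) q := by
      obtain ⟨r, hr⟩ := hgdvd
      have hr0 : r ≠ 0 := by rintro rfl; rw [mul_zero] at hr; exact hq0 hr
      have h6 := congrArg Polynomial.natDegree hr
      rw [Polynomial.natDegree_mul hg0 hr0] at h6
      have h7 : r.natDegree = 0 := by omega
      have h8 : IsUnit r := by
        rw [Polynomial.eq_C_of_natDegree_eq_zero h7] at hr0 ⊢
        exact Polynomial.isUnit_C.2 (isUnit_iff_ne_zero.2 (by simpa using hr0))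
      exact ⟨h8.unit, hr.symm⟩
    exact h5.dvd_iff_dvd_left.1 (EuclideanDomain.gcd_dvd_left p q)
  refine ⟨?_, hker, ?_, heven', v, fun p => ⟨hann p, ?_⟩, hcyc⟩
  · rw [hker] at hk2
    obtain ⟨k, hk⟩ := hN
    omega
  · refine (hss.minpoly_squarefree).squarefree_of_dvd (hann _ ?_)
    rw [minpoly.aeval]; rfl
  · rintro ⟨r, rfl⟩
    rw [mul_comm, map_mul, Module.End.mul_apply, hqv, map_zero]

/-! ### Regular semisimple elements over `ℂ⸨X⸩`. -/

section

variable {n : ℕ} (γ : LieAlgebra.Orthogonal.typeD (Fin n) ℂ⸨X⸩)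

theorem stdB_nondegenerate : (stdB n).Nondegenerate := by
  refine Matrix.Nondegenerate.toBilin' (Matrix.nondegenerate_of_det_ne_zero fun h => ?_)
  have h1 := congrArg Matrix.det (JD_mul_JD n ℂ⸨X⸩)
  rw [Matrix.det_mul, h, zero_mul, Matrix.det_one] at h1
  exact zero_ne_one h1

theorem mem_typeD_of_skew {A : Module.End ℂ⸨X⸩ (Fin n ⊕ Fin n → ℂ⸨X⸩)}
    (hA : ∀ x y, stdB n (A x) y = -stdB n x (A y)) :
    LinearMap.toMatrix' A ∈ LieAlgebra.Orthogonal.typeD (Fin n) ℂ⸨X⸩ := by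
  rw [mem_typeD]
  have h1 : ∀ i j, (LieAlgebra.Orthogonal.JD (Fin n) ℂ⸨X⸩ * LinearMap.toMatrix' A) i j =
      stdB n (Pi.single i 1) (A (Pi.single j 1)) := by
    intro i j
    rw [stdB_apply, ← Matrix.toLin'_toMatrix' A, Matrix.toLin'_apply, Matrix.mulVec_mulVec,
      LinearMap.toMatrix'_toLin', single_one_dotProduct, Matrix.mulVec_single_one]
    rfl
  ext1 i j
  rw [Matrix.transpose_apply, Matrix.neg_apply, h1, h1, stdB_symm, hA]

theorem finrank_le_of_regular (hγ : IsRegularSemisimple γ)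
    (Z : Submodule ℂ⸨X⸩ (Module.End ℂ⸨X⸩ (Fin n ⊕ Fin n → ℂ⸨X⸩)))
    (hZ : ∀ A ∈ Z, (∀ x, A (Matrix.toLin' (γ : Matrix (Fin n ⊕ Fin n) (Fin n ⊕ Fin n) ℂ⸨X⸩) x) =
      Matrix.toLin' (γ : Matrix (Fin n ⊕ Fin n) (Fin n ⊕ Fin n) ℂ⸨X⸩) (A x)) ∧
      ∀ x y, stdB n (A x) y = -stdB n x (A y)) :
    Module.finrank ℂ⸨X⸩ Z ≤ n := by
  obtain ⟨f, hf⟩ : ∃ f : Z →ₗ[ℂ⸨X⸩] LinearMap.ker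
      (LieAlgebra.ad ℂ⸨X⸩ (LieAlgebra.Orthogonal.typeD (Fin n) ℂ⸨X⸩) γ),
      ∀ A, ((f A).1 : Matrix (Fin n ⊕ Fin n) (Fin n ⊕ Fin n) ℂ⸨X⸩) =
        LinearMap.toMatrix' (A : Module.End ℂ⸨X⸩ (Fin n ⊕ Fin n → ℂ⸨X⸩)) := by
    refine ⟨⟨⟨fun A => ⟨⟨LinearMap.toMatrix' A.1, mem_typeD_of_skew (hZ A A.2).2⟩, ?_⟩, ?_⟩, ?_⟩,
      fun A => rfl⟩
    · rw [LinearMap.mem_ker, LieAlgebra.ad_apply]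
      refine Subtype.ext ?_
      change (γ : Matrix (Fin n ⊕ Fin n) (Fin n ⊕ Fin n) ℂ⸨X⸩) * LinearMap.toMatrix' A.1 -
        LinearMap.toMatrix' A.1 * (γ : Matrix (Fin n ⊕ Fin n) (Fin n ⊕ Fin n) ℂ⸨X⸩) = 0
      rw [sub_eq_zero]
      refine Matrix.toLin'.injective (LinearMap.ext fun x => ?_)
      rw [Matrix.toLin'_mul, Matrix.toLin'_mul, Matrix.toLin'_toMatrix']
      exact ((hZ A A.2).1 x).symm
    · intro A A'
      refine Subtype.ext (Subtype.ext ?_)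
      exact map_add LinearMap.toMatrix' A.1 A'.1
    · intro c A
      refine Subtype.ext (Subtype.ext ?_)
      exact map_smul LinearMap.toMatrix' c A.1
  have hinj : Function.Injective f := by
    intro A A' h
    refine Subtype.ext (LinearMap.toMatrix'.injective ?_)
    rw [← hf, ← hf, h]
  exact (LinearMap.finrank_le_finrank_of_injective hinj).trans_eq hγ.2

theorem two_ne_zero_laurent : (2 : ℂ⸨X⸩) ≠ 0 := by
  rw [← map_ofNat (HahnSeries.C (Γ := ℤ) (R := ℂ)) 2]
  exact (_root_.map_ne_zero _).2 two_ne_zero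

theorem exists_cyclic_vector (hγ : IsRegularSemisimple γ)
    {Γ : Module.End ℂ⸨X⸩ (Fin n ⊕ Fin n → ℂ⸨X⸩)}
    (hΓ : Γ = Matrix.toLin' (γ : Matrix (Fin n ⊕ Fin n) (Fin n ⊕ Fin n) ℂ⸨X⸩))
    {N : ℕ} {q : ℂ⸨X⸩[X]}
    (hχ : (γ : Matrix (Fin n ⊕ Fin n) (Fin n ⊕ Fin n) ℂ⸨X⸩).charpoly = Polynomial.X ^ N * q)
    (hq : q.coeff 0 ≠ 0) :
    (N = 0 ∨ N = 2) ∧ Module.finrank ℂ⸨X⸩ (LinearMap.ker Γ) = N ∧ Squarefree q ∧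
      q.comp (-Polynomial.X) = q ∧ ∃ v, (∀ p : ℂ⸨X⸩[X], aeval Γ p (Γ v) = 0 ↔ q ∣ p) ∧
        ∀ x, ∃ p : ℂ⸨X⸩[X], Γ x = aeval Γ p (Γ v) := by
  have hskew : ∀ x y, stdB n (Γ x) y = -stdB n x (Γ y) := fun x y => by
    rw [hΓ]; exact stdB_skew γ x y
  have hcharp : LinearMap.charpoly Γ =
      (γ : Matrix (Fin n ⊕ Fin n) (Fin n ⊕ Fin n) ℂ⸨X⸩).charpoly := by
    rw [hΓ]; exact Matrix.charpoly_toLin' _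
  have hdim : Module.finrank ℂ⸨X⸩ (Fin n ⊕ Fin n → ℂ⸨X⸩) = 2 * n := by
    rw [Module.finrank_pi, Fintype.card_sum, Fintype.card_fin]; ring
  exact exists_cyclic_vector_of_commutant two_ne_zero_laurent stdB_nondegenerate (stdB_symm n)
    hskew (hΓ ▸ hγ.1) hdim
    (fun Z hZ => finrank_le_of_regular γ hγ Z (by rw [← hΓ]; exact hZ)) (hcharp.trans hχ)
    (by rw [hcharp]; exact charpoly_comp_neg_X_of_typeD γ) hq

end

/-! ### Characteristic polynomials of topologically nilpotent matrices -/

theorem ordGE_one_mem_nhds : {x : ℂ⸨X⸩ | OrdGE x 1} ∈ nhds (0 : ℂ⸨X⸩) := by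
  have h := (Valued.isOpen_ball (R := ℂ⸨X⸩) (1 : MonoidWithZeroHom.ValueGroup₀
    (.ofClass (Valued.v : Valuation ℂ⸨X⸩ _)))).mem_nhds (x := 0) (by simp)
  refine Filter.mem_of_superset h fun x hx => ?_
  have hx' : Valued.v x < 1 := (Valuation.restrict_lt_one_iff _).1 hx
  intro k hk
  have hle : Valued.v x ≤ WithZero.exp (-1 : ℤ) := by
    rcases eq_or_ne (Valued.v x) 0 with h0 | h0
    · rw [h0]; exact zero_le
    · rw [← WithZero.exp_zero, ← WithZero.log_lt_iff_lt_exp h0] at hx'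
      rw [← WithZero.exp_log h0, WithZero.exp_le_exp]
      omega
  exact (LaurentSeries.valuation_le_iff_coeff_lt_eq_zero ℂ).1 hle k (by exact_mod_cast hk)

section

variable {ι : Type*} [Fintype ι] [DecidableEq ι]

theorem exists_forall_ordGE_pow {M : Matrix ι ι ℂ⸨X⸩} (hM : IsTopologicallyNilpotent M) :
    ∃ k0, ∀ k ≥ k0, ∀ i j, OrdGE ((M ^ k) i j) 1 := by
  have h1 : ∀ i j, ∀ᶠ k in Filter.atTop, OrdGE ((M ^ k) i j) 1 := by
    intro i j
    have h2 := tendsto_pi_nhds.1 (tendsto_pi_nhds.1 hM i) j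
    exact h2 ordGE_one_mem_nhds
  have h2 := Filter.eventually_all.2 fun i => Filter.eventually_all.2 (h1 i)
  exact Filter.eventually_atTop.1 h2

theorem charpoly_mul_self_comp {R : Type*} [CommRing R] (M : Matrix ι ι R) :
    (M * M).charpoly.comp (Polynomial.X ^ 2) = M.charpoly * (-M).charpoly := by
  have h1 : (M * M).charpoly.comp (Polynomial.X ^ 2) =
      Polynomial.compRingHom (Polynomial.X ^ 2) (M * M).charpoly := rfl
  rw [h1, Matrix.charpoly, Matrix.charpoly, Matrix.charpoly, RingHom.map_det, ← Matrix.det_mul]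
  congr 1
  have h2 : (Polynomial.compRingHom (Polynomial.X ^ 2)).mapMatrix (M * M).charmatrix =
      Matrix.scalar ι (Polynomial.X ^ 2 : R[X]) - Polynomial.C.mapMatrix (M * M) := by
    ext1 i j
    rw [RingHom.mapMatrix_apply, Matrix.map_apply, Matrix.charmatrix_apply, Matrix.sub_apply]
    by_cases h : i = j
    · subst h
      simp
    · simp [h]
  rw [h2, Matrix.charmatrix, Matrix.charmatrix, map_neg, sub_neg_eq_add, sub_mul, mul_add,
    mul_add, ← map_mul, ← map_mul, (Matrix.scalar_commute (Polynomial.X : R[X])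
      (fun _ => Commute.all _ _) (Polynomial.C.mapMatrix M)).eq, pow_two]
  abel

theorem charpoly_mod_step (hc : Even (Fintype.card ι)) {M : Matrix ι ι ℂ⸨X⸩} {P Q : ℂ⟦X⟧[X]}
    (hP : P.map (algebraMap ℂ⟦X⟧ ℂ⸨X⸩) = M.charpoly)
    (hQ : Q.map (algebraMap ℂ⟦X⟧ ℂ⸨X⸩) = (M * M).charpoly)
    (hQX : Q.map (PowerSeries.constantCoeff (R := ℂ)) = Polynomial.X ^ Fintype.card ι) :
    P.map (PowerSeries.constantCoeff (R := ℂ)) = Polynomial.X ^ Fintype.card ι := by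
  have h1 : Q.comp (Polynomial.X ^ 2) = P * P.comp (-Polynomial.X) := by
    refine Polynomial.map_injective _ algebraMap_injective ?_
    rw [Polynomial.map_comp, hQ, Polynomial.map_mul, Polynomial.map_comp, hP, Polynomial.map_pow,
      Polynomial.map_X, Polynomial.map_neg, Polynomial.map_X, ← charpoly_neg_comp hc]
    exact charpoly_mul_self_comp M
  have h2 := congrArg (Polynomial.map (PowerSeries.constantCoeff (R := ℂ))) h1
  rw [Polynomial.map_comp, hQX, Polynomial.map_mul, Polynomial.map_pow, Polynomial.map_X,
    Polynomial.X_pow_comp, ← pow_mul] at h2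
  have hPm : P.Monic := by
    refine Polynomial.monic_of_injective algebraMap_injective ?_
    rw [hP]; exact M.charpoly_monic
  obtain ⟨i, -, hi⟩ := (dvd_prime_pow Polynomial.prime_X _).1 ⟨_, h2⟩
  have h3 := Polynomial.eq_of_monic_of_associated (hPm.map _) (Polynomial.monic_X_pow i) hi
  have h4 : P.natDegree = Fintype.card ι := by
    rw [← Polynomial.natDegree_map_eq_of_injective algebraMap_injective, hP,
      Matrix.charpoly_natDegree_eq_dim]
  have h5 := congrArg Polynomial.natDegree h3
  rw [hPm.natDegree_map, Polynomial.natDegree_X_pow, h4] at h5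
  rw [h3, h5]

theorem exists_lift_charpoly_mul_self (hc : Even (Fintype.card ι)) {M : Matrix ι ι ℂ⸨X⸩}
    {P : ℂ⟦X⟧[X]} (hP : P.map (algebraMap ℂ⟦X⟧ ℂ⸨X⸩) = M.charpoly) :
    ∃ Q : ℂ⟦X⟧[X], Q.map (algebraMap ℂ⟦X⟧ ℂ⸨X⸩) = (M * M).charpoly := by
  refine exists_lift_of_ordGE fun i => ?_
  have h1 : (M * M).charpoly.comp (Polynomial.X ^ 2) =
      (P * P.comp (-Polynomial.X)).map (algebraMap ℂ⟦X⟧ ℂ⸨X⸩) := by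
    rw [Polynomial.map_mul, Polynomial.map_comp, hP, Polynomial.map_neg, Polynomial.map_X,
      ← charpoly_neg_comp hc]
    exact charpoly_mul_self_comp M
  rw [← Polynomial.coeff_expand_mul two_pos, Polynomial.expand_eq_comp_X_pow, h1,
    Polynomial.coeff_map]
  exact ordGE_algebraMap _

/-- After enough squarings the entries are divisible by `t`. The result descends through `χ_{M²}(λ²)
= χ_M(λ) χ_{-M}(λ)`: a monic factor of a power of `λ` modulo `t` is itself a power of `λ`. -/
theorem charpoly_mod_eq_X_pow (hc : Even (Fintype.card ι)) (j : ℕ) {M : Matrix ι ι ℂ⸨X⸩}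
    (hM : ∀ i k, OrdGE ((M ^ 2 ^ j) i k) 1) {P : ℂ⟦X⟧[X]}
    (hP : P.map (algebraMap ℂ⟦X⟧ ℂ⸨X⸩) = M.charpoly) :
    P.map (PowerSeries.constantCoeff (R := ℂ)) = Polynomial.X ^ Fintype.card ι := by
  induction j generalizing M P with
  | zero =>
    rw [pow_zero, pow_one] at hM
    have h1 : ∀ i k, ∃ p : ℂ⟦X⟧, algebraMap ℂ⟦X⟧ ℂ⸨X⸩ p = M i k := fun i k =>
      ordGE_zero_iff.1 ((hM i k).mono zero_le_one)
    choose A hA using h1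
    have h2 : (Matrix.of A).map (algebraMap ℂ⟦X⟧ ℂ⸨X⸩) = M := by
      ext1 i k; exact hA i k
    have h3 : (Matrix.of A).map (PowerSeries.constantCoeff (R := ℂ)) = 0 := by
      ext1 i k
      change PowerSeries.constantCoeff (A i k) = 0
      rw [← coeff_zero_algebraMap, hA]
      exact (hM i k).coeff_zero
    have h4 : P = (Matrix.of A).charpoly := by
      refine Polynomial.map_injective _ algebraMap_injective ?_
      rw [hP, ← Matrix.charpoly_map, h2]
    rw [h4, ← Matrix.charpoly_map, h3, Matrix.charpoly_zero]
  | succ j ih =>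
    obtain ⟨Q, hQ⟩ := exists_lift_charpoly_mul_self hc hP
    refine charpoly_mod_step hc hP hQ (ih (fun i k => ?_) hQ)
    rw [← sq, ← pow_mul, ← pow_succ']
    exact hM i k

theorem charpoly_mod_of_isTopologicallyNilpotent (hc : Even (Fintype.card ι))
    {M : Matrix ι ι ℂ⸨X⸩} (hM : IsTopologicallyNilpotent M) {P : ℂ⟦X⟧[X]}
    (hP : P.map (algebraMap ℂ⟦X⟧ ℂ⸨X⸩) = M.charpoly) :
    P.map (PowerSeries.constantCoeff (R := ℂ)) = Polynomial.X ^ Fintype.card ι := by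
  obtain ⟨k, hk⟩ := exists_forall_ordGE_pow hM
  exact charpoly_mod_eq_X_pow hc k (hk _ Nat.lt_two_pow_self.le) hP

end

/-! ### Slopes of polynomials -/

theorem OrdGE.sum_coeff {α : Type*} {s : Finset α} {f : α → ℂ⸨X⸩} (k : ℤ) :
    (∑ i ∈ s, f i).coeff k = ∑ i ∈ s, (f i).coeff k := by
  simp

/-- The coefficient at the last vertex of lowest weight does not cancel in a product. -/
theorem exists_extremal {p : ℂ⸨X⸩[X]} (hp : p ≠ 0) (r : ℚ) :
    ∃ (i : ℕ) (k : ℤ), OrdEq (p.coeff i) k ∧ (∀ j, OrdGE (p.coeff j) (k + i * r - j * r)) ∧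
      ∀ j, i < j → OrdGT (p.coeff j) (k + i * r - j * r) := by
  classical
  obtain ⟨o, ho⟩ : ∃ o : ℕ → ℤ, ∀ i ∈ p.support, OrdEq (p.coeff i) (o i) :=
    ⟨fun i => (p.coeff i).order, fun i hi => ordEq_order (Polynomial.mem_support_iff.1 hi)⟩
  obtain ⟨i, hi, hmin⟩ := Finset.exists_min_image p.support
    (fun i => toLex ((o i + i * r : ℚ), -(i : ℤ))) (Polynomial.support_nonempty.2 hp)
  have key : ∀ j, p.coeff j ≠ 0 → (o i + i * r : ℚ) < o j + j * r ∨
      (o i + i * r : ℚ) = o j + j * r ∧ j ≤ i := by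
    intro j hj
    have h := hmin j (Polynomial.mem_support_iff.2 hj)
    rw [Prod.Lex.toLex_le_toLex] at h
    rcases h with h | ⟨h, h'⟩
    · exact Or.inl h
    · exact Or.inr ⟨h, by simpa using h'⟩
  refine ⟨i, o i, ho i hi, fun j => ?_, fun j hj => ?_⟩
  · by_cases h0 : p.coeff j = 0
    · rw [h0]; exact OrdGE.zero _
    · refine (ho j (Polynomial.mem_support_iff.2 h0)).1.mono ?_
      rcases key j h0 with h | ⟨h, -⟩ <;> linarith
  · by_cases h0 : p.coeff j = 0
    · rw [h0]; exact OrdGT.zero _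
    · refine (ho j (Polynomial.mem_support_iff.2 h0)).1.gt ?_
      rcases key j h0 with h | ⟨h, h'⟩
      · linarith
      · omega

theorem OrdGT.mul {x y : ℂ⸨X⸩} {r s : ℚ} (hx : OrdGT x r) (hy : OrdGE y s) :
    OrdGT (x * y) (r + s) := by
  intro k hk
  rw [HahnSeries.coeff_mul]
  refine Finset.sum_eq_zero fun ij hij => ?_
  have h := (Finset.mem_antidiagonal.1 hij).2.2
  by_cases h1 : (ij.1 : ℚ) ≤ r
  · simp [hx _ h1]
  · have : (ij.2 : ℚ) < s := by
      have : (ij.1 : ℚ) + ij.2 = k := by exact_mod_cast h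
      linarith [not_le.1 h1]
    simp [hy _ this]

/-- Give `λ^j` the weight `j r` and `t` the weight `1`. The product of the two last vertices of
lowest weight does not cancel, so their weights add up to at least `deg(p s) r`; each is at most the
weight of the monic top term of its polynomial, so both are equalities. -/
theorem slope_of_mul {p s : ℂ⸨X⸩[X]} (hp : p.Monic) (hs : s.Monic) {r : ℚ}
    (h : ∀ k, OrdGE ((p * s).coeff k) ((p * s).natDegree * r - k * r)) (i : ℕ) :
    OrdGE (p.coeff i) (p.natDegree * r - i * r) := by
  obtain ⟨i0, a, ha, hge, hgt⟩ := exists_extremal hp.ne_zero r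
  obtain ⟨j0, b, hb, hge', hgt'⟩ := exists_extremal hs.ne_zero r
  have hco : ((p * s).coeff (i0 + j0)).coeff (a + b) ≠ 0 := by
    rw [Polynomial.coeff_mul, OrdGE.sum_coeff, Finset.sum_eq_single (i0, j0)]
    · exact (ha.mul hb).2
    · rintro ⟨i, j⟩ hij hne
      rw [Finset.HasAntidiagonal.mem_antidiagonal] at hij
      simp only at hij ⊢
      have e : (i : ℚ) + j = i0 + j0 := by exact_mod_cast hij
      have e' : (i : ℚ) * r + j * r = i0 * r + j0 * r := by rw [← add_mul, e, add_mul]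
      rcases lt_trichotomy i i0 with h1 | h1 | h1
      · rw [mul_comm]
        refine ((hgt' j (by omega)).mul (hge i)) _ ?_
        push_cast
        linarith
      · exact absurd (Prod.ext h1 (by simp; omega)) hne
      · refine ((hgt i h1).mul (hge' j)) _ ?_
        push_cast
        linarith
    · intro h1
      exact absurd ((Finset.HasAntidiagonal.mem_antidiagonal (n := i0 + j0) (a := (i0, j0))).2 rfl) h1
  have hdeg : ((p * s).natDegree : ℚ) = p.natDegree + s.natDegree := by
    rw [hp.natDegree_mul hs]; push_cast; ring
  have h1 : ((p * s).natDegree : ℚ) * r - (i0 + j0 : ℕ) * r ≤ (a + b : ℤ) := by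
    by_contra hlt
    exact hco (h (i0 + j0) _ (not_le.1 hlt))
  have htop : ∀ {g : ℂ⸨X⸩[X]} {c : ℚ} {m : ℕ}, g.Monic →
      OrdGE (g.coeff g.natDegree) (c + m * r - g.natDegree * r) →
      c + m * r ≤ g.natDegree * r := by
    intro g c m hg h2
    rw [Polynomial.coeff_natDegree, hg.leadingCoeff] at h2
    have := ordEq_one.le_of_ordGE h2
    push_cast at this
    linarith
  have h2 := htop hp (hge _)
  have h3 := htop hs (hge' _)
  refine (hge i).mono ?_
  push_cast at h1
  rw [hdeg] at h1
  linarith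

/-- A factor of a polynomial with a single slope has that slope. -/
theorem ordEq_coeff_zero_of_mul {p s : ℂ⸨X⸩[X]} (hp : p.Monic) (hs : s.Monic) {r : ℚ} {m : ℤ}
    (h : ∀ k, OrdGE ((p * s).coeff k) ((p * s).natDegree * r - k * r))
    (h0 : OrdEq ((p * s).coeff 0) m) (hm : (m : ℚ) = (p * s).natDegree * r) :
    ∃ k : ℤ, OrdEq (p.coeff 0) k ∧ (k : ℚ) = p.natDegree * r := by
  have hne := h0.ne_zero
  rw [Polynomial.mul_coeff_zero] at hne h0
  obtain ⟨k, hk⟩ := exists_ordEq (left_ne_zero_of_mul hne)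
  obtain ⟨l, hl⟩ := exists_ordEq (right_ne_zero_of_mul hne)
  have h1 := hk.le_of_ordGE (slope_of_mul hp hs h 0)
  have h2 := hl.le_of_ordGE (slope_of_mul hs hp (r := r) (by rw [mul_comm s]; exact h) 0)
  have h3 : k + l = m := (hk.mul hl).unique h0
  have h4 : (k : ℚ) + l = m := by exact_mod_cast h3
  rw [hp.natDegree_mul hs] at hm
  push_cast at hm
  refine ⟨k, hk, ?_⟩
  simp only [Nat.cast_zero, zero_mul, sub_zero] at h1 h2
  linarith

/-! ### The discriminant of the kernel -/

section

variable {K : Type*} [Field K]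

/-- A non-zero entry `M i0 j` gives an invertible `2 × 2` block of determinant `(M i0 j)²`, and the
Schur complement of this block is again skew. -/
theorem isSquare_det_fin_of_skew (h2 : (2 : K) ≠ 0) (m : ℕ) (M : Matrix (Fin m) (Fin m) K)
    (hM : M.transpose = -M) : IsSquare M.det := by
  induction m using Nat.strong_induction_on with
  | _ m ih =>
  have hentry : ∀ i j, M j i = -M i j := fun i j => by
    have := congrFun (congrFun hM i) j
    simpa using this
  rcases Nat.eq_zero_or_pos m with rfl | hpos
  · rw [Matrix.det_isEmpty]; exact IsSquare.one
  obtain ⟨i0, hi0⟩ : ∃ i0 : Fin m, (i0 : ℕ) = 0 := ⟨⟨0, hpos⟩, rfl⟩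
  by_cases hrow : ∀ j, M i0 j = 0
  · rw [Matrix.det_eq_zero_of_row_eq_zero i0 hrow]; exact IsSquare.zero
  push Not at hrow
  obtain ⟨j, hj⟩ := hrow
  have hdiag : ∀ i, M i i = 0 := fun i => by
    have h3 := hentry i i
    have h4 : 2 * M i i = 0 := by linear_combination h3
    exact (mul_eq_zero.1 h4).resolve_left h2
  have hji : j ≠ i0 := by rintro rfl; exact hj (hdiag _)
  obtain ⟨k, rfl⟩ : ∃ k, m = 2 + k := by
    have : (j : ℕ) ≠ (i0 : ℕ) := fun h => hji (Fin.ext h)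
    exact ⟨m - 2, by omega⟩
  obtain ⟨e, he⟩ : ∃ e : Fin 2 ⊕ Fin k ≃ Fin (2 + k),
      e = finSumFinEquiv.trans (Equiv.swap (finSumFinEquiv (Sum.inl 1)) j) := ⟨_, rfl⟩
  have he0 : e (Sum.inl 0) = i0 := by
    have h3 : finSumFinEquiv (Sum.inl 0 : Fin 2 ⊕ Fin k) = i0 := Fin.ext (by simp [hi0])
    rw [he, Equiv.trans_apply, h3, Equiv.swap_apply_of_ne_of_ne _ hji.symm]
    intro h4
    have := congrArg Fin.val h4
    simp [hi0] at this
  have he1 : e (Sum.inl 1) = j := by rw [he, Equiv.trans_apply, Equiv.swap_apply_left]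
  obtain ⟨M', hM'⟩ : ∃ M', M' = M.submatrix e e := ⟨_, rfl⟩
  have hM't : M'.transpose = -M' := by
    ext x y
    rw [hM', Matrix.transpose_apply, Matrix.neg_apply, Matrix.submatrix_apply,
      Matrix.submatrix_apply, hentry]
  rw [← Matrix.det_submatrix_equiv_self e M, ← hM', ← Matrix.fromBlocks_toBlocks M']
  rw [← Matrix.fromBlocks_toBlocks M', Matrix.fromBlocks_transpose, Matrix.fromBlocks_neg,
    Matrix.fromBlocks_inj] at hM't
  obtain ⟨hA, hC, hB, hD⟩ := hM't
  have hAdet : M'.toBlocks₁₁.det = M i0 j * M i0 j := by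
    rw [Matrix.det_fin_two]
    have h11 : ∀ x y, M'.toBlocks₁₁ x y = M (e (Sum.inl x)) (e (Sum.inl y)) := fun x y => by
      rw [hM']; rfl
    rw [h11, h11, h11, h11, he0, he1, hdiag, hentry i0 j]
    ring
  have : Invertible M'.toBlocks₁₁ := Matrix.invertibleOfIsUnitDet _ (by
    rw [hAdet]; exact isUnit_iff_ne_zero.2 (mul_ne_zero hj hj))
  rw [Matrix.det_fromBlocks₁₁, hAdet]
  refine (IsSquare.mul_self _).mul (ih k (by omega) _ ?_)
  rw [Matrix.transpose_sub, Matrix.transpose_mul, Matrix.transpose_mul, Matrix.invOf_eq_nonsing_inv,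
    Matrix.transpose_nonsing_inv, hA, hB, hC, hD]
  have hinv : (-M'.toBlocks₁₁)⁻¹ = -(M'.toBlocks₁₁)⁻¹ := Matrix.inv_eq_right_inv (by
    rw [neg_mul_neg, ← Matrix.invOf_eq_nonsing_inv, mul_invOf_self])
  rw [hinv]
  simp only [Matrix.neg_mul, Matrix.mul_neg, neg_neg, Matrix.mul_assoc]
  abel

theorem isSquare_det_of_skew (h2 : (2 : K) ≠ 0) {ι : Type*} [Fintype ι] [DecidableEq ι]
    {M : Matrix ι ι K} (hM : M.transpose = -M) : IsSquare M.det := by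
  rw [← Matrix.det_submatrix_equiv_self (Fintype.equivFin ι).symm M]
  refine isSquare_det_fin_of_skew h2 _ _ ?_
  rw [Matrix.transpose_submatrix, hM]
  rfl

/-- `M P = 0` implies `(X - M)(X - P Q) = X (X - M - P Q)`. Take determinants, and compare the
characteristic polynomials of `P Q` and `Q P`. -/
theorem charpoly_add_mul {ι κ : Type*} [Fintype ι] [DecidableEq ι] [Fintype κ] [DecidableEq κ]
    {M : Matrix ι ι K} {P : Matrix ι κ K} (Q : Matrix κ ι K) (h : M * P = 0) :
    Polynomial.X ^ Fintype.card κ * (M + P * Q).charpoly = M.charpoly * (Q * P).charpoly := by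
  have h1 : M.charpoly * (P * Q).charpoly =
      Polynomial.X ^ Fintype.card ι * (M + P * Q).charpoly := by
    rw [Matrix.charpoly, Matrix.charpoly, Matrix.charpoly, ← Matrix.det_mul, ← Matrix.det_smul]
    congr 1
    have h3 : (Polynomial.C : K →+* K[X]).mapMatrix M * (Polynomial.C : K →+* K[X]).mapMatrix (P * Q) = 0 := by
      rw [← map_mul, ← Matrix.mul_assoc, h, Matrix.zero_mul, map_zero]
    have h4 : ∀ A : Matrix ι ι K[X], Matrix.scalar ι (Polynomial.X : K[X]) * A =
        (Polynomial.X : K[X]) • A := fun A => by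
      rw [Matrix.scalar_apply, ← Matrix.smul_eq_diagonal_mul]
    have h5 : ∀ A : Matrix ι ι K[X], A * Matrix.scalar ι (Polynomial.X : K[X]) =
        (Polynomial.X : K[X]) • A := fun A => by
      rw [← h4, (Matrix.scalar_commute (Polynomial.X : K[X]) (fun _ => Commute.all _ _) A).eq]
    rw [Matrix.charmatrix, Matrix.charmatrix, Matrix.charmatrix, map_add, sub_mul, mul_sub,
      mul_sub, h3, h4, h4, h5, smul_sub, smul_add]
    abel
  have h6 := Matrix.charpoly_mul_comm' P Q
  refine mul_left_cancel₀ (pow_ne_zero (Fintype.card ι) (Polynomial.X_ne_zero (R := K))) ?_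
  calc _ = Polynomial.X ^ Fintype.card κ *
        (Polynomial.X ^ Fintype.card ι * (M + P * Q).charpoly) := by ring
    _ = M.charpoly * (Polynomial.X ^ Fintype.card κ * (P * Q).charpoly) := by rw [← h1]; ring
    _ = _ := by rw [h6]; ring

theorem coeff_zero_charpoly_of_even {ι : Type*} [Fintype ι] [DecidableEq ι]
    (hc : Even (Fintype.card ι)) (M : Matrix ι ι K) : M.charpoly.coeff 0 = M.det := by
  rw [Matrix.det_eq_sign_charpoly_coeff, hc.neg_one_pow, one_mul]

theorem isSquare_det_mul_charpoly_coeff_zero (h2 : (2 : K) ≠ 0) {ι : Type*} [Fintype ι]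
    [DecidableEq ι] (hc : Even (Fintype.card ι)) {J A : Matrix ι ι K}
    (hA : (J * A).transpose = -(J * A)) : IsSquare (J.det * A.charpoly.coeff 0) := by
  rw [coeff_zero_charpoly_of_even hc, ← Matrix.det_mul]
  exact isSquare_det_of_skew h2 hA

/-- `A` is perturbed on its kernel by the skew map `x ↦ ⟨v, x⟩ w - ⟨w, x⟩ v`. This replaces the
factor `X²` of the characteristic polynomial by `X² + ⟨v, v⟩ ⟨w, w⟩`, and the constant term is again
governed by the determinant of a skew matrix. -/
theorem isSquare_det_mul_kernel (h2 : (2 : K) ≠ 0) {ι : Type*} [Fintype ι]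
    [DecidableEq ι] (hc : Even (Fintype.card ι)) {J A : Matrix ι ι K} (hJ : J.transpose = J)
    (hA : (J * A).transpose = -(J * A)) {q : K[X]} (hχ : A.charpoly = Polynomial.X ^ 2 * q)
    {v w : ι → K} (hv : A.mulVec v = 0) (hw : A.mulVec w = 0)
    (hvw : v ⬝ᵥ J.mulVec w = 0) :
    IsSquare (J.det * (q.coeff 0 * (v ⬝ᵥ J.mulVec v * w ⬝ᵥ J.mulVec w))) := by
  obtain ⟨P, hP⟩ : ∃ P : Matrix ι (Fin 2) K, P = Matrix.of fun i => ![w i, -v i] := ⟨_, rfl⟩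
  obtain ⟨Q, hQ⟩ : ∃ Q : Matrix (Fin 2) ι K, Q = Matrix.of ![J.mulVec v, J.mulVec w] := ⟨_, rfl⟩
  have hAP : A * P = 0 := by
    ext i j
    have h3 := congrFun hv i
    have h4 := congrFun hw i
    simp only [Matrix.mulVec, dotProduct, Pi.zero_apply] at h3 h4
    fin_cases j
    · simpa [Matrix.mul_apply, hP] using h4
    · simpa [Matrix.mul_apply, hP] using h3
  have hJP : ∀ i, (J * P) i 0 = J.mulVec w i ∧ (J * P) i 1 = -J.mulVec v i := fun i => by
    simp [Matrix.mul_apply, hP, Matrix.mulVec, dotProduct]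
  have hskew : (J * (A + P * Q)).transpose = -(J * (A + P * Q)) := by
    rw [Matrix.mul_add, Matrix.transpose_add, hA, neg_add, add_right_inj, ← Matrix.mul_assoc]
    ext i j
    rw [Matrix.transpose_apply, Matrix.neg_apply, Matrix.mul_apply, Matrix.mul_apply,
      Fin.sum_univ_two, Fin.sum_univ_two, (hJP i).1, (hJP i).2, (hJP j).1, (hJP j).2, hQ]
    simp
    ring
  have hsymm : ∀ x y : ι → K, x ⬝ᵥ J.mulVec y = y ⬝ᵥ J.mulVec x := fun x y => by
    rw [Matrix.dotProduct_mulVec, ← Matrix.mulVec_transpose, hJ, dotProduct_comm]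
  have hcol : ∀ (y : ι → K) (k), (∀ i, P i k = y i) → ∀ z : ι → K,
      ∑ i, J.mulVec z i * P i k = z ⬝ᵥ J.mulVec y := fun y k hy z => by
    rw [hsymm, dotProduct]
    exact Finset.sum_congr rfl fun i _ => by rw [hy, mul_comm]
  have h0 : ∀ i, P i 0 = w i := fun i => by simp [hP]
  have h1 : ∀ i, P i 1 = (-v) i := fun i => by simp [hP]
  have hQP : (Q * P).charpoly = Polynomial.X ^ 2 +
      Polynomial.C (v ⬝ᵥ J.mulVec v * w ⬝ᵥ J.mulVec w) := by
    have e00 : (Q * P) 0 0 = 0 := by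
      rw [Matrix.mul_apply, hQ]; exact (hcol w 0 h0 v).trans hvw
    have e01 : (Q * P) 0 1 = -(v ⬝ᵥ J.mulVec v) := by
      rw [Matrix.mul_apply, hQ]; refine (hcol (-v) 1 h1 v).trans ?_
      rw [Matrix.mulVec_neg, dotProduct_neg]
    have e10 : (Q * P) 1 0 = w ⬝ᵥ J.mulVec w := by
      rw [Matrix.mul_apply, hQ]; exact hcol w 0 h0 w
    have e11 : (Q * P) 1 1 = 0 := by
      rw [Matrix.mul_apply, hQ]; refine (hcol (-v) 1 h1 w).trans ?_
      rw [Matrix.mulVec_neg, dotProduct_neg, hsymm, hvw, neg_zero]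
    rw [Matrix.charpoly_fin_two, Matrix.trace_fin_two, Matrix.det_fin_two, e00, e01, e10, e11]
    simp
  have h3 := charpoly_add_mul Q hAP
  rw [hχ, hQP, Fintype.card_fin, mul_assoc] at h3
  have h4 := mul_left_cancel₀ (pow_ne_zero 2 (Polynomial.X_ne_zero (R := K))) h3
  have h5 := isSquare_det_mul_charpoly_coeff_zero h2 hc hskew
  rw [h4, Polynomial.mul_coeff_zero] at h5
  simpa using h5

end

theorem even_of_isSquare {x : ℂ⸨X⸩} {k : ℤ} (h : IsSquare x) (hx : OrdEq x k) : Even k := by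
  obtain ⟨y, rfl⟩ := h
  obtain ⟨l, hl⟩ := exists_ordEq (left_ne_zero_of_mul hx.ne_zero)
  exact ⟨l, hx.unique (hl.mul hl)⟩

section

variable {n : ℕ}

/-- `JD` is an involution, so its determinant is `±1`, and `-1` is a square. -/
theorem isSquare_of_isSquare_det_JD_mul {x : ℂ⸨X⸩}
    (h : IsSquare ((LieAlgebra.Orthogonal.JD (Fin n) ℂ⸨X⸩).det * x)) : IsSquare x := by
  have h4 := congrArg Matrix.det (JD_mul_JD n ℂ⸨X⸩)
  rw [Matrix.det_mul, Matrix.det_one] at h4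
  obtain ⟨y, hy⟩ := h
  obtain ⟨i, hi, -⟩ := exists_sq_eq_neg_one
  rcases mul_self_eq_one_iff.1 h4 with h5 | h5
  · exact ⟨y, by rw [← hy, h5, one_mul]⟩
  · refine ⟨i * y, ?_⟩
    have : i * y * (i * y) = i ^ 2 * (y * y) := by ring
    rw [this, hi, ← hy, h5]
    ring

theorem even_card_sum_self (n : ℕ) : Even (Fintype.card (Fin n ⊕ Fin n)) := by simp

theorem isSquare_charpoly_coeff_zero (γ : LieAlgebra.Orthogonal.typeD (Fin n) ℂ⸨X⸩) :
    IsSquare ((γ : Matrix (Fin n ⊕ Fin n) (Fin n ⊕ Fin n) ℂ⸨X⸩).charpoly.coeff 0) :=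
  isSquare_of_isSquare_det_JD_mul (isSquare_det_mul_charpoly_coeff_zero two_ne_zero_laurent
    (even_card_sum_self n) (mem_typeD.1 γ.2))

theorem isSquare_of_kernel (γ : LieAlgebra.Orthogonal.typeD (Fin n) ℂ⸨X⸩) {q : ℂ⸨X⸩[X]}
    (hχ : (γ : Matrix (Fin n ⊕ Fin n) (Fin n ⊕ Fin n) ℂ⸨X⸩).charpoly = Polynomial.X ^ 2 * q)
    {v w : Fin n ⊕ Fin n → ℂ⸨X⸩}
    (hv : Matrix.toLin' (γ : Matrix (Fin n ⊕ Fin n) (Fin n ⊕ Fin n) ℂ⸨X⸩) v = 0)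
    (hw : Matrix.toLin' (γ : Matrix (Fin n ⊕ Fin n) (Fin n ⊕ Fin n) ℂ⸨X⸩) w = 0)
    (hvw : stdB n v w = 0) : IsSquare (q.coeff 0 * (stdB n v v * stdB n w w)) := by
  rw [stdB_apply] at hvw ⊢
  rw [stdB_apply]
  exact isSquare_of_isSquare_det_JD_mul (isSquare_det_mul_kernel two_ne_zero_laurent
    (even_card_sum_self n) (JD_transpose n ℂ⸨X⸩) (mem_typeD.1 γ.2) hχ hv hw hvw)

end

/-! ### Vectors of the kernel -/

section

variable {K V : Type*} [Field K] [AddCommGroup V] [Module K V] {B : LinearMap.BilinForm K V}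

theorem exists_orthogonal_pair (h2 : (2 : K) ≠ 0) (hBs : ∀ x y, B x y = B y x)
    {W : Submodule K V} (hW : Module.finrank K W = 2)
    (hnd : ∀ x ∈ W, (∀ y ∈ W, B x y = 0) → x = 0) :
    ∃ e ∈ W, ∃ e' ∈ W, B e e ≠ 0 ∧ B e' e' ≠ 0 ∧ B e e' = 0 := by
  have : FiniteDimensional K W := Module.finite_of_finrank_pos (by omega)
  have : Invertible (2 : K) := invertibleOfNonzero h2
  have hs : LinearMap.IsSymm (B.restrict W) := ⟨fun x y => hBs _ _⟩
  obtain ⟨b, hb⟩ := LinearMap.BilinForm.exists_orthogonal_basis hs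
  have hsep : (B.restrict W).SeparatingLeft := fun x hx =>
    Subtype.ext (hnd x x.2 fun y hy => hx ⟨y, hy⟩)
  have h3 := hb.not_isOrtho_basis_self_of_separatingLeft hsep
  rw [LinearMap.isOrthoᵢ_def] at hb
  refine ⟨b ⟨0, by omega⟩, (b _).2, b ⟨1, by omega⟩, (b _).2, h3 _, h3 _, hb _ _ ?_⟩
  intro h
  simp at h

/-- The vectors `u = s e + e'` and `u' = s e - e'` are isotropic; the orthonormal pair is `u + c u'`
and `i (u - c u')`. -/
theorem exists_orthonormal_pair (h2 : (2 : K) ≠ 0) {i : K} (hi : i ^ 2 = -1)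
    (hBs : ∀ x y, B x y = B y x) {e e' : V} (he : B e e ≠ 0) (he' : B e' e' ≠ 0)
    (hee : B e e' = 0) (hsq : IsSquare (B e e * B e' e')) :
    ∃ a b c d : K, B (a • e + b • e') (a • e + b • e') = 1 ∧
      B (c • e + d • e') (c • e + d • e') = 1 ∧ B (a • e + b • e') (c • e + d • e') = 0 := by
  have hee' : B e' e = 0 := by rw [hBs, hee]
  obtain ⟨y, hy⟩ := hsq
  obtain ⟨s, hs⟩ : ∃ s, s = i * y / B e e := ⟨_, rfl⟩
  have hs2 : s ^ 2 * B e e + B e' e' = 0 := by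
    rw [hs]
    field_simp
    rw [hi]
    linear_combination hy
  obtain ⟨c, hc⟩ : ∃ c, c * (4 * B e' e') = -1 := by
    have h4 : (4 : K) ≠ 0 := by
      have : (4 : K) = 2 * 2 := by norm_num
      rw [this]; exact mul_ne_zero h2 h2
    exact ⟨-1 / (4 * B e' e'), div_mul_cancel₀ _ (mul_ne_zero h4 he')⟩
  refine ⟨s + c * s, 1 - c, i * (s - c * s), i * (1 + c), ?_, ?_, ?_⟩
  all_goals
    simp only [map_add, map_smul, LinearMap.add_apply, LinearMap.smul_apply, smul_eq_mul, hee, hee',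
      mul_zero, add_zero, zero_add]
  · linear_combination (1 + c) ^ 2 * hs2 - hc
  · linear_combination i ^ 2 * (1 - c) ^ 2 * hs2 + i ^ 2 * hc - hi
  · linear_combination i * (1 - c ^ 2) * hs2

theorem form_smul_smul_eq_zero {x y : V} (h : B x y = 0) (c d : K) : B (c • x) (d • y) = 0 := by
  rw [map_smul, map_smul, LinearMap.smul_apply, h, smul_zero, smul_zero]

end

variable {V : Type} [AddCommGroup V] [Module ℂ⸨X⸩ V] {B : LinearMap.BilinForm ℂ⸨X⸩ V}
  {Γ : Module.End ℂ⸨X⸩ V}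

theorem isSquare_of_ordEq_even {x : ℂ⸨X⸩} {k : ℤ} (hx : OrdEq x k) (hk : Even k) : IsSquare x := by
  obtain ⟨a, rfl⟩ := hk
  obtain ⟨y, hy, -⟩ := exists_sq_eq (by rwa [two_mul] : OrdEq x (2 * a))
  exact ⟨y, by rw [← hy, sq]⟩

theorem ordEq_smul_smul {e : V} {k : ℤ} (h : OrdEq (B e e) k) (c : ℤ) :
    OrdEq (B (tp c • e) (tp c • e)) (c + (c + k)) := by
  rw [map_smul, map_smul, LinearMap.smul_apply, smul_eq_mul, smul_eq_mul]
  exact (ordEq_tp c).mul ((ordEq_tp c).mul h)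

/-- By the discriminant, `M` plus the orders of the norms of an orthogonal basis of the kernel is
even. If `M` is even, the product of the norms is a square and the plane has an orthonormal basis.
Otherwise exactly one norm has odd order, and powers of `t` bring the two orders to `0` and `-1`: a
chain and a plug. -/
theorem kernelPiece {q : ℂ⸨X⸩} {M : ℤ} (hq : OrdEq q M) (hBs : ∀ x y, B x y = B y x)
    (hker : Module.finrank ℂ⸨X⸩ (LinearMap.ker Γ) = 2)
    (hnd : ∀ x ∈ LinearMap.ker Γ, (∀ y ∈ LinearMap.ker Γ, B x y = 0) → x = 0)
    (hsq : ∀ v w, Γ v = 0 → Γ w = 0 → B v w = 0 → IsSquare (q * (B v v * B w w)))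
    {ν : ℚ} (hν : 1 / 2 < ν) :
    (Even M → Piece B Γ false false (LinearMap.ker Γ) ν (Multiset.replicate 2 1)) ∧
    (¬ Even M → Piece B Γ true false (LinearMap.ker Γ) ν (Multiset.replicate 1 1)) := by
  obtain ⟨e, he, e', he', h1, h2, h3⟩ := exists_orthogonal_pair two_ne_zero_laurent hBs hker hnd
  have h4 := hsq e e' he he' h3
  obtain ⟨a, ha⟩ := exists_ordEq h1
  obtain ⟨b, hb⟩ := exists_ordEq h2
  have h5 : Even (M + (a + b)) := even_of_isSquare h4 (hq.mul (ha.mul hb))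
  constructor
  · intro hM
    have h6 : IsSquare (B e e * B e' e') :=
      isSquare_of_ordEq_even (ha.mul hb) ((Int.even_add.1 h5).1 hM)
    obtain ⟨i, hi, -⟩ := exists_sq_eq_neg_one
    obtain ⟨c1, c2, c3, c4, h7, h8, h9⟩ :=
      exists_orthonormal_pair two_ne_zero_laurent hi hBs h1 h2 h3 h6
    have hmem : ∀ c d : ℂ⸨X⸩, c • e + d • e' ∈ LinearMap.ker Γ := fun c d =>
      add_mem (Submodule.smul_mem _ _ he) (Submodule.smul_mem _ _ he')
    refine kernelPiece_closed (hmem c1 c2) (hmem c3 c4) (hmem _ _) (hmem _ _) ?_ ?_ h9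
      (by rw [hBs]; exact h9) hν
    · rw [h7]; exact ordEq_one
    · rw [h8]; exact ordEq_one
  · intro hM
    have h6 : ¬ Even (a + b) := fun h => hM ((Int.even_add.1 h5).2 h)
    have key : ∀ e e' : V, Γ e = 0 → Γ e' = 0 → B e' e = 0 → ∀ a b : ℤ, OrdEq (B e e) a →
        OrdEq (B e' e') b → Even a → ¬ Even b →
        Piece B Γ true false (LinearMap.ker Γ) ν (Multiset.replicate 1 1) := by
      intro e e' he he' h3 a b ha hb ha2 hb2
      obtain ⟨c, rfl⟩ := ha2
      obtain ⟨d, rfl⟩ := Int.not_even_iff_odd.1 hb2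
      have h7 := ordEq_smul_smul ha (-c)
      have h8 := ordEq_smul_smul hb (-d - 1)
      rw [show -c + (-c + (c + c)) = 0 by ring] at h7
      rw [show -d - 1 + (-d - 1 + (2 * d + 1)) = -1 by ring] at h8
      refine kernelPiece_plug (Submodule.smul_mem _ _ he) (Submodule.smul_mem _ _ he')
        (Submodule.smul_mem (LinearMap.ker Γ) _ he) (Submodule.smul_mem (LinearMap.ker Γ) _ he')
        h7 h8 (form_smul_smul_eq_zero h3 _ _) hν
    by_cases ha2 : Even a
    · exact key e e' he he' (by rw [hBs, h3]) a b ha hb ha2 fun hb2 => h6 (ha2.add hb2)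
    · refine key e' e he' he h3 b a hb ha ?_ ha2
      by_contra hb2
      exact h6 ((Int.not_even_iff_odd.1 ha2).add_odd (Int.not_even_iff_odd.1 hb2))

/-! ### Polynomials of a single slope -/

/-- `p` is monic with non-zero constant term and its Newton polygon is a segment of slope `r`. -/
structure HasSlope (p : ℂ⸨X⸩[X]) (r : ℚ) : Prop where
  monic : p.Monic
  ge : ∀ k, OrdGE (p.coeff k) (p.natDegree * r - k * r)
  low : ∃ k : ℤ, OrdEq (p.coeff 0) k ∧ (k : ℚ) = p.natDegree * r

theorem HasSlope.of_mul {p s : ℂ⸨X⸩[X]} {r : ℚ} (h : HasSlope (p * s) r) (hp : p.Monic) :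
    HasSlope p r := by
  have hs := hp.of_mul_monic_left h.monic
  obtain ⟨m, h0, hm⟩ := h.low
  exact ⟨hp, slope_of_mul hp hs h.ge, ordEq_coeff_zero_of_mul hp hs h.ge h0 hm⟩

theorem isCoprime_of_monic_irreducible {K : Type*} [Field K] {p s : K[X]} (hp : p ≠ 0)
    (h : ∀ u : K[X], u.Monic → Irreducible u → u ∣ p → u ∣ s → False) : IsCoprime p s := by
  classical
  refine isCoprime_of_irreducible_dvd (fun h0 => hp h0.1) fun z hz hzp hzs => ?_
  have huz : Associated (normalize z) z := normalize_associated z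
  exact h _ (Polynomial.monic_normalize hz.ne_zero) (huz.irreducible_iff.2 hz) (huz.dvd.trans hzp)
    (huz.dvd.trans hzs)

/-- A common irreducible factor would have both slopes. -/
theorem HasSlope.isCoprime {p s : ℂ⸨X⸩[X]} {r r' : ℚ} (hp : HasSlope p r) (hs : HasSlope s r')
    (hr : r ≠ r') : IsCoprime p s := by
  refine isCoprime_of_monic_irreducible hp.monic.ne_zero fun u hum hu hup hus => ?_
  obtain ⟨a, rfl⟩ := hup
  obtain ⟨b, rfl⟩ := hus
  obtain ⟨k, hk, hkr⟩ := (hp.of_mul hum).low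
  obtain ⟨k', hk', hkr'⟩ := (hs.of_mul hum).low
  obtain rfl := hk.unique hk'
  have hd : (u.natDegree : ℚ) ≠ 0 := by
    have := hu.natDegree_pos
    exact_mod_cast this.ne'
  exact hr (mul_left_cancel₀ hd (hkr.symm.trans hkr'))

theorem ordGE_neg_one_pow_mul {x : ℂ⸨X⸩} {r : ℚ} (h : OrdGE x r) (k : ℕ) :
    OrdGE ((-1) ^ k * x) r := by
  rcases neg_one_pow_eq_or ℂ⸨X⸩ k with hk | hk
  · rw [hk, one_mul]; exact h
  · rw [hk, neg_one_mul]; exact h.neg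

theorem ordEq_neg_one_pow_mul {x : ℂ⸨X⸩} {r : ℤ} (h : OrdEq x r) (k : ℕ) :
    OrdEq ((-1) ^ k * x) r := by
  rcases neg_one_pow_eq_or ℂ⸨X⸩ k with hk | hk
  · rw [hk, one_mul]; exact h
  · rw [hk, neg_one_mul]; exact h.neg

/-- The monic polynomial whose roots are the opposites of those of `p`. -/
def rootNeg {K : Type*} [CommRing K] (p : K[X]) : K[X] :=
  Polynomial.C ((-1) ^ p.natDegree) * p.comp (-Polynomial.X)

section

variable {K : Type*} [Field K]

theorem coeff_rootNeg (p : K[X]) (k : ℕ) :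
    (rootNeg p).coeff k = (-1) ^ p.natDegree * ((-1) ^ k * p.coeff k) := by
  rw [rootNeg, Polynomial.coeff_C_mul, coeff_comp_neg_X]

theorem natDegree_rootNeg (p : K[X]) : (rootNeg p).natDegree = p.natDegree := by
  rw [rootNeg, Polynomial.natDegree_C_mul (pow_ne_zero _ (neg_ne_zero.2 one_ne_zero)),
    Polynomial.natDegree_comp, Polynomial.natDegree_neg, Polynomial.natDegree_X, mul_one]

theorem monic_rootNeg {p : K[X]} (hp : p.Monic) : (rootNeg p).Monic := by
  rw [Polynomial.Monic, Polynomial.leadingCoeff, natDegree_rootNeg, coeff_rootNeg, ← mul_assoc,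
    ← mul_pow, neg_one_mul, neg_neg, one_pow, one_mul]
  exact hp

theorem rootNeg_dvd {p q : K[X]} (h : p ∣ q) (hq : q.comp (-Polynomial.X) = q) :
    rootNeg p ∣ q := by
  have hu : IsUnit (Polynomial.C ((-1 : K) ^ p.natDegree)) :=
    Polynomial.isUnit_C.2 (isUnit_iff_ne_zero.2 (pow_ne_zero _ (neg_ne_zero.2 one_ne_zero)))
  rw [rootNeg, hu.mul_left_dvd, ← hq]
  obtain ⟨a, rfl⟩ := h
  rw [Polynomial.mul_comp]
  exact dvd_mul_right _ _

theorem comp_neg_X_eq_of_rootNeg_eq (h2 : (2 : K) ≠ 0) {p : K[X]} (h : rootNeg p = p)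
    (h0 : p.coeff 0 ≠ 0) : Even p.natDegree ∧ p.comp (-Polynomial.X) = p := by
  have hev : Even p.natDegree := by
    by_contra hodd
    have h1 := congrArg (fun a => Polynomial.coeff a 0) h
    rw [coeff_rootNeg, (Nat.not_even_iff_odd.1 hodd).neg_one_pow, pow_zero, one_mul] at h1
    have h3 : 2 * p.coeff 0 = 0 := by linear_combination -h1
    exact (mul_ne_zero h2 h0) h3
  refine ⟨hev, ?_⟩
  rw [rootNeg, hev.neg_one_pow, Polynomial.C_1, one_mul] at h
  exact h

theorem isCoprime_list_prod {p : K[X]} {l : List K[X]} (h : ∀ q ∈ l, IsCoprime p q) :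
    IsCoprime p l.prod := by
  induction l with
  | nil => exact isCoprime_one_right
  | cons a l ih =>
    rw [List.prod_cons]
    exact (h a List.mem_cons_self).mul_right (ih fun q hq => h q (List.mem_cons_of_mem _ hq))

end

theorem HasSlope.rootNeg {p : ℂ⸨X⸩[X]} {r : ℚ} (h : HasSlope p r) :
    HasSlope (LoopSO.rootNeg p) r := by
  refine ⟨monic_rootNeg h.monic, fun k => ?_, ?_⟩
  · rw [natDegree_rootNeg, coeff_rootNeg]
    exact ordGE_neg_one_pow_mul (ordGE_neg_one_pow_mul (h.ge k) _) _
  · obtain ⟨k, hk, hkr⟩ := h.low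
    refine ⟨k, ?_, ?_⟩
    · rw [coeff_rootNeg]
      exact ordEq_neg_one_pow_mul (ordEq_neg_one_pow_mul hk _) _
    · rw [natDegree_rootNeg]; exact hkr

/-- The polynomial with the opposite roots divides the even polynomial `p s` and is coprime to `s`,
so it is `p` itself. An odd degree would make the constant term vanish. -/
theorem HasSlope.even {p s : ℂ⸨X⸩[X]} {r : ℚ} (h : HasSlope p r) (hs : IsCoprime (LoopSO.rootNeg p) s)
    (hq : (p * s).comp (-Polynomial.X) = p * s) :
    Even p.natDegree ∧ p.comp (-Polynomial.X) = p := by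
  have h1 : LoopSO.rootNeg p ∣ p := hs.dvd_of_dvd_mul_right (rootNeg_dvd (dvd_mul_right _ _) hq)
  have h2 : LoopSO.rootNeg p = p :=
    (Polynomial.eq_of_monic_of_dvd_of_natDegree_le (monic_rootNeg h.monic) h.monic h1
      (natDegree_rootNeg p).ge).symm
  obtain ⟨k, hk, -⟩ := h.low
  exact comp_neg_X_eq_of_rootNeg_eq two_ne_zero_laurent h2 hk.ne_zero

/-! ### The factors of a Newton factorization -/

/-- The slope of a factor. -/
def slopeOf (f : ℂ⟦X⟧[X]) : ℚ := (constOrder f).toNat / f.natDegree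

theorem ordEq_coeff_zero_of_constOrder {f : ℂ⟦X⟧[X]} (h : constOrder f ≠ ⊤) :
    OrdEq (algebraMap ℂ⟦X⟧ ℂ⸨X⸩ (f.coeff 0)) (constOrder f).toNat := by
  refine ⟨(ordGE_algebraMap_iff _ _).2 fun k hk => ?_, ?_⟩
  · refine PowerSeries.coeff_of_lt_order k ?_
    rw [← constOrder, ← ENat.natCast_toNat h]
    exact_mod_cast hk
  · rw [coeff_algebraMap]
    exact PowerSeries.coeff_order fun h0 => h (by rw [constOrder, h0, PowerSeries.order_zero])

theorem hasSlope_of_hasSingleSlope {f : ℂ⟦X⟧[X]} (hf : f.Monic) (hd : 0 < f.natDegree)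
    (hs : HasSingleSlope f) (h : constOrder f ≠ ⊤) :
    HasSlope (f.map (algebraMap ℂ⟦X⟧ ℂ⸨X⸩)) (slopeOf f) := by
  have hd' : (0 : ℚ) < f.natDegree := by exact_mod_cast hd
  have hnd : (f.map (algebraMap ℂ⟦X⟧ ℂ⸨X⸩)).natDegree = f.natDegree := hf.natDegree_map _
  refine ⟨hf.map _, fun k => ?_, (constOrder f).toNat, ?_, ?_⟩
  · rw [hnd, Polynomial.coeff_map]
    rcases lt_or_ge f.natDegree k with hk | hk
    · rw [Polynomial.coeff_eq_zero_of_natDegree_lt hk, map_zero]; exact OrdGE.zero _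
    refine (ordGE_algebraMap_iff _ _).2 fun j hj => ?_
    refine PowerSeries.coeff_of_lt_order j ?_
    by_contra hlt
    have h1 := hs (f.natDegree - k) (Nat.sub_le _ _)
    rw [lowerCoeff, Nat.sub_sub_self hk, ← ENat.natCast_toNat h] at h1
    have h2 : ((f.natDegree - k : ℕ) : ℕ∞) * (constOrder f).toNat ≤ (f.natDegree : ℕ∞) * j :=
      h1.trans (by gcongr; exact not_lt.1 hlt)
    have h3 : (f.natDegree - k) * (constOrder f).toNat ≤ f.natDegree * j := by exact_mod_cast h2
    have h4 : ((f.natDegree : ℚ) - k) * (constOrder f).toNat ≤ f.natDegree * j := by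
      rw [← Nat.cast_sub hk]; exact_mod_cast h3
    have h5 : (f.natDegree : ℚ) * slopeOf f - k * slopeOf f =
        ((f.natDegree : ℚ) - k) * (constOrder f).toNat / f.natDegree := by
      rw [slopeOf]; ring
    rw [h5, lt_div_iff₀ hd'] at hj
    linarith
  · rw [Polynomial.coeff_map]
    exact ordEq_coeff_zero_of_constOrder h
  · rw [hnd, slopeOf, mul_div_cancel₀ _ hd'.ne']
    simp

theorem eq_X_pow_of_constOrder_eq_top {f : ℂ⟦X⟧[X]} (hf : f.Monic)
    (hs : HasSingleSlope f) (h : constOrder f = ⊤) : f = Polynomial.X ^ f.natDegree := by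
  ext1 k
  rw [Polynomial.coeff_X_pow]
  split_ifs with hk
  · rw [hk]; exact hf
  rcases lt_or_gt_of_ne hk with hk | hk
  · have h1 := hs (f.natDegree - k) (Nat.sub_le _ _)
    have h2 : ((f.natDegree - k : ℕ) : ℕ∞) ≠ 0 := by
      rw [Ne, Nat.cast_eq_zero]; omega
    rw [h, ENat.mul_top h2, top_le_iff, lowerCoeff, Nat.sub_sub_self hk.le] at h1
    by_contra h3
    have h4 : PowerSeries.order (f.coeff k) ≠ ⊤ := fun h5 => h3 (PowerSeries.order_eq_top.1 h5)
    rw [← ENat.natCast_toNat h4, ← Nat.cast_mul] at h1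
    exact ENat.natCast_ne_top _ h1
  · exact Polynomial.coeff_eq_zero_of_natDegree_lt hk

theorem slopeOf_lt {f g : ℂ⟦X⟧[X]} (hf : 0 < f.natDegree) (hg : 0 < g.natDegree)
    (h : constOrder f ≠ ⊤) (h' : constOrder g ≠ ⊤)
    (hlt : (g.natDegree : ℕ∞) * constOrder f < (f.natDegree : ℕ∞) * constOrder g) :
    slopeOf f < slopeOf g := by
  rw [← ENat.natCast_toNat h, ← ENat.natCast_toNat h'] at hlt
  have h1 : g.natDegree * (constOrder f).toNat < f.natDegree * (constOrder g).toNat := by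
    exact_mod_cast hlt
  rw [slopeOf, slopeOf, div_lt_div_iff₀ (by exact_mod_cast hf) (by exact_mod_cast hg)]
  rw [mul_comm, mul_comm ((constOrder g).toNat : ℚ)]
  exact_mod_cast h1

/-- A factor with infinite `m` cannot be followed by another one, since the strict inequality of
slopes would read `⊤ < _`. -/
theorem exists_eq_append_of_pairwise {fs : List ℂ⟦X⟧[X]} (hpos : ∀ f ∈ fs, 0 < f.natDegree)
    (h : fs.Pairwise fun f g =>
      (g.natDegree : ℕ∞) * constOrder f < (f.natDegree : ℕ∞) * constOrder g) :
    ∃ gs ks : List ℂ⟦X⟧[X], fs = gs ++ ks ∧ (∀ g ∈ gs, constOrder g ≠ ⊤) ∧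
      (ks = [] ∨ ∃ k, ks = [k] ∧ constOrder k = ⊤) := by
  induction fs with
  | nil => exact ⟨[], [], rfl, by simp, Or.inl rfl⟩
  | cons f fs ih =>
    rw [List.pairwise_cons] at h
    by_cases hf : constOrder f = ⊤
    · refine ⟨[], f :: fs, rfl, by simp, Or.inr ⟨f, ?_, hf⟩⟩
      rcases fs with _ | ⟨g, fs⟩
      · rfl
      have h1 := h.1 g List.mem_cons_self
      have h2 := hpos g (by simp)
      rw [hf, ENat.mul_top (by exact_mod_cast h2.ne')] at h1
      exact absurd h1 not_top_lt
    · obtain ⟨gs, ks, rfl, h1, h2⟩ := ih (fun g hg => hpos g (List.mem_cons_of_mem _ hg)) h.2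
      refine ⟨f :: gs, ks, rfl, ?_, h2⟩
      intro g hg
      rcases List.mem_cons.1 hg with rfl | hg
      · exact hf
      · exact h1 g hg

theorem constOrder_pos {f P : ℂ⟦X⟧[X]} {N : ℕ} (hf : f.Monic) (hd : 0 < f.natDegree) (hfP : f ∣ P)
    (hP : P.map (PowerSeries.constantCoeff (R := ℂ)) = Polynomial.X ^ N) :
    constOrder f ≠ 0 := by
  have h1 : f.map (PowerSeries.constantCoeff (R := ℂ)) ∣ Polynomial.X ^ N := by
    rw [← hP]; exact Polynomial.map_dvd _ hfP
  obtain ⟨k, -, hk⟩ := (dvd_prime_pow Polynomial.prime_X _).1 h1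
  have h2 := Polynomial.eq_of_monic_of_associated (hf.map _) (Polynomial.monic_X_pow k) hk
  have h3 : k ≠ 0 := by
    rintro rfl
    have h4 := hf.natDegree_map (PowerSeries.constantCoeff (R := ℂ))
    rw [h2, pow_zero, Polynomial.natDegree_one] at h4
    omega
  have h4 := congrArg (fun p => Polynomial.coeff p 0) h2
  simp only [Polynomial.coeff_map, Polynomial.coeff_X_pow, h3.symm, if_false] at h4
  rw [← PowerSeries.coeff_zero_eq_constantCoeff_apply] at h4
  have h5 : (1 : ℕ∞) ≤ constOrder f := PowerSeries.nat_le_order _ _ fun i hi => by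
    obtain rfl : i = 0 := by omega
    exact h4
  exact (zero_lt_one.trans_le h5).ne'

/-! ### The cyclic modules of the factors -/

section

variable {K V : Type*} [Field K] [AddCommGroup V] [Module K V] {B : LinearMap.BilinForm K V}
  {Γ : Module.End K V}

/-- The submodule `K[Γ] v`. -/
def cyc (Γ : Module.End K V) (v : V) : Submodule K V where
  carrier := {x | ∃ p : K[X], aeval Γ p v = x}
  add_mem' := by
    rintro _ _ ⟨p, rfl⟩ ⟨p', rfl⟩
    exact ⟨p + p', by rw [map_add, LinearMap.add_apply]⟩
  zero_mem' := ⟨0, by rw [map_zero, LinearMap.zero_apply]⟩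
  smul_mem' := by
    rintro c _ ⟨p, rfl⟩
    exact ⟨c • p, by rw [map_smul, LinearMap.smul_apply]⟩

theorem apply_mem_cyc (Γ : Module.End K V) (v : V) : ∀ x ∈ cyc Γ v, Γ x ∈ cyc Γ v := by
  rintro _ ⟨p, rfl⟩
  exact ⟨Polynomial.X * p, by rw [map_mul, Polynomial.aeval_X, Module.End.mul_apply]⟩

theorem aeval_mul_apply (p r : K[X]) (x : V) :
    aeval Γ (p * r) x = aeval Γ p (aeval Γ r x) := by
  rw [map_mul, Module.End.mul_apply]

theorem aeval_aeval_eq_zero_iff {q f g : K[X]} {u : V} (hu : ∀ p : K[X], aeval Γ p u = 0 ↔ q ∣ p)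
    (hq : q = f * g) (hg : g ≠ 0) (p : K[X]) : aeval Γ p (aeval Γ g u) = 0 ↔ f ∣ p := by
  rw [← aeval_mul_apply, hu, hq]
  exact mul_dvd_mul_iff_right hg

/-- `g'(Γ)` is self-adjoint because `g'` is even; moved across the pairing it produces `g g'`, which
kills `u`. -/
theorem form_cyc_eq_zero (hΓ : ∀ x y, B (Γ x) y = -B x (Γ y)) {q g g' : K[X]} {u : V}
    (hu : ∀ p : K[X], aeval Γ p u = 0 ↔ q ∣ p) (hg' : g'.comp (-Polynomial.X) = g')
    (hd : q ∣ g * g') : ∀ x ∈ cyc Γ (aeval Γ g u), ∀ y ∈ cyc Γ (aeval Γ g' u), B x y = 0 := by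
  rintro _ ⟨p, rfl⟩ _ ⟨p', rfl⟩
  have h1 : aeval Γ p' (aeval Γ g' u) = aeval Γ g' (aeval Γ p' u) := by
    rw [← aeval_mul_apply, mul_comm, aeval_mul_apply]
  rw [h1, aeval_skew hΓ, hg', ← aeval_mul_apply, ← aeval_mul_apply,
    (hu _).2 (hd.trans ⟨p, by ring⟩), map_zero, LinearMap.zero_apply]

theorem form_ker_apply_eq_zero (hΓ : ∀ x y, B (Γ x) y = -B x (Γ y)) {x : V} (hx : Γ x = 0) (y : V) :
    B x (Γ y) = 0 := by
  have h := hΓ x y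
  rw [hx, map_zero, LinearMap.zero_apply] at h
  exact neg_eq_zero.1 h.symm

theorem form_cyc_ker_eq_zero (hBs : ∀ x y, B x y = B y x) (hΓ : ∀ x y, B (Γ x) y = -B x (Γ y))
    (g : K[X]) (v : V) :
    ∀ x ∈ cyc Γ (aeval Γ g (Γ v)), ∀ y ∈ LinearMap.ker Γ, B x y = 0 := by
  rintro _ ⟨p, rfl⟩ y hy
  rw [aeval_apply_comm, aeval_apply_comm, hBs]
  exact form_ker_apply_eq_zero hΓ hy _

theorem eq_zero_of_form_ker (hB : ∀ x, (∀ y, B x y = 0) → x = 0)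
    (hΓ : ∀ x y, B (Γ x) y = -B x (Γ y)) (hc : IsCompl (LinearMap.ker Γ) (LinearMap.range Γ)) :
    ∀ x ∈ LinearMap.ker Γ, (∀ y ∈ LinearMap.ker Γ, B x y = 0) → x = 0 := by
  intro x hx h
  refine hB x fun y => ?_
  have hy : y ∈ LinearMap.ker Γ ⊔ LinearMap.range Γ := by rw [hc.sup_eq_top]; trivial
  obtain ⟨a, ha, _, ⟨b, rfl⟩, rfl⟩ := Submodule.mem_sup.1 hy
  rw [map_add, h a ha, form_ker_apply_eq_zero hΓ hx, add_zero]

/-- Moving `g(Γ)` across the pairing shows that `(g p g)(Γ) Γ v` is orthogonal to the range, and it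
is orthogonal to the kernel as every vector of the range is. So it vanishes, and `f`, coprime to
`g`, divides `p`. -/
theorem dvd_of_form_cyc (hB : ∀ x, (∀ y, B x y = 0) → x = 0) (hBs : ∀ x y, B x y = B y x)
    (hΓ : ∀ x y, B (Γ x) y = -B x (Γ y)) (hc : IsCompl (LinearMap.ker Γ) (LinearMap.range Γ))
    {q f g : K[X]} {v : V} (hv : ∀ p : K[X], aeval Γ p (Γ v) = 0 ↔ q ∣ p)
    (hgen : ∀ x, ∃ p : K[X], Γ x = aeval Γ p (Γ v)) (hq : q = f * g) (hfg : IsCoprime f g)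
    (hg : g.comp (-Polynomial.X) = g) (p : K[X])
    (hp : ∀ r : K[X], B (aeval Γ p (aeval Γ g (Γ v))) (aeval Γ r (aeval Γ g (Γ v))) = 0) :
    f ∣ p := by
  have h1 : aeval Γ (g * (p * g)) (Γ v) = 0 := by
    refine hB _ fun y => ?_
    have hy : y ∈ LinearMap.ker Γ ⊔ LinearMap.range Γ := by rw [hc.sup_eq_top]; trivial
    obtain ⟨a, ha, _, ⟨b, rfl⟩, rfl⟩ := Submodule.mem_sup.1 hy
    rw [map_add, aeval_apply_comm, hBs, form_ker_apply_eq_zero hΓ ha, zero_add,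
      ← aeval_apply_comm]
    obtain ⟨r, hr⟩ := hgen b
    have h2 := hp r
    rw [← aeval_mul_apply, ← aeval_mul_apply, mul_comm r, aeval_mul_apply g, aeval_skew hΓ, hg,
      ← aeval_mul_apply, ← hr] at h2
    exact h2
  rw [hv, hq] at h1
  exact hfg.dvd_of_dvd_mul_right (hfg.dvd_of_dvd_mul_left ((dvd_mul_right f g).trans h1))

end

/-! ### The piece of a factor -/

theorem monic_squarefree_left {K : Type*} [Field K] {q f g : K[X]} (hq : q = f * g)
    (h : Squarefree q) (h0 : q.coeff 0 ≠ 0) :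
    Squarefree f ∧ IsCoprime f g ∧ f.coeff 0 ≠ 0 ∧ g ≠ 0 := by
  subst hq
  rw [Polynomial.mul_coeff_zero] at h0
  refine ⟨h.of_mul_left, (squarefree_mul_iff.1 h).1.isCoprime, left_ne_zero_of_mul h0, ?_⟩
  rintro rfl
  simp at h0

theorem left_eq_of_mul_comp {K : Type*} [Field K] {q f g : K[X]} (hq : q = f * g) (hf : f ≠ 0)
    (hfe : f.comp (-Polynomial.X) = f) (hqe : q.comp (-Polynomial.X) = q) :
    g.comp (-Polynomial.X) = g := by
  rw [hq, Polynomial.mul_comp, hfe] at hqe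
  exact mul_left_cancel₀ hf hqe

section

variable {V : Type} [AddCommGroup V] [Module ℂ⸨X⸩ V] {B : LinearMap.BilinForm ℂ⸨X⸩ V}
  {Γ : Module.End ℂ⸨X⸩ V}

/-- The scale `T` of `exists_cyclic_form` is arbitrary, so every normalisation `t^(-ε)` of the
pairing is available on the same factor. -/
theorem exists_cycForm (hB : ∀ x, (∀ y, B x y = 0) → x = 0) (hBs : ∀ x y, B x y = B y x)
    (hΓ : ∀ x y, B (Γ x) y = -B x (Γ y)) (hc : IsCompl (LinearMap.ker Γ) (LinearMap.range Γ))
    {q g : ℂ⸨X⸩[X]} {v : V} (hv : ∀ p : ℂ⸨X⸩[X], aeval Γ p (Γ v) = 0 ↔ q ∣ p)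
    (hgen : ∀ x, ∃ p : ℂ⸨X⸩[X], Γ x = aeval Γ p (Γ v)) (hsq : Squarefree q)
    (hqe : q.comp (-Polynomial.X) = q) (hq0 : q.coeff 0 ≠ 0) {f : ℂ⟦X⟧[X]}
    (hq : q = f.map (algebraMap ℂ⟦X⟧ ℂ⸨X⸩) * g)
    (hfe : (f.map (algebraMap ℂ⟦X⟧ ℂ⸨X⸩)).comp (-Polynomial.X) = f.map (algebraMap ℂ⟦X⟧ ℂ⸨X⸩))
    (hf : f.Monic) {h : ℕ} (hh : 0 < h) (hd : f.natDegree = 2 * h)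
    (hs : HasSlope (f.map (algebraMap ℂ⟦X⟧ ℂ⸨X⸩)) (slopeOf f)) (h0 : constOrder f ≠ 0)
    (ht : constOrder f ≠ ⊤) (ε : ℤ) :
    ∃ W F, CycForm B Γ W F f h (constOrder f).toNat ε ∧
      ∀ b, W b ∈ cyc Γ (aeval Γ g (Γ v)) := by
  obtain ⟨hfsq, hfg, hf0, hg0⟩ := monic_squarefree_left hq hsq hq0
  have hge := left_eq_of_mul_comp hq (hf.map _).ne_zero hfe hqe
  have hnd : (f.map (algebraMap ℂ⟦X⟧ ℂ⸨X⸩)).natDegree = 2 * h := (hf.natDegree_map _).trans hd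
  have hslope : slopeOf f = (constOrder f).toNat / (2 * h) := by
    rw [slopeOf, hd]; push_cast; ring
  have hh' : (0 : ℚ) < h := by exact_mod_cast hh
  obtain ⟨W, F, h1, h2, h3, h4, h5, h6⟩ := exists_cyclic_form two_ne_zero_laurent
    (fun g hg h0 d => exists_dvd_sq_sub_X_mul_sq hg h0 d) hBs hΓ (hf.map _) hfe hfsq hf0 hh hnd
    ((aeval_aeval_eq_zero_iff hv hq hg0 _).2 dvd_rfl)
    (fun p hp => dvd_of_form_cyc hB hBs hΓ hc hv hgen hq hfg hge p hp) (tp (-ε))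
  have hlc : ∀ j, algebraMap ℂ⟦X⟧ ℂ⸨X⸩ (lowerCoeff f j) =
      (f.map (algebraMap ℂ⟦X⟧ ℂ⸨X⸩)).coeff (2 * h - j) := fun j => by
    rw [Polynomial.coeff_map, lowerCoeff, hd]
  refine ⟨W, F, ⟨hh, ?_, ?_, ?_, ?_, h2, h3, ?_, h5, h6⟩, fun b => ?_⟩
  · rw [Nat.pos_iff_ne_zero, Ne, ENat.toNat_eq_zero]
    tauto
  · exact hf
  · intro j hj
    rw [hlc]
    refine (hs.ge (2 * h - j)).mono (le_of_eq ?_)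
    rw [hnd, hslope, Nat.cast_sub hj]
    push_cast
    ring
  · rw [hlc, Nat.sub_self, Polynomial.coeff_map]
    exact ordEq_coeff_zero_of_constOrder ht
  · intro e
    rw [← h4 e]
    exact Finset.sum_congr rfl fun j _ => by rw [hlc]
  · obtain ⟨p, hp⟩ := h1 b
    exact ⟨p, hp.symm⟩

end

open Classical in
/-- The contribution of a factor `f` with `f(0) ≠ 0` to the partition. -/
def factorPart (ε : Bool) (f : ℂ⟦X⟧[X]) : Multiset ℕ :=
  if Odd (constOrder f).toNat then
    if ε then lowered f.natDegree (constOrder f).toNat else raised f.natDegree (constOrder f).toNat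
  else
    if ε then balanced f.natDegree (constOrder f).toNat else evenPart f (constOrder f).toNat

/-- The flag after a factor. -/
def nextFlag (ε : Bool) (f : ℂ⟦X⟧[X]) : Bool := xor ε (decide (Odd (constOrder f).toNat))

theorem modifyD_cons {f : ℂ⟦X⟧[X]} (hf : constOrder f ≠ ⊤) (ε : Bool) (fs : List ℂ⟦X⟧[X]) :
    modifyD ε (f :: fs) = factorPart ε f + modifyD (nextFlag ε f) fs := by
  by_cases h : Odd (constOrder f).toNat <;> cases ε <;> simp [modifyD, factorPart, nextFlag, hf, h]

theorem two_dvd_sub_iff_not {m : ℕ} : (2 : ℤ) ∣ m - 1 ↔ Odd m := by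
  rw [← Nat.not_even_iff_odd, even_iff_two_dvd]
  omega

variable {V : Type} [AddCommGroup V] [Module ℂ⸨X⸩ V]
  {B : LinearMap.BilinForm ℂ⸨X⸩ V} {Γ : Module.End ℂ⸨X⸩ V}

theorem CycForm.monoPiece {W : ℤ → V} {F : ℤ → ℂ⸨X⸩} {f : ℂ⟦X⟧[X]} {h m : ℕ} {ε : Bool}
    (C : CycForm B Γ W F f h m (if ε then 1 else 0)) {U : Submodule ℂ⸨X⸩ V}
    (hU : ∀ b, W b ∈ U) :
    Piece B Γ ε (xor ε (decide (Odd m))) U (m / (2 * h))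
      ((chainLens h m (if ε then 1 else 0)).filter (0 < ·)) := by
  have h1 := C.cycVec.piece (xor ε (decide (Odd m))) (by
    have := two_dvd_sub_iff_not (m := m)
    by_cases hm : Odd m <;> cases ε <;> simp [hm] at this ⊢ <;> omega) hU
  rw [map_chainExps, Int.cast_natCast, Int.cast_natCast] at h1
  exact h1

theorem factorPiece (hBs : ∀ x y, B x y = B y x) {f : ℂ⟦X⟧[X]} {h : ℕ} (hd : f.natDegree = 2 * h)
    {U : Submodule ℂ⸨X⸩ V}
    (hC : ∀ ε : ℤ, ∃ W F, CycForm B Γ W F f h (constOrder f).toNat ε ∧ ∀ b, W b ∈ U) (ε : Bool) :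
    Piece B Γ ε (nextFlag ε f) U (slopeOf f) ((factorPart ε f).filter (0 < ·)) := by
  obtain ⟨m, hm⟩ : ∃ m, m = (constOrder f).toNat := ⟨_, rfl⟩
  obtain ⟨W, F, C, hU⟩ := hC (if ε then 1 else 0)
  have hν : slopeOf f = m / (2 * h) := by
    rw [slopeOf, hd, ← hm]; push_cast; ring
  rw [nextFlag, factorPart, hν, hd, ← hm]
  rw [← hm] at C
  have hh := C.h_pos
  have hm0 := C.m_pos
  have h1 := C.monoPiece hU
  by_cases hodd : Odd m
  · rw [if_pos hodd]
    cases ε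
    · rwa [if_neg Bool.false_ne_true, chainLens_eq_raised hh hm0 hodd] at h1
    · rwa [if_pos rfl, chainLens_eq_lowered hh hm0 hodd] at h1
  have hev : 2 ∣ m := even_iff_two_dvd.1 (Nat.not_odd_iff_even.1 hodd)
  rw [if_neg hodd]
  cases ε
  swap
  · rwa [if_pos rfl, chainLens_eq_balanced hh hm0 hev (Or.inr rfl)] at h1
  rw [if_neg Bool.false_ne_true] at h1 ⊢
  rw [evenPart, hd]
  by_cases h2 : 2 * h % m ≠ 0 ∨ Odd (2 * h / m)
  · rw [if_pos (by tauto)]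
    rwa [chainLens_eq_balanced hh hm0 hev (Or.inl ⟨rfl, h2⟩)] at h1
  push Not at h2
  obtain ⟨h2, h3⟩ := h2
  rw [Nat.not_odd_iff_even] at h3
  by_cases h4 : IsSquare (grPoly (balanced (2 * h) m) (2 * h / m) f)
  · rw [if_pos (by tauto)]
    -- Although nothing is pending, the square case uses the pairing scaled by `t⁻¹`, for which the
    -- vectors `t^(-i) Γ^(k i) v` have level `-1/2`.
    obtain ⟨W', F', C', hU'⟩ := hC 1
    rw [← hm] at C'
    have := C'.squarePiece hBs h2 h3 hev h4 hU' (m / (2 * h))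
    simpa [hodd] using this
  · rw [if_neg (by rw [← Nat.not_even_iff_odd]; tauto)]
    rwa [chainLens_eq_spread hh hm0 hev h2 h3] at h1

/-- The flags account for the surplus `1` of a raised partition and the missing `1` of a lowered
one. -/
theorem sum_factorPart {f : ℂ⟦X⟧[X]} {h : ℕ} (hd : f.natDegree = 2 * h) (hh : 0 < h)
    (hm0 : 0 < (constOrder f).toNat) (ε : Bool) :
    (factorPart ε f).sum + ε.toNat = f.natDegree + (nextFlag ε f).toNat := by
  obtain ⟨m, hm⟩ : ∃ m, m = (constOrder f).toNat := ⟨_, rfl⟩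
  rw [nextFlag, factorPart, hd, ← hm]
  rw [← hm] at hm0
  have key := fun e he => sum_chainLens (ε := e) hh hm0 he
  by_cases hodd : Odd m
  · have h1 := two_dvd_sub_iff_not.2 hodd
    rw [if_pos hodd]
    cases ε
    · have h2 := key 0 (Or.inl rfl)
      rw [chainLens_eq_raised hh hm0 hodd, if_pos (by simpa using h1)] at h2
      simp [hodd]
      omega
    · have h2 := key 1 (Or.inr rfl)
      rw [chainLens_eq_lowered hh hm0 hodd, if_neg (by omega)] at h2
      simp [hodd]
      omega
  have hev : 2 ∣ m := even_iff_two_dvd.1 (Nat.not_odd_iff_even.1 hodd)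
  have hbal : (balanced (2 * h) m).sum = 2 * h := by
    have h2 := key 1 (Or.inr rfl)
    rw [chainLens_eq_balanced hh hm0 hev (Or.inr rfl), if_pos (by omega)] at h2
    omega
  rw [if_neg hodd]
  cases ε
  · rw [if_neg Bool.false_ne_true, evenPart, hd]
    split_ifs with h1
    · simp [hodd, hbal]
    · rw [← Nat.not_even_iff_odd] at h1
      have h2 := key 0 (Or.inl rfl)
      rw [chainLens_eq_spread hh hm0 hev (by tauto) (by tauto), if_neg (by omega)] at h2
      simp [hodd]
      omega
  · simp [hodd, hbal]

/-! ### Gluing the pieces of the factors -/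

theorem sum_filter_pos (M : Multiset ℕ) : (M.filter (0 < ·)).sum = M.sum := by
  induction M using Multiset.induction_on with
  | empty => rfl
  | cons a M ih =>
    rcases Nat.eq_zero_or_pos a with rfl | ha
    · simp [ih]
    · simp [ha, ih]

section

variable {V : Type} [AddCommGroup V] [Module ℂ⸨X⸩ V]

/-- The submodule `U` carries the pieces of the factor `g`. -/
structure FactorModule (B : LinearMap.BilinForm ℂ⸨X⸩ V) (Γ : Module.End ℂ⸨X⸩ V)
    (U : Submodule ℂ⸨X⸩ V) (g : ℂ⟦X⟧[X]) : Prop where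
  ne_top : constOrder g ≠ ⊤
  slope_pos : 0 < slopeOf g
  apply_mem : ∀ x ∈ U, Γ x ∈ U
  piece : ∀ ε, Piece B Γ ε (nextFlag ε g) U (slopeOf g) ((factorPart ε g).filter (0 < ·))
  sum_eq : ∀ ε, (factorPart ε g).sum + ε.toNat = g.natDegree + (nextFlag ε g).toNat

variable {B : LinearMap.BilinForm ℂ⸨X⸩ V} {Γ : Module.End ℂ⸨X⸩ V}

theorem piece_empty : Piece B Γ false false ⊥ 0 0 :=
  ⟨Empty, inferInstance, trivialSys (fun j => j.elim) 1, 0, fun _ => 0,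
    trivialSys_isGood (by norm_num) (fun j => j.elim) (fun j => j.elim) (fun j => j.elim),
    fun j => j.elim, zero_mem _, fun _ => zero_mem _, rfl, by simp,
    fun _ => trivialSys_startOK _ _ _, by simp, by simp⟩

theorem nextFlag_toNat (ε : Bool) (f : ℂ⟦X⟧[X]) :
    ((nextFlag ε f).toNat + ε.toNat + (constOrder f).toNat) % 2 = 0 := by
  rw [nextFlag]
  by_cases h : Odd (constOrder f).toNat
  · have := Nat.odd_iff.1 h
    cases ε <;> simp [h] <;> omega
  · have := Nat.even_iff.1 (Nat.not_odd_iff_even.1 h)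
    cases ε <;> simp [h] <;> omega

/-- The slopes increase along the list, which is what `Piece.glue` needs to close a pending vector
at a later factor. The sum of the `m` has the parity of the change of the flag. -/
theorem exists_piece_append (hBs : ∀ x y, B x y = B y x) {U : ℂ⟦X⟧[X] → Submodule ℂ⸨X⸩ V}
    (gs : List ℂ⟦X⟧[X]) (ε : Bool) (U₀ : Submodule ℂ⸨X⸩ V) (ν₀ : ℚ) (M₀ : Multiset ℕ)
    (hP : Piece B Γ false ε U₀ ν₀ M₀) (hU₀ : ∀ x ∈ U₀, Γ x ∈ U₀)
    (hg : ∀ g ∈ gs, FactorModule B Γ (U g) g) (hν : ∀ g ∈ gs, ν₀ < slopeOf g)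
    (horth₀ : ∀ g ∈ gs, ∀ x ∈ U₀, ∀ y ∈ U g, B x y = 0)
    (hlt : gs.Pairwise fun g g' => slopeOf g < slopeOf g')
    (horth : gs.Pairwise fun g g' => ∀ x ∈ U g, ∀ y ∈ U g', B x y = 0) :
    ∃ ε' U' ν' M', Piece B Γ false ε' U' ν' (M₀ + M') ∧ (∀ x ∈ U', Γ x ∈ U') ∧
      (∀ W : Submodule ℂ⸨X⸩ V, (∀ x ∈ U₀, ∀ y ∈ W, B x y = 0) →
        (∀ g ∈ gs, ∀ x ∈ U g, ∀ y ∈ W, B x y = 0) → ∀ x ∈ U', ∀ y ∈ W, B x y = 0) ∧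
      (∀ ks, (modifyD ε (gs ++ ks)).filter (0 < ·) = M' + (modifyD ε' ks).filter (0 < ·)) ∧
      M'.sum + ε.toNat = (gs.map Polynomial.natDegree).sum + ε'.toNat ∧
      (ε'.toNat + ε.toNat + (gs.map fun g => (constOrder g).toNat).sum) % 2 = 0 := by
  induction gs generalizing ε U₀ ν₀ M₀ with
  | nil => exact ⟨ε, U₀, ν₀, 0, by rwa [add_zero], hU₀, fun W h _ => h, fun ks => by simp,
      by simp, by simp; omega⟩
  | cons g gs ih =>
    have hgm : g ∈ g :: gs := List.mem_cons_self
    have hgs : ∀ {g'}, g' ∈ gs → g' ∈ g :: gs := List.mem_cons_of_mem g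
    rw [List.pairwise_cons] at hlt horth
    have G := hg g hgm
    have h1 := hP.glue hBs hU₀ G.apply_mem (horth₀ g hgm) (G.piece ε) fun _ => hν g hgm
    obtain ⟨ε', U', ν', M', hP', hU', hW, hmod, hsum, hpar⟩ := ih (nextFlag ε g) (U₀ ⊔ U g)
      (slopeOf g) _ h1 (by
        intro x hx
        obtain ⟨a, ha, b, hb, rfl⟩ := Submodule.mem_sup.1 hx
        rw [map_add]
        exact Submodule.add_mem_sup (hU₀ a ha) (G.apply_mem b hb))
      (fun g' hg' => hg g' (hgs hg')) hlt.1 (by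
        intro g' hg' x hx y hy
        obtain ⟨a, ha, b, hb, rfl⟩ := Submodule.mem_sup.1 hx
        rw [map_add, LinearMap.add_apply, horth₀ g' (hgs hg') a ha y hy,
          horth.1 g' hg' b hb y hy, add_zero]) hlt.2 horth.2
    refine ⟨ε', U', ν', (factorPart ε g).filter (0 < ·) + M', by rwa [← add_assoc], hU', ?_, ?_, ?_,
      ?_⟩
    · intro W h₀ h
      refine hW W ?_ fun g' hg' => h g' (hgs hg')
      intro x hx y hy
      obtain ⟨a, ha, b, hb, rfl⟩ := Submodule.mem_sup.1 hx
      rw [map_add, LinearMap.add_apply, h₀ a ha y hy, h g hgm b hb y hy, add_zero]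
    · intro ks
      rw [List.cons_append, modifyD_cons G.ne_top, Multiset.filter_add, hmod, add_assoc]
    · have := G.sum_eq ε
      rw [Multiset.sum_add, sum_filter_pos, List.map_cons, List.sum_cons]
      omega
    · have := nextFlag_toNat ε g
      rw [List.map_cons, List.sum_cons]
      omega

end

theorem ordEq_coeff_zero_list_prod {gs : List ℂ⟦X⟧[X]} (h : ∀ g ∈ gs, constOrder g ≠ ⊤) :
    OrdEq ((gs.prod.map (algebraMap ℂ⟦X⟧ ℂ⸨X⸩)).coeff 0)
      (gs.map fun g => (constOrder g).toNat).sum := by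
  induction gs with
  | nil =>
    rw [List.prod_nil, Polynomial.map_one, Polynomial.coeff_one_zero]
    exact ordEq_one
  | cons g gs ih =>
    rw [List.prod_cons, Polynomial.map_mul, Polynomial.mul_coeff_zero, List.map_cons, List.sum_cons,
      Nat.cast_add, Polynomial.coeff_map]
    exact (ordEq_coeff_zero_of_constOrder (h g List.mem_cons_self)).mul
      (ih fun g' hg' => h g' (List.mem_cons_of_mem _ hg'))

theorem natDegree_list_prod {R : Type*} [CommRing R] {gs : List R[X]} (h : ∀ g ∈ gs, g.Monic) :
    gs.prod.Monic ∧ gs.prod.natDegree = (gs.map Polynomial.natDegree).sum := by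
  induction gs with
  | nil => exact ⟨Polynomial.monic_one, by simp⟩
  | cons g gs ih =>
    obtain ⟨h1, h2⟩ := ih fun g' hg' => h g' (List.mem_cons_of_mem _ hg')
    have h3 := h g List.mem_cons_self
    rw [List.prod_cons, List.map_cons, List.sum_cons, h3.natDegree_mul h1, h2]
    exact ⟨h3.mul h1, rfl⟩

theorem hasReduction_of_piece {n : ℕ} (γ : LieAlgebra.Orthogonal.typeD (Fin n) ℂ⸨X⸩)
    {U : Submodule ℂ⸨X⸩ (Fin n ⊕ Fin n → ℂ⸨X⸩)} {ν : ℚ} {M : Multiset ℕ}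
    (h : Piece (stdB n) (Matrix.toLin' (γ : Matrix (Fin n ⊕ Fin n) (Fin n ⊕ Fin n) ℂ⸨X⸩)) false false
      U ν M) (hM : M.sum = 2 * n) : HasReduction γ M := by
  obtain ⟨J, _, S, L, Y, hS, -, -, -, hd, -, h0, -, -⟩ := h
  rw [← hd]
  refine hasReduction_of_chainSys γ S hS (h0 rfl) ?_
  rw [← hM, ← hd]
  rfl

/-! ### The factors of the characteristic polynomial -/

theorem map_prod_list {R S : Type*} [CommRing R] [CommRing S] (φ : R →+* S) (l : List R[X]) :
    l.prod.map φ = (l.map (Polynomial.map φ)).prod := by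
  induction l with
  | nil => simp
  | cons a l ih => rw [List.prod_cons, Polynomial.map_mul, ih, List.map_cons, List.prod_cons]

theorem map_mul_dvd_map_mul {R K : Type*} [CommRing R] [Field K] {a b : R[X]} (h : a ∣ b)
    (φ : R →+* K) (c : K[X]) : a.map φ * c ∣ b.map φ * c :=
  mul_dvd_mul_right (Polynomial.map_dvd φ h) c

open Classical in
/-- The product of the factors of the list different from `g`. -/
def cofactor (gs : List ℂ⟦X⟧[X]) (g : ℂ⟦X⟧[X]) : ℂ⸨X⸩[X] :=
  ((gs.erase g).prod).map (algebraMap ℂ⟦X⟧ ℂ⸨X⸩)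

theorem mul_cofactor {gs : List ℂ⟦X⟧[X]} {g : ℂ⟦X⟧[X]} (hg : g ∈ gs) :
    gs.prod.map (algebraMap ℂ⟦X⟧ ℂ⸨X⸩) =
      g.map (algebraMap ℂ⟦X⟧ ℂ⸨X⸩) * cofactor gs g := by
  classical
  rw [← List.prod_erase hg, Polynomial.map_mul, cofactor]

theorem prod_dvd_cofactor_mul_cofactor {gs : List ℂ⟦X⟧[X]} {g g' : ℂ⟦X⟧[X]}
    (hg' : g' ∈ gs) (h : g ≠ g') :
    gs.prod.map (algebraMap ℂ⟦X⟧ ℂ⸨X⸩) ∣ cofactor gs g * cofactor gs g' := by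
  classical
  rw [mul_cofactor hg']
  have h1 : g' ∣ (gs.erase g).prod := List.dvd_prod ((List.mem_erase_of_ne h.symm).2 hg')
  exact map_mul_dvd_map_mul h1 _ _

theorem slopeOf_injOn {gs : List ℂ⟦X⟧[X]}
    (hlt : gs.Pairwise fun g g' => slopeOf g < slopeOf g') {g g' : ℂ⟦X⟧[X]} (hg : g ∈ gs)
    (hg' : g' ∈ gs) (h : slopeOf g = slopeOf g') : g = g' := by
  have h1 : (gs.map slopeOf).Nodup := by
    rw [List.Nodup, List.pairwise_map]
    exact hlt.imp fun h => h.ne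
  exact List.inj_on_of_nodup_map h1 hg hg' h

theorem even_of_mem {gs : List ℂ⟦X⟧[X]}
    (hs : ∀ g ∈ gs, HasSlope (g.map (algebraMap ℂ⟦X⟧ ℂ⸨X⸩)) (slopeOf g))
    (hlt : gs.Pairwise fun g g' => slopeOf g < slopeOf g')
    (hq : (gs.prod.map (algebraMap ℂ⟦X⟧ ℂ⸨X⸩)).comp (-Polynomial.X) =
      gs.prod.map (algebraMap ℂ⟦X⟧ ℂ⸨X⸩)) {g : ℂ⟦X⟧[X]} (hg : g ∈ gs) :
    Even (g.map (algebraMap ℂ⟦X⟧ ℂ⸨X⸩)).natDegree ∧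
      (g.map (algebraMap ℂ⟦X⟧ ℂ⸨X⸩)).comp (-Polynomial.X) =
        g.map (algebraMap ℂ⟦X⟧ ℂ⸨X⸩) := by
  classical
  rw [mul_cofactor hg] at hq
  refine (hs g hg).even ?_ hq
  have h1 : gs.Nodup := hlt.imp fun h1 h2 => by rw [h2] at h1; exact lt_irrefl _ h1
  rw [cofactor, map_prod_list]
  refine isCoprime_list_prod fun p hp => ?_
  obtain ⟨g', hg', rfl⟩ := List.mem_map.1 hp
  obtain ⟨hne, hg'⟩ := h1.mem_erase_iff.1 hg'
  exact (hs g hg).rootNeg.isCoprime (hs g' hg') fun h => hne (slopeOf_injOn hlt hg hg' h).symm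

theorem exists_factorModules {V : Type} [AddCommGroup V] [Module ℂ⸨X⸩ V]
    {B : LinearMap.BilinForm ℂ⸨X⸩ V} {Γ : Module.End ℂ⸨X⸩ V}
    (hB : ∀ x, (∀ y, B x y = 0) → x = 0) (hBs : ∀ x y, B x y = B y x)
    (hΓ : ∀ x y, B (Γ x) y = -B x (Γ y)) (hc : IsCompl (LinearMap.ker Γ) (LinearMap.range Γ))
    {gs : List ℂ⟦X⟧[X]} (hm : ∀ g ∈ gs, g.Monic) (hd : ∀ g ∈ gs, 0 < g.natDegree)
    (hss : ∀ g ∈ gs, HasSingleSlope g) (ht : ∀ g ∈ gs, constOrder g ≠ ⊤)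
    (h0 : ∀ g ∈ gs, constOrder g ≠ 0) (hlt : gs.Pairwise fun g g' => slopeOf g < slopeOf g')
    {q : ℂ⸨X⸩[X]} (hq : q = gs.prod.map (algebraMap ℂ⟦X⟧ ℂ⸨X⸩)) {v : V}
    (hv : ∀ p : ℂ⸨X⸩[X], aeval Γ p (Γ v) = 0 ↔ q ∣ p)
    (hgen : ∀ x, ∃ p : ℂ⸨X⸩[X], Γ x = aeval Γ p (Γ v)) (hsq : Squarefree q)
    (hqe : q.comp (-Polynomial.X) = q) :
    ∃ U : ℂ⟦X⟧[X] → Submodule ℂ⸨X⸩ V, (∀ g ∈ gs, FactorModule B Γ (U g) g) ∧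
      (gs.Pairwise fun g g' => ∀ x ∈ U g, ∀ y ∈ U g', B x y = 0) ∧
      ∀ g ∈ gs, ∀ x ∈ U g, ∀ y ∈ LinearMap.ker Γ, B x y = 0 := by
  have hs : ∀ g ∈ gs, HasSlope (g.map (algebraMap ℂ⟦X⟧ ℂ⸨X⸩)) (slopeOf g) := fun g hg =>
    hasSlope_of_hasSingleSlope (hm g hg) (hd g hg) (hss g hg) (ht g hg)
  have hq0 : q.coeff 0 ≠ 0 := by rw [hq]; exact (ordEq_coeff_zero_list_prod ht).ne_zero
  have hev := fun {g} (hg : g ∈ gs) => even_of_mem hs hlt (hq ▸ hqe) hg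
  have hqc : ∀ {g}, g ∈ gs → q = g.map (algebraMap ℂ⟦X⟧ ℂ⸨X⸩) * cofactor gs g :=
    fun hg => hq.trans (mul_cofactor hg)
  have hm0 : ∀ {g}, g ∈ gs → 0 < (constOrder g).toNat := fun {g} hg => by
    have h1 := h0 g hg
    have h2 := ht g hg
    rw [Nat.pos_iff_ne_zero, Ne, ENat.toNat_eq_zero]
    tauto
  refine ⟨fun g => cyc Γ (aeval Γ (cofactor gs g) (Γ v)), fun g hg => ?_, ?_,
    fun g _ => form_cyc_ker_eq_zero hBs hΓ _ v⟩
  · obtain ⟨h, hh⟩ := (hev hg).1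
    rw [(hm g hg).natDegree_map, ← two_mul] at hh
    have hh0 : 0 < h := by have := hd g hg; omega
    refine ⟨ht g hg, div_pos (by exact_mod_cast hm0 hg) (by exact_mod_cast hd g hg),
      apply_mem_cyc Γ _, factorPiece hBs hh fun ε => ?_, sum_factorPart hh hh0 (hm0 hg)⟩
    exact exists_cycForm hB hBs hΓ hc hv hgen hsq hqe hq0 (hqc hg) (hev hg).2 (hm g hg) hh0 hh
      (hs g hg) (h0 g hg) (ht g hg) ε
  · refine hlt.imp_of_mem fun {g g'} hg hg' hlt' => ?_
    have hne : g ≠ g' := by rintro rfl; exact lt_irrefl _ hlt'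
    exact form_cyc_eq_zero hΓ hv
      (left_eq_of_mul_comp (hqc hg') ((hm g' hg').map _).ne_zero (hev hg').2 hqe)
      (hq ▸ prod_dvd_cofactor_mul_cofactor hg' hne)

/-! ### Existence of the reduction -/

theorem map_mul_swap {R S : Type*} [CommRing R] [CommRing S] (φ : R →+* S) (a b : R[X]) :
    (a * b).map φ = b.map φ * a.map φ := by
  rw [Polynomial.map_mul, mul_comm]

theorem sum_natDegree_of_charpoly {n : ℕ} {M : Matrix (Fin n ⊕ Fin n) (Fin n ⊕ Fin n) ℂ⸨X⸩}
    {fs : List ℂ⟦X⟧[X]} (hm : ∀ f ∈ fs, f.Monic)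
    (h : M.charpoly = fs.prod.map (algebraMap ℂ⟦X⟧ ℂ⸨X⸩)) :
    (fs.map Polynomial.natDegree).sum = 2 * n := by
  have h1 := congrArg Polynomial.natDegree h
  rw [Matrix.charpoly_natDegree_eq_dim, (natDegree_list_prod hm).1.natDegree_map,
    (natDegree_list_prod hm).2] at h1
  rw [← h1]
  simp [two_mul]

theorem hasReduction_partitionD {n : ℕ} (γ : LieAlgebra.Orthogonal.typeD (Fin n) ℂ⸨X⸩)
    (hγ : γ ∈ heart n) (fs : List ℂ⟦X⟧[X])
    (hfs : IsNewtonFactorization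
      (γ : Matrix (Fin n ⊕ Fin n) (Fin n ⊕ Fin n) ℂ⸨X⸩).charpoly fs) :
    HasReduction γ (partitionD fs) := by
  obtain ⟨hprod, hmonic, hpos, hsingle, hdecr⟩ := hfs
  have hsum := sum_natDegree_of_charpoly hmonic hprod
  have hmod := charpoly_mod_of_isTopologicallyNilpotent (even_card_sum_self n) hγ.1 hprod.symm
  have hne0 : ∀ f ∈ fs, constOrder f ≠ 0 := fun f hf =>
    constOrder_pos (hmonic f hf) (hpos f hf) (List.dvd_prod hf) hmod
  obtain ⟨gs, ks, rfl, ht, hks⟩ := exists_eq_append_of_pairwise hpos hdecr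
  have hmem : ∀ {g}, g ∈ gs → g ∈ gs ++ ks := fun hg => List.mem_append_left _ hg
  have hlt : gs.Pairwise fun g g' => slopeOf g < slopeOf g' :=
    (List.pairwise_append.1 hdecr).1.imp_of_mem fun hg hg' h =>
      slopeOf_lt (hpos _ (hmem hg)) (hpos _ (hmem hg')) (ht _ hg) (ht _ hg') h
  obtain ⟨q, hq⟩ : ∃ q, q = gs.prod.map (algebraMap ℂ⟦X⟧ ℂ⸨X⸩) := ⟨_, rfl⟩
  have hqord : OrdEq (q.coeff 0) (gs.map fun g => (constOrder g).toNat).sum := by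
    rw [hq]; exact ordEq_coeff_zero_list_prod ht
  have hkX : ks.prod.map (algebraMap ℂ⟦X⟧ ℂ⸨X⸩) =
      Polynomial.X ^ (ks.map Polynomial.natDegree).sum := by
    rcases hks with rfl | ⟨k, rfl, hk⟩
    · simp
    · have h1 := eq_X_pow_of_constOrder_eq_top (hmonic k (by simp)) (hsingle k (by simp)) hk
      rw [List.prod_singleton, List.map_singleton, List.sum_singleton]
      conv_lhs => rw [h1]
      rw [Polynomial.map_pow, Polynomial.map_X]
  have hχ : (γ : Matrix (Fin n ⊕ Fin n) (Fin n ⊕ Fin n) ℂ⸨X⸩).charpoly =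
      Polynomial.X ^ (ks.map Polynomial.natDegree).sum * q := by
    rw [hprod, List.prod_append, map_mul_swap, hkX, hq]
  obtain ⟨Γ, hΓ⟩ : ∃ Γ : Module.End ℂ⸨X⸩ (Fin n ⊕ Fin n → ℂ⸨X⸩),
      Γ = Matrix.toLin' (γ : Matrix (Fin n ⊕ Fin n) (Fin n ⊕ Fin n) ℂ⸨X⸩) := ⟨_, rfl⟩
  have hskew : ∀ x y, stdB n (Γ x) y = -stdB n x (Γ y) := fun x y => by
    rw [hΓ]; exact stdB_skew γ x y
  have hB : ∀ x, (∀ y, stdB n x y = 0) → x = 0 := fun x hx =>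
    (stdB_nondegenerate (n := n)).1 x hx
  have hBs := stdB_symm n
  have hc : IsCompl (LinearMap.ker Γ) (LinearMap.range Γ) :=
    isCompl_ker_range (hΓ ▸ hγ.2.1)
  obtain ⟨hN, hker, hsq, hqe, v, hv, hgen⟩ := exists_cyclic_vector γ hγ.2 hΓ hχ hqord.ne_zero
  obtain ⟨U, hU, horth, hUker⟩ := exists_factorModules hB hBs hskew hc
    (fun g hg => hmonic g (hmem hg)) (fun g hg => hpos g (hmem hg))
    (fun g hg => hsingle g (hmem hg)) ht (fun g hg => hne0 g (hmem hg)) hlt hq hv hgen hsq hqe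
  obtain ⟨ε, U', ν, M, hP, hU', hW, hpart, hMsum, hpar⟩ := exists_piece_append hBs gs false ⊥ 0 0
    piece_empty (fun x hx => by rw [(Submodule.mem_bot _).1 hx, map_zero]; exact zero_mem _) hU
    (fun g hg => (hU g hg).slope_pos)
    (fun g _ x hx y _ => by rw [(Submodule.mem_bot _).1 hx, map_zero, LinearMap.zero_apply])
    hlt horth
  have hW' := hW (LinearMap.ker Γ)
    (fun x hx y _ => by rw [(Submodule.mem_bot _).1 hx, map_zero, LinearMap.zero_apply]) hUker
  rw [zero_add] at hP
  rw [partitionD, hpart]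
  rw [List.map_append, List.sum_append] at hsum
  rw [Bool.toNat_false, add_zero] at hMsum hpar
  rcases hks with rfl | ⟨k, rfl, hk⟩
  -- Without a kernel the constant term of the characteristic polynomial is a square, so the number
  -- of odd `m` is even and nothing is left pending.
  · have hχq := isSquare_charpoly_coeff_zero γ
    rw [hχ, List.map_nil, List.sum_nil, pow_zero, one_mul] at hχq
    have hev := even_of_isSquare hχq hqord
    have hε : ε = false := by
      rw [Int.even_iff] at hev
      cases ε
      · rfl
      · rw [Bool.toNat_true] at hpar; omega
    subst hε
    have h1 : (modifyD false []).filter (0 < ·) = 0 := by simp [modifyD]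
    rw [h1, add_zero]
    subst hΓ
    refine hasReduction_of_piece γ hP ?_
    simp at hsum hMsum
    omega
  · rw [List.map_singleton, List.sum_singleton] at hN hker hχ hsum
    have hk2 : k.natDegree = 2 := hN.resolve_left (hpos k (by simp)).ne'
    rw [hk2] at hker hχ hsum
    -- The kernel accepts any slope above `1/2`; gluing also requires it to exceed the preceding
    -- one.
    obtain ⟨ν', hν', hν''⟩ : ∃ ν' : ℚ, ν < ν' ∧ 1 / 2 < ν' :=
      ⟨max ν (1 / 2) + 1, (le_max_left _ _).trans_lt (lt_add_one _),
        (le_max_right _ _).trans_lt (lt_add_one _)⟩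
    have hK := kernelPiece hqord hBs hker (eq_zero_of_form_ker hB hskew hc)
      (fun v w hv hw hvw => isSquare_of_kernel γ hχ (hΓ ▸ hv) (hΓ ▸ hw) hvw) hν''
    have hkerΓ : ∀ x ∈ LinearMap.ker Γ, Γ x ∈ LinearMap.ker Γ := fun x hx => by
      rw [LinearMap.mem_ker.1 hx]; exact zero_mem _
    have hlast : (modifyD ε [k]).filter (0 < ·) = Multiset.replicate (2 - ε.toNat) 1 := by
      cases ε <;> simp [modifyD, hk, hk2, Multiset.filter_eq_self]
    -- The flag is the parity of the order of `q.coeff 0`, so the kernel provides a plug exactly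
    -- when a vector is pending.
    have hKP : Piece (stdB n) Γ ε false (LinearMap.ker Γ) ν' (Multiset.replicate (2 - ε.toNat) 1) := by
      cases ε
      · refine hK.1 (Int.even_iff.2 ?_)
        rw [Bool.toNat_false] at hpar
        omega
      · refine hK.2 fun h => ?_
        rw [Int.even_iff] at h
        rw [Bool.toNat_true] at hpar
        omega
    rw [hlast]
    have h2 := hP.glue hBs hU' hkerΓ hW' hKP fun _ => hν'
    subst hΓ
    refine hasReduction_of_piece γ h2 ?_
    rw [Multiset.sum_add, Multiset.sum_replicate]
    cases ε <;> simp at hMsum ⊢ <;> omega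

end LoopSO

end

theorem mainTheorem4 (n : ℕ) (γ : LieAlgebra.Orthogonal.typeD (Fin n) ℂ⸨X⸩)
    (hγ : γ ∈ LoopSO.heart n) (fs : List ℂ⟦X⟧[X])
    (hfs : LoopSO.IsNewtonFactorization
      (γ : Matrix (Fin n ⊕ Fin n) (Fin n ⊕ Fin n) ℂ⸨X⸩).charpoly fs) :
    LoopSO.HasReduction γ (LoopSO.partitionD fs) := by
  exact LoopSO.hasReduction_partitionD γ hγ fs hfs
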